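/- Let $\mathbb K=\mathbb R$ or $\mathbb C$. A \emph{universal $p$-differential operator of no-loop type} is the association, to any smooth manifold $M$, any torsion-free linear connection $\nabla$ on $M$ and any Poisson tensor $P$ on $M$, of an operator $A^{(M,\nabla,P)}:C^\infty(M,\mathbb K)^p\to C^\infty(M,\mathbb K)$ of the form $A(f_1,\dots,f_p)=\sum A^{J_1,\dots,J_p}\,\nabla^{sym}_{J_1}f_1\cdots\nabla^{sym}_{J_p}f_p$ (finite sum, $\nabla^{sym}_J$ the symmetrised iterated covariant derivative), whose tensors $A^{J_1,\dots,J_p}$ are given by a linear combination, with constant coefficients independent of $(M,\nabla,P)$, of concatenations (index contractions) of $P$, the curvature tensor $R$ and their iterated covariant derivatives, where indices are contracted only between different factors. It is \emph{of degree $r$} if $A^{(M,\nabla,tP)}=t^rA^{(M,\nabla,P)}$ for all real $t$, and \emph{of order one in each argument} if only blocks with $|J_1|=\dots=|J_p|=1$ occur. A \emph{universal star product} is a family $*=m+\sum_{r\ge1}\nu^rC_r$ of star products on all $(M,\nabla,P)$ ($m$ the pointwise multiplication, $*$ associative on $C^\infty(M)[[\nu]]$, $C_1(f,g)-C_1(g,f)=2\{f,g\}$,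 each $C_r$ vanishing on constants), where $C_r$ is a universal bidifferential operator of no-loop type and of degree $r$. A \emph{universal Poisson 2-cocycle of no-loop type} is a universal skewsymmetric bidifferential operator $p$ of no-loop type, of order one in each argument, such that for all $(M,\nabla,P)$ $$\sum_{\mathrm{cyc}(u,v,w)}\big(\{p(u,v),w\}+p(\{u,v\},w)\big)=0 .$$ It is a \emph{universal Poisson coboundary of no-loop type} if $p=\delta_PB$, $(\delta_PB)(u,v)=\{u,B(v)\}-\{v,B(u)\}-B(\{u,v\})$, with $B$ a universal differential operator of no-loop type and of order one. $H^2_{(no\text{-}loop)\,pol\,j}$ is the quotient of the universal Poisson 2-cocycles of no-loop type of degree $j$ by the coboundaries of such $B$ of degree $j-1$. A \emph{gauge series} is a formal series $E=\sum_{r\ge2}\nu^rE_r$ of universal differential operators of no-loop type vanishing on constants, $E_r$ of degree $r$; put $f\,\big((\exp\operatorname{ad}E)*\big)\,g=\exp E\big((\exp(-E)f)*(\exp(-E)g)\big)$. Two universal star products $*,*'$ are \emph{universally equivalent} if $*'=(\exp\operatorname{ad}E)*$ for some gauge series $E$, and \emph{universally equivalent at order $k$} if $(\exp\operatorname{ad}E)*$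 and $*'$ agree modulo $\nu^{k+1}$ for some gauge series $E$. \textbf{Lemma.} Let $*=m+\sum\nu^rC_r$ and $*'=m+\sum\nu^rC'_r$ be universal star products. (1) Suppose that they coincide modulo $\nu^k$, i.e. $C_r=C'_r$ for $r<k$. Then $C'_k-C_k$ is a Hochschild 2-cocycle and a universal bidifferential operator of no-loop type and of degree $k$. Its skewsymmetric part $p_2$ is a universal Poisson 2-cocycle of no-loop type and of degree $k$. If $p_2$ is a universal Poisson coboundary of no-loop type, then there is a gauge series $E$ such that $(\exp\operatorname{ad}E)*$ and $*'$ coincide modulo $\nu^{k+1}$. (2) If $H^2_{(no\text{-}loop)\,pol\,j}=0$ for all $j\ge2$, then $*$ and $*'$ are universally equivalent. (3) If $H^2_{(no\text{-}loop)\,pol\,j}=0$ for all $2\le j\le k$, then $*$ and $*'$ are universally equivalent at order $k$. -/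

import Mathlib

open scoped Manifold ContDiff

universe u

namespace UniversalStar

noncomputable section

/-! ### Manifolds and smooth functions -/

/-- The model space `ℝ^d`. -/
abbrev Model (d : ℕ) : Type := EuclideanSpace ℝ (Fin d)

/-- A smooth (Hausdorff, second countable) manifold of finite dimension. -/
structure Mfd where
  dim : ℕ
  carrier : Type u
  [top : TopologicalSpace carrier]
  [charted : ChartedSpace (Model dim) carrier]
  [smooth : IsManifold (𝓡 dim) ∞ carrier]
  [t2 : T2Space carrier]
  [secondCountable : SecondCountableTopology carrier]

instance : CoeSort Mfd.{u} (Type u) := ⟨Mfd.carrier⟩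

attribute [instance] Mfd.top Mfd.charted Mfd.smooth Mfd.t2 Mfd.secondCountable

/-- All smooth charts of `M`. -/
abbrev Mfd.charts (M : Mfd.{u}) : Set (OpenPartialHomeomorph M (Model M.dim)) :=
  IsManifold.maximalAtlas (𝓡 M.dim) ∞ M

instance instContMDiffRingRCLike (𝕜 : Type) [RCLike 𝕜] : ContMDiffRing 𝓘(ℝ, 𝕜) ∞ 𝕜 where
  toContMDiffAdd := inferInstance
  contMDiff_mul := by
    rw [contMDiff_iff]
    refine ⟨continuous_mul, fun x y => ?_⟩
    simp only [mfld_simps, chartAt_self_eq]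
    rw [contDiffOn_univ]
    exact contDiff_mul

/-- The algebra `C^∞(M)` of smooth `𝕜`-valued functions on `M`, with `𝕜 = ℝ` or `ℂ`. -/
abbrev Fun (𝕜 : Type) [RCLike 𝕜] (M : Mfd.{u}) : Type u :=
  ContMDiffMap (𝓡 M.dim) 𝓘(ℝ, 𝕜) M 𝕜 ∞

/-- The constant function `a`. -/
def constFun {𝕜 : Type} [RCLike 𝕜] (M : Mfd.{u}) (a : 𝕜) : Fun 𝕜 M := ContMDiffMap.const a

/-! ### Local coordinates -/

/-- Partial derivative `∂_i` on `ℝ^d`. -/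
def pd {d : ℕ} {F : Type} [NormedAddCommGroup F] [NormedSpace ℝ F] (i : Fin d)
    (f : Model d → F) (y : Model d) : F :=
  fderiv ℝ f y (EuclideanSpace.single i 1)

/-- The coordinate vector field `∂_i` of the chart `c` (meaningful on `c.source`). -/
def coordField {M : Mfd.{u}} (c : OpenPartialHomeomorph M (Model M.dim)) (i : Fin M.dim) (x : M) :
    TangentSpace (𝓡 M.dim) x :=
  mfderiv (𝓡 M.dim) (𝓡 M.dim) c.symm (c x) (EuclideanSpace.single i (1 : ℝ) : Model M.dim)

/-- The coordinate one-form `dx^i` of the chart `c` (meaningful on `c.source`). -/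
def coordForm {M : Mfd.{u}} (c : OpenPartialHomeomorph M (Model M.dim)) (i : Fin M.dim) (x : M) :
    TangentSpace (𝓡 M.dim) x →L[ℝ] ℝ :=
  (EuclideanSpace.proj i : Model M.dim →L[ℝ] ℝ).comp (mfderiv (𝓡 M.dim) (𝓡 M.dim) c x)

/-! ### Connections and Poisson tensors -/

/-- A smooth torsion-free linear connection on `M`. -/
structure Connection (M : Mfd.{u}) where
  cov : CovariantDerivative (𝓡 M.dim) (Model M.dim) (TangentSpace (𝓡 M.dim) : M → Type)
  smooth : CovariantDerivative.ContMDiffCovariantDerivative cov ∞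
  torsionFree : cov.torsion = 0

/-- Christoffel symbols `Γ^k_{ij}` in the chart `c`: `∇_{∂_i} ∂_j = ∑ k, Γ^k_{ij} ∂_k`. -/
def Connection.christoffel {M : Mfd.{u}} (D : Connection M)
    (c : OpenPartialHomeomorph M (Model M.dim)) (k i j : Fin M.dim) (y : Model M.dim) : ℝ :=
  coordForm c k (c.symm y) (D.cov (coordField c j) (c.symm y) (coordField c i (c.symm y)))

/-- Contravariant 2-tensors at `x`, as bilinear forms on the cotangent space. -/
abbrev Bivec (M : Mfd.{u}) (x : M) : Type :=
  (TangentSpace (𝓡 M.dim) x →L[ℝ] ℝ) →ₗ[ℝ] (TangentSpace (𝓡 M.dim) x →L[ℝ] ℝ) →ₗ[ℝ] ℝ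

/-- Components `t^{ij} = t(dx^i, dx^j)` in the chart `c`. -/
def bivComp {M : Mfd.{u}} (t : ∀ x : M, Bivec M x)
    (c : OpenPartialHomeomorph M (Model M.dim)) (i j : Fin M.dim) (y : Model M.dim) : ℝ :=
  t (c.symm y) (coordForm c i (c.symm y)) (coordForm c j (c.symm y))

/-- A Poisson tensor on `M`: a smooth skewsymmetric contravariant 2-tensor `P` satisfying the
Jacobi identity `∑ l, (P^{il} ∂_l P^{jk} + P^{jl} ∂_l P^{ki} + P^{kl} ∂_l P^{ij}) = 0`. -/
structure PoissonTensor (M : Mfd.{u}) where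
  tensor : ∀ x : M, Bivec M x
  skew : ∀ x α β, tensor x α β = - tensor x β α
  smooth : ∀ c ∈ M.charts, ∀ i j, ContDiffOn ℝ ∞ (bivComp tensor c i j) c.target
  jacobi : ∀ c ∈ M.charts, ∀ y ∈ c.target, ∀ i j k,
    ∑ l, (bivComp tensor c i l y * pd l (bivComp tensor c j k) y +
      bivComp tensor c j l y * pd l (bivComp tensor c k i) y +
      bivComp tensor c k l y * pd l (bivComp tensor c i j) y) = 0

lemma bivComp_apply {M : Mfd.{u}} (t : ∀ x : M, Bivec M x)
    {c : OpenPartialHomeomorph M (Model M.dim)} {x : M} (hx : x ∈ c.source) (i j : Fin M.dim) :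
    bivComp t c i j (c x) = t x (coordForm c i x) (coordForm c j x) := by
  unfold bivComp; rw [c.left_inv hx]

lemma bivComp_smul {M : Mfd.{u}} (t : ∀ x : M, Bivec M x) (a : ℝ)
    (c : OpenPartialHomeomorph M (Model M.dim)) (i j : Fin M.dim) :
    bivComp (fun x => a • t x) c i j = a • bivComp t c i j := by
  funext y; simp [bivComp]

/-- The Poisson tensor `a P`. -/
def PoissonTensor.scale {M : Mfd.{u}} (a : ℝ) (P : PoissonTensor M) : PoissonTensor M where
  tensor x := a • P.tensor x
  skew x α β := by simp [P.skew x α β]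
  smooth c hc i j := by
    rw [bivComp_smul]; exact (P.smooth c hc i j).const_smul a
  jacobi c hc y hy i j k := by
    have hpd : ∀ l i j, pd l (a • bivComp P.tensor c i j) y =
        a * pd l (bivComp P.tensor c i j) y := by
      intro l i j
      have hd : DifferentiableAt ℝ (bivComp P.tensor c i j) y :=
        ((P.smooth c hc i j).contDiffAt (c.open_target.mem_nhds hy)).differentiableAt (by simp)
      simp [pd, fderiv_const_smul hd]
    have h := P.jacobi c hc y hy i j k
    calc _ = a * a * ∑ l, (bivComp P.tensor c i l y * pd l (bivComp P.tensor c j k) y +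
      bivComp P.tensor c j l y * pd l (bivComp P.tensor c k i) y +
      bivComp P.tensor c k l y * pd l (bivComp P.tensor c i j) y) := by
          rw [Finset.mul_sum]
          refine Finset.sum_congr rfl fun l _ => ?_
          rw [bivComp_smul, bivComp_smul, bivComp_smul, bivComp_smul, bivComp_smul, bivComp_smul,
            hpd, hpd, hpd]
          simp only [Pi.smul_apply, smul_eq_mul]
          ring
      _ = 0 := by rw [h, mul_zero]

/-! ### The Poisson bracket of `𝕜`-valued functions -/

section Bracket

variable {𝕜 : Type} [RCLike 𝕜]

/-- The function `f` read in the chart `c`. -/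
def inChart {M : Mfd.{u}} (f : Fun 𝕜 M) (c : OpenPartialHomeomorph M (Model M.dim)) :
    Model M.dim → 𝕜 :=
  fun y => f (c.symm y)

/-- `∑ i j, P^{ij} ∂_i f ∂_j g`, computed in the chart `c`. -/
def bracketInChart {M : Mfd.{u}} (P : PoissonTensor M) (f g : Fun 𝕜 M)
    (c : OpenPartialHomeomorph M (Model M.dim)) (y : Model M.dim) : 𝕜 :=
  ∑ i, ∑ j, ((bivComp P.tensor c i j y : ℝ) : 𝕜) *
    (pd i (inChart f c) y * pd j (inChart g c) y)

lemma contDiffOn_inChart {M : Mfd.{u}} (f : Fun 𝕜 M) {c : OpenPartialHomeomorph M (Model M.dim)}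
    (hc : c ∈ M.charts) : ContDiffOn ℝ ∞ (inChart f c) c.target := by
  rw [← contMDiffOn_iff_contDiffOn]
  exact f.contMDiff.comp_contMDiffOn (contMDiffOn_symm_of_mem_maximalAtlas hc)

lemma chart_mdifferentiable {M : Mfd.{u}} {c : OpenPartialHomeomorph M (Model M.dim)}
    (hc : c ∈ M.charts) : c.MDifferentiable (𝓡 M.dim) (𝓡 M.dim) :=
  ⟨(contMDiffOn_of_mem_maximalAtlas hc).mdifferentiableOn (by simp),
    (contMDiffOn_symm_of_mem_maximalAtlas hc).mdifferentiableOn (by simp)⟩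

lemma pd_inChart {M : Mfd.{u}} (f : Fun 𝕜 M) {c : OpenPartialHomeomorph M (Model M.dim)}
    (hc : c ∈ M.charts) {x : M} (hx : x ∈ c.source) (i : Fin M.dim) :
    pd i (inChart f c) (c x) = mfderiv (𝓡 M.dim) 𝓘(ℝ, 𝕜) f x (coordField c i x) := by
  have h := mfderiv_comp (I := 𝓡 M.dim) (I' := 𝓡 M.dim) (I'' := 𝓘(ℝ, 𝕜)) (g := f) (f := c.symm)
    (c x) (f.contMDiff.contMDiffAt.mdifferentiableAt (by simp))
    ((chart_mdifferentiable hc).mdifferentiableAt_symm (c.map_source hx))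
  rw [c.left_inv hx] at h
  have h2 : mfderiv (𝓡 M.dim) 𝓘(ℝ, 𝕜) (f ∘ c.symm) (c x) = fderiv ℝ (inChart f c) (c x) :=
    mfderiv_eq_fderiv
  rw [h2] at h
  unfold pd coordField
  rw [h]
  rfl

lemma bracket_change {d : ℕ} {V : Type} [AddCommGroup V] [TopologicalSpace V] [Module ℝ V]
    (t : (V →L[ℝ] ℝ) →ₗ[ℝ] (V →L[ℝ] ℝ) →ₗ[ℝ] ℝ) (φ ψ : V →L[ℝ] 𝕜)
    (A A' : Model d →L[ℝ] V) (B B' : V →L[ℝ] Model d)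
    (h : ∀ v, A (B v) = v) (h' : ∀ v, A' (B' v) = v) :
    ∑ i, ∑ j, ((t ((EuclideanSpace.proj i : Model d →L[ℝ] ℝ).comp B)
        ((EuclideanSpace.proj j : Model d →L[ℝ] ℝ).comp B) : ℝ) : 𝕜) *
        (φ (A (EuclideanSpace.single i 1)) * ψ (A (EuclideanSpace.single j 1))) =
    ∑ i, ∑ j, ((t ((EuclideanSpace.proj i : Model d →L[ℝ] ℝ).comp B')
        ((EuclideanSpace.proj j : Model d →L[ℝ] ℝ).comp B') : ℝ) : 𝕜) *
        (φ (A' (EuclideanSpace.single i 1)) * ψ (A' (EuclideanSpace.single j 1))) := by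
  have hdec : ∀ w : Model d, w = ∑ i, w i • (EuclideanSpace.single i (1 : ℝ) : Model d) := by
    intro w
    ext j
    simp [Pi.single_apply]
  set q : Fin d → Fin d → ℝ := fun i k => (B (A' (EuclideanSpace.single k 1))) i with hq
  have hform : ∀ i, (EuclideanSpace.proj i : Model d →L[ℝ] ℝ).comp B =
      ∑ k, q i k • (EuclideanSpace.proj k : Model d →L[ℝ] ℝ).comp B' := by
    intro i
    ext v
    have h1 : B v = ∑ k, (B' v) k • B (A' (EuclideanSpace.single k 1)) := by
      conv_lhs => rw [← h' v, hdec (B' v)]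
      simp
    simp [h1, hq, mul_comm]
  have hvec : ∀ (χ : V →L[ℝ] 𝕜) (k : Fin d), χ (A' (EuclideanSpace.single k 1)) =
      ∑ i, (q i k : 𝕜) * χ (A (EuclideanSpace.single i 1)) := by
    intro χ k
    conv_lhs => rw [← h (A' (EuclideanSpace.single k 1)), hdec (B (A' (EuclideanSpace.single k 1)))]
    simp [hq, RCLike.real_smul_eq_coe_mul]
  have hL : ∀ i j, t ((EuclideanSpace.proj i : Model d →L[ℝ] ℝ).comp B)
      ((EuclideanSpace.proj j : Model d →L[ℝ] ℝ).comp B) =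
      ∑ k, ∑ l, q i k * q j l * t ((EuclideanSpace.proj k : Model d →L[ℝ] ℝ).comp B')
        ((EuclideanSpace.proj l : Model d →L[ℝ] ℝ).comp B') := by
    intro i j
    rw [hform i, hform j]
    simp only [map_sum, map_smul, LinearMap.sum_apply, LinearMap.smul_apply, smul_eq_mul,
      Finset.mul_sum]
    rw [Finset.sum_comm]
    exact Finset.sum_congr rfl fun k _ => Finset.sum_congr rfl fun l _ => by ring
  simp only [hL, hvec, RCLike.ofReal_sum, RCLike.ofReal_mul, Finset.sum_mul, Finset.mul_sum]
  have hcomm : ∀ T : Fin d → Fin d → Fin d → Fin d → 𝕜,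
      ∑ i, ∑ j, ∑ k, ∑ l, T i j k l = ∑ k, ∑ l, ∑ j, ∑ i, T i j k l := by
    intro T
    calc _ = ∑ i, ∑ k, ∑ l, ∑ j, T i j k l :=
          Finset.sum_congr rfl fun i _ => by
            rw [Finset.sum_comm]
            exact Finset.sum_congr rfl fun k _ => Finset.sum_comm
      _ = ∑ k, ∑ l, ∑ i, ∑ j, T i j k l := by
          rw [Finset.sum_comm]
          exact Finset.sum_congr rfl fun k _ => Finset.sum_comm
      _ = _ := Finset.sum_congr rfl fun k _ => Finset.sum_congr rfl fun l _ => Finset.sum_comm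
  rw [hcomm]
  refine Finset.sum_congr rfl fun k _ => Finset.sum_congr rfl fun l _ =>
    Finset.sum_congr rfl fun i _ => Finset.sum_congr rfl fun j _ => ?_
  ring

/-- The value of the bracket does not depend on the chart. -/
lemma bracketInChart_eq {M : Mfd.{u}} (P : PoissonTensor M) (f g : Fun 𝕜 M)
    {c c' : OpenPartialHomeomorph M (Model M.dim)} (hc : c ∈ M.charts) (hc' : c' ∈ M.charts)
    {x : M} (hx : x ∈ c.source) (hx' : x ∈ c'.source) :
    bracketInChart P f g c (c x) = bracketInChart P f g c' (c' x) := by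
  have key := bracket_change (𝕜 := 𝕜) (P.tensor x) (mfderiv (𝓡 M.dim) 𝓘(ℝ, 𝕜) f x)
    (mfderiv (𝓡 M.dim) 𝓘(ℝ, 𝕜) g x)
    (mfderiv (𝓡 M.dim) (𝓡 M.dim) c.symm (c x)) (mfderiv (𝓡 M.dim) (𝓡 M.dim) c'.symm (c' x))
    (mfderiv (𝓡 M.dim) (𝓡 M.dim) c x) (mfderiv (𝓡 M.dim) (𝓡 M.dim) c' x)
    (fun v => DFunLike.congr_fun ((chart_mdifferentiable hc).symm_comp_deriv hx) v)
    (fun v => DFunLike.congr_fun ((chart_mdifferentiable hc').symm_comp_deriv hx') v)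
  unfold bracketInChart
  simp only [pd_inChart f hc hx, pd_inChart g hc hx, pd_inChart f hc' hx', pd_inChart g hc' hx',
    bivComp_apply P.tensor hx, bivComp_apply P.tensor hx']
  exact key

lemma contDiffOn_bracketInChart {M : Mfd.{u}} (P : PoissonTensor M) (f g : Fun 𝕜 M)
    {c : OpenPartialHomeomorph M (Model M.dim)} (hc : c ∈ M.charts) :
    ContDiffOn ℝ ∞ (bracketInChart P f g c) c.target := by
  have hpd : ∀ (f : Fun 𝕜 M) i, ContDiffOn ℝ ∞ (pd i (inChart f c)) c.target := fun f i =>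
    ((contDiffOn_inChart f hc).fderiv_of_isOpen c.open_target (by simp)).clm_apply contDiffOn_const
  unfold bracketInChart
  refine ContDiffOn.sum fun i _ => ContDiffOn.sum fun j _ => ContDiffOn.mul ?_ ?_
  · exact (RCLike.ofRealCLM (K := 𝕜)).contDiff.comp_contDiffOn (P.smooth c hc i j)
  · exact (hpd f i).mul (hpd g j)

/-- The Poisson bracket `{f, g} = P(df, dg)`. -/
def bracket {M : Mfd.{u}} (P : PoissonTensor M) (f g : Fun 𝕜 M) : Fun 𝕜 M where
  val x := bracketInChart P f g (chartAt (Model M.dim) x) (chartAt (Model M.dim) x x)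
  property := by
    intro x
    have hc : chartAt (Model M.dim) x ∈ M.charts := IsManifold.chart_mem_maximalAtlas x
    have hsrc := (chartAt (Model M.dim) x).open_source.mem_nhds (mem_chart_source (Model M.dim) x)
    have h1 : ContMDiffAt (𝓡 M.dim) 𝓘(ℝ, 𝕜) ∞
        (fun z => bracketInChart P f g (chartAt (Model M.dim) x) (chartAt (Model M.dim) x z)) x := by
      have h2 := ((contMDiffOn_iff_contDiffOn.2 (contDiffOn_bracketInChart P f g hc)).comp
        (contMDiffOn_of_mem_maximalAtlas hc)
        (fun z hz => (chartAt (Model M.dim) x).map_source hz))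
      exact h2.contMDiffAt hsrc
    refine h1.congr_of_eventuallyEq (Filter.eventuallyEq_of_mem hsrc fun z hz => ?_)
    exact bracketInChart_eq P f g (IsManifold.chart_mem_maximalAtlas z) hc
      (mem_chart_source _ z) hz

/-- The bracket is `∑ i j, P^{ij} ∂_i f ∂_j g` in every chart. -/
lemma bracket_apply {M : Mfd.{u}} (P : PoissonTensor M) (f g : Fun 𝕜 M)
    {c : OpenPartialHomeomorph M (Model M.dim)} (hc : c ∈ M.charts) {x : M} (hx : x ∈ c.source) :
    bracket P f g x = bracketInChart P f g c (c x) :=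
  bracketInChart_eq P f g (IsManifold.chart_mem_maximalAtlas x) hc (mem_chart_source _ x) hx

lemma inChart_add {M : Mfd.{u}} (f g : Fun 𝕜 M) (c : OpenPartialHomeomorph M (Model M.dim)) :
    inChart (f + g) c = inChart f c + inChart g c := rfl

lemma pd_inChart_add {M : Mfd.{u}} (f g : Fun 𝕜 M)
    {c : OpenPartialHomeomorph M (Model M.dim)} (hc : c ∈ M.charts) {y : Model M.dim}
    (hy : y ∈ c.target) (i : Fin M.dim) :
    pd i (inChart (f + g) c) y = pd i (inChart f c) y + pd i (inChart g c) y := by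
  have hd : ∀ f : Fun 𝕜 M, DifferentiableAt ℝ (inChart f c) y := fun f =>
    ((contDiffOn_inChart f hc).contDiffAt (c.open_target.mem_nhds hy)).differentiableAt (by simp)
  rw [inChart_add, pd, fderiv_add (hd f) (hd g)]
  rfl

lemma bracket_add_left {M : Mfd.{u}} (P : PoissonTensor M) (f f' g : Fun 𝕜 M) :
    bracket P (f + f') g = bracket P f g + bracket P f' g := by
  ext x
  have hc : chartAt (Model M.dim) x ∈ M.charts := IsManifold.chart_mem_maximalAtlas x
  have ht := (chartAt (Model M.dim) x).map_source (mem_chart_source (Model M.dim) x)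
  change (bracketInChart P _ _ _ _ : 𝕜) = bracketInChart P _ _ _ _ + bracketInChart P _ _ _ _
  simp only [bracketInChart, pd_inChart_add _ _ hc ht, add_mul, mul_add, Finset.sum_add_distrib]

lemma bracket_add_right {M : Mfd.{u}} (P : PoissonTensor M) (f g g' : Fun 𝕜 M) :
    bracket P f (g + g') = bracket P f g + bracket P f g' := by
  ext x
  have hc : chartAt (Model M.dim) x ∈ M.charts := IsManifold.chart_mem_maximalAtlas x
  have ht := (chartAt (Model M.dim) x).map_source (mem_chart_source (Model M.dim) x)
  change (bracketInChart P _ _ _ _ : 𝕜) = bracketInChart P _ _ _ _ + bracketInChart P _ _ _ _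
  simp only [bracketInChart, pd_inChart_add _ _ hc ht, mul_add, Finset.sum_add_distrib]

lemma bracket_neg_left {M : Mfd.{u}} (P : PoissonTensor M) (f g : Fun 𝕜 M) :
    bracket P (-f) g = - bracket P f g :=
  map_neg (AddMonoidHom.mk' (fun f : Fun 𝕜 M => bracket P f g) fun a b => bracket_add_left P a b g) f

lemma bracket_neg_right {M : Mfd.{u}} (P : PoissonTensor M) (f g : Fun 𝕜 M) :
    bracket P f (-g) = - bracket P f g :=
  map_neg (AddMonoidHom.mk' (fun g : Fun 𝕜 M => bracket P f g) fun a b => bracket_add_right P f a b) g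

lemma bracket_zero_left {M : Mfd.{u}} (P : PoissonTensor M) (g : Fun 𝕜 M) :
    bracket P 0 g = 0 :=
  map_zero (AddMonoidHom.mk' (fun f : Fun 𝕜 M => bracket P f g) fun a b => bracket_add_left P a b g)

lemma bracket_zero_right {M : Mfd.{u}} (P : PoissonTensor M) (f : Fun 𝕜 M) :
    bracket P f 0 = 0 :=
  map_zero (AddMonoidHom.mk' (fun g : Fun 𝕜 M => bracket P f g) fun a b => bracket_add_right P f a b)

end Bracket

/-! ### Iterated covariant derivatives in coordinates

In a chart, a tensor field with `p` upper and `q` lower indices is given by its components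
`T^{I}_{J}`, with `I : Fin p → Fin d` and `J : Fin q → Fin d`. -/

/-- Component functions of a tensor field of type `(p, q)` on (an open subset of) `ℝ^d`. -/
abbrev Comp (d : ℕ) (F : Type) (p q : ℕ) : Type :=
  (Fin p → Fin d) → (Fin q → Fin d) → Model d → F

section Nabla

variable {d : ℕ} {F : Type} [NormedAddCommGroup F] [NormedSpace ℝ F]

/-- Covariant derivative of a tensor with respect to the Christoffel symbols `G k i j = Γ^k_{ij}`;
the index of the new derivative is the first lower index. -/
def covD (G : Fin d → Fin d → Fin d → Model d → ℝ) {p q : ℕ} (T : Comp d F p q) :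
    Comp d F p (q + 1) := fun I J y =>
  pd (J 0) (T I (Fin.tail J)) y
    + ∑ s : Fin p, ∑ m, G (I s) (J 0) m y • T (Function.update I s m) (Fin.tail J) y
    - ∑ s : Fin q, ∑ m, G m (J 0) (J s.succ) y • T I (Function.update (Fin.tail J) s m) y

/-- `∇^m f`, a tensor with `m` lower indices. -/
def nablaFun (G : Fin d → Fin d → Fin d → Model d → ℝ) (f : Model d → F) :
    (m : ℕ) → Comp d F 0 m
  | 0 => fun _ _ => f
  | m + 1 => covD G (nablaFun G f m)

/-- The symmetrised covariant derivative `∇^{sym}_J f`, with `J = (j_1, …, j_m)`. -/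
def nablaSym (G : Fin d → Fin d → Fin d → Model d → ℝ) (f : Model d → F) (m : ℕ)
    (J : Fin m → Fin d) (y : Model d) : F :=
  ((m.factorial : ℝ)⁻¹) • ∑ σ : Equiv.Perm (Fin m), nablaFun G f m Fin.elim0 (J ∘ σ) y

/-- `∇^a P`, a tensor with two upper indices and `a` lower indices. -/
def nablaBivec (G : Fin d → Fin d → Fin d → Model d → ℝ) (P : Fin d → Fin d → Model d → ℝ) :
    (a : ℕ) → Comp d ℝ 2 a
  | 0 => fun I _ => P (I 0) (I 1)
  | a + 1 => covD G (nablaBivec G P a)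

/-- The curvature tensor: the component with upper index `l` and lower indices `i, j, k` is the
`l`-th component of `R(∂_i, ∂_j) ∂_k`. -/
def curvature (G : Fin d → Fin d → Fin d → Model d → ℝ) : Comp d ℝ 1 3 := fun I J y =>
  pd (J 0) (G (I 0) (J 1) (J 2)) y - pd (J 1) (G (I 0) (J 0) (J 2)) y
    + ∑ m, (G (I 0) (J 0) m y * G m (J 1) (J 2) y - G (I 0) (J 1) m y * G m (J 0) (J 2) y)

/-- `∇^b R`, a tensor with one upper index and `3 + b` lower indices (derivatives first). -/
def nablaCurv (G : Fin d → Fin d → Fin d → Model d → ℝ) : (b : ℕ) → Comp d ℝ 1 (3 + b)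
  | 0 => curvature G
  | b + 1 => covD G (nablaCurv G b)

end Nabla

/-! ### Universal Poisson-related multidifferential operators -/

/-- A factor `(∇^a P)^{··}_{·…·}` with its indices labelled by `Fin n`. -/
structure PFactor (n : ℕ) where
  order : ℕ
  up : Fin 2 → Fin n
  low : Fin order → Fin n

/-- A factor `(∇^b R)^{·}_{·…·}` with its indices labelled by `Fin n`. -/
structure RFactor (n : ℕ) where
  order : ℕ
  up : Fin n
  low : Fin (3 + order) → Fin n

/-- A monomial of a universal `k`-differential operator, written in Einstein's convention: a product
of factors `∇^a P`, `∇^b R` and of one symmetrised covariant derivative `∇^{sym}_{J_l} f_l` of each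
of the arguments `f_1, …, f_k`, in which each of the `n` summation indices occurs exactly once as an
upper index and exactly once as a lower index. The indices of the block `J_l` are the free upper
indices of the contravariant tensor, obtained by concatenating the factors `∇^a P` and `∇^b R`,
that is associated to the operator. -/
structure Monomial (k : ℕ) where
  n : ℕ
  numP : ℕ
  facP : Fin numP → PFactor n
  numR : ℕ
  facR : Fin numR → RFactor n
  ord : Fin k → ℕ
  arg : (l : Fin k) → Fin (ord l) → Fin n
  upper_once : Function.Bijective
    (Sum.elim (fun s : Fin numP × Fin 2 => (facP s.1).up s.2) (fun j : Fin numR => (facR j).up))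
  lower_once : Function.Bijective
    (Sum.elim (fun s : (i : Fin numP) × Fin (facP i).order => (facP s.1).low s.2)
      (Sum.elim (fun s : (j : Fin numR) × Fin (3 + (facR j).order) => (facR s.1).low s.2)
        (fun s : (l : Fin k) × Fin (ord l) => arg s.1 s.2)))

/-- No-loop type: indices are only contracted between different factors. -/
def Monomial.NoLoop {k : ℕ} (Γ : Monomial k) : Prop :=
  (∀ i s t, (Γ.facP i).up s ≠ (Γ.facP i).low t) ∧ (∀ j t, (Γ.facR j).up ≠ (Γ.facR j).low t)

/-- Value of a monomial, in coordinates, for Christoffel symbols `G`, components `P` of the Poisson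
tensor and functions `f l`: the sum over all the values of the summation indices. -/
def Monomial.eval {𝕜 : Type} [RCLike 𝕜] {k d : ℕ} (Γ : Monomial k)
    (G : Fin d → Fin d → Fin d → Model d → ℝ) (P : Fin d → Fin d → Model d → ℝ)
    (f : Fin k → Model d → 𝕜) (y : Model d) : 𝕜 :=
  ∑ v : Fin Γ.n → Fin d,
    ((∏ i, nablaBivec G P (Γ.facP i).order (v ∘ (Γ.facP i).up) (v ∘ (Γ.facP i).low) y : ℝ) : 𝕜) *
    ((∏ j, nablaCurv G (Γ.facR j).order (fun _ => v (Γ.facR j).up) (v ∘ (Γ.facR j).low) y : ℝ)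
      : 𝕜) *
    ∏ l, nablaSym G (f l) (Γ.ord l) (v ∘ Γ.arg l) y

/-- The association, to any manifold `M`, any torsion-free connection and any Poisson tensor on `M`,
of a `k`-ary operation on `C^∞(M)`. -/
abbrev MultiOp (𝕜 : Type) [RCLike 𝕜] (k : ℕ) : Type (u + 1) :=
  ∀ M : Mfd.{u}, Connection M → PoissonTensor M → (Fin k → Fun 𝕜 M) → Fun 𝕜 M

section Universal

variable {𝕜 : Type} [RCLike 𝕜] {k : ℕ}

/-- The linear combination of monomials `∑ Γ, e Γ • Γ`, with constant coefficients that do not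
depend on the manifold, computes the operator in all charts of all manifolds. -/
def MultiOp.RepresentedBy (A : MultiOp.{u} 𝕜 k) (e : Monomial k →₀ 𝕜) : Prop :=
  ∀ (M : Mfd.{u}) (D : Connection M) (P : PoissonTensor M) (f : Fin k → Fun 𝕜 M),
    ∀ c ∈ M.charts, ∀ x ∈ c.source,
      A M D P f x = e.sum fun Γ a =>
        a * Γ.eval (D.christoffel c) (bivComp P.tensor c) (fun l => inChart (f l) c) (c x)

/-- Universal Poisson-related `k`-differential operators of no-loop type. -/
def MultiOp.IsNoLoop (A : MultiOp.{u} 𝕜 k) : Prop :=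
  ∃ e : Monomial k →₀ 𝕜, (∀ Γ ∈ e.support, Γ.NoLoop) ∧ A.RepresentedBy e

/-- Universal Poisson-related `k`-differential operators of no-loop type and of order one in each
argument, `A(f_1, …, f_k) = a(df_1, …, df_k)` for a universal contravariant `k`-tensor `a`. -/
def MultiOp.IsNoLoopTensor (A : MultiOp.{u} 𝕜 k) : Prop :=
  ∃ e : Monomial k →₀ 𝕜, (∀ Γ ∈ e.support, Γ.NoLoop ∧ ∀ l, Γ.ord l = 1) ∧ A.RepresentedBy e

/-- `A` is a polynomial of degree `r` in the Poisson structure: `A^{(M,∇,tP)} = t^r A^{(M,∇,P)}`. -/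
def MultiOp.IsHomogeneous (A : MultiOp.{u} 𝕜 k) (r : ℕ) : Prop :=
  ∀ (M : Mfd.{u}) (D : Connection M) (P : PoissonTensor M) (t : ℝ) (f : Fin k → Fun 𝕜 M),
    A M D (P.scale t) f = t ^ r • A M D P f

lemma MultiOp.RepresentedBy.add {A B : MultiOp.{u} 𝕜 k} {e e' : Monomial k →₀ 𝕜}
    (h : A.RepresentedBy e) (h' : B.RepresentedBy e') : (A + B).RepresentedBy (e + e') := by
  intro M D P f c hc x hx
  rw [Finsupp.sum_add_index' (by simp) (by intros; ring), ← h M D P f c hc x hx,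
    ← h' M D P f c hc x hx]
  rfl

lemma MultiOp.RepresentedBy.neg {A : MultiOp.{u} 𝕜 k} {e : Monomial k →₀ 𝕜}
    (h : A.RepresentedBy e) : (-A).RepresentedBy (-e) := by
  intro M D P f c hc x hx
  rw [Finsupp.sum_neg_index (by simp)]
  simp only [neg_mul, Finsupp.sum_neg]
  rw [← h M D P f c hc x hx]
  rfl

lemma MultiOp.RepresentedBy.zero : (0 : MultiOp.{u} 𝕜 k).RepresentedBy 0 := by
  intro M D P f c hc x hx
  rw [Finsupp.sum_zero_index]
  rfl

lemma MultiOp.IsNoLoopTensor.add {A B : MultiOp.{u} 𝕜 k} (hA : A.IsNoLoopTensor)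
    (hB : B.IsNoLoopTensor) : (A + B).IsNoLoopTensor := by
  classical
  obtain ⟨e, he, h⟩ := hA
  obtain ⟨e', he', h'⟩ := hB
  refine ⟨e + e', fun Γ hΓ => ?_, h.add h'⟩
  rcases Finset.mem_union.1 (Finsupp.support_add hΓ) with h1 | h1
  exacts [he Γ h1, he' Γ h1]

lemma MultiOp.IsNoLoopTensor.neg {A : MultiOp.{u} 𝕜 k} (hA : A.IsNoLoopTensor) :
    (-A).IsNoLoopTensor := by
  obtain ⟨e, he, h⟩ := hA
  exact ⟨-e, fun Γ hΓ => he Γ (by simpa using hΓ), h.neg⟩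

lemma MultiOp.IsNoLoopTensor.zero : (0 : MultiOp.{u} 𝕜 k).IsNoLoopTensor :=
  ⟨0, by simp, MultiOp.RepresentedBy.zero⟩

lemma MultiOp.IsHomogeneous.add {A B : MultiOp.{u} 𝕜 k} {r : ℕ} (hA : A.IsHomogeneous r)
    (hB : B.IsHomogeneous r) : (A + B).IsHomogeneous r := by
  intro M D P t f
  change A M D _ f + B M D _ f = t ^ r • (A M D P f + B M D P f)
  rw [hA M D P t f, hB M D P t f, smul_add]

lemma MultiOp.IsHomogeneous.neg {A : MultiOp.{u} 𝕜 k} {r : ℕ} (hA : A.IsHomogeneous r) :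
    (-A).IsHomogeneous r := by
  intro M D P t f
  change - A M D _ f = t ^ r • (- A M D P f)
  rw [hA M D P t f, smul_neg]

lemma MultiOp.IsHomogeneous.zero {r : ℕ} : (0 : MultiOp.{u} 𝕜 k).IsHomogeneous r := by
  intro M D P t f
  change (0 : Fun 𝕜 M) = t ^ r • (0 : Fun 𝕜 M)
  rw [smul_zero]

/-! ### Hochschild cocycles and universal Poisson cohomology of no-loop type -/

/-- `C` is a Hochschild 2-cocycle of `C^∞(M)`, for all `(M, ∇, P)`. -/
def IsHochschildCocycle (C : MultiOp.{u} 𝕜 2) : Prop :=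
  ∀ (M : Mfd.{u}) (D : Connection M) (P : PoissonTensor M) (f g h : Fun 𝕜 M),
    f * C M D P ![g, h] - C M D P ![f * g, h] + C M D P ![f, g * h] - C M D P ![f, g] * h = 0

/-- The skewsymmetric part `(C(f, g) - C(g, f)) / 2`. -/
def skewPart (C : MultiOp.{u} 𝕜 2) : MultiOp.{u} 𝕜 2 := fun M D P f =>
  (2⁻¹ : ℝ) • (C M D P ![f 0, f 1] - C M D P ![f 1, f 0])

/-- `C` is skewsymmetric. -/
def IsSkew (C : MultiOp.{u} 𝕜 2) : Prop :=
  ∀ (M : Mfd.{u}) (D : Connection M) (P : PoissonTensor M) (f g : Fun 𝕜 M),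
    C M D P ![f, g] = - C M D P ![g, f]

/-- The Chevalley cocycle condition for a skewsymmetric `C`: the sum over the cyclic permutations of
`u, v, w` of `{C(u, v), w} + C({u, v}, w)` vanishes. -/
def IsChevalleyClosed (C : MultiOp.{u} 𝕜 2) : Prop :=
  ∀ (M : Mfd.{u}) (D : Connection M) (P : PoissonTensor M) (f g h : Fun 𝕜 M),
    (bracket P (C M D P ![f, g]) h + C M D P ![bracket P f g, h]) +
    (bracket P (C M D P ![g, h]) f + C M D P ![bracket P g h, f]) +
    (bracket P (C M D P ![h, f]) g + C M D P ![bracket P h f, g]) = 0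

/-- The Chevalley coboundary of a 1-cochain:
`(δ_P B)(f, g) = {f, B(g)} - {g, B(f)} - B({f, g})`. -/
def chevalleyD (B : MultiOp.{u} 𝕜 1) : MultiOp.{u} 𝕜 2 := fun M D P f =>
  bracket P (f 0) (B M D P ![f 1]) - bracket P (f 1) (B M D P ![f 0])
    - B M D P ![bracket P (f 0) (f 1)]

/-- Universal Poisson 2-cocycles of no-loop type. -/
structure IsPoissonCocycle (C : MultiOp.{u} 𝕜 2) : Prop where
  tensor : C.IsNoLoopTensor
  skew : IsSkew C
  closed : IsChevalleyClosed C

/-- Universal Poisson 2-coboundaries of no-loop type. -/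
def IsPoissonCoboundary (C : MultiOp.{u} 𝕜 2) : Prop :=
  ∃ B : MultiOp.{u} 𝕜 1, B.IsNoLoopTensor ∧ C = chevalleyD B

variable (𝕜)

/-- Universal Poisson 2-cocycles of no-loop type and of degree `j` in the Poisson structure. -/
def cocycles (j : ℕ) : AddSubgroup (MultiOp.{u} 𝕜 2) where
  carrier := {C | IsPoissonCocycle C ∧ C.IsHomogeneous j}
  add_mem' := by
    rintro A B ⟨hA, hA'⟩ ⟨hB, hB'⟩
    refine ⟨⟨hA.tensor.add hB.tensor, fun M D P f g => ?_, fun M D P f g h => ?_⟩, hA'.add hB'⟩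
    · simp only [Pi.add_apply]
      rw [hA.skew M D P f g, hB.skew M D P f g, neg_add]
    · have h1 := hA.closed M D P f g h
      have h2 := hB.closed M D P f g h
      simp only [Pi.add_apply, bracket_add_left]
      rw [← add_zero (0 : Fun 𝕜 M)]
      nth_rewrite 1 [← h1]
      rw [← h2]
      abel
  zero_mem' := by
    refine ⟨⟨.zero, fun M D P f g => ?_, fun M D P f g h => ?_⟩, .zero⟩
    · simp
    · simp [bracket_zero_left]
  neg_mem' := by
    rintro A ⟨hA, hA'⟩
    refine ⟨⟨hA.tensor.neg, fun M D P f g => ?_, fun M D P f g h => ?_⟩, hA'.neg⟩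
    · simp only [Pi.neg_apply]
      rw [hA.skew M D P f g]
    · have h1 := hA.closed M D P f g h
      simp only [Pi.neg_apply, bracket_neg_left]
      rw [← neg_zero, ← h1]
      abel

/-- Coboundaries of universal 1-cochains of no-loop type and of degree `j - 1` in the Poisson
structure (used for `1 ≤ j` only). -/
def coboundaries (j : ℕ) : AddSubgroup (MultiOp.{u} 𝕜 2) where
  carrier := {C | ∃ B : MultiOp.{u} 𝕜 1, B.IsNoLoopTensor ∧ B.IsHomogeneous (j - 1) ∧
    C = chevalleyD B}
  add_mem' := by
    rintro _ _ ⟨A, hA, hA', rfl⟩ ⟨B, hB, hB', rfl⟩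
    refine ⟨A + B, hA.add hB, hA'.add hB', ?_⟩
    funext M D P f
    simp only [chevalleyD, Pi.add_apply, bracket_add_right]
    abel
  zero_mem' := by
    refine ⟨0, .zero, .zero, ?_⟩
    funext M D P f
    simp [chevalleyD, bracket_zero_right]
  neg_mem' := by
    rintro _ ⟨A, hA, hA', rfl⟩
    refine ⟨-A, hA.neg, hA'.neg, ?_⟩
    funext M D P f
    simp only [chevalleyD, Pi.neg_apply, bracket_neg_right]
    abel

/-- `H^2_{(no-loop) pol j}`: the universal Poisson 2-cohomology of no-loop type and of degree `j` in
the Poisson structure. -/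
abbrev H2NoLoopPol (j : ℕ) : Type (u + 1) :=
  cocycles.{u} 𝕜 j ⧸ (coboundaries.{u} 𝕜 j).addSubgroupOf (cocycles.{u} 𝕜 j)

variable {𝕜}

/-! ### Universal star products -/

/-- The `ν`-bilinear extension to `C^∞(M)[[ν]]` of `f * g = ∑ r, ν^r C_r(f, g)`. -/
def starMul {A : Type u} [CommRing A] (C : ℕ → (Fin 2 → A) → A) (F G : PowerSeries A) :
    PowerSeries A :=
  PowerSeries.mk fun n => ∑ p ∈ Finset.HasAntidiagonal.antidiagonal n,
    ∑ q ∈ Finset.HasAntidiagonal.antidiagonal p.2, C p.1 ![PowerSeries.coeff q.1 F, PowerSeries.coeff q.2 G]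

/-- `∑ r, ν^r C_r` is a star product on `(M, P)`. (That the `C_r` are bidifferential operators is
part of the universality required below.) -/
structure IsStarProduct {M : Mfd.{u}} (P : PoissonTensor M)
    (C : ℕ → (Fin 2 → Fun 𝕜 M) → Fun 𝕜 M) : Prop where
  zeroth : ∀ f g, C 0 ![f, g] = f * g
  assoc : ∀ F G H : PowerSeries (Fun 𝕜 M),
    starMul C (starMul C F G) H = starMul C F (starMul C G H)
  first : ∀ f g, C 1 ![f, g] - C 1 ![g, f] = 2 * bracket P f g
  const_left : ∀ r, 1 ≤ r → ∀ (a : 𝕜) g, C r ![constFun M a, g] = 0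
  const_right : ∀ r, 1 ≤ r → ∀ f (a : 𝕜), C r ![f, constFun M a] = 0

/-- `∑ r, ν^r C_r` is a universal star product. -/
structure IsUniversalStarProduct (C : ℕ → MultiOp.{u} 𝕜 2) : Prop where
  star : ∀ (M : Mfd.{u}) (D : Connection M) (P : PoissonTensor M),
    IsStarProduct P fun r => C r M D P
  noLoop : ∀ r, 1 ≤ r → (C r).IsNoLoop
  homogeneous : ∀ r, 1 ≤ r → (C r).IsHomogeneous r

/-- A formal series `E = ∑_{r ≥ 2} ν^r E_r` of universal differential operators vanishing on
constants, of no-loop type, with `E_r` a polynomial of degree `r` in the Poisson structure. -/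
structure IsGaugeSeries (E : ℕ → MultiOp.{u} 𝕜 1) : Prop where
  low : ∀ r, r < 2 → E r = 0
  noLoop : ∀ r, 2 ≤ r → (E r).IsNoLoop
  homogeneous : ∀ r, 2 ≤ r → (E r).IsHomogeneous r
  const : ∀ r, 2 ≤ r → ∀ (M : Mfd.{u}) (D : Connection M) (P : PoissonTensor M) (a : 𝕜),
    E r M D P ![constFun M a] = 0

/-- The `ν`-linear extension to `C^∞(M)[[ν]]` of `f ↦ ∑ r, ν^r E_r(f)`. -/
def opSeries {A : Type u} [CommRing A] (E : ℕ → (Fin 1 → A) → A) (F : PowerSeries A) :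
    PowerSeries A :=
  PowerSeries.mk fun n => ∑ p ∈ Finset.HasAntidiagonal.antidiagonal n,
    E p.1 ![PowerSeries.coeff p.2 F]

/-- `exp E = ∑ m, E^m / m!`, for a series `E` with `E_0 = 0`; then `E^m` only contributes to the
coefficients of `ν^n` with `m ≤ n`. -/
def expSeries {A : Type u} [CommRing A] [Algebra ℝ A] (E : ℕ → (Fin 1 → A) → A)
    (F : PowerSeries A) : PowerSeries A :=
  PowerSeries.mk fun n => ∑ m ∈ Finset.range (n + 1),
    ((m.factorial : ℝ)⁻¹) • PowerSeries.coeff n ((opSeries E)^[m] F)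

/-- The coefficients of the product `(exp ad E) *`, that is of
`f *' g = exp E ((exp (-E) f) * (exp (-E) g))`. -/
def expAd (E : ℕ → MultiOp.{u} 𝕜 1) (C : ℕ → MultiOp.{u} 𝕜 2) : ℕ → MultiOp.{u} 𝕜 2 :=
  fun r M D P f => PowerSeries.coeff r <|
    expSeries (fun s => E s M D P) <|
      starMul (fun s => C s M D P)
        (expSeries (fun s => (-E s) M D P) (PowerSeries.C (f 0)))
        (expSeries (fun s => (-E s) M D P) (PowerSeries.C (f 1)))

/-- Two series of bidifferential operators coincide modulo `ν^k`. -/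
def CoincideMod (C C' : ℕ → MultiOp.{u} 𝕜 2) (k : ℕ) : Prop := ∀ r, r < k → C r = C' r

/-- `C` and `C'` are universally equivalent up to and including order `k`: some `(exp ad E) C`
coincides with `C'` modulo `ν^{k+1}`. -/
def EquivalentAtOrder (C C' : ℕ → MultiOp.{u} 𝕜 2) (k : ℕ) : Prop :=
  ∃ E : ℕ → MultiOp.{u} 𝕜 1, IsGaugeSeries E ∧ CoincideMod (expAd E C) C' (k + 1)

/-- `C` and `C'` are universally equivalent: `C' = (exp ad E) C` for some `E`. -/
def UniversallyEquivalent (C C' : ℕ → MultiOp.{u} 𝕜 2) : Prop :=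
  ∃ E : ℕ → MultiOp.{u} 𝕜 1, IsGaugeSeries E ∧ expAd E C = C'

end Universal

end

end UniversalStar

open UniversalStar

/-! The argument climbs through the powers of ν. If two universal star products agree below ν^k,
subtracting their associativity relations in order k shows that D = C'_k − C_k is a Hochschild
cocycle. Antisymmetrising the difference of the relations in order k+1 over three arguments cancels
the unknown C'_{k+1} − C_{k+1} and leaves the Chevalley equation for the skew part p₂
(`IsUniversalStarProduct.isPoissonCocycle`). This uses C_1 = C'_1 = { , }, which follows by counting
indices: with one factor P and two differentiated arguments the only monomial is ±P^{ij} ∂_i f ∂_j g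
(`isSkew_of_degree_one`).

The point beyond the classical argument is that everything stays universal. Operators are tested on
functions whose symmetrised covariant derivatives at a point are, up to order N, the powers of a
covector ξ (`exists_fun_isExpAt`). Such exponentials multiply by adding exponents, they separate
multidifferential operators (`functional_eq_zero`, `evalAt_eq_zero_of_exp`), and a monomial acts on
them by a polynomial in the exponents, homogeneous in each of them. Identities therefore split by
order of differentiation, just as P ↦ tP splits them by degree in P. The skew part of D is a
biderivation, so monomials of order one suffice (`skewPart_isNoLoopTensor`). If S = ∑ S_n is the
symbol of D, sorted by total order, the symmetric part of D is the Hochschild coboundary of an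
operator with symbol T(ξ) = ∑ (2 − 2^n)⁻¹ S_n(ξ, ξ), obtained by letting all derivatives of a
monomial act on a single argument (`exists_primitive`).

If p₂ = δ_P B with B of degree k−1, and A is the primitive of the symmetric part, then −ν^{k−1}B −
ν^k A is added to the exponent. Order k−1 does not change because B is a derivation; order k changes
by δ_P B plus the coboundary of A, that is by D (`exists_gauge_step`). For k = 2 the exponent may
have no term in ν, and indeed B = 0: the only vector field of degree one would be the divergence ∇_i
P^{ij}, which is a loop (`eq_zero_of_degree_one`). Perturbing the exponent instead of composing two
gauges avoids the Campbell–Hausdorff series (`conj_perturbation`). A step in order k touches only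
the coefficients from k−1 on, so infinitely many steps have a ν-adic limit.

Repeating the step requires that (exp ad E)* be again a universal star product, hence that no-loop
operators be closed under composition (`MultiOp.IsNoLoop.comp`). Differentiating a product by the
Leibniz rule adds a fresh index to one factor, so no loop arises. Passing between iterated and
symmetrised derivatives of a function produces, by the Ricci identity, curvature contracted with a
derivative of the function that has fewer indices: a contraction between different factors again
(`nabFam_sub_symFam`, `closed_mem_of_weight`). -/

namespace UniversalStar

noncomputable section

/-! ### Coordinate fields and Christoffel symbols: smoothness, symmetry, change of chart. -/

section ChartFields

variable {M : Mfd.{u}}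

/-- The derivative of a chart as a continuous linear equivalence. -/
def chartDeriv {c : OpenPartialHomeomorph M (Model M.dim)} (hc : c ∈ M.charts) {x : M}
    (hx : x ∈ c.source) :
    TangentSpace (𝓡 M.dim) x ≃L[ℝ] TangentSpace (𝓡 M.dim) (c x) :=
  (chart_mdifferentiable hc).mfderiv hx

lemma chartDeriv_coe {c : OpenPartialHomeomorph M (Model M.dim)} (hc : c ∈ M.charts) {x : M}
    (hx : x ∈ c.source) :
    (chartDeriv hc hx : TangentSpace (𝓡 M.dim) x →L[ℝ] TangentSpace (𝓡 M.dim) (c x)) =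
      mfderiv (𝓡 M.dim) (𝓡 M.dim) c x := rfl

/-- A constant vector field on the model space. -/
def constField {d : ℕ} (e : Model d) (y : Model d) : TangentSpace (𝓡 d) y := e

/-- In this form the smoothness of coordinate fields and the vanishing of their brackets follow from
naturality of the pullback. -/
lemma coordField_eq_mpullback {c : OpenPartialHomeomorph M (Model M.dim)} (hc : c ∈ M.charts)
    {x : M} (hx : x ∈ c.source) (i : Fin M.dim) :
    coordField c i x = VectorField.mpullback (𝓡 M.dim) (𝓡 M.dim) c
      (constField (EuclideanSpace.single i (1 : ℝ))) x := by
  rw [VectorField.mpullback_apply, ← chartDeriv_coe hc hx, ContinuousLinearMap.inverse_equiv]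
  rfl

lemma coordField_eventuallyEq_mpullback {c : OpenPartialHomeomorph M (Model M.dim)}
    (hc : c ∈ M.charts) {x : M} (hx : x ∈ c.source) (i : Fin M.dim) :
    coordField c i =ᶠ[nhds x] VectorField.mpullback (𝓡 M.dim) (𝓡 M.dim) c
      (constField (EuclideanSpace.single i (1 : ℝ))) :=
  Filter.eventually_of_mem (c.open_source.mem_nhds hx) fun _ hz => coordField_eq_mpullback hc hz i

lemma contMDiffAt_constField {d : ℕ} (e : Model d) (y : Model d) :
    ContMDiffAt (𝓡 d) (𝓡 d).tangent ∞
      (fun z => (⟨z, constField e z⟩ : TangentBundle (𝓡 d) (Model d))) y := by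
  have := (contMDiffWithinAt_vectorSpace_iff_contDiffWithinAt (𝕜 := ℝ) (E := Model d)
    (V := constField e) (s := Set.univ) (x := y) (n := ∞)).2 contDiffWithinAt_const
  exact this.contMDiffAt Filter.univ_mem

lemma contMDiffAt_coordField {c : OpenPartialHomeomorph M (Model M.dim)} (hc : c ∈ M.charts)
    {x : M} (hx : x ∈ c.source) (i : Fin M.dim) :
    ContMDiffAt (𝓡 M.dim) (𝓡 M.dim).tangent ∞
      (fun z => (⟨z, coordField c i z⟩ : TangentBundle (𝓡 M.dim) M)) x := by
  have h := ContMDiffAt.mpullback_vectorField_preimage (I := 𝓡 M.dim) (I' := 𝓡 M.dim) (n := ∞)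
    (m := ∞) (f := c) (x₀ := x) (V := constField (EuclideanSpace.single i (1 : ℝ)))
    (contMDiffAt_constField _ _)
    ((contMDiffOn_of_mem_maximalAtlas hc).contMDiffAt (c.open_source.mem_nhds hx))
    ⟨chartDeriv hc hx, chartDeriv_coe hc hx⟩ (by simp)
  refine h.congr_of_eventuallyEq ?_
  filter_upwards [coordField_eventuallyEq_mpullback hc hx i] with z hz
  rw [hz]

/-- Constant fields on the model space commute, and pulling back along a chart respects the bracket.
-/
lemma mlieBracket_coordField {c : OpenPartialHomeomorph M (Model M.dim)} (hc : c ∈ M.charts)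
    {x : M} (hx : x ∈ c.source) (i j : Fin M.dim) :
    VectorField.mlieBracket (𝓡 M.dim) (coordField c i) (coordField c j) x = 0 := by
  have hm : minSmoothness ℝ 2 = 2 := minSmoothness_of_isRCLikeNormedField
  have : IsManifold (𝓡 M.dim) (minSmoothness ℝ 2) M := by
    rw [hm]; exact IsManifold.of_le (n := ∞) (WithTop.coe_le_coe.2 (le_top : (2 : ℕ∞) ≤ ⊤))
  have h := VectorField.mpullback_mlieBracket (I := 𝓡 M.dim) (I' := 𝓡 M.dim) (n := ∞)
    (f := c) (x₀ := x) (V := constField (EuclideanSpace.single i (1 : ℝ)))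
    (W := constField (EuclideanSpace.single j (1 : ℝ)))
    ((contMDiffAt_constField _ _).mdifferentiableAt (by simp))
    ((contMDiffAt_constField _ _).mdifferentiableAt (by simp))
    ((contMDiffOn_of_mem_maximalAtlas hc).contMDiffAt (c.open_source.mem_nhds hx))
    (by rw [hm]; exact WithTop.coe_le_coe.2 (le_top : (2 : ℕ∞) ≤ ⊤))
  have e : VectorField.mlieBracket (𝓡 M.dim)
      (constField (EuclideanSpace.single i (1 : ℝ) : Model M.dim))
      (constField (EuclideanSpace.single j (1 : ℝ))) = 0 := by
    rw [← VectorField.mlieBracketWithin_univ, VectorField.mlieBracketWithin_eq_lieBracketWithin]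
    funext y
    have h0 : ∀ e : Model M.dim, fderivWithin ℝ (constField e) Set.univ y = 0 := fun e =>
      fderivWithin_const_apply e
    simp only [VectorField.lieBracketWithin, h0]
    exact sub_zero _
  rw [Filter.EventuallyEq.mlieBracket_vectorField_eq (coordField_eventuallyEq_mpullback hc hx i)
    (coordField_eventuallyEq_mpullback hc hx j), ← h, e, VectorField.mpullback_zero]
  rfl

/-- Vanishing torsion on commuting fields. This symmetry is what removes the torsion term from the
Ricci identity. -/
lemma Connection.christoffel_symm (D : Connection M) {c : OpenPartialHomeomorph M (Model M.dim)}
    (hc : c ∈ M.charts) {y : Model M.dim} (hy : y ∈ c.target) (k i j : Fin M.dim) :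
    D.christoffel c k i j y = D.christoffel c k j i y := by
  have hx := c.map_target hy
  have h := (CovariantDerivative.torsion_eq_zero_iff D.cov).1 D.torsionFree
    ((contMDiffAt_coordField hc hx i).mdifferentiableAt (by simp))
    ((contMDiffAt_coordField hc hx j).mdifferentiableAt (by simp))
  rw [mlieBracket_coordField hc hx, sub_eq_zero] at h
  unfold Connection.christoffel
  rw [h]

/-- A coordinate field, cut off to a globally smooth vector field. -/
lemma exists_global_coordField {c : OpenPartialHomeomorph M (Model M.dim)} (hc : c ∈ M.charts)
    {x : M} (hx : x ∈ c.source) (i : Fin M.dim) :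
    ∃ σ : ∀ z : M, TangentSpace (𝓡 M.dim) z,
      ContMDiff (𝓡 M.dim) (𝓡 M.dim).tangent ∞
        (fun z => (⟨z, σ z⟩ : TangentBundle (𝓡 M.dim) M)) ∧
      ∀ᶠ z in nhds x, σ z = coordField c i z := by
  obtain ⟨b, hb⟩ := (SmoothBumpFunction.nhds_basis_tsupport (I := 𝓡 M.dim) x).mem_iff.1
    (c.open_source.mem_nhds hx)
  refine ⟨fun z => b z • coordField c i z, fun z => ?_, ?_⟩
  · by_cases hz : z ∈ tsupport b
    · exact (b.contMDiffAt (x := z)).smul_section (contMDiffAt_coordField hc (hb.2 hz) i)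
    · have h0 : ContMDiffAt (𝓡 M.dim) (𝓡 M.dim).tangent ∞
          (fun z => (⟨z, 0⟩ : TangentBundle (𝓡 M.dim) M)) z :=
        (Bundle.contMDiff_zeroSection ℝ (TangentSpace (𝓡 M.dim) : M → Type)).contMDiffAt
      refine h0.congr_of_eventuallyEq ?_
      have : (tsupport b)ᶜ ∈ nhds z := (isClosed_tsupport b).isOpen_compl.mem_nhds hz
      filter_upwards [this] with w hw
      simp [image_eq_zero_of_notMem_tsupport hw]
  · filter_upwards [b.eventuallyEq_one] with z hz
    simp [hz]

/-- Smoothness of a connection speaks of globally smooth fields, while ∂_j lives only on the chart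
domain. So ∂_j is cut off near a point, which by locality does not change its covariant derivative
there. -/
lemma contDiffOn_christoffel (D : Connection M) {c : OpenPartialHomeomorph M (Model M.dim)}
    (hc : c ∈ M.charts) (k i j : Fin M.dim) :
    ContDiffOn ℝ ∞ (D.christoffel c k i j) c.target := by
  intro y hy
  refine ContDiffAt.contDiffWithinAt ?_
  have hx := c.map_target hy
  obtain ⟨σ, hσ, hσc⟩ := exists_global_coordField hc hx j
  have hcov := D.smooth.contMDiff.contMDiff (σ := σ) (by simpa using! hσ.contMDiffOn)
  have hZ := (hcov.contMDiffAt (Filter.univ_mem)).clm_bundle_apply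
    (contMDiffAt_coordField hc hx i)
  -- Pulled back to the model space, smoothness of the field ∇_i ∂_j becomes ordinary smoothness,
  -- and its k-th coordinate is the Christoffel symbol.
  have hW := ContMDiffAt.mpullback_vectorField_preimage (I := 𝓡 M.dim) (I' := 𝓡 M.dim) (n := ∞)
    (m := ∞) (f := c.symm) (x₀ := y) hZ
    ((contMDiffOn_symm_of_mem_maximalAtlas hc).contMDiffAt (c.open_target.mem_nhds hy))
    (by
      rw [← c.right_inv hy, c.left_inv hx]
      exact ⟨(chartDeriv hc hx).symm, rfl⟩) (by simp)
  have hW' := ((contMDiffWithinAt_vectorSpace_iff_contDiffWithinAt (𝕜 := ℝ) (E := Model M.dim)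
    (s := Set.univ)).1 hW.contMDiffWithinAt).contDiffAt Filter.univ_mem
  refine ((EuclideanSpace.proj k : Model M.dim →L[ℝ] ℝ).contDiff.contDiffAt.comp y
    hW').congr_of_eventuallyEq ?_
  have h1 : ∀ᶠ w in nhds y, w ∈ c.target := c.open_target.mem_nhds hy
  have h2 : ∀ᶠ w in nhds y, ∀ᶠ z in nhds (c.symm w), σ z = coordField c j z :=
    ((c.continuousAt_symm hy).eventually (eventually_eventually_nhds.2 hσc))
  filter_upwards [h1, h2] with w hw hw2
  have hxw := c.map_target hw
  have e1 : D.cov σ (c.symm w) = D.cov (coordField c j) (c.symm w) :=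
    D.cov.isCovariantDerivativeOnUniv.congr_of_eventuallyEq
      (hσ.contMDiffAt.mdifferentiableAt (by simp))
      ((contMDiffAt_coordField hc hxw j).mdifferentiableAt (by simp)) Filter.univ_mem hw2
  have e2 : (mfderiv (𝓡 M.dim) (𝓡 M.dim) c.symm w).inverse =
      mfderiv (𝓡 M.dim) (𝓡 M.dim) c (c.symm w) := by
    have h3 : (mfderiv (𝓡 M.dim) (𝓡 M.dim) c.symm (c (c.symm w))).inverse =
        mfderiv (𝓡 M.dim) (𝓡 M.dim) c (c.symm w) :=
      ContinuousLinearMap.inverse_equiv (chartDeriv hc hxw).symm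
    rw [c.right_inv hw] at h3
    exact h3
  change coordForm c k (c.symm w) (D.cov (coordField c j) (c.symm w) (coordField c i (c.symm w))) =
    (EuclideanSpace.proj k : Model M.dim →L[ℝ] ℝ)
      ((mfderiv (𝓡 M.dim) (𝓡 M.dim) c.symm w).inverse
        (D.cov σ (c.symm w) (coordField c i (c.symm w))))
  rw [e1, e2]
  rfl

lemma cov_sum_smul (D : Connection M) {ι : Type} (s : Finset ι)
    (σ : ι → ∀ z : M, TangentSpace (𝓡 M.dim) z) (g : ι → M → ℝ) (x : M)
    (hσ : ∀ a, MDifferentiableAt (𝓡 M.dim) (𝓡 M.dim).tangent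
      (fun z => (⟨z, σ a z⟩ : TangentBundle (𝓡 M.dim) M)) x)
    (hg : ∀ a, MDifferentiableAt (𝓡 M.dim) 𝓘(ℝ, ℝ) (g a) x) :
    D.cov (∑ a ∈ s, g a • σ a) x =
      ∑ a ∈ s, (g a x • D.cov (σ a) x + (mvfderiv (𝓡 M.dim) (g a) x).smulRight (σ a x)) := by
  classical
  induction s using Finset.induction_on with
  | empty => simp
  | insert a s ha ih =>
    rw [Finset.sum_insert ha, Finset.sum_insert ha, ← ih,
      D.cov.isCovariantDerivativeOnUniv.add, D.cov.isCovariantDerivativeOnUniv.leibniz (hσ a) (hg a)]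
    · exact (hg a).smul_section (hσ a)
    · have := MDifferentiableAt.sum_section (I := 𝓡 M.dim) (s := s) (t := fun a => g a • σ a)
        (fun b _ => (hg b).smul_section (hσ b))
      simpa using! this

/-- The transition function from the chart `c` to the chart `c'`. -/
def transition (c c' : OpenPartialHomeomorph M (Model M.dim)) : Model M.dim → Model M.dim :=
  fun y => c' (c.symm y)

lemma contDiffAt_transition {c c' : OpenPartialHomeomorph M (Model M.dim)} (hc : c ∈ M.charts)
    (hc' : c' ∈ M.charts) {x : M} (hx : x ∈ c.source) (hx' : x ∈ c'.source) :
    ContDiffAt ℝ ∞ (transition c c') (c x) := by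
  rw [← contMDiffAt_iff_contDiffAt]
  have h1 : ContMDiffAt (𝓡 M.dim) (𝓡 M.dim) ∞ c.symm (c x) :=
    (contMDiffOn_symm_of_mem_maximalAtlas hc).contMDiffAt
      (c.open_target.mem_nhds (c.map_source hx))
  have h2 : ContMDiffAt (𝓡 M.dim) (𝓡 M.dim) ∞ c' (c.symm (c x)) := by
    rw [c.left_inv hx]
    exact (contMDiffOn_of_mem_maximalAtlas hc').contMDiffAt (c'.open_source.mem_nhds hx')
  exact h2.comp (c x) h1

lemma mfderiv_chart_coordField {c c' : OpenPartialHomeomorph M (Model M.dim)} (hc : c ∈ M.charts)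
    (hc' : c' ∈ M.charts) {x : M} (hx : x ∈ c.source) (hx' : x ∈ c'.source) (j : Fin M.dim) :
    mfderiv (𝓡 M.dim) (𝓡 M.dim) c' x (coordField c j x) =
      fderiv ℝ (transition c c') (c x) (EuclideanSpace.single j 1) := by
  have h := mfderiv_comp (I := 𝓡 M.dim) (I' := 𝓡 M.dim) (I'' := 𝓡 M.dim) (g := c') (f := c.symm)
    (c x) (by rw [c.left_inv hx]; exact (chart_mdifferentiable hc').mdifferentiableAt hx')
    ((chart_mdifferentiable hc).mdifferentiableAt_symm (c.map_source hx))
  rw [c.left_inv hx] at h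
  have h2 : mfderiv (𝓡 M.dim) (𝓡 M.dim) (c' ∘ c.symm) (c x) = fderiv ℝ (transition c c') (c x) :=
    mfderiv_eq_fderiv
  rw [h2] at h
  rw [h]
  rfl

lemma euclidean_eq_sum {d : ℕ} (w : Model d) :
    w = ∑ i, w i • (EuclideanSpace.single i (1 : ℝ) : Model d) := by
  ext j
  simp [Pi.single_apply]

lemma pd_coord {d d' : ℕ} {φ : Model d → Model d'} {y : Model d} (h : DifferentiableAt ℝ φ y)
    (i : Fin d) (a : Fin d') :
    pd i (fun z => φ z a) y = fderiv ℝ φ y (EuclideanSpace.single i 1) a := by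
  have := ((EuclideanSpace.proj a : Model d' →L[ℝ] ℝ).hasFDerivAt.comp y h.hasFDerivAt).fderiv
  change fderiv ℝ ((EuclideanSpace.proj a : Model d' →L[ℝ] ℝ) ∘ φ) y _ = _
  rw [this]
  rfl

lemma coordField_change {c c' : OpenPartialHomeomorph M (Model M.dim)} (hc : c ∈ M.charts)
    (hc' : c' ∈ M.charts) {x : M} (hx : x ∈ c.source) (hx' : x ∈ c'.source) (j : Fin M.dim) :
    coordField c j x =
      ∑ a, pd j (fun z => transition c c' z a) (c x) • coordField c' a x := by
  apply (chartDeriv hc' hx').injective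
  rw [map_sum]
  have h1 : chartDeriv hc' hx' (coordField c j x) = _ := mfderiv_chart_coordField hc hc' hx hx' j
  rw [h1]
  have h2 : ∀ a, chartDeriv hc' hx' (coordField c' a x) = (EuclideanSpace.single a (1 : ℝ)) :=
    fun a => (chartDeriv hc' hx').apply_symm_apply _
  simp only [map_smul, h2,
    pd_coord ((contDiffAt_transition hc hc' hx hx').differentiableAt (by simp))]
  exact euclidean_eq_sum _

lemma coordForm_coordField {c c' : OpenPartialHomeomorph M (Model M.dim)} (hc : c ∈ M.charts)
    (hc' : c' ∈ M.charts) {x : M} (hx : x ∈ c.source) (hx' : x ∈ c'.source) (e j : Fin M.dim) :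
    coordForm c' e x (coordField c j x) = pd j (fun z => transition c c' z e) (c x) := by
  rw [pd_coord ((contDiffAt_transition hc hc' hx hx').differentiableAt (by simp)),
    ← mfderiv_chart_coordField hc hc' hx hx' j]
  rfl

lemma coordForm_change {c c' : OpenPartialHomeomorph M (Model M.dim)} (hc : c ∈ M.charts)
    (hc' : c' ∈ M.charts) {x : M} (hx : x ∈ c.source) (hx' : x ∈ c'.source) (e : Fin M.dim)
    (v : TangentSpace (𝓡 M.dim) x) :
    coordForm c' e x v =
      ∑ k, pd k (fun z => transition c c' z e) (c x) * coordForm c k x v := by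
  have hv : v = ∑ k, coordForm c k x v • coordField c k x := by
    apply (chartDeriv hc hx).injective
    rw [map_sum]
    have h2 : ∀ a, chartDeriv hc hx (coordField c a x) = (EuclideanSpace.single a (1 : ℝ)) :=
      fun a => (chartDeriv hc hx).apply_symm_apply _
    simp only [map_smul, h2]
    exact euclidean_eq_sum _
  conv_lhs => rw [hv]
  simp only [map_sum, map_smul, smul_eq_mul, coordForm_coordField hc hc' hx hx']
  exact Finset.sum_congr rfl fun _ _ => mul_comm _ _

/-- Transformation law of the Christoffel symbols. -/
lemma Connection.christoffel_change (D : Connection M)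
    {c c' : OpenPartialHomeomorph M (Model M.dim)} (hc : c ∈ M.charts)
    (hc' : c' ∈ M.charts) {x : M} (hx : x ∈ c.source) (hx' : x ∈ c'.source) (e i j : Fin M.dim) :
    ∑ k, pd k (fun z => transition c c' z e) (c x) * D.christoffel c k i j (c x) =
      pd i (pd j (fun z => transition c c' z e)) (c x) +
      ∑ a, ∑ b, pd j (fun z => transition c c' z a) (c x) *
        pd i (fun z => transition c c' z b) (c x) * D.christoffel c' e b a (c' x) := by
  have hpd : ∀ a, ContDiffAt ℝ ∞ (pd j (fun z => transition c c' z a)) (c x) := fun a =>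
    (((EuclideanSpace.proj a : Model M.dim →L[ℝ] ℝ).contDiff.contDiffAt.comp (c x)
      (contDiffAt_transition hc hc' hx hx')).fderiv_right (m := ∞) (by simp)).clm_apply
      contDiffAt_const
  set g : Fin M.dim → M → ℝ := fun a z => pd j (fun z => transition c c' z a) (c z) with hg
  have hgd : ∀ a, MDifferentiableAt (𝓡 M.dim) 𝓘(ℝ, ℝ) (g a) x := fun a =>
    (((hpd a).contMDiffAt.mdifferentiableAt (by simp)).comp x
      ((chart_mdifferentiable hc).mdifferentiableAt hx) :)
  have hσ : ∀ a, MDifferentiableAt (𝓡 M.dim) (𝓡 M.dim).tangent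
      (fun z => (⟨z, coordField c' a z⟩ : TangentBundle (𝓡 M.dim) M)) x := fun a =>
    (contMDiffAt_coordField hc' hx' a).mdifferentiableAt (by simp)
  have hmv : ∀ a, mvfderiv (𝓡 M.dim) (g a) x (coordField c i x) =
      pd i (pd j (fun z => transition c c' z a)) (c x) := by
    intro a
    have h := mfderiv_comp (I := 𝓡 M.dim) (I' := 𝓡 M.dim) (I'' := 𝓘(ℝ, ℝ))
      (g := pd j (fun z => transition c c' z a)) (f := c) x
      ((hpd a).contMDiffAt.mdifferentiableAt (by simp))
      ((chart_mdifferentiable hc).mdifferentiableAt hx)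
    have h2 : mfderiv (𝓡 M.dim) 𝓘(ℝ, ℝ) (pd j (fun z => transition c c' z a)) (c x) =
      fderiv ℝ (pd j (fun z => transition c c' z a)) (c x) := mfderiv_eq_fderiv
    have h3 : mfderiv (𝓡 M.dim) (𝓡 M.dim) c x (coordField c i x) =
      (EuclideanSpace.single i (1 : ℝ)) := (chartDeriv hc hx).apply_symm_apply _
    change mfderiv (𝓡 M.dim) 𝓘(ℝ, ℝ) (pd j (fun z => transition c c' z a) ∘ c) x
      (coordField c i x) = _
    rw [h, h2]
    exact congrArg _ h3
  -- Expanding ∂_j in the other frame turns its covariant derivative into a Leibniz sum: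
  -- differentiating the coefficients gives the second derivatives of the transition map,
  -- differentiating the frame gives the other Christoffel symbols.
  have hev : coordField c j =ᶠ[nhds x] ∑ a, g a • coordField c' a := by
    filter_upwards [c.open_source.mem_nhds hx, c'.open_source.mem_nhds hx'] with z hz hz'
    rw [coordField_change hc hc' hz hz' j]
    exact (Finset.sum_apply z Finset.univ (fun a => g a • coordField c' a)).symm
  have hcov : D.cov (coordField c j) x = D.cov (∑ a, g a • coordField c' a) x :=
    D.cov.isCovariantDerivativeOnUniv.congr_of_eventuallyEq
      ((contMDiffAt_coordField hc hx j).mdifferentiableAt (by simp))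
      (((contMDiffAt_coordField hc hx j).mdifferentiableAt (by simp)).congr_of_eventuallyEq
        (by filter_upwards [hev] with z hz; rw [hz]; rfl)) Filter.univ_mem hev
  rw [cov_sum_smul D _ _ _ _ hσ hgd] at hcov
  have hL : ∀ k, D.christoffel c k i j (c x) =
      coordForm c k x (D.cov (coordField c j) x (coordField c i x)) := fun k => by
    unfold Connection.christoffel; rw [c.left_inv hx]
  have hR : ∀ a b, D.christoffel c' e b a (c' x) =
      coordForm c' e x (D.cov (coordField c' a) x (coordField c' b x)) := fun a b => by
    unfold Connection.christoffel; rw [c'.left_inv hx']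
  simp only [hL, hR]
  rw [← coordForm_change hc hc' hx hx', hcov]
  have hone : ∀ a, coordForm c' e x (coordField c' a x) = if a = e then 1 else 0 := by
    intro a
    have h3 : mfderiv (𝓡 M.dim) (𝓡 M.dim) c' x (coordField c' a x) =
      (EuclideanSpace.single a (1 : ℝ)) := (chartDeriv hc' hx').apply_symm_apply _
    refine (congrArg (EuclideanSpace.proj e : Model M.dim →L[ℝ] ℝ) h3).trans ?_
    simp [eq_comm]
  simp only [sum_apply, add_apply,
    smul_apply, ContinuousLinearMap.smulRight_apply, hmv, map_sum, map_add,
    map_smul, smul_eq_mul, hone, Finset.sum_add_distrib]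
  rw [add_comm]
  congr 1
  · simp
  · refine Finset.sum_congr rfl fun a _ => ?_
    conv_lhs => rw [coordField_change hc hc' hx hx' i]
    simp only [map_sum, map_smul, smul_eq_mul, Finset.mul_sum, hg]
    exact Finset.sum_congr rfl fun b _ => by ring

end ChartFields

/-! ### Smoothness of iterated covariant derivatives in coordinates. -/

section Smoothness

variable {d : ℕ} {F : Type} [NormedAddCommGroup F] [NormedSpace ℝ F]
  {G : Fin d → Fin d → Fin d → Model d → ℝ} {U : Set (Model d)}

lemma contDiffOn_pd (hU : IsOpen U) {f : Model d → F} (hf : ContDiffOn ℝ ∞ f U) (i : Fin d) :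
    ContDiffOn ℝ ∞ (pd i f) U :=
  (hf.fderiv_of_isOpen hU (by simp)).clm_apply contDiffOn_const

lemma contDiffOn_covD (hU : IsOpen U) (hG : ∀ k i j, ContDiffOn ℝ ∞ (G k i j) U) {p q : ℕ}
    {T : Comp d F p q} (hT : ∀ I J, ContDiffOn ℝ ∞ (T I J) U) (I : Fin p → Fin d)
    (J : Fin (q + 1) → Fin d) : ContDiffOn ℝ ∞ (covD G T I J) U := by
  unfold covD
  refine ((contDiffOn_pd hU (hT _ _) _).add ?_).sub ?_
  · exact ContDiffOn.sum fun s _ => ContDiffOn.sum fun m _ => (hG _ _ _).smul (hT _ _)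
  · exact ContDiffOn.sum fun s _ => ContDiffOn.sum fun m _ => (hG _ _ _).smul (hT _ _)

lemma contDiffOn_nablaFun (hU : IsOpen U) (hG : ∀ k i j, ContDiffOn ℝ ∞ (G k i j) U)
    {f : Model d → F} (hf : ContDiffOn ℝ ∞ f U) (m : ℕ) (I : Fin 0 → Fin d)
    (J : Fin m → Fin d) : ContDiffOn ℝ ∞ (nablaFun G f m I J) U := by
  induction m with
  | zero => exact hf
  | succ m ih => exact contDiffOn_covD hU hG (fun I J => by rw [Subsingleton.elim I]; exact ih _) I J

lemma contDiffOn_nablaSym (hU : IsOpen U) (hG : ∀ k i j, ContDiffOn ℝ ∞ (G k i j) U)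
    {f : Model d → F} (hf : ContDiffOn ℝ ∞ f U) (m : ℕ) (J : Fin m → Fin d) :
    ContDiffOn ℝ ∞ (nablaSym G f m J) U := by
  unfold nablaSym
  exact contDiffOn_const.smul (ContDiffOn.sum fun σ _ => contDiffOn_nablaFun hU hG hf m _ _)

lemma contDiffOn_nablaBivec (hU : IsOpen U) (hG : ∀ k i j, ContDiffOn ℝ ∞ (G k i j) U)
    {P : Fin d → Fin d → Model d → ℝ} (hP : ∀ i j, ContDiffOn ℝ ∞ (P i j) U) (a : ℕ)
    (I : Fin 2 → Fin d) (J : Fin a → Fin d) : ContDiffOn ℝ ∞ (nablaBivec G P a I J) U := by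
  induction a generalizing I with
  | zero => exact hP _ _
  | succ m ih => exact contDiffOn_covD hU hG (fun I J => ih I J) I J

lemma contDiffOn_nablaCurv (hU : IsOpen U) (hG : ∀ k i j, ContDiffOn ℝ ∞ (G k i j) U) (b : ℕ)
    (I : Fin 1 → Fin d) (J : Fin (3 + b) → Fin d) : ContDiffOn ℝ ∞ (nablaCurv G b I J) U := by
  induction b generalizing I with
  | zero =>
    unfold nablaCurv curvature
    refine ((contDiffOn_pd hU (hG _ _ _) _).sub (contDiffOn_pd hU (hG _ _ _) _)).add ?_
    exact ContDiffOn.sum fun m _ => ((hG _ _ _).mul (hG _ _ _)).sub ((hG _ _ _).mul (hG _ _ _))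
  | succ m ih => exact contDiffOn_covD hU hG (fun I J => ih I J) I J

end Smoothness

/-! ### Covariant derivatives depend only on germs. -/

section Locality

variable {d : ℕ} {F : Type} [NormedAddCommGroup F] [NormedSpace ℝ F]
  {G : Fin d → Fin d → Fin d → Model d → ℝ} {U : Set (Model d)}

lemma pd_congr (hU : IsOpen U) {f g : Model d → F} (h : Set.EqOn f g U) (i : Fin d) :
    Set.EqOn (pd i f) (pd i g) U := by
  intro y hy
  have : f =ᶠ[nhds y] g := Filter.eventuallyEq_of_mem (hU.mem_nhds hy) h
  unfold pd
  rw [this.fderiv_eq]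

lemma covD_congr (hU : IsOpen U) {p q : ℕ} {T T' : Comp d F p q}
    (h : ∀ I J, Set.EqOn (T I J) (T' I J) U) (I : Fin p → Fin d)
    (J : Fin (q + 1) → Fin d) : Set.EqOn (covD G T I J) (covD G T' I J) U := by
  intro y hy
  unfold covD
  rw [pd_congr hU (h I (Fin.tail J)) _ hy]
  have hT : ∀ I J, T I J y = T' I J y := fun I J => h I J hy
  simp only [hT]

lemma nablaFun_congr (hU : IsOpen U) {f g : Model d → F} (h : Set.EqOn f g U) (m : ℕ)
    (I : Fin 0 → Fin d) (J : Fin m → Fin d) :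
    Set.EqOn (nablaFun G f m I J) (nablaFun G g m I J) U := by
  induction m generalizing I with
  | zero => exact h
  | succ m ih => exact covD_congr hU (fun I J => ih I J) I J

lemma nablaSym_congr (hU : IsOpen U) {f g : Model d → F} (h : Set.EqOn f g U) (m : ℕ)
    (J : Fin m → Fin d) : Set.EqOn (nablaSym G f m J) (nablaSym G g m J) U := by
  intro y hy
  unfold nablaSym
  congr 1
  exact Finset.sum_congr rfl fun σ _ => nablaFun_congr hU h _ _ _ hy

end Locality

/-! ### Renaming a summation index. -/

section SumExchange

/-- The involution exchanging the value `J s` with `a`. -/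
lemma sum_sum_update {ι A B : Type*} [Fintype ι] [DecidableEq ι] [Fintype A] [AddCommMonoid B]
    (s : ι) (Φ : (ι → A) → A → B) :
    ∑ J : ι → A, ∑ a, Φ (Function.update J s a) (J s) = ∑ J : ι → A, ∑ a, Φ J a := by
  rw [← Fintype.sum_prod_type', ← Fintype.sum_prod_type']
  refine Fintype.sum_equiv ⟨fun p => (Function.update p.1 s p.2, p.1 s),
    fun p => (Function.update p.1 s p.2, p.1 s), fun p => ?_, fun p => ?_⟩ _ _ fun p => rfl
  all_goals simp

end SumExchange

/-! ### Iterated covariant derivatives as derivatives along the geodesic spray. -/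

section Jet

variable {d : ℕ} {F : Type} [NormedAddCommGroup F] [NormedSpace ℝ F]
  {G : Fin d → Fin d → Fin d → Model d → ℝ} {U : Set (Model d)}

/-- The vertical part of the geodesic spray. -/
def spray (G : Fin d → Fin d → Fin d → Model d → ℝ) (y v : Model d) : Model d :=
  WithLp.toLp 2 fun m => -∑ j, ∑ k, G m j k y * v j * v k

/-- The contraction of `∇^m f` with the `m`-th power of the vector `v`. -/
def jet (G : Fin d → Fin d → Fin d → Model d → ℝ) (f : Model d → F) (m : ℕ)
    (p : Model d × Model d) : F :=
  ∑ J : Fin m → Fin d, (∏ s, p.2 (J s)) • nablaFun G f m Fin.elim0 J p.1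

lemma jet_zero (f : Model d → F) (p : Model d × Model d) : jet G f 0 p = f p.1 := by
  simp [jet, nablaFun]

lemma hasFDerivAt_jet (hU : IsOpen U) (hG : ∀ k i j, ContDiffOn ℝ ∞ (G k i j) U)
    {f : Model d → F} (hf : ContDiffOn ℝ ∞ f U) (m : ℕ) {y : Model d} (hy : y ∈ U)
    (v : Model d) :
    HasFDerivAt (jet G f m) (∑ J : Fin m → Fin d,
      ((∏ s, v (J s)) • (fderiv ℝ (nablaFun G f m Fin.elim0 J) y).comp
          (ContinuousLinearMap.fst ℝ (Model d) (Model d)) +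
        (∑ s, (∏ s' ∈ Finset.univ.erase s, v (J s')) •
          (EuclideanSpace.proj (J s) : Model d →L[ℝ] ℝ).comp
            (ContinuousLinearMap.snd ℝ (Model d) (Model d))).smulRight
              (nablaFun G f m Fin.elim0 J y))) (y, v) := by
  refine HasFDerivAt.fun_sum fun J _ => ?_
  have h1 : HasFDerivAt (nablaFun G f m Fin.elim0 J) (fderiv ℝ (nablaFun G f m Fin.elim0 J) y) y :=
    (((contDiffOn_nablaFun hU hG hf m _ J).contDiffAt (hU.mem_nhds hy)).differentiableAt
      (by simp)).hasFDerivAt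
  have h2 := HasFDerivAt.comp (f := Prod.fst) ((y, v) : Model d × Model d) h1
    (ContinuousLinearMap.fst ℝ (Model d) (Model d)).hasFDerivAt
  have h3 : HasFDerivAt (fun p : Model d × Model d => ∏ s, p.2 (J s))
      (∑ s, (∏ s' ∈ Finset.univ.erase s, v (J s')) •
          (EuclideanSpace.proj (J s) : Model d →L[ℝ] ℝ).comp
            (ContinuousLinearMap.snd ℝ (Model d) (Model d))) (y, v) := by
    refine HasFDerivAt.finsetProd (u := Finset.univ)
      (g := fun s (p : Model d × Model d) => p.2 (J s)) (x := (y, v)) fun s _ => ?_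
    exact ((EuclideanSpace.proj (J s) : Model d →L[ℝ] ℝ).comp
            (ContinuousLinearMap.snd ℝ (Model d) (Model d))).hasFDerivAt
  exact h3.smul h2

lemma fderiv_eq_sum_pd (f : Model d → F) (y v : Model d) :
    fderiv ℝ f y v = ∑ i, v i • pd i f y := by
  conv_lhs => rw [euclidean_eq_sum v]
  simp [pd]

/-- Iterated covariant derivatives are iterated derivatives along the geodesic spray. -/
lemma jet_succ (hU : IsOpen U) (hG : ∀ k i j, ContDiffOn ℝ ∞ (G k i j) U)
    {f : Model d → F} (hf : ContDiffOn ℝ ∞ f U) (m : ℕ) {y : Model d} (hy : y ∈ U)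
    (v : Model d) :
    jet G f (m + 1) (y, v) = fderiv ℝ (jet G f m) (y, v) (v, spray G y v) := by
  rw [(hasFDerivAt_jet hU hG hf m hy v).fderiv]
  simp only [sum_apply, add_apply, smul_apply, ContinuousLinearMap.smulRight_apply,
    ContinuousLinearMap.comp_apply, ContinuousLinearMap.coe_fst', ContinuousLinearMap.coe_snd',
    Finset.sum_add_distrib]
  -- The newest derivative index is the first one; it is split off from the tuple.
  have hL : jet G f (m + 1) (y, v) = ∑ j, ∑ J : Fin m → Fin d, (v j * ∏ s, v (J s)) •
      (pd j (nablaFun G f m Fin.elim0 J) y - ∑ s, ∑ a, G a j (J s) y •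
        nablaFun G f m Fin.elim0 (Function.update J s a) y) := by
    unfold jet
    rw [← (Fin.consEquiv (fun _ : Fin (m + 1) => Fin d)).sum_comp, Fintype.sum_prod_type]
    refine Finset.sum_congr rfl fun j _ => Finset.sum_congr rfl fun J _ => ?_
    simp [Fin.consEquiv, Fin.prod_univ_succ, nablaFun, covD]
  -- Exchanging the summation index a with J s makes the Christoffel correction in slot s replace
  -- the factor v^{J s} by Γ^{J s}_{jk} v^j v^k, which is minus a component of the spray.
  have hR : ∀ s : Fin m, ∀ j, ∑ J : Fin m → Fin d, ∑ a, (v j * ∏ s, v (J s)) •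
      G a j (J s) y • nablaFun G f m Fin.elim0 (Function.update J s a) y =
      ∑ J : Fin m → Fin d, ∑ k, ((∏ s' ∈ Finset.univ.erase s, v (J s')) *
        (G (J s) j k y * v j * v k)) • nablaFun G f m Fin.elim0 J y := by
    intro s j
    rw [← sum_sum_update s]
    refine Finset.sum_congr rfl fun J _ => Finset.sum_congr rfl fun a _ => ?_
    rw [← Finset.mul_prod_erase Finset.univ (fun s' => v (Function.update J s a s'))
      (Finset.mem_univ s), smul_smul, Function.update_idem, Function.update_eq_self]
    congr 1
    rw [Finset.prod_congr rfl fun s' hs' => by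
      rw [Function.update_of_ne (Finset.ne_of_mem_erase hs')]]
    simp only [Function.update_self]
    ring
  have hA : ∑ J : Fin m → Fin d, (∑ s, (∏ s' ∈ Finset.univ.erase s, v (J s')) •
      (EuclideanSpace.proj (J s) : Model d →L[ℝ] ℝ) (spray G y v)) •
        nablaFun G f m Fin.elim0 J y =
      - ∑ s, ∑ j, ∑ J : Fin m → Fin d, ∑ k, ((∏ s' ∈ Finset.univ.erase s, v (J s')) *
        (G (J s) j k y * v j * v k)) • nablaFun G f m Fin.elim0 J y := by
    rw [← Finset.sum_neg_distrib]
    simp only [Finset.sum_smul]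
    rw [Finset.sum_comm]
    refine Finset.sum_congr rfl fun s _ => ?_
    rw [Finset.sum_comm, ← Finset.sum_neg_distrib]
    refine Finset.sum_congr rfl fun J _ => ?_
    simp only [← Finset.sum_smul, ← Finset.mul_sum, ← neg_smul]
    simp [spray]
  rw [hL]
  erw [hA]
  simp only [← hR, smul_sub, Finset.sum_sub_distrib]
  rw [sub_eq_add_neg]
  congr 1
  · rw [Finset.sum_comm]
    refine Finset.sum_congr rfl fun J _ => ?_
    rw [fderiv_eq_sum_pd, Finset.smul_sum]
    exact Finset.sum_congr rfl fun j _ => by rw [smul_smul, mul_comm]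
  · congr 1
    simp only [Finset.smul_sum]
    exact (Finset.sum_congr rfl fun j _ => Finset.sum_comm).trans Finset.sum_comm

lemma contDiffOn_jet (hU : IsOpen U) (hG : ∀ k i j, ContDiffOn ℝ ∞ (G k i j) U)
    {f : Model d → F} (hf : ContDiffOn ℝ ∞ f U) (m : ℕ) {p : Model d × Model d}
    (hp : p.1 ∈ U) : DifferentiableAt ℝ (jet G f m) p :=
  (hasFDerivAt_jet hU hG hf m hp p.2).differentiableAt

/-- An iterated derivative along one fixed vector field is additive because a single derivative is;
no symmetrisation has to be handled. The other algebraic rules for jets are proved in the same way.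
-/
lemma jet_add (hU : IsOpen U) (hG : ∀ k i j, ContDiffOn ℝ ∞ (G k i j) U)
    {f g : Model d → F} (hf : ContDiffOn ℝ ∞ f U) (hg : ContDiffOn ℝ ∞ g U) (m : ℕ)
    {p : Model d × Model d} (hp : p.1 ∈ U) :
    jet G (fun y => f y + g y) m p = jet G f m p + jet G g m p := by
  induction m generalizing p with
  | zero => simp [jet_zero]
  | succ m ih =>
    obtain ⟨y, v⟩ := p
    have hev : jet G (fun y => f y + g y) m =ᶠ[nhds (y, v)] fun p => jet G f m p + jet G g m p :=
      Filter.eventually_of_mem ((hU.prod isOpen_univ).mem_nhds ⟨hp, trivial⟩)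
        fun q hq => ih hq.1
    rw [jet_succ hU hG (hf.add hg) m hp, jet_succ hU hG hf m hp, jet_succ hU hG hg m hp,
      hev.fderiv_eq, fderiv_fun_add (contDiffOn_jet hU hG hf m hp) (contDiffOn_jet hU hG hg m hp)]
    rfl

end Jet

/-! ### Leibniz rule for jets. -/

section JetAlgebra

variable {d : ℕ} {𝕜 : Type} [RCLike 𝕜]
  {G : Fin d → Fin d → Fin d → Model d → ℝ} {U : Set (Model d)}

/-- The m-th power of a derivation applied to a product: the binomial formula holds because all
derivatives are taken along the same field. -/
lemma jet_mul (hU : IsOpen U) (hG : ∀ k i j, ContDiffOn ℝ ∞ (G k i j) U)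
    {f g : Model d → 𝕜} (hf : ContDiffOn ℝ ∞ f U) (hg : ContDiffOn ℝ ∞ g U) (m : ℕ)
    {p : Model d × Model d} (hp : p.1 ∈ U) :
    jet G (fun y => f y * g y) m p = ∑ ij ∈ Finset.HasAntidiagonal.antidiagonal m,
      m.choose ij.1 • (jet G f ij.1 p * jet G g ij.2 p) := by
  induction m generalizing p with
  | zero => simp [jet_zero]
  | succ m ih =>
    obtain ⟨y, v⟩ := p
    have hev : jet G (fun y => f y * g y) m =ᶠ[nhds (y, v)]
        fun p => ∑ ij ∈ Finset.HasAntidiagonal.antidiagonal m,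
          m.choose ij.1 • (jet G f ij.1 p * jet G g ij.2 p) :=
      Filter.eventually_of_mem ((hU.prod isOpen_univ).mem_nhds ⟨hp, trivial⟩)
        fun q hq => ih hq.1
    have hd := fun i => contDiffOn_jet hU hG hf i (p := (y, v)) hp
    have hd' := fun i => contDiffOn_jet hU hG hg i (p := (y, v)) hp
    rw [jet_succ hU hG (hf.mul hg) m hp, hev.fderiv_eq,
      Finset.sum_antidiagonal_choose_succ_nsmul (fun i j => jet G f i (y, v) * jet G g j (y, v)),
      fderiv_fun_sum fun ij _ => ((hd ij.1).fun_mul (hd' ij.2)).fun_const_smul _, sum_apply,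
      ← Finset.sum_add_distrib]
    refine Finset.sum_congr rfl fun ij hij => ?_
    have hch : m.choose ij.2 = m.choose ij.1 := by
      rw [Finset.HasAntidiagonal.mem_antidiagonal] at hij
      rw [← hij, Nat.choose_symm_add]
    rw [hch, fderiv_fun_const_smul ((hd ij.1).fun_mul (hd' ij.2)), fderiv_fun_mul (hd ij.1) (hd' ij.2),
      jet_succ hU hG hf _ hp, jet_succ hU hG hg _ hp, ← smul_add]
    simp only [smul_apply, add_apply, smul_eq_mul]
    congr 1
    ring

lemma jet_const_mul (hU : IsOpen U) (hG : ∀ k i j, ContDiffOn ℝ ∞ (G k i j) U)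
    {f : Model d → 𝕜} (hf : ContDiffOn ℝ ∞ f U) (a : 𝕜) (m : ℕ)
    {p : Model d × Model d} (hp : p.1 ∈ U) :
    jet G (fun y => a * f y) m p = a * jet G f m p := by
  induction m generalizing p with
  | zero => simp [jet_zero]
  | succ m ih =>
    obtain ⟨y, v⟩ := p
    have hev : jet G (fun y => a * f y) m =ᶠ[nhds (y, v)] fun p => a * jet G f m p :=
      Filter.eventually_of_mem ((hU.prod isOpen_univ).mem_nhds ⟨hp, trivial⟩)
        fun q hq => ih hq.1
    rw [jet_succ hU hG (contDiffOn_const.mul hf) m hp, jet_succ hU hG hf m hp,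
      hev.fderiv_eq, fderiv_const_mul (contDiffOn_jet hU hG hf m hp)]
    rfl

lemma jet_const (hU : IsOpen U) (hG : ∀ k i j, ContDiffOn ℝ ∞ (G k i j) U)
    (a : 𝕜) (m : ℕ) {p : Model d × Model d} (hp : p.1 ∈ U) :
    jet G (fun _ => a) (m + 1) p = 0 := by
  induction m generalizing p with
  | zero =>
    obtain ⟨y, v⟩ := p
    have : jet G (fun _ => a) 0 = fun _ => a := funext fun q => jet_zero _ _
    rw [jet_succ hU hG contDiffOn_const 0 hp, this]
    simp
  | succ m ih =>
    obtain ⟨y, v⟩ := p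
    have hev : jet G (fun _ => a) (m + 1) =ᶠ[nhds (y, v)] fun p => 0 :=
      Filter.eventually_of_mem ((hU.prod isOpen_univ).mem_nhds ⟨hp, trivial⟩)
        fun q hq => ih hq.1
    rw [jet_succ hU hG contDiffOn_const _ hp, hev.fderiv_eq]
    simp

lemma jet_one (hU : IsOpen U) (hG : ∀ k i j, ContDiffOn ℝ ∞ (G k i j) U)
    {f : Model d → 𝕜} (hf : ContDiffOn ℝ ∞ f U) {y : Model d} (hy : y ∈ U) (v : Model d) :
    jet G f 1 (y, v) = fderiv ℝ f y v := by
  have h0 : jet G f 0 = f ∘ Prod.fst := funext fun q => jet_zero _ _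
  have hd : DifferentiableAt ℝ f y :=
    (hf.contDiffAt (hU.mem_nhds hy)).differentiableAt (by simp)
  rw [jet_succ hU hG hf 0 hy, h0]
  have := (HasFDerivAt.comp (f := Prod.fst) ((y, v) : Model d × Model d) hd.hasFDerivAt
    (ContinuousLinearMap.fst ℝ (Model d) (Model d)).hasFDerivAt).fderiv
  rw [this]
  rfl

end JetAlgebra

/-! ### Jets under a change of coordinates. -/

section JetChange

variable {d : ℕ} {F : Type} [NormedAddCommGroup F] [NormedSpace ℝ F]
  {G G' : Fin d → Fin d → Fin d → Model d → ℝ} {O U U' : Set (Model d)}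

/-- Jets along the sprays of two connections related by a change of coordinates `φ`. -/
lemma jet_change (hU' : IsOpen U') (hO : IsOpen O) (hOU : O ⊆ U) (hU : IsOpen U)
    (hG : ∀ k i j, ContDiffOn ℝ ∞ (G k i j) U) (hG' : ∀ k i j, ContDiffOn ℝ ∞ (G' k i j) U')
    {φ : Model d → Model d} (hφ : ContDiffOn ℝ ∞ φ O) (hφU : Set.MapsTo φ O U')
    (hlaw : ∀ y ∈ O, ∀ e i j, ∑ k, pd k (fun z => φ z e) y * G k i j y =
      pd i (pd j (fun z => φ z e)) y +
      ∑ a, ∑ b, pd j (fun z => φ z a) y * pd i (fun z => φ z b) y * G' e b a (φ y))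
    {f f' : Model d → F} (hf : ContDiffOn ℝ ∞ f U) (hf' : ContDiffOn ℝ ∞ f' U')
    (hff : ∀ y ∈ O, f y = f' (φ y)) (m : ℕ) {y : Model d} (hy : y ∈ O) (v : Model d) :
    jet G f m (y, v) = jet G' f' m (φ y, fderiv ℝ φ y v) := by
  induction m generalizing y v with
  | zero => simp [jet_zero, hff y hy]
  | succ m ih =>
    have hev : jet G f m =ᶠ[nhds (y, v)] fun p => jet G' f' m (φ p.1, fderiv ℝ φ p.1 p.2) :=
      Filter.eventually_of_mem ((hO.prod isOpen_univ).mem_nhds ⟨hy, trivial⟩)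
        fun q hq => ih hq.1 q.2
    have hφy : ContDiffAt ℝ ∞ φ y := hφ.contDiffAt (hO.mem_nhds hy)
    have hd : DifferentiableAt ℝ φ y := hφy.differentiableAt (by simp)
    have hd2 : DifferentiableAt ℝ (fderiv ℝ φ) y :=
      (hφy.fderiv_right (m := ∞) (by simp)).differentiableAt (by simp)
    have h1 : HasFDerivAt (fun p : Model d × Model d => φ p.1)
        ((fderiv ℝ φ y).comp (ContinuousLinearMap.fst ℝ (Model d) (Model d))) (y, v) :=
      HasFDerivAt.comp (f := Prod.fst) ((y, v) : Model d × Model d) hd.hasFDerivAt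
        (ContinuousLinearMap.fst ℝ (Model d) (Model d)).hasFDerivAt
    have h2 : HasFDerivAt (fun p : Model d × Model d => fderiv ℝ φ p.1)
        ((fderiv ℝ (fderiv ℝ φ) y).comp (ContinuousLinearMap.fst ℝ (Model d) (Model d))) (y, v) :=
      HasFDerivAt.comp (f := Prod.fst) ((y, v) : Model d × Model d) hd2.hasFDerivAt
        (ContinuousLinearMap.fst ℝ (Model d) (Model d)).hasFDerivAt
    have h3 := h2.clm_apply (ContinuousLinearMap.snd ℝ (Model d) (Model d)).hasFDerivAt
    have h4 := HasFDerivAt.comp ((y, v) : Model d × Model d)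
      (contDiffOn_jet hU' hG' hf' m
        (p := (φ y, fderiv ℝ φ y v)) (hφU hy)).hasFDerivAt (h1.prodMk h3)
    rw [jet_succ hU hG hf m (hOU hy), jet_succ hU' hG' hf' m (hφU hy), hev.fderiv_eq]
    refine (congrArg (fun L => L (v, spray G y v)) h4.fderiv).trans ?_
    refine congrArg (fderiv ℝ (jet G' f' m) (φ y, fderiv ℝ φ y v)) ?_
    refine Prod.ext rfl ?_
    -- What remains is that the tangent map of φ carries one spray to the other: dφ(S(v)) + d²φ(v,
    -- v) = S'(dφ v). This is the transformation law of the Christoffel symbols contracted with v^i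
    -- v^j.
    change fderiv ℝ φ y (spray G y v) + fderiv ℝ (fderiv ℝ φ) y v v =
      spray G' (φ y) (fderiv ℝ φ y v)
    have hcomp : ∀ w e, fderiv ℝ φ y w e = ∑ i, w i * pd i (fun z => φ z e) y := by
      intro w e
      refine (congrArg (fun u => fderiv ℝ φ y u e) (euclidean_eq_sum w)).trans ?_
      simp [pd_coord hd]
    have hcomp2 : ∀ e, fderiv ℝ (fderiv ℝ φ) y v v e =
        ∑ i, ∑ j, v i * v j * pd i (pd j (fun z => φ z e)) y := by
      intro e
      have hpd : ∀ i j, pd i (pd j (fun z => φ z e)) y =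
          fderiv ℝ (fderiv ℝ φ) y (EuclideanSpace.single i 1) (EuclideanSpace.single j 1) e := by
        intro i j
        have he : pd j (fun z => φ z e) =ᶠ[nhds y]
            fun z => fderiv ℝ φ z (EuclideanSpace.single j 1) e :=
          Filter.eventually_of_mem (hO.mem_nhds hy) fun z hz =>
            pd_coord ((hφ.contDiffAt (hO.mem_nhds hz)).differentiableAt (by simp)) j e
        have h5 := (hd2.hasFDerivAt.clm_apply
          (hasFDerivAt_const (EuclideanSpace.single j (1 : ℝ) : Model d) y))
        have h6 := ((EuclideanSpace.proj e : Model d →L[ℝ] ℝ).hasFDerivAt.comp y h5)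
        unfold pd at he ⊢
        rw [he.fderiv_eq]
        refine (congrArg (fun L => L (EuclideanSpace.single i (1 : ℝ))) h6.fderiv).trans ?_
        simp
      simp only [hpd]
      have h7 : ∀ L : Model d →L[ℝ] Model d →L[ℝ] Model d, L v v e = ∑ i, ∑ j, v i * v j *
          L (EuclideanSpace.single i 1) (EuclideanSpace.single j 1) e := by
        intro L
        refine (congrArg (fun u => L u u e) (euclidean_eq_sum v)).trans ?_
        simp only [map_sum, map_smul, sum_apply, smul_apply]
        simp [Finset.mul_sum, mul_assoc]
        rw [Finset.sum_comm]
        exact Finset.sum_congr rfl fun _ _ => Finset.sum_congr rfl fun _ _ => by ring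
      exact h7 _
    ext e
    have hlaw' := hlaw y hy e
    simp only [PiLp.add_apply, hcomp, hcomp2, spray]
    have hsum : ∑ i, ∑ j, v i * v j * ∑ k, pd k (fun z => φ z e) y * G k i j y =
        ∑ i, ∑ j, v i * v j * (pd i (pd j (fun z => φ z e)) y +
          ∑ a, ∑ b, pd j (fun z => φ z a) y * pd i (fun z => φ z b) y * G' e b a (φ y)) :=
      Finset.sum_congr rfl fun i _ => Finset.sum_congr rfl fun j _ => by rw [hlaw']
    simp only [mul_add, Finset.sum_add_distrib] at hsum
    have e1 : ∑ i, (-∑ j, ∑ k, G i j k y * v j * v k) * pd i (fun z => φ z e) y =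
        -∑ i, ∑ j, v i * v j * ∑ k, pd k (fun z => φ z e) y * G k i j y := by
      simp only [neg_mul, Finset.sum_neg_distrib, Finset.sum_mul, Finset.mul_sum]
      rw [Finset.sum_comm]
      congr 1
      refine Finset.sum_congr rfl fun i _ => ?_
      rw [Finset.sum_comm]
      exact Finset.sum_congr rfl fun _ _ => Finset.sum_congr rfl fun _ _ => by ring
    have e2 : ∑ j, ∑ k, G' e j k (φ y) * (∑ i, v i * pd i (fun z => φ z j) y) *
          (∑ i, v i * pd i (fun z => φ z k) y) =
        ∑ i, ∑ j, v i * v j * ∑ a, ∑ b, pd j (fun z => φ z a) y * pd i (fun z => φ z b) y *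
          G' e b a (φ y) := by
      have e3 : ∀ T : Fin d → Fin d → Fin d → Fin d → ℝ, ∑ i, ∑ j, ∑ a, ∑ b, T i j a b =
          ∑ b, ∑ a, ∑ j, ∑ i, T i j a b := by
        intro T
        calc _ = ∑ i, ∑ b, ∑ a, ∑ j, T i j a b := by
              refine Finset.sum_congr rfl fun i _ => ?_
              rw [Finset.sum_comm]
              calc _ = ∑ a, ∑ b, ∑ j, T i j a b :=
                    Finset.sum_congr rfl fun a _ => Finset.sum_comm
                _ = _ := Finset.sum_comm
          _ = ∑ b, ∑ a, ∑ i, ∑ j, T i j a b := by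
              rw [Finset.sum_comm]
              exact Finset.sum_congr rfl fun b _ => Finset.sum_comm
          _ = _ := Finset.sum_congr rfl fun b _ => Finset.sum_congr rfl fun a _ =>
              Finset.sum_comm
      simp only [Finset.mul_sum, Finset.sum_mul]
      rw [e3]
      exact Finset.sum_congr rfl fun _ _ => Finset.sum_congr rfl fun _ _ =>
        Finset.sum_congr rfl fun _ _ => Finset.sum_congr rfl fun _ _ => by ring
    rw [e1, e2, hsum]
    ring

end JetChange

/-! ### Symmetric tensors and powers of covectors. -/

section SymmetricTensors

variable {d : ℕ} {𝕜 : Type} [RCLike 𝕜]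

/-- Fibres of equal size are matched one by one. Hence tuples giving the same monomial differ by a
permutation of their entries. -/
lemma exists_perm_of_card_fiber {m : ℕ} {A : Type} [DecidableEq A] {J J' : Fin m → A}
    (h : ∀ a, Fintype.card {s // J s = a} = Fintype.card {s // J' s = a}) :
    ∃ σ : Equiv.Perm (Fin m), J' ∘ σ = J := by
  let e : ∀ a, {s // J s = a} ≃ {s // J' s = a} := fun a => Fintype.equivOfCardEq (h a)
  refine ⟨(Equiv.sigmaFiberEquiv J).symm.trans
    ((Equiv.sigmaCongrRight e).trans (Equiv.sigmaFiberEquiv J')), ?_⟩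
  funext s
  exact (e (J s) ⟨s, rfl⟩).2

lemma sum_single_apply {m : ℕ} (J : Fin m → Fin d) (a : Fin d) :
    (∑ s, Finsupp.single (J s) 1 : Fin d →₀ ℕ) a = Fintype.card {s // J s = a} := by
  classical
  rw [Finsupp.finsetSum_apply, Fintype.card_subtype, Finset.card_filter]
  exact Finset.sum_congr rfl fun s _ => by simp [Finsupp.single_apply]

/-- Multi-indices of length at most `N`. -/
abbrev MultiIdx (d N : ℕ) : Type := Σ m : Fin (N + 1), (Fin m → Fin d)

/-- A family of tensors, symmetric in their indices. -/
def IsSymmetricFamily {N : ℕ} (t : MultiIdx d N → 𝕜) : Prop :=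
  ∀ (m : Fin (N + 1)) (J : Fin m → Fin d) (σ : Equiv.Perm (Fin m)), t ⟨m, J ∘ σ⟩ = t ⟨m, J⟩

/-- The family of the powers of `ξ`. -/
def powFamily (𝕜 : Type) [RCLike 𝕜] (N : ℕ) (ξ : Fin d → ℝ) : MultiIdx d N → 𝕜 :=
  fun p => ∏ s, (ξ (p.2 s) : 𝕜)

/-- The hypothesis says that a polynomial with coefficients built from `a` vanishes at all real
points, so it is the zero polynomial. A symmetric t depends only on the monomial of a tuple, so
pairing with t is a linear functional of that polynomial. -/
lemma pairing_eq_zero {N : ℕ} (a : MultiIdx d N → 𝕜)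
    (h : ∀ ξ : Fin d → ℝ, ∑ p, a p * powFamily 𝕜 N ξ p = 0)
    {t : MultiIdx d N → 𝕜} (ht : IsSymmetricFamily t) : ∑ p, a p * t p = 0 := by
  classical
  let mon : MultiIdx d N → (Fin d →₀ ℕ) := fun p => ∑ s, Finsupp.single (p.2 s) 1
  have hmon : ∀ p p', mon p = mon p' → t p = t p' := by
    rintro ⟨m, J⟩ ⟨m', J'⟩ hp
    have hdeg : ∀ p : MultiIdx d N, (mon p).degree = p.1 := by
      intro p
      simp [mon]
    have hm : m = m' := by
      have := congrArg Finsupp.degree hp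
      rw [hdeg, hdeg] at this
      exact Fin.ext this
    subst hm
    obtain ⟨σ, hσ⟩ := exists_perm_of_card_fiber (J := J) (J' := J') fun b => by
      rw [← sum_single_apply, ← sum_single_apply]
      exact DFunLike.congr_fun hp b
    rw [← hσ, ht]
  -- The value of t on any tuple with the given exponents; by symmetry the choice does not matter.
  let τ : (Fin d →₀ ℕ) → 𝕜 := fun α => if hα : ∃ p, mon p = α then t hα.choose else 0
  have hτ : ∀ p, τ (mon p) = t p := by
    intro p
    have hex : ∃ p', mon p' = mon p := ⟨p, rfl⟩
    simp only [τ, dif_pos hex]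
    exact hmon _ _ hex.choose_spec
  let P : MvPolynomial (Fin d) 𝕜 := ∑ p, MvPolynomial.monomial (mon p) (a p)
  have hP : P = 0 := by
    -- Over ℂ too it is enough to test real points, since ℝ is infinite.
    refine MvPolynomial.funext_set (fun _ => Set.range (RCLike.ofReal : ℝ → 𝕜))
      (fun _ => Set.infinite_range_of_injective RCLike.ofReal_injective) fun x hx => ?_
    have hx' : ∀ i, ∃ r : ℝ, (r : 𝕜) = x i := fun i => hx i trivial
    choose ξ hξ using hx'
    rw [map_zero, ← h ξ, map_sum]
    refine Finset.sum_congr rfl fun p _ => ?_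
    rw [MvPolynomial.eval_monomial]
    congr 1
    simp only [mon, powFamily, hξ]
    rw [← Finsupp.prod_finsetSum_index (by simp) (by intros; rw [pow_add])]
    exact Finset.prod_congr rfl fun s _ => by simp
  have hL := congrArg ((MvPolynomial.basisMonomials (Fin d) 𝕜).constr 𝕜 τ) hP
  rw [map_zero, map_sum] at hL
  rw [← hL]
  refine Finset.sum_congr rfl fun p _ => ?_
  have : MvPolynomial.monomial (mon p) (a p) =
      a p • MvPolynomial.basisMonomials (Fin d) 𝕜 (mon p) := by
    rw [MvPolynomial.coe_basisMonomials, MvPolynomial.smul_monomial, smul_eq_mul, mul_one]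
  rw [this, map_smul, Module.Basis.constr_basis, hτ, smul_eq_mul]

/-- Symmetric tensors are spanned by powers. -/
lemma mem_span_powFamily {N : ℕ} {t : MultiIdx d N → 𝕜} (ht : IsSymmetricFamily t) :
    t ∈ Submodule.span 𝕜 (Set.range (powFamily (d := d) 𝕜 N)) := by
  classical
  by_contra hn
  -- A functional that kills all powers kills every symmetric family, so it cannot detect t.
  obtain ⟨f, hf, hf0⟩ := Submodule.exists_dual_map_eq_bot_of_notMem hn inferInstance
  apply hf
  rw [LinearMap.pi_apply_eq_sum_univ]
  simp only [smul_eq_mul]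
  refine (Finset.sum_congr rfl fun p _ => mul_comm _ _).trans
    (pairing_eq_zero (fun p => f fun j => if p = j then 1 else 0) (fun ξ => ?_) ht)
  have : f (powFamily 𝕜 N ξ) = 0 := by
    have h1 : f (powFamily 𝕜 N ξ) ∈ (Submodule.span 𝕜 (Set.range (powFamily (d := d) 𝕜 N))).map f :=
      Submodule.mem_map_of_mem (Submodule.subset_span ⟨ξ, rfl⟩)
    rw [hf0] at h1
    exact (Submodule.mem_bot 𝕜).1 h1
  refine Eq.trans ?_ this
  rw [LinearMap.pi_apply_eq_sum_univ]
  exact Finset.sum_congr rfl fun p _ => by rw [smul_eq_mul, mul_comm]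

/-- A symmetric tensor is determined by its contractions with powers of vectors. -/
lemma symm_tensor_ext {m : ℕ} {a b : (Fin m → Fin d) → 𝕜}
    (ha : ∀ J (σ : Equiv.Perm (Fin m)), a (J ∘ σ) = a J)
    (hb : ∀ J (σ : Equiv.Perm (Fin m)), b (J ∘ σ) = b J)
    (h : ∀ v : Fin d → ℝ, ∑ J, a J * ∏ s, (v (J s) : 𝕜) = ∑ J, b J * ∏ s, (v (J s) : 𝕜)) :
    a = b := by
  classical
  -- The difference a − b, placed in length m and extended by zero to the shorter tuples.
  let c : MultiIdx d m → 𝕜 := fun p => if hp : (p.1 : ℕ) = m then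
    a (p.2 ∘ Fin.cast hp.symm) - b (p.2 ∘ Fin.cast hp.symm) else 0
  have hsum : ∀ T : (Fin m → Fin d) → 𝕜, ∀ g : MultiIdx d m → 𝕜,
      (∀ J, g ⟨Fin.last m, J⟩ = T J) →
      ∑ p, c p * g p = ∑ J, (a J - b J) * T J := by
    intro T g hg
    rw [Fintype.sum_sigma, Fintype.sum_eq_single (Fin.last m)]
    · exact Finset.sum_congr rfl fun J _ => by rw [hg]; simp [c]
    · intro i hi
      refine Finset.sum_eq_zero fun J _ => ?_
      have : (i : ℕ) ≠ m := fun h => hi (Fin.ext h)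
      simp [c, this]
  have hsymm : IsSymmetricFamily c := by
    intro i J σ
    by_cases hi : (i : ℕ) = m
    · have hi' : i = Fin.last m := Fin.ext hi
      subst hi'
      have e1 := ha J σ
      have e2 := hb J σ
      simp only [c, dif_pos hi]
      exact congrArg₂ (· - ·) e1 e2
    · simp [c, hi]
  -- Pairing the difference with its own conjugate, which is again symmetric, gives ∑ |a − b|² = 0.
  have key := pairing_eq_zero c (t := fun p => starRingEnd 𝕜 (c p)) (fun ξ => ?_) ?_
  · rw [hsum (fun J => starRingEnd 𝕜 (a J - b J)) _ (fun J => by simp [c])] at key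
    simp only [RCLike.mul_conj] at key
    have key2 : ∑ J, ‖a J - b J‖ ^ 2 = 0 := by exact_mod_cast key
    rw [Finset.sum_eq_zero_iff_of_nonneg fun _ _ => by positivity] at key2
    funext J
    have := key2 J (Finset.mem_univ J)
    rw [← sub_eq_zero, ← norm_eq_zero]
    exact pow_eq_zero_iff (two_ne_zero) |>.1 this
  · rw [hsum (fun J => ∏ s, (ξ (J s) : 𝕜)) _ (fun J => rfl)]
    simp only [sub_mul, Finset.sum_sub_distrib, h ξ, sub_self]
  · intro i J σ
    simp only [hsymm i J σ]

end SymmetricTensors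

/-! ### Functions that are exponentials to finite order at a point. -/

section NormalFunctions

variable {d : ℕ} {𝕜 : Type} [RCLike 𝕜]
  {G : Fin d → Fin d → Fin d → Model d → ℝ} {U : Set (Model d)}

lemma nablaSym_perm {F : Type} [NormedAddCommGroup F] [NormedSpace ℝ F] (f : Model d → F) (m : ℕ)
    (J : Fin m → Fin d) (y : Model d) (σ : Equiv.Perm (Fin m)) :
    nablaSym G f m (J ∘ σ) y = nablaSym G f m J y := by
  unfold nablaSym
  congr 1
  exact Fintype.sum_equiv (Equiv.mulLeft σ) _ _ fun τ => rfl

/-- Contracting with a power of v sees only the symmetrised tensor; since symmetric tensors are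
determined by such contractions, jets and symmetrised derivatives carry the same information. -/
lemma jet_eq_sum_nablaSym (f : Model d → 𝕜) (m : ℕ) (y v : Model d) :
    jet G f m (y, v) = ∑ J : Fin m → Fin d, nablaSym G f m J y * ∏ s, (v (J s) : 𝕜) := by
  have h1 : ∀ σ : Equiv.Perm (Fin m), ∑ J : Fin m → Fin d,
      nablaFun G f m Fin.elim0 (J ∘ σ) y * ∏ s, (v (J s) : 𝕜) = jet G f m (y, v) := by
    intro σ
    unfold jet
    refine Fintype.sum_equiv (σ.arrowCongr (Equiv.refl (Fin d))).symm _ _ fun J => ?_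
    have : ∏ s, v ((J ∘ σ) s) = ∏ s, v (J s) := Equiv.prod_comp σ fun s => v (J s)
    change _ = (∏ s, v ((J ∘ σ) s)) • nablaFun G f m Fin.elim0 (J ∘ σ) y
    rw [this, RCLike.real_smul_eq_coe_mul, mul_comm, RCLike.ofReal_prod]
  simp only [nablaSym, smul_mul_assoc, Finset.sum_mul]
  rw [← Finset.smul_sum, Finset.sum_comm]
  simp only [h1, Finset.sum_const, Finset.card_univ, Fintype.card_perm, Fintype.card_fin]
  rw [← Nat.cast_smul_eq_nsmul ℝ, smul_smul, inv_mul_cancel₀ (by positivity), one_smul]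

lemma sum_prod_eq_pow (m : ℕ) (ξ v : Fin d → 𝕜) :
    ∑ J : Fin m → Fin d, (∏ s, ξ (J s)) * ∏ s, v (J s) = (∑ i, ξ i * v i) ^ m := by
  rw [Finset.sum_pow', Fintype.piFinset_univ]
  exact Finset.sum_congr rfl fun J _ => Finset.prod_mul_distrib.symm

/-- `f` is an exponential with exponent `ξ` to order `N` at `y`. -/
def IsExpAt (G : Fin d → Fin d → Fin d → Model d → ℝ) (N : ℕ) (y : Model d) (ξ : Fin d → ℝ)
    (f : Model d → 𝕜) : Prop :=
  ∀ m ≤ N, ∀ J : Fin m → Fin d, nablaSym G f m J y = ∏ s, (ξ (J s) : 𝕜)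

/-- In terms of jets an exponential has values (ξ·v)^m, so the binomial theorem governs products. -/
lemma isExpAt_iff_jet {N : ℕ} {y : Model d} {ξ : Fin d → ℝ} {f : Model d → 𝕜} :
    IsExpAt G N y ξ f ↔ ∀ m ≤ N, ∀ v, jet G f m (y, v) = (∑ i, (ξ i : 𝕜) * (v i : 𝕜)) ^ m := by
  constructor
  · intro h m hm v
    rw [jet_eq_sum_nablaSym, ← sum_prod_eq_pow]
    exact Finset.sum_congr rfl fun J _ => by rw [h m hm]
  · intro h m hm
    refine congrFun (symm_tensor_ext (fun J σ => nablaSym_perm f m J y σ)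
      (fun J σ => Equiv.prod_comp σ fun s => (ξ (J s) : 𝕜)) fun v => ?_)
    have := h m hm (WithLp.toLp 2 v)
    rw [jet_eq_sum_nablaSym, ← sum_prod_eq_pow] at this
    exact this

/-- All derivatives of `f` and `g` at `y` agree to order `N`. -/
def JetEq (G : Fin d → Fin d → Fin d → Model d → ℝ) (N : ℕ) (y : Model d)
    (f g : Model d → 𝕜) : Prop :=
  ∀ m ≤ N, ∀ J : Fin m → Fin d, nablaSym G f m J y = nablaSym G g m J y

lemma jetEq_iff_jet {N : ℕ} {y : Model d} {f g : Model d → 𝕜} :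
    JetEq G N y f g ↔ ∀ m ≤ N, ∀ v, jet G f m (y, v) = jet G g m (y, v) := by
  constructor
  · intro h m hm v
    rw [jet_eq_sum_nablaSym, jet_eq_sum_nablaSym]
    exact Finset.sum_congr rfl fun J _ => by rw [h m hm]
  · intro h m hm
    refine congrFun (symm_tensor_ext (fun J σ => nablaSym_perm f m J y σ)
      (fun J σ => nablaSym_perm g m J y σ) fun v => ?_)
    have := h m hm (WithLp.toLp 2 v)
    rwa [jet_eq_sum_nablaSym, jet_eq_sum_nablaSym] at this

lemma jet_sum (hU : IsOpen U) (hG : ∀ k i j, ContDiffOn ℝ ∞ (G k i j) U) {ι : Type*}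
    (s : Finset ι) {f : ι → Model d → 𝕜} (hf : ∀ i, ContDiffOn ℝ ∞ (f i) U) (m : ℕ)
    {p : Model d × Model d} (hp : p.1 ∈ U) :
    jet G (fun y => ∑ i ∈ s, f i y) m p = ∑ i ∈ s, jet G (f i) m p := by
  classical
  induction s using Finset.induction_on with
  | empty =>
    simp only [Finset.sum_empty]
    have := jet_const_mul hU hG (f := fun _ => (0 : 𝕜)) contDiffOn_const 0 m hp
    simpa using this
  | insert a s ha ih =>
    simp only [Finset.sum_insert ha]
    rw [jet_add hU hG (hf a) (ContDiffOn.sum fun i _ => hf i) m hp, ih]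

/-- A factor that vanishes at y contributes only when it is differentiated. With at most n
derivatives for n factors each must be hit exactly once, which can happen in n! ways. -/
lemma jet_prod_of_vanishing (hU : IsOpen U) (hG : ∀ k i j, ContDiffOn ℝ ∞ (G k i j) U)
    {y : Model d} (hy : y ∈ U) (v : Model d) {n : ℕ} {w : Fin n → Model d → 𝕜}
    (hw : ∀ s, ContDiffOn ℝ ∞ (w s) U) (h0 : ∀ s, w s y = 0) {m : ℕ} (hm : m ≤ n) :
    jet G (fun z => ∏ s, w s z) m (y, v) =
      if m = n then (n.factorial : 𝕜) * ∏ s, fderiv ℝ (w s) y v else 0 := by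
  induction n generalizing m with
  | zero =>
    obtain rfl : m = 0 := by omega
    simp [jet_zero]
  | succ n ih =>
    simp only [Fin.prod_univ_succ]
    rw [jet_mul hU hG (hw 0) (contDiffOn_prod fun s _ => hw (Fin.succ s)) m hy]
    have hrest := fun {i} => ih (m := i) (fun s => hw s.succ) (fun s => h0 s.succ)
    -- No derivative on the first factor gives zero, and two or more leave fewer than n for the n
    -- remaining factors; only one derivative is possible.
    have hterm : ∀ ij ∈ Finset.HasAntidiagonal.antidiagonal m, ij ≠ (1, m - 1) →
        m.choose ij.1 • (jet G (w 0) ij.1 (y, v) *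
          jet G (fun z => ∏ s : Fin n, w s.succ z) ij.2 (y, v)) = 0 := by
      rintro ⟨i, j⟩ hij hne
      rw [Finset.HasAntidiagonal.mem_antidiagonal] at hij
      simp only at hij
      rcases Nat.eq_zero_or_pos i with rfl | hi
      · simp [jet_zero, h0]
      · have hi1 : i ≠ 1 := by
          rintro rfl
          exact hne (Prod.ext rfl (by simp only; omega))
        rw [hrest (by omega), if_neg (by omega), mul_zero, smul_zero]
    rcases Nat.eq_zero_or_pos m with rfl | hmpos
    · rw [Finset.sum_eq_zero fun ij hij => hterm ij hij ?_]
      · simp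
      · rintro rfl
        simp at hij
    · rw [Finset.sum_eq_single_of_mem (1, m - 1)
        (by rw [Finset.HasAntidiagonal.mem_antidiagonal]; simp only; omega)
        (fun ij hij hne => hterm ij hij hne)]
      simp only
      rw [hrest (by omega), jet_one hU hG (hw 0) hy]
      by_cases hmn : m = n + 1
      · subst hmn
        simp [Nat.factorial_succ]
        ring
      · rw [if_neg (by omega), if_neg hmn]
        simp

/-- Induction on the order: the derivatives of order N+1 are corrected by a homogeneous polynomial
of degree N+1 in coordinates centred at y, which does not disturb the lower orders. -/
lemma exists_isExpAt (hU : IsOpen U) (hG : ∀ k i j, ContDiffOn ℝ ∞ (G k i j) U)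
    {y : Model d} (hy : y ∈ U) (N : ℕ) (ξ : Fin d → ℝ) :
    ∃ f : Model d → 𝕜, ContDiff ℝ ∞ f ∧ IsExpAt G N y ξ f := by
  simp only [isExpAt_iff_jet]
  induction N with
  | zero =>
    refine ⟨fun _ => 1, contDiff_const, fun m hm v => ?_⟩
    obtain rfl : m = 0 := by omega
    simp [jet_zero]
  | succ N ih =>
    obtain ⟨f, hf, hfj⟩ := ih
    let w : Fin d → Model d → 𝕜 := fun i z => ((z i - y i : ℝ) : 𝕜)
    have hw : ∀ i, ContDiff ℝ ∞ (w i) := fun i =>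
      (RCLike.ofRealCLM (K := 𝕜)).contDiff.comp
        (((EuclideanSpace.proj i : Model d →L[ℝ] ℝ).contDiff).sub contDiff_const)
    have hw0 : ∀ i, w i y = 0 := fun i => by simp [w]
    have hwd : ∀ i v, fderiv ℝ (w i) y v = (v i : 𝕜) := by
      intro i v
      have h1 : HasFDerivAt (fun z : Model d => z i - y i)
          (EuclideanSpace.proj i : Model d →L[ℝ] ℝ) y :=
        ((EuclideanSpace.proj i : Model d →L[ℝ] ℝ).hasFDerivAt).sub_const _
      have h2 := ((RCLike.ofRealCLM (K := 𝕜)).hasFDerivAt).comp y h1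
      exact congrArg (fun L => L v) h2.fderiv
    -- The defect of the top symmetrised derivative; the inverse factorial compensates the one in
    -- `jet_prod_of_vanishing`.
    let r : (Fin (N + 1) → Fin d) → 𝕜 := fun J =>
      (((N + 1).factorial : 𝕜))⁻¹ * (∏ s, (ξ (J s) : 𝕜) - nablaSym G f (N + 1) J y)
    have hprod : ∀ J : Fin (N + 1) → Fin d, ContDiff ℝ ∞ (fun z => ∏ s, w (J s) z) := fun J =>
      contDiff_prod fun s _ => hw (J s)
    refine ⟨fun z => f z + ∑ J, r J * ∏ s, w (J s) z,
      hf.add (ContDiff.sum fun J _ => contDiff_const.mul (hprod J)), fun m hm v => ?_⟩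
    rw [jet_add hU hG hf.contDiffOn
      (ContDiff.sum fun J _ => contDiff_const.mul (hprod J)).contDiffOn m hy,
      jet_sum hU hG _ (fun J => (contDiff_const.mul (hprod J)).contDiffOn) m hy]
    simp only [jet_const_mul hU hG (hprod _).contDiffOn _ m (p := (y, v)) hy,
      jet_prod_of_vanishing hU hG hy v (fun s => (hw _).contDiffOn) (fun s => hw0 _) hm, hwd]
    by_cases hmN : m = N + 1
    · subst hmN
      simp only [if_true]
      rw [jet_eq_sum_nablaSym, ← Finset.sum_add_distrib, ← sum_prod_eq_pow]
      refine Finset.sum_congr rfl fun J _ => ?_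
      have : ((N + 1).factorial : 𝕜) ≠ 0 := by exact_mod_cast (N + 1).factorial_ne_zero
      simp only [r]
      field_simp
      ring
    · simp [hmN, hfj m (by omega) v]

end NormalFunctions

/-! ### Exponentials on a manifold. -/

section GlobalFunctions

variable {𝕜 : Type} [RCLike 𝕜] {M : Mfd.{u}}

/-- A smooth function in a chart extends, near a given point, to a global smooth function. -/
lemma exists_fun_eqOn {c : OpenPartialHomeomorph M (Model M.dim)} (hc : c ∈ M.charts) {x : M}
    (hx : x ∈ c.source) {h : Model M.dim → 𝕜} (hh : ContDiff ℝ ∞ h) :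
    ∃ (f : Fun 𝕜 M) (O : Set (Model M.dim)), IsOpen O ∧ c x ∈ O ∧ Set.EqOn (inChart f c) h O := by
  obtain ⟨b, hb⟩ := (SmoothBumpFunction.nhds_basis_tsupport (I := 𝓡 M.dim) x).mem_iff.1
    (c.open_source.mem_nhds hx)
  have hsm : ContMDiff (𝓡 M.dim) 𝓘(ℝ, 𝕜) ∞ (fun z => b z • h (c z)) := by
    refine contMDiff_of_tsupport fun z hz => ?_
    have hz' : z ∈ c.source := hb.2 (tsupport_smul_subset_left _ _ hz)
    exact b.contMDiffAt.smul ((hh.contMDiff.contMDiffAt).comp z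
      ((contMDiffOn_of_mem_maximalAtlas hc).contMDiffAt (c.open_source.mem_nhds hz')))
  have hev : ∀ᶠ y in nhds (c x), y ∈ c.target ∧ b (c.symm y) = 1 := by
    refine Filter.Eventually.and (c.open_target.mem_nhds (c.map_source hx)) ?_
    have h1 := c.continuousAt_symm (c.map_source hx)
    rw [ContinuousAt, c.left_inv hx] at h1
    exact h1.eventually b.eventuallyEq_one
  obtain ⟨O, hO, hOo, hxO⟩ := eventually_nhds_iff.1 hev
  refine ⟨⟨_, hsm⟩, O, hOo, hxO, fun y hy => ?_⟩
  change b (c.symm y) • h (c (c.symm y)) = h y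
  rw [(hO y hy).2, c.right_inv (hO y hy).1, one_smul]

lemma exists_fun_isExpAt (D : Connection M) {c : OpenPartialHomeomorph M (Model M.dim)}
    (hc : c ∈ M.charts) {x : M} (hx : x ∈ c.source) (N : ℕ) (ξ : Fin M.dim → ℝ) :
    ∃ f : Fun 𝕜 M, IsExpAt (D.christoffel c) N (c x) ξ (inChart f c) := by
  obtain ⟨h, hh, hexp⟩ := exists_isExpAt (𝕜 := 𝕜) c.open_target (contDiffOn_christoffel D hc)
    (c.map_source hx) N ξ
  obtain ⟨f, O, hO, hxO, hf⟩ := exists_fun_eqOn hc hx hh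
  exact ⟨f, fun m hm J => by rw [nablaSym_congr hO hf m J hxO]; exact hexp m hm J⟩

end GlobalFunctions

/-! ### Separating homogeneous components of an identity. -/

section PolynomialExtraction

variable {𝕜 : Type} [RCLike 𝕜]

/-- A polynomial identity in a real variable can be weighted degree by degree. -/
lemma sum_weight_eq_zero {ι : Type*} (s : Finset ι) (deg : ι → ℕ) (b : ι → 𝕜)
    (h : ∀ t : ℝ, ∑ i ∈ s, (t : 𝕜) ^ deg i * b i = 0) (w : ℕ → 𝕜) :
    ∑ i ∈ s, w (deg i) * b i = 0 := by
  classical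
  let p : Polynomial 𝕜 := ∑ i ∈ s, Polynomial.monomial (deg i) (b i)
  have hp : p = 0 := by
    refine Polynomial.eq_zero_of_infinite_isRoot p
      ((Set.infinite_range_of_injective (RCLike.ofReal_injective (K := 𝕜))).mono ?_)
    rintro _ ⟨t, rfl⟩
    simp only [Set.mem_ofPred_eq, Polynomial.IsRoot, p, Polynomial.eval_finsetSum,
      Polynomial.eval_monomial]
    rw [← h t]
    exact Finset.sum_congr rfl fun i _ => mul_comm _ _
  have hcoef : ∀ n, ∑ i ∈ s with deg i = n, b i = 0 := by
    intro n
    have := congrArg (fun q => Polynomial.coeff q n) hp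
    simp only [p, Polynomial.finsetSum_coeff, Polynomial.coeff_monomial,
      Polynomial.coeff_zero] at this
    rwa [← Finset.sum_filter] at this
  rw [← Finset.sum_fiberwise_of_maps_to (t := s.image deg)
    (fun i hi => Finset.mem_image_of_mem deg hi)]
  refine Finset.sum_eq_zero fun n _ => ?_
  rw [Finset.sum_congr rfl (g := fun i => w n * b i) fun i hi => by
    rw [(Finset.mem_filter.1 hi).2], ← Finset.mul_sum, hcoef, mul_zero]

end PolynomialExtraction

/-! ### Linearity of symmetrised derivatives, deduced from jets. -/

section Linearity

variable {d : ℕ} {𝕜 : Type} [RCLike 𝕜]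
  {G : Fin d → Fin d → Fin d → Model d → ℝ} {U : Set (Model d)}

lemma nablaSym_add (hU : IsOpen U) (hG : ∀ k i j, ContDiffOn ℝ ∞ (G k i j) U)
    {f g : Model d → 𝕜} (hf : ContDiffOn ℝ ∞ f U) (hg : ContDiffOn ℝ ∞ g U) (m : ℕ)
    (J : Fin m → Fin d) {y : Model d} (hy : y ∈ U) :
    nablaSym G (fun z => f z + g z) m J y = nablaSym G f m J y + nablaSym G g m J y := by
  refine congrFun (symm_tensor_ext (a := fun J => nablaSym G (fun z => f z + g z) m J y)
    (b := fun J => nablaSym G f m J y + nablaSym G g m J y)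
    (fun J σ => nablaSym_perm _ m J y σ)
    (fun J σ => by rw [nablaSym_perm, nablaSym_perm]) fun v => ?_) J
  have := jet_add hU hG hf hg m (p := (y, WithLp.toLp 2 v)) hy
  simp only [jet_eq_sum_nablaSym] at this
  simp only [add_mul, Finset.sum_add_distrib]
  exact this

lemma nablaSym_const_mul (hU : IsOpen U) (hG : ∀ k i j, ContDiffOn ℝ ∞ (G k i j) U)
    {f : Model d → 𝕜} (hf : ContDiffOn ℝ ∞ f U) (a : 𝕜) (m : ℕ)
    (J : Fin m → Fin d) {y : Model d} (hy : y ∈ U) :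
    nablaSym G (fun z => a * f z) m J y = a * nablaSym G f m J y := by
  refine congrFun (symm_tensor_ext (a := fun J => nablaSym G (fun z => a * f z) m J y)
    (b := fun J => a * nablaSym G f m J y)
    (fun J σ => nablaSym_perm _ m J y σ)
    (fun J σ => by rw [nablaSym_perm]) fun v => ?_) J
  have := jet_const_mul hU hG hf a m (p := (y, WithLp.toLp 2 v)) hy
  simp only [jet_eq_sum_nablaSym, Finset.mul_sum] at this
  simp only [mul_assoc]
  exact this

lemma nablaSym_const (hU : IsOpen U) (hG : ∀ k i j, ContDiffOn ℝ ∞ (G k i j) U) (a : 𝕜) {m : ℕ}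
    (hm : m ≠ 0) (J : Fin m → Fin d) {y : Model d} (hy : y ∈ U) :
    nablaSym G (fun _ => a) m J y = 0 := by
  obtain ⟨m, rfl⟩ := Nat.exists_eq_succ_of_ne_zero hm
  refine congrFun (symm_tensor_ext (a := fun J => nablaSym G (fun _ => a) (m + 1) J y)
    (b := fun J => 0) (fun J σ => nablaSym_perm _ _ J y σ) (fun J σ => rfl) fun v => ?_) J
  have := jet_const hU hG a m (p := (y, WithLp.toLp 2 v)) hy
  rw [jet_eq_sum_nablaSym] at this
  simpa using this

lemma nablaSym_zero_order (f : Model d → 𝕜) (J : Fin 0 → Fin d) (y : Model d) :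
    nablaSym G f 0 J y = f y := by
  simp [nablaSym, nablaFun]

end Linearity

/-! ### Combinations of monomials: multilinearity, dependence on jets, symbols. -/

section EvalComb

variable {𝕜 : Type} [RCLike 𝕜] {k : ℕ}

/-- The value of a linear combination of monomials, in coordinates. -/
def evalComb {d : ℕ} (e : Monomial k →₀ 𝕜) (G : Fin d → Fin d → Fin d → Model d → ℝ)
    (P : Fin d → Fin d → Model d → ℝ) (f : Fin k → Model d → 𝕜) (y : Model d) : 𝕜 :=
  Finsupp.linearCombination 𝕜 (fun Γ => Γ.eval G P f y) e

lemma evalComb_eq_sum {d : ℕ} (e : Monomial k →₀ 𝕜) (G : Fin d → Fin d → Fin d → Model d → ℝ)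
    (P : Fin d → Fin d → Model d → ℝ) (f : Fin k → Model d → 𝕜) (y : Model d) :
    evalComb e G P f y = ∑ Γ ∈ e.support, e Γ * Γ.eval G P f y := rfl

/-- The contraction of the contravariant tensor of a monomial with given covariant tensors. -/
def Monomial.contract {d : ℕ} (Γ : Monomial k) (G : Fin d → Fin d → Fin d → Model d → ℝ)
    (P : Fin d → Fin d → Model d → ℝ) (y : Model d) (T : ∀ l, (Fin (Γ.ord l) → Fin d) → 𝕜) : 𝕜 :=
  ∑ v : Fin Γ.n → Fin d,
    ((∏ i, nablaBivec G P (Γ.facP i).order (v ∘ (Γ.facP i).up) (v ∘ (Γ.facP i).low) y : ℝ) : 𝕜) *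
    ((∏ j, nablaCurv G (Γ.facR j).order (fun _ => v (Γ.facR j).up) (v ∘ (Γ.facR j).low) y : ℝ)
      : 𝕜) *
    ∏ l, T l (v ∘ Γ.arg l)

lemma Monomial.eval_eq_contract {d : ℕ} (Γ : Monomial k)
    (G : Fin d → Fin d → Fin d → Model d → ℝ)
    (P : Fin d → Fin d → Model d → ℝ) (f : Fin k → Model d → 𝕜) (y : Model d) :
    Γ.eval G P f y = Γ.contract G P y fun l J => nablaSym G (f l) (Γ.ord l) J y := rfl

lemma Monomial.contract_update_add {d : ℕ} (Γ : Monomial k)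
    (G : Fin d → Fin d → Fin d → Model d → ℝ)
    (P : Fin d → Fin d → Model d → ℝ) (y : Model d) {T T' T'' : ∀ l, (Fin (Γ.ord l) → Fin d) → 𝕜}
    (l : Fin k) (h : T l = T' l + T'' l) (h' : ∀ i ≠ l, T i = T' i) (h'' : ∀ i ≠ l, T i = T'' i) :
    Γ.contract G P y T = Γ.contract G P y T' + Γ.contract G P y T'' := by
  classical
  unfold Monomial.contract
  rw [← Finset.sum_add_distrib]
  refine Finset.sum_congr rfl fun v _ => ?_
  rw [← mul_add]
  congr 1
  have e1 : ∏ i : {i // i ≠ l}, T' i (v ∘ Γ.arg i) = ∏ i : {i // i ≠ l}, T i (v ∘ Γ.arg i) :=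
    Finset.prod_congr rfl fun i _ => by rw [h' i i.2]
  have e2 : ∏ i : {i // i ≠ l}, T'' i (v ∘ Γ.arg i) = ∏ i : {i // i ≠ l}, T i (v ∘ Γ.arg i) :=
    Finset.prod_congr rfl fun i _ => by rw [h'' i i.2]
  rw [Fintype.prod_eq_mul_prod_subtype_ne _ l,
    Fintype.prod_eq_mul_prod_subtype_ne (fun i => T' i (v ∘ Γ.arg i)) l,
    Fintype.prod_eq_mul_prod_subtype_ne (fun i => T'' i (v ∘ Γ.arg i)) l, e1, e2, h]
  exact add_mul _ _ _

lemma Monomial.contract_update_mul {d : ℕ} (Γ : Monomial k)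
    (G : Fin d → Fin d → Fin d → Model d → ℝ)
    (P : Fin d → Fin d → Model d → ℝ) (y : Model d) {T T' : ∀ l, (Fin (Γ.ord l) → Fin d) → 𝕜}
    (l : Fin k) (a : 𝕜) (h : T l = a • T' l) (h' : ∀ i ≠ l, T i = T' i) :
    Γ.contract G P y T = a * Γ.contract G P y T' := by
  classical
  unfold Monomial.contract
  rw [Finset.mul_sum]
  refine Finset.sum_congr rfl fun v _ => ?_
  rw [Fintype.prod_eq_mul_prod_subtype_ne _ l,
    Fintype.prod_eq_mul_prod_subtype_ne (fun i => T' i (v ∘ Γ.arg i)) l, h,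
    Finset.prod_congr rfl fun (i : {i // i ≠ l}) _ => by rw [h' i i.2], Pi.smul_apply, smul_eq_mul]
  ring

variable {M : Mfd.{u}}

/-- The value at `x` of a linear combination of monomials, computed in the chart `c`. -/
def evalAt (e : Monomial k →₀ 𝕜) (D : Connection M) (P : PoissonTensor M)
    (c : OpenPartialHomeomorph M (Model M.dim)) (f : Fin k → Fun 𝕜 M) (x : M) : 𝕜 :=
  evalComb e (D.christoffel c) (bivComp P.tensor c) (fun l => inChart (f l) c) (c x)

lemma MultiOp.RepresentedBy.apply {A : MultiOp.{u} 𝕜 k} {e : Monomial k →₀ 𝕜}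
    (h : A.RepresentedBy e) {D : Connection M} {P : PoissonTensor M}
    {c : OpenPartialHomeomorph M (Model M.dim)} (hc : c ∈ M.charts) {x : M} (hx : x ∈ c.source)
    (f : Fin k → Fun 𝕜 M) : A M D P f x = evalAt e D P c f x := h M D P f c hc x hx

lemma nablaSym_inChart_add (D : Connection M) {c : OpenPartialHomeomorph M (Model M.dim)}
    (hc : c ∈ M.charts) {x : M} (hx : x ∈ c.source) (f g : Fun 𝕜 M) (m : ℕ)
    (J : Fin m → Fin M.dim) :
    nablaSym (D.christoffel c) (inChart (f + g) c) m J (c x) =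
      nablaSym (D.christoffel c) (inChart f c) m J (c x) +
      nablaSym (D.christoffel c) (inChart g c) m J (c x) :=
  nablaSym_add c.open_target (contDiffOn_christoffel D hc) (contDiffOn_inChart f hc)
    (contDiffOn_inChart g hc) m J (c.map_source hx)

lemma nablaSym_inChart_const_mul (D : Connection M) {c : OpenPartialHomeomorph M (Model M.dim)}
    (hc : c ∈ M.charts) {x : M} (hx : x ∈ c.source) (a : 𝕜) (f : Fun 𝕜 M) (m : ℕ)
    (J : Fin m → Fin M.dim) :
    nablaSym (D.christoffel c) (inChart (constFun M a * f) c) m J (c x) =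
      a * nablaSym (D.christoffel c) (inChart f c) m J (c x) :=
  nablaSym_const_mul c.open_target (contDiffOn_christoffel D hc) (contDiffOn_inChart f hc) a
    m J (c.map_source hx)

lemma evalAt_update_add (e : Monomial k →₀ 𝕜) (D : Connection M) (P : PoissonTensor M)
    {c : OpenPartialHomeomorph M (Model M.dim)} (hc : c ∈ M.charts) {x : M} (hx : x ∈ c.source)
    (f : Fin k → Fun 𝕜 M) (l : Fin k) (g h : Fun 𝕜 M) :
    evalAt e D P c (Function.update f l (g + h)) x =
      evalAt e D P c (Function.update f l g) x + evalAt e D P c (Function.update f l h) x := by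
  simp only [evalAt, evalComb_eq_sum]
  rw [← Finset.sum_add_distrib]
  refine Finset.sum_congr rfl fun Γ _ => ?_
  rw [← mul_add]
  congr 1
  simp only [Monomial.eval_eq_contract]
  refine Γ.contract_update_add _ _ _ l ?_ (fun i hi => ?_) (fun i hi => ?_)
  · funext J
    simp only [Function.update_self, Pi.add_apply]
    exact nablaSym_inChart_add D hc hx g h _ J
  · simp only [Function.update_of_ne hi]
  · simp only [Function.update_of_ne hi]

lemma evalAt_update_const_mul (e : Monomial k →₀ 𝕜) (D : Connection M) (P : PoissonTensor M)
    {c : OpenPartialHomeomorph M (Model M.dim)} (hc : c ∈ M.charts) {x : M} (hx : x ∈ c.source)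
    (f : Fin k → Fun 𝕜 M) (l : Fin k) (a : 𝕜) (g : Fun 𝕜 M) :
    evalAt e D P c (Function.update f l (constFun M a * g)) x =
      a * evalAt e D P c (Function.update f l g) x := by
  simp only [evalAt, evalComb_eq_sum]
  rw [Finset.mul_sum]
  refine Finset.sum_congr rfl fun Γ _ => ?_
  rw [mul_left_comm]
  congr 1
  simp only [Monomial.eval_eq_contract]
  refine Γ.contract_update_mul _ _ _ l a ?_ (fun i hi => ?_)
  · funext J
    simp only [Function.update_self, Pi.smul_apply, smul_eq_mul]
    exact nablaSym_inChart_const_mul D hc hx a g _ J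
  · simp only [Function.update_of_ne hi]

/-- `f` and `g` agree to order `N` at `x`. -/
def FunJetEq (D : Connection M) (c : OpenPartialHomeomorph M (Model M.dim)) (x : M) (N : ℕ)
    (f g : Fun 𝕜 M) : Prop :=
  JetEq (D.christoffel c) N (c x) (inChart f c) (inChart g c)

/-- `f` is an exponential with exponent `ξ`, to order `N` at `x`. -/
def FunExpAt (D : Connection M) (c : OpenPartialHomeomorph M (Model M.dim)) (x : M) (N : ℕ)
    (ξ : Fin M.dim → ℝ) (f : Fun 𝕜 M) : Prop :=
  IsExpAt (D.christoffel c) N (c x) ξ (inChart f c)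

lemma evalAt_congr_jet {e : Monomial k →₀ 𝕜} (D : Connection M) (P : PoissonTensor M)
    {c : OpenPartialHomeomorph M (Model M.dim)} {x : M} {N : ℕ}
    (hN : ∀ Γ ∈ e.support, ∀ l, Γ.ord l ≤ N) {f g : Fin k → Fun 𝕜 M}
    (h : ∀ l, FunJetEq D c x N (f l) (g l)) : evalAt e D P c f x = evalAt e D P c g x := by
  simp only [evalAt, evalComb_eq_sum]
  refine Finset.sum_congr rfl fun Γ hΓ => ?_
  simp only [Monomial.eval_eq_contract]
  congr 2
  funext l J
  exact h l _ (hN Γ hΓ l) J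

/-- The symbol of a monomial. -/
def Monomial.symbol {d : ℕ} (Γ : Monomial k) (G : Fin d → Fin d → Fin d → Model d → ℝ)
    (P : Fin d → Fin d → Model d → ℝ) (y : Model d) (ξ : Fin k → Fin d → ℝ) : 𝕜 :=
  Γ.contract G P y fun l J => ∏ s, (ξ l (J s) : 𝕜)

/-- Homogeneity in each exponent is the device that separates monomials by their order in each
argument. -/
lemma Monomial.symbol_smul {d : ℕ} (Γ : Monomial k) (G : Fin d → Fin d → Fin d → Model d → ℝ)
    (P : Fin d → Fin d → Model d → ℝ) (y : Model d) (t : Fin k → ℝ) (ξ : Fin k → Fin d → ℝ) :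
    Γ.symbol (𝕜 := 𝕜) G P y (fun l => t l • ξ l) =
      (∏ l, (t l : 𝕜) ^ Γ.ord l) * Γ.symbol G P y ξ := by
  unfold Monomial.symbol Monomial.contract
  rw [Finset.mul_sum]
  refine Finset.sum_congr rfl fun v _ => ?_
  simp only [Pi.smul_apply, smul_eq_mul, RCLike.ofReal_mul, Finset.prod_mul_distrib,
    Finset.prod_const, Finset.card_univ, Fintype.card_fin]
  ring

/-- On exponentials the symmetrised derivatives are powers of the exponents, so the manifold enters
only through P, R and these powers. -/
lemma evalAt_exp {e : Monomial k →₀ 𝕜} (D : Connection M) (P : PoissonTensor M)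
    {c : OpenPartialHomeomorph M (Model M.dim)} {x : M} {N : ℕ}
    (hN : ∀ Γ ∈ e.support, ∀ l, Γ.ord l ≤ N) {f : Fin k → Fun 𝕜 M} {ξ : Fin k → Fin M.dim → ℝ}
    (h : ∀ l, FunExpAt D c x N (ξ l) (f l)) : evalAt e D P c f x =
      ∑ Γ ∈ e.support, e Γ * Γ.symbol (D.christoffel c) (bivComp P.tensor c) (c x) ξ := by
  simp only [evalAt, evalComb_eq_sum]
  refine Finset.sum_congr rfl fun Γ hΓ => ?_
  simp only [Monomial.eval_eq_contract, Monomial.symbol]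
  congr 2
  funext l J
  exact h l _ (hN Γ hΓ l) J

/-- The Leibniz rule for jets against the binomial theorem for (ξ·v + η·v)^m. -/
lemma funExpAt_mul {D : Connection M} {c : OpenPartialHomeomorph M (Model M.dim)}
    (hc : c ∈ M.charts) {x : M} (hx : x ∈ c.source) {N : ℕ} {ξ η : Fin M.dim → ℝ}
    {f g : Fun 𝕜 M} (hf : FunExpAt D c x N ξ f) (hg : FunExpAt D c x N η g) :
    FunExpAt D c x N (ξ + η) (f * g) := by
  unfold FunExpAt at *
  rw [isExpAt_iff_jet] at *
  intro m hm v
  refine (jet_mul c.open_target (contDiffOn_christoffel D hc) (contDiffOn_inChart f hc)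
    (contDiffOn_inChart g hc) m (c.map_source hx)).trans ?_
  have : ∑ i, ((ξ + η) i : 𝕜) * (v i : 𝕜) =
      ∑ i, (ξ i : 𝕜) * (v i : 𝕜) + ∑ i, (η i : 𝕜) * (v i : 𝕜) := by
    rw [← Finset.sum_add_distrib]
    exact Finset.sum_congr rfl fun i _ => by simp [add_mul]
  rw [this, (Commute.all _ _).add_pow']
  refine Finset.sum_congr rfl fun ij hij => ?_
  rw [Finset.HasAntidiagonal.mem_antidiagonal] at hij
  rw [hf _ (by omega), hg _ (by omega)]

lemma funJetEq_mul {D : Connection M} {c : OpenPartialHomeomorph M (Model M.dim)}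
    (hc : c ∈ M.charts) {x : M} (hx : x ∈ c.source) {N : ℕ}
    {f f' g : Fun 𝕜 M} (hf : FunJetEq D c x N f f') :
    FunJetEq D c x N (f * g) (f' * g) := by
  unfold FunJetEq at *
  rw [jetEq_iff_jet] at *
  intro m hm v
  refine (jet_mul c.open_target (contDiffOn_christoffel D hc) (contDiffOn_inChart f hc)
    (contDiffOn_inChart g hc) m (c.map_source hx)).trans (Eq.trans ?_
    (jet_mul c.open_target (contDiffOn_christoffel D hc) (contDiffOn_inChart f' hc)
    (contDiffOn_inChart g hc) m (c.map_source hx)).symm)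
  refine Finset.sum_congr rfl fun ij hij => ?_
  rw [Finset.HasAntidiagonal.mem_antidiagonal] at hij
  rw [hf _ (by omega)]

lemma funExpAt_apply {D : Connection M} {c : OpenPartialHomeomorph M (Model M.dim)}
    {x : M} (hx : x ∈ c.source) {N : ℕ} {ξ : Fin M.dim → ℝ}
    {f : Fun 𝕜 M} (hf : FunExpAt D c x N ξ f) : f x = 1 := by
  have := hf 0 (by omega) Fin.elim0
  rw [nablaSym_zero_order] at this
  simpa [inChart, c.left_inv hx] using this

/-- A linear functional that depends only on the `N`-jet at `x` and that vanishes on exponentials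
vanishes. -/
lemma functional_eq_zero (D : Connection M) {c : OpenPartialHomeomorph M (Model M.dim)}
    (hc : c ∈ M.charts) {x : M} (hx : x ∈ c.source) (N : ℕ) (L : Fun 𝕜 M → 𝕜)
    (hadd : ∀ f g, L (f + g) = L f + L g) (hmul : ∀ a f, L (constFun M a * f) = a * L f)
    (hjet : ∀ f g, FunJetEq D c x N f g → L f = L g)
    (hexp : ∀ ξ f, FunExpAt D c x N ξ f → L f = 0) (f : Fun 𝕜 M) : L f = 0 := by
  classical
  have hx' := c.map_source hx
  choose E hE using fun ξ => exists_fun_isExpAt (𝕜 := 𝕜) D hc hx N ξ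
  let t : MultiIdx M.dim N → 𝕜 := fun p =>
    nablaSym (D.christoffel c) (inChart f c) p.1 p.2 (c x)
  -- The derivatives of f up to order N form a symmetric family, hence a combination of powers of
  -- covectors. The same combination of exponentials has the same N-jet as f.
  obtain ⟨a, ha⟩ := Finsupp.mem_span_range_iff_exists_finsupp.1
    (mem_span_powFamily (t := t) fun m J σ => nablaSym_perm _ _ _ _ _)
  have hL0 : L 0 = 0 := by
    have := hmul 0 0
    rwa [mul_zero, zero_mul] at this
  let Lh : Fun 𝕜 M →+ 𝕜 := ⟨⟨L, hL0⟩, hadd⟩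
  have hsum : ∀ s : Finset (Fin M.dim → ℝ), ∀ m (J : Fin m → Fin M.dim),
      nablaSym (D.christoffel c) (inChart (∑ ξ ∈ s, constFun M (a ξ) * E ξ) c) m J (c x) =
      ∑ ξ ∈ s, a ξ * nablaSym (D.christoffel c) (inChart (E ξ) c) m J (c x) := by
    intro s m J
    induction s using Finset.induction_on with
    | empty =>
      have := nablaSym_inChart_const_mul D hc hx (0 : 𝕜) (0 : Fun 𝕜 M) m J
      rw [mul_zero, zero_mul] at this
      simpa using this
    | insert ξ s hξ ih =>
      rw [Finset.sum_insert hξ, Finset.sum_insert hξ, nablaSym_inChart_add D hc hx, ih,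
        nablaSym_inChart_const_mul D hc hx]
  have hf : FunJetEq D c x N f (∑ ξ ∈ a.support, constFun M (a ξ) * E ξ) := by
    intro m hm J
    rw [hsum]
    have := congrFun ha ⟨⟨m, by omega⟩, J⟩
    rw [Finsupp.sum, Finset.sum_apply] at this
    refine this.symm.trans (Finset.sum_congr rfl fun ξ _ => ?_)
    rw [hE ξ m hm J]
    rfl
  rw [hjet _ _ hf]
  change Lh _ = 0
  rw [map_sum]
  refine Finset.sum_eq_zero fun ξ _ => ?_
  change L _ = 0
  rw [hmul, hexp ξ _ (hE ξ), mul_zero]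

end EvalComb

/-! ### Discarding superfluous monomials of a represented operator. -/

section Filters

variable {𝕜 : Type} [RCLike 𝕜] {k : ℕ} {M : Mfd.{u}}

lemma exists_ord_bound (e : Monomial k →₀ 𝕜) : ∃ N, ∀ Γ ∈ e.support, ∀ l, Γ.ord l ≤ N :=
  ⟨∑ Γ ∈ e.support, ∑ l, Γ.ord l, fun Γ hΓ l =>
    (Finset.single_le_sum (f := fun l => Γ.ord l) (fun _ _ => Nat.zero_le _)
      (Finset.mem_univ l)).trans
    (Finset.single_le_sum (f := fun Γ : Monomial k => ∑ l, Γ.ord l) (fun _ _ => Nat.zero_le _) hΓ)⟩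

lemma FunJetEq.refl (D : Connection M) (c : OpenPartialHomeomorph M (Model M.dim)) (x : M) (N : ℕ)
    (f : Fun 𝕜 M) : FunJetEq D c x N f f := fun _ _ _ => rfl

lemma FunJetEq.update {D : Connection M} {c : OpenPartialHomeomorph M (Model M.dim)} {x : M} {N : ℕ}
    {g h : Fun 𝕜 M} (hgh : FunJetEq D c x N g h) (f : Fin k → Fun 𝕜 M) (l i : Fin k) :
    FunJetEq D c x N (Function.update f l g i) (Function.update f l h i) := by
  rcases eq_or_ne i l with rfl | hi
  · simpa using hgh
  · simpa [Function.update_of_ne hi] using FunJetEq.refl D c x N (f i)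

/-- A linear combination of monomials that vanishes on exponentials vanishes. -/
lemma evalAt_eq_zero_of_exp {e : Monomial k →₀ 𝕜} (D : Connection M) (P : PoissonTensor M)
    {c : OpenPartialHomeomorph M (Model M.dim)} (hc : c ∈ M.charts) {x : M} (hx : x ∈ c.source)
    {N : ℕ} (hN : ∀ Γ ∈ e.support, ∀ l, Γ.ord l ≤ N)
    (h : ∀ (ξ : Fin k → Fin M.dim → ℝ) (f : Fin k → Fun 𝕜 M),
      (∀ l, FunExpAt D c x N (ξ l) (f l)) → evalAt e D P c f x = 0) (f : Fin k → Fun 𝕜 M) :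
    evalAt e D P c f x = 0 := by
  classical
  -- The arguments outside s are exponentials; they are released one at a time by
  -- `functional_eq_zero`.
  suffices H : ∀ (s : Finset (Fin k)) (f : Fin k → Fun 𝕜 M),
      (∀ l ∉ s, ∃ ξ, FunExpAt D c x N ξ (f l)) → evalAt e D P c f x = 0 from
    H Finset.univ f (by simp)
  intro s
  induction s using Finset.induction_on with
  | empty =>
    intro f hf
    choose ξ hξ using fun l => hf l (Finset.notMem_empty l)
    exact h ξ f hξ
  | insert l s hl ih =>
    intro f hf
    rw [← Function.update_eq_self l f]
    refine functional_eq_zero D hc hx N (fun g => evalAt e D P c (Function.update f l g) x)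
      (fun g h => evalAt_update_add e D P hc hx f l g h)
      (fun a g => evalAt_update_const_mul e D P hc hx f l a g)
      (fun g h hgh => evalAt_congr_jet D P hN fun i => hgh.update f l i)
      (fun ξ g hg => ih _ fun i hi => ?_) (f l)
    rcases eq_or_ne i l with rfl | hil
    · exact ⟨ξ, by simpa using hg⟩
    · rw [Function.update_of_ne hil]
      exact hf i (by simp [hil, hi])

lemma evalAt_filter_add (e : Monomial k →₀ 𝕜) (p : Monomial k → Prop) [DecidablePred p]
    (D : Connection M) (P : PoissonTensor M)
    (c : OpenPartialHomeomorph M (Model M.dim)) (f : Fin k → Fun 𝕜 M) (x : M) :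
    evalAt e D P c f x = evalAt (e.filter p) D P c f x + evalAt (e.filter fun Γ => ¬ p Γ) D P c f x := by
  unfold evalAt evalComb
  rw [← map_add, Finsupp.filter_add_filter_not]

lemma evalAt_filter (e : Monomial k →₀ 𝕜) (p : Monomial k → Prop) [DecidablePred p]
    (D : Connection M) (P : PoissonTensor M)
    (c : OpenPartialHomeomorph M (Model M.dim)) (f : Fin k → Fun 𝕜 M) (x : M) :
    evalAt (e.filter p) D P c f x = ∑ Γ ∈ e.support, (if p Γ then 1 else 0) *
      (e Γ * Γ.eval (D.christoffel c) (bivComp P.tensor c) (fun l => inChart (f l) c) (c x)) := by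
  unfold evalAt
  rw [evalComb_eq_sum, Finsupp.support_filter, Finset.sum_filter]
  refine Finset.sum_congr rfl fun Γ _ => ?_
  by_cases h : p Γ <;> simp [h]

lemma MultiOp.RepresentedBy.filter {A : MultiOp.{u} 𝕜 k} {e : Monomial k →₀ 𝕜}
    (h : A.RepresentedBy e) (p : Monomial k → Prop) [DecidablePred p]
    (h0 : ∀ (M : Mfd.{u}) (D : Connection M) (P : PoissonTensor M) (f : Fin k → Fun 𝕜 M),
      ∀ c ∈ M.charts, ∀ x ∈ c.source, evalAt (e.filter fun Γ => ¬ p Γ) D P c f x = 0) :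
    A.RepresentedBy (e.filter p) := by
  intro M D P f c hc x hx
  rw [h.apply hc hx, evalAt_filter_add e p, h0 M D P f c hc x hx, add_zero]
  rfl

lemma Monomial.eval_of_ord_eq_zero {d : ℕ} (Γ : Monomial k) (l : Fin k) (hl : Γ.ord l = 0)
    (G : Fin d → Fin d → Fin d → Model d → ℝ)
    (P : Fin d → Fin d → Model d → ℝ) (f g : Fin k → Model d → 𝕜) (y : Model d) (hg : g l y = 1)
    (hfg : ∀ i ≠ l, g i = f i) :
    Γ.eval G P f y = f l y * Γ.eval G P g y := by
  simp only [Monomial.eval_eq_contract]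
  have h0 : ∀ (f : Model d → 𝕜) m (J : Fin m → Fin d), m = 0 → nablaSym G f m J y = f y := by
    rintro f _ J rfl
    exact nablaSym_zero_order f J y
  refine Γ.contract_update_mul _ _ _ l _ ?_ fun i hi => ?_
  · funext J
    rw [Pi.smul_apply, h0 _ _ _ hl, h0 _ _ _ hl, hg, smul_eq_mul, mul_one]
  · simp only [hfg i hi]

lemma Monomial.contract_eq_zero {d : ℕ} (Γ : Monomial k)
    (G : Fin d → Fin d → Fin d → Model d → ℝ)
    (P : Fin d → Fin d → Model d → ℝ) (y : Model d) {T : ∀ l, (Fin (Γ.ord l) → Fin d) → 𝕜}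
    (l : Fin k) (h : T l = 0) : Γ.contract G P y T = 0 := by
  unfold Monomial.contract
  refine Finset.sum_eq_zero fun v _ => ?_
  rw [Finset.prod_eq_zero (Finset.mem_univ l) (by rw [h]; rfl), mul_zero]

lemma Monomial.eval_const {D : Connection M} {P : PoissonTensor M}
    {c : OpenPartialHomeomorph M (Model M.dim)} (hc : c ∈ M.charts) {x : M} (hx : x ∈ c.source)
    (Γ : Monomial k) (l : Fin k) (hl : Γ.ord l ≠ 0) {f : Fin k → Fun 𝕜 M} {a : 𝕜}
    (hf : f l = constFun M a) :
    Γ.eval (D.christoffel c) (bivComp P.tensor c) (fun l => inChart (f l) c) (c x) = 0 := by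
  rw [Monomial.eval_eq_contract]
  refine Γ.contract_eq_zero _ _ _ l ?_
  funext J
  rw [hf]
  exact nablaSym_const c.open_target (contDiffOn_christoffel D hc) a hl J (c.map_source hx)

/-- If an operator vanishes when its `l`-th argument is constant, then the monomials that do not
differentiate this argument may be omitted. -/
lemma MultiOp.RepresentedBy.filter_ord_ne_zero {A : MultiOp.{u} 𝕜 k} {e : Monomial k →₀ 𝕜}
    (h : A.RepresentedBy e) (l : Fin k)
    (h0 : ∀ (M : Mfd.{u}) (D : Connection M) (P : PoissonTensor M) (f : Fin k → Fun 𝕜 M),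
      f l = constFun M 1 → A M D P f = 0) :
    A.RepresentedBy (e.filter fun Γ => Γ.ord l ≠ 0) := by
  classical
  refine h.filter _ fun M D P f c hc x hx => ?_
  -- A monomial that does not differentiate the l-th argument is f_l times its value at f_l = 1, and
  -- the other monomials vanish at f_l = 1. So the discarded part is f_l times a value of the
  -- operator on a constant.
  have key : evalAt (e.filter fun Γ => ¬ Γ.ord l ≠ 0) D P c f x = f l x *
      evalAt e D P c (Function.update f l (constFun M 1)) x := by
    rw [evalAt_filter, evalAt, evalComb_eq_sum, Finset.mul_sum]
    refine Finset.sum_congr rfl fun Γ _ => ?_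
    by_cases hl : Γ.ord l = 0
    · rw [Γ.eval_of_ord_eq_zero l hl _ _ _
        (fun i => inChart (Function.update f l (constFun M 1) i) c) _
        (by simp only [inChart, Function.update_self]; rfl)
        (fun i hi => by simp [Function.update_of_ne hi])]
      simp only [hl, inChart, c.left_inv hx]
      simp
      ring
    · rw [Γ.eval_const hc hx l hl (a := 1) (f := Function.update f l (constFun M 1)) (by simp)]
      simp [hl]
  rw [key, ← h.apply hc hx, h0 M D P _ (by simp)]
  simp

lemma nablaBivec_smul {d : ℕ} {G : Fin d → Fin d → Fin d → Model d → ℝ} {U : Set (Model d)}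
    (hU : IsOpen U) (hG : ∀ k i j, ContDiffOn ℝ ∞ (G k i j) U)
    {P : Fin d → Fin d → Model d → ℝ} (hP : ∀ i j, ContDiffOn ℝ ∞ (P i j) U) (t : ℝ) (a : ℕ)
    (I : Fin 2 → Fin d) (J : Fin a → Fin d) {y : Model d} (hy : y ∈ U) :
    nablaBivec G (fun i j => t • P i j) a I J y = t * nablaBivec G P a I J y := by
  induction a generalizing I y with
  | zero => rfl
  | succ a ih =>
    have hd : ∀ I J, DifferentiableAt ℝ (nablaBivec G P a I J) y := fun I J =>
      ((contDiffOn_nablaBivec hU hG hP a I J).contDiffAt (hU.mem_nhds hy)).differentiableAt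
        (by simp)
    have h1 : ∀ I J, Set.EqOn (nablaBivec G (fun i j => t • P i j) a I J)
      (t • nablaBivec G P a I J) U := fun I J z hz => ih I J hz
    change covD _ _ _ _ _ = t * covD _ _ _ _ _
    unfold covD
    rw [pd_congr hU (h1 _ _) _ hy]
    simp only [h1 _ _ hy, Pi.smul_apply, smul_eq_mul, mul_sub, mul_add, Finset.mul_sum]
    congr 1
    · congr 1
      · simp [pd, fderiv_const_smul (hd _ _)]
      · exact Finset.sum_congr rfl fun s _ => Finset.sum_congr rfl fun m _ => by ring
    · exact Finset.sum_congr rfl fun s _ => Finset.sum_congr rfl fun m _ => by ring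

/-- The number of factors P is the degree in P: covariant derivatives are linear in P and the
curvature does not contain it. -/
lemma Monomial.eval_scale {D : Connection M} {P : PoissonTensor M}
    {c : OpenPartialHomeomorph M (Model M.dim)} (hc : c ∈ M.charts) {x : M} (hx : x ∈ c.source)
    (Γ : Monomial k) (t : ℝ) (f : Fin k → Model M.dim → 𝕜) :
    Γ.eval (D.christoffel c) (bivComp (P.scale t).tensor c) f (c x) =
      (t : 𝕜) ^ Γ.numP * Γ.eval (D.christoffel c) (bivComp P.tensor c) f (c x) := by
  have hb : bivComp (P.scale t).tensor c = fun i j => t • bivComp P.tensor c i j :=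
    funext fun i => funext fun j => bivComp_smul P.tensor t c i j
  unfold Monomial.eval
  rw [hb, Finset.mul_sum]
  refine Finset.sum_congr rfl fun v _ => ?_
  have : ∀ i, nablaBivec (D.christoffel c) (fun i j => t • bivComp P.tensor c i j) (Γ.facP i).order
      (v ∘ (Γ.facP i).up) (v ∘ (Γ.facP i).low) (c x) = t * nablaBivec (D.christoffel c)
      (bivComp P.tensor c) (Γ.facP i).order (v ∘ (Γ.facP i).up) (v ∘ (Γ.facP i).low) (c x) :=
    fun i => nablaBivec_smul c.open_target (contDiffOn_christoffel D hc) (P.smooth c hc) t _ _ _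
      (c.map_source hx)
  simp only [this, Finset.prod_mul_distrib, Finset.prod_const, Finset.card_univ, Fintype.card_fin,
    RCLike.ofReal_mul, RCLike.ofReal_pow]
  ring

lemma evalAt_scale (e : Monomial k →₀ 𝕜) {D : Connection M} {P : PoissonTensor M}
    {c : OpenPartialHomeomorph M (Model M.dim)} (hc : c ∈ M.charts) {x : M} (hx : x ∈ c.source)
    (t : ℝ) (f : Fin k → Fun 𝕜 M) :
    evalAt e D (P.scale t) c f x = ∑ Γ ∈ e.support, (t : 𝕜) ^ Γ.numP *
      (e Γ * Γ.eval (D.christoffel c) (bivComp P.tensor c) (fun l => inChart (f l) c) (c x)) := by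
  rw [evalAt, evalComb_eq_sum]
  refine Finset.sum_congr rfl fun Γ _ => ?_
  rw [Γ.eval_scale hc hx]
  ring

lemma MultiOp.RepresentedBy.isHomogeneous {A : MultiOp.{u} 𝕜 k} {e : Monomial k →₀ 𝕜}
    (h : A.RepresentedBy e) {r : ℕ} (hr : ∀ Γ ∈ e.support, Γ.numP = r) : A.IsHomogeneous r := by
  intro M D P t f
  ext x
  have hc : chartAt (Model M.dim) x ∈ M.charts := IsManifold.chart_mem_maximalAtlas x
  have hx := mem_chart_source (Model M.dim) x
  rw [h.apply hc hx, evalAt_scale e hc hx]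
  change _ = t ^ r • A M D P f x
  rw [h.apply hc hx, evalAt, evalComb_eq_sum, Finset.smul_sum]
  refine Finset.sum_congr rfl fun Γ hΓ => ?_
  rw [hr Γ hΓ, RCLike.real_smul_eq_coe_mul, RCLike.ofReal_pow]

/-- A homogeneous operator of degree `r` only needs monomials with `r` factors `P`. -/
lemma MultiOp.RepresentedBy.filter_numP {A : MultiOp.{u} 𝕜 k} {e : Monomial k →₀ 𝕜}
    (h : A.RepresentedBy e) {r : ℕ} (hr : A.IsHomogeneous r) :
    A.RepresentedBy (e.filter fun Γ => Γ.numP = r) := by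
  refine h.filter _ fun M D P f c hc x hx => ?_
  rw [evalAt_filter]
  -- The extra index `none` carries minus the value of the operator, in degree r. The sum is then
  -- identically zero in t, and the weight removes exactly degree r.
  have := sum_weight_eq_zero (Finset.insertNone e.support)
    (fun o : Option (Monomial k) => o.elim r Monomial.numP)
    (fun o => o.elim (-A M D P f x) fun Γ => e Γ * Γ.eval (D.christoffel c) (bivComp P.tensor c)
      (fun l => inChart (f l) c) (c x)) (fun t => ?_) (fun n => if n = r then 0 else 1)
  · rw [Finset.sum_insertNone] at this
    simp only [Option.elim, if_true, zero_mul, zero_add] at this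
    refine Eq.trans (Finset.sum_congr rfl fun Γ _ => ?_) this
    by_cases hΓ : Γ.numP = r <;> simp [hΓ]
  · rw [Finset.sum_insertNone]
    simp only [Option.elim]
    rw [← evalAt_scale e hc hx, ← h.apply hc hx, hr M D P t f]
    change _ + t ^ r • A M D P f x = 0
    rw [RCLike.real_smul_eq_coe_mul, RCLike.ofReal_pow]
    ring

/-- If the symbol is linear in the `l`-th argument, then only the monomials of order one in this
argument are needed. -/
lemma MultiOp.RepresentedBy.filter_ord_eq_one {A : MultiOp.{u} 𝕜 k} {e : Monomial k →₀ 𝕜}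
    (h : A.RepresentedBy e) (l : Fin k)
    (h0 : ∀ (M : Mfd.{u}) (D : Connection M) (P : PoissonTensor M) (c) (_ : c ∈ M.charts)
      (x : M) (_ : x ∈ c.source) (N : ℕ) (_ : ∀ Γ ∈ e.support, ∀ l, Γ.ord l ≤ N)
      (f g : Fin k → Fun 𝕜 M) (ξ : Fin k → Fin M.dim → ℝ), (∀ i, FunExpAt D c x N (ξ i) (f i)) →
      (∀ i, FunExpAt D c x N (Function.update ξ l ((2 : ℝ) • ξ l) i) (g i)) →
      A M D P g x = 2 * A M D P f x) :
    A.RepresentedBy (e.filter fun Γ => Γ.ord l = 1) := by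
  classical
  refine h.filter _ fun M D P f c hc x hx => ?_
  obtain ⟨N, hN⟩ := exists_ord_bound e
  refine evalAt_eq_zero_of_exp D P hc hx (N := N) (fun Γ hΓ => hN Γ (by
    rw [Finsupp.support_filter, Finset.mem_filter] at hΓ; exact hΓ.1)) (fun ξ f hf => ?_) f
  rw [evalAt_filter]
  have hup : ∀ s : ℝ, Function.update ξ l (s • ξ l) =
      fun i => (Function.update (1 : Fin k → ℝ) l s i) • ξ i := by
    intro s
    funext i
    rcases eq_or_ne i l with rfl | hi
    · simp
    · simp [Function.update_of_ne hi]
  have hS : ∀ s : ℝ, ∀ f : Fin k → Fun 𝕜 M,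
      (∀ i, FunExpAt D c x N (Function.update ξ l (s • ξ l) i) (f i)) → A M D P f x =
      ∑ Γ ∈ e.support, (s : 𝕜) ^ Γ.ord l *
        (e Γ * Γ.symbol (D.christoffel c) (bivComp P.tensor c) (c x) ξ) := by
    intro s f hf
    rw [h.apply hc hx, evalAt_exp D P hN hf]
    refine Finset.sum_congr rfl fun Γ _ => ?_
    rw [hup, Γ.symbol_smul, Finset.prod_eq_single l]
    · simp only [Function.update_self]
      ring
    · intro i _ hi
      simp [Function.update_of_ne hi]
    · simp
  -- Doubling the exponent multiplies the part of order n by 2^n, whereas the hypothesis demands a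
  -- factor 2. So the parts weighted by 2^n − 2 cancel for every scaling t; the inverse weight
  -- isolates all n ≠ 1, where 2^n − 2 does not vanish.
  have key := sum_weight_eq_zero e.support (fun Γ => Γ.ord l)
    (fun Γ => ((2 : 𝕜) ^ Γ.ord l - 2) *
      (e Γ * Γ.symbol (D.christoffel c) (bivComp P.tensor c) (c x) ξ)) (fun t => ?_)
    (fun n => if n = 1 then 0 else ((2 : 𝕜) ^ n - 2)⁻¹)
  · refine Eq.trans (Finset.sum_congr rfl fun Γ hΓ => ?_) key
    have hev : Γ.eval (D.christoffel c) (bivComp P.tensor c) (fun l => inChart (f l) c) (c x) =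
        Γ.symbol (D.christoffel c) (bivComp P.tensor c) (c x) ξ := by
      simp only [Monomial.eval_eq_contract, Monomial.symbol]
      congr 1
      funext i J
      exact hf i _ (hN Γ hΓ i) J
    rw [hev]
    by_cases h1 : Γ.ord l = 1
    · simp [h1]
    · have h2 : ((2 : 𝕜) ^ Γ.ord l - 2) ≠ 0 := by
        intro h3
        rw [sub_eq_zero] at h3
        have h4 : (2 : ℕ) ^ Γ.ord l = 2 ^ 1 := by exact_mod_cast h3
        exact h1 (Nat.pow_right_injective le_rfl h4)
      simp only [h1, if_false, not_false_eq_true, if_true, one_mul]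
      rw [← mul_assoc, inv_mul_cancel₀ h2, one_mul]
  · choose E hE using fun s : ℝ => fun i => exists_fun_isExpAt (𝕜 := 𝕜) D hc hx N
      (Function.update ξ l (s • ξ l) i)
    have h1 := hS _ _ (hE t)
    have h2 := hS _ _ (hE (2 * t))
    have h3 := h0 M D P c hc x hx N hN (E t) (E (2 * t)) (Function.update ξ l (t • ξ l)) (hE t)
      (fun i => by rw [Function.update_self, Function.update_idem, smul_smul]; exact hE (2 * t) i)
    rw [h1, h2, Finset.mul_sum, ← sub_eq_zero, ← Finset.sum_sub_distrib] at h3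
    rw [← h3]
    refine Finset.sum_congr rfl fun Γ _ => ?_
    push_cast
    rw [mul_pow]
    ring

end Filters

/-! ### Jets and exponentials in two charts. -/

section ChartChange

variable {𝕜 : Type} [RCLike 𝕜] {M : Mfd.{u}}

/-- `jet_change` on the overlap, with the transition map as coordinate change and
`christoffel_change` as the law relating the two connections. -/
lemma jet_inChart (D : Connection M) {c c' : OpenPartialHomeomorph M (Model M.dim)}
    (hc : c ∈ M.charts) (hc' : c' ∈ M.charts) {x : M} (hx : x ∈ c.source) (hx' : x ∈ c'.source)
    (f : Fun 𝕜 M) (m : ℕ) (v : Model M.dim) :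
    jet (D.christoffel c) (inChart f c) m (c x, v) =
      jet (D.christoffel c') (inChart f c') m (c' x, fderiv ℝ (transition c c') (c x) v) := by
  have hO : IsOpen (c.target ∩ c.symm ⁻¹' c'.source) :=
    c.symm.isOpen_inter_preimage c'.open_source
  have hmem : ∀ y ∈ c.target ∩ c.symm ⁻¹' c'.source, ∃ z, z ∈ c.source ∧ z ∈ c'.source ∧ y = c z :=
    fun y hy => ⟨c.symm y, c.map_target hy.1, hy.2, (c.right_inv hy.1).symm⟩
  have hcx : c' x = transition c c' (c x) := by
    change c' x = c' (c.symm (c x))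
    rw [c.left_inv hx]
  rw [hcx]
  refine jet_change c'.open_target hO Set.inter_subset_left c.open_target
    (contDiffOn_christoffel D hc) (contDiffOn_christoffel D hc') (φ := transition c c') ?_ ?_ ?_
    (contDiffOn_inChart f hc) (contDiffOn_inChart f hc') ?_ m
    ⟨c.map_source hx, by simpa [c.left_inv hx] using hx'⟩ v
  · intro y hy
    obtain ⟨z, hz, hz', rfl⟩ := hmem y hy
    exact (contDiffAt_transition hc hc' hz hz').contDiffWithinAt
  · intro y hy
    exact c'.map_source hy.2
  · intro y hy e i j
    obtain ⟨z, hz, hz', rfl⟩ := hmem y hy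
    have := D.christoffel_change hc hc' hz hz' e i j
    have h2 : c' z = transition c c' (c z) := by
      change c' z = c' (c.symm (c z))
      rw [c.left_inv hz]
    rwa [h2] at this
  · intro y hy
    change f (c.symm y) = f (c'.symm (c' (c.symm y)))
    rw [c'.left_inv hy.2]

lemma FunJetEq.change {D : Connection M} {c c' : OpenPartialHomeomorph M (Model M.dim)}
    (hc : c ∈ M.charts) (hc' : c' ∈ M.charts) {x : M} (hx : x ∈ c.source) (hx' : x ∈ c'.source)
    {N : ℕ} {f g : Fun 𝕜 M} (h : FunJetEq D c' x N f g) : FunJetEq D c x N f g := by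
  unfold FunJetEq at *
  rw [jetEq_iff_jet] at *
  intro m hm v
  rw [jet_inChart D hc hc' hx hx', jet_inChart D hc hc' hx hx', h m hm]

/-- The covector with components `ξ` in the chart `c'`, in the chart `c`. -/
def pullCovector (c c' : OpenPartialHomeomorph M (Model M.dim)) (x : M) (ξ : Fin M.dim → ℝ) :
    Fin M.dim → ℝ :=
  fun i => ∑ j, ξ j * fderiv ℝ (transition c c') (c x) (EuclideanSpace.single i 1) j

lemma pullCovector_smul (c c' : OpenPartialHomeomorph M (Model M.dim)) (x : M) (t : ℝ)
    (ξ : Fin M.dim → ℝ) : pullCovector c c' x (t • ξ) = t • pullCovector c c' x ξ := by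
  funext i
  simp [pullCovector, Finset.mul_sum, mul_assoc]

lemma sum_pullCovector (c c' : OpenPartialHomeomorph M (Model M.dim)) (x : M)
    (ξ : Fin M.dim → ℝ) (v : Model M.dim) :
    ∑ i, (pullCovector c c' x ξ i : 𝕜) * (v i : 𝕜) =
      ∑ j, (ξ j : 𝕜) * ((fderiv ℝ (transition c c') (c x) v j : ℝ) : 𝕜) := by
  have h : ∑ i, pullCovector c c' x ξ i * v i =
      ∑ j, ξ j * fderiv ℝ (transition c c') (c x) v j := by
    conv_rhs => rw [euclidean_eq_sum v]
    simp only [pullCovector, map_sum, map_smul, Finset.sum_mul]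
    rw [Finset.sum_comm]
    refine Finset.sum_congr rfl fun j _ => ?_
    simp only [WithLp.ofLp_sum, Finset.sum_apply, WithLp.ofLp_smul, Pi.smul_apply, smul_eq_mul,
      Finset.mul_sum]
    exact Finset.sum_congr rfl fun i _ => by ring
  exact_mod_cast congrArg (fun r : ℝ => (r : 𝕜)) h

/-- Jets in the two charts correspond through the derivative of the transition map acting on v, so
the exponent transforms by the transposed derivative. -/
lemma FunExpAt.change {D : Connection M} {c c' : OpenPartialHomeomorph M (Model M.dim)}
    (hc : c ∈ M.charts) (hc' : c' ∈ M.charts) {x : M} (hx : x ∈ c.source) (hx' : x ∈ c'.source)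
    {N : ℕ} {ξ : Fin M.dim → ℝ} {f : Fun 𝕜 M} (h : FunExpAt D c' x N ξ f) :
    FunExpAt D c x N (pullCovector c c' x ξ) f := by
  unfold FunExpAt at *
  rw [isExpAt_iff_jet] at *
  intro m hm v
  rw [jet_inChart D hc hc' hx hx', h m hm, sum_pullCovector]

end ChartChange

/-! ### Gluing chartwise values into an operator. -/

section GlobalOperator

variable {𝕜 : Type} [RCLike 𝕜] {k : ℕ} {M : Mfd.{u}}

lemma contDiffOn_eval {d : ℕ} {U : Set (Model d)} (hU : IsOpen U)
    {G : Fin d → Fin d → Fin d → Model d → ℝ} (hG : ∀ k i j, ContDiffOn ℝ ∞ (G k i j) U)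
    {P : Fin d → Fin d → Model d → ℝ} (hP : ∀ i j, ContDiffOn ℝ ∞ (P i j) U)
    {f : Fin k → Model d → 𝕜} (hf : ∀ l, ContDiffOn ℝ ∞ (f l) U) (Γ : Monomial k) :
    ContDiffOn ℝ ∞ (Γ.eval G P f) U := by
  unfold Monomial.eval
  refine ContDiffOn.sum fun v _ => ContDiffOn.mul (ContDiffOn.mul ?_ ?_) ?_
  · exact (RCLike.ofRealCLM (K := 𝕜)).contDiff.comp_contDiffOn
      (contDiffOn_prod fun i _ => contDiffOn_nablaBivec hU hG hP _ _ _)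
  · exact (RCLike.ofRealCLM (K := 𝕜)).contDiff.comp_contDiffOn
      (contDiffOn_prod fun i _ => contDiffOn_nablaCurv hU hG _ _ _)
  · exact contDiffOn_prod fun i _ => contDiffOn_nablaSym hU hG (hf i) _ _

lemma contDiffOn_evalComb (e : Monomial k →₀ 𝕜) (D : Connection M) (P : PoissonTensor M)
    {c : OpenPartialHomeomorph M (Model M.dim)} (hc : c ∈ M.charts) (f : Fin k → Fun 𝕜 M) :
    ContDiffOn ℝ ∞ (evalComb e (D.christoffel c) (bivComp P.tensor c)
      fun l => inChart (f l) c) c.target := by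
  change ContDiffOn ℝ ∞ (fun y => ∑ Γ ∈ e.support, e Γ * Γ.eval (D.christoffel c)
    (bivComp P.tensor c) (fun l => inChart (f l) c) y) c.target
  exact ContDiffOn.sum fun Γ _ => contDiffOn_const.mul
    (contDiffOn_eval c.open_target (contDiffOn_christoffel D hc) (P.smooth c hc)
      (fun l => contDiffOn_inChart (f l) hc) Γ)

/-- A linear combination of monomials whose value does not depend on the chart represents an
operator. -/
lemma exists_representedBy (e : Monomial k →₀ 𝕜)
    (h : ∀ (M : Mfd.{u}) (D : Connection M) (P : PoissonTensor M) (f : Fin k → Fun 𝕜 M)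
      (c c' : OpenPartialHomeomorph M (Model M.dim)), c ∈ M.charts → c' ∈ M.charts →
      ∀ x ∈ c.source, x ∈ c'.source → evalAt e D P c f x = evalAt e D P c' f x) :
    ∃ A : MultiOp.{u} 𝕜 k, A.RepresentedBy e := by
  refine ⟨fun M D P f => ⟨fun x => evalAt e D P (chartAt (Model M.dim) x) f x, fun x => ?_⟩,
    fun M D P f c hc x hx => h M D P f _ c (IsManifold.chart_mem_maximalAtlas x) hc x
      (mem_chart_source _ x) hx⟩
  have hc : chartAt (Model M.dim) x ∈ M.charts := IsManifold.chart_mem_maximalAtlas x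
  have hsrc := (chartAt (Model M.dim) x).open_source.mem_nhds (mem_chart_source (Model M.dim) x)
  have h1 : ContMDiffAt (𝓡 M.dim) 𝓘(ℝ, 𝕜) ∞
      (fun z => evalAt e D P (chartAt (Model M.dim) x) f z) x :=
    ((contMDiffOn_iff_contDiffOn.2 (contDiffOn_evalComb e D P hc f)).comp
      (contMDiffOn_of_mem_maximalAtlas hc)
      (fun z hz => (chartAt (Model M.dim) x).map_source hz)).contMDiffAt hsrc
  exact h1.congr_of_eventuallyEq (Filter.eventuallyEq_of_mem hsrc fun z hz =>
    h M D P f _ _ (IsManifold.chart_mem_maximalAtlas z) hc z (mem_chart_source _ z) hz)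

end GlobalOperator

/-! ### Symbols and the cocycle equation. -/

section Symbols

variable {𝕜 : Type} [RCLike 𝕜] {k : ℕ} {M : Mfd.{u}}

/-- The symbol of a linear combination of monomials. -/
def symbolSum (e : Monomial k →₀ 𝕜) (D : Connection M) (P : PoissonTensor M)
    (c : OpenPartialHomeomorph M (Model M.dim)) (x : M) (ξ : Fin k → Fin M.dim → ℝ) : 𝕜 :=
  ∑ Γ ∈ e.support, e Γ * Γ.symbol (D.christoffel c) (bivComp P.tensor c) (c x) ξ

lemma MultiOp.RepresentedBy.apply_exp {A : MultiOp.{u} 𝕜 k} {e : Monomial k →₀ 𝕜}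
    (hA : A.RepresentedBy e) {D : Connection M} {P : PoissonTensor M}
    {c : OpenPartialHomeomorph M (Model M.dim)} (hc : c ∈ M.charts) {x : M} (hx : x ∈ c.source)
    {N : ℕ} (hN : ∀ Γ ∈ e.support, ∀ l, Γ.ord l ≤ N) {f : Fin k → Fun 𝕜 M}
    {ξ : Fin k → Fin M.dim → ℝ} (h : ∀ l, FunExpAt D c x N (ξ l) (f l)) :
    A M D P f x = symbolSum e D P c x ξ := by
  rw [hA.apply hc hx, evalAt_exp D P hN h]
  rfl

/-- The total order of differentiation of a monomial. -/
def Monomial.deg (Γ : Monomial k) : ℕ := ∑ l, Γ.ord l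

lemma Monomial.symbol_smul_all {d : ℕ} (Γ : Monomial k) (G : Fin d → Fin d → Fin d → Model d → ℝ)
    (P : Fin d → Fin d → Model d → ℝ) (y : Model d) (t : ℝ) (ξ : Fin k → Fin d → ℝ) :
    Γ.symbol (𝕜 := 𝕜) G P y (t • ξ) = (t : 𝕜) ^ Γ.deg * Γ.symbol G P y ξ := by
  refine (Γ.symbol_smul G P y (fun _ => t) ξ).trans ?_
  rw [Finset.prod_pow_eq_pow_sum]
  rfl

lemma symbolSum_smul (e : Monomial k →₀ 𝕜) (D : Connection M) (P : PoissonTensor M)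
    (c : OpenPartialHomeomorph M (Model M.dim)) (x : M) (t : ℝ) (ξ : Fin k → Fin M.dim → ℝ) :
    symbolSum e D P c x (t • ξ) = ∑ Γ ∈ e.support, (t : 𝕜) ^ Γ.deg *
      (e Γ * Γ.symbol (D.christoffel c) (bivComp P.tensor c) (c x) ξ) := by
  unfold symbolSum
  refine Finset.sum_congr rfl fun Γ _ => ?_
  rw [Γ.symbol_smul_all]
  ring

lemma forall_funExpAt_pair {D : Connection M} {c : OpenPartialHomeomorph M (Model M.dim)} {x : M}
    {N : ℕ} {ξ η : Fin M.dim → ℝ} {f g : Fun 𝕜 M} (hf : FunExpAt D c x N ξ f)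
    (hg : FunExpAt D c x N η g) : ∀ l, FunExpAt D c x N (![ξ, η] l) (![f, g] l) :=
  Fin.forall_fin_two.2 ⟨hf, hg⟩

lemma forall_funExpAt_single {D : Connection M} {c : OpenPartialHomeomorph M (Model M.dim)} {x : M}
    {N : ℕ} {ξ : Fin M.dim → ℝ} {f : Fun 𝕜 M} (hf : FunExpAt D c x N ξ f) :
    ∀ l, FunExpAt D c x N (![ξ] l) (![f] l) :=
  Fin.forall_fin_one.2 hf

variable {A : MultiOp.{u} 𝕜 2} {e : Monomial 2 →₀ 𝕜}

/-- On exponentials, which take the value 1 at x and multiply by adding exponents, the Hochschild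
equation becomes the cocycle equation of the additive group of covectors. -/
lemma symbolSum_cocycle (hA : A.RepresentedBy e) (hcoc : IsHochschildCocycle A)
    (D : Connection M) (P : PoissonTensor M)
    {c : OpenPartialHomeomorph M (Model M.dim)} (hc : c ∈ M.charts) {x : M} (hx : x ∈ c.source)
    (ξ η ζ : Fin M.dim → ℝ) :
    symbolSum e D P c x ![η, ζ] - symbolSum e D P c x ![ξ + η, ζ] +
      symbolSum e D P c x ![ξ, η + ζ] - symbolSum e D P c x ![ξ, η] = 0 := by
  obtain ⟨N, hN⟩ := exists_ord_bound e
  choose E hE using fun ξ => exists_fun_isExpAt (𝕜 := 𝕜) D hc hx N ξ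
  have h := DFunLike.congr_fun (hcoc M D P (E ξ) (E η) (E ζ)) x
  rw [← hA.apply_exp hc hx hN (forall_funExpAt_pair (hE η) (hE ζ)),
    ← hA.apply_exp hc hx hN (forall_funExpAt_pair (funExpAt_mul hc hx (hE ξ) (hE η)) (hE ζ)),
    ← hA.apply_exp hc hx hN (forall_funExpAt_pair (hE ξ) (funExpAt_mul hc hx (hE η) (hE ζ))),
    ← hA.apply_exp hc hx hN (forall_funExpAt_pair (hE ξ) (hE η))]
  have h1 : E ξ x = 1 := funExpAt_apply hx (hE ξ)
  have h2 : E ζ x = 1 := funExpAt_apply hx (hE ζ)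
  change E ξ x * A M D P ![E η, E ζ] x - A M D P ![E ξ * E η, E ζ] x +
    A M D P ![E ξ, E η * E ζ] x - A M D P ![E ξ, E η] x * E ζ x = 0 at h
  rwa [h1, h2, one_mul, mul_one] at h

end Symbols

/-! ### A universal primitive of the symmetric part of a Hochschild cocycle. -/

section Primitive

variable {𝕜 : Type} [RCLike 𝕜]

lemma bijective_sumMap_id {A B C D : Type} {f : A ⊕ B → D} (g : C → B) (hg : Function.Bijective g)
    (hf : Function.Bijective f) : Function.Bijective (f ∘ Sum.map id g) :=
  hf.comp (Function.bijective_id.sumMap hg)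

/-- The identification of the derivatives of the merged argument with those of both arguments. -/
def mergeEquiv (a : Fin 2 → ℕ) : (Σ _ : Fin 1, Fin (a 0 + a 1)) ≃ (Σ l : Fin 2, Fin (a l)) :=
  (Equiv.uniqueSigma fun _ : Fin 1 => Fin (a 0 + a 1)).trans <| finSumFinEquiv.symm.trans
    { toFun := Sum.elim (fun i => ⟨0, i⟩) fun i => ⟨1, i⟩
      invFun := fun s => match s with
        | ⟨0, i⟩ => Sum.inl i
        | ⟨1, i⟩ => Sum.inr i
      left_inv := by rintro (i | i) <;> rfl
      right_inv := by
        rintro ⟨l, i⟩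
        fin_cases l <;> rfl }

lemma append_eq_mergeEquiv {a : Fin 2 → ℕ} {n : ℕ} (g : (l : Fin 2) → Fin (a l) → Fin n)
    (s : Σ _ : Fin 1, Fin (a 0 + a 1)) :
    Fin.append (g 0) (g 1) s.2 = (fun s : Σ l, Fin (a l) => g s.1 s.2) (mergeEquiv a s) := by
  obtain ⟨l, i⟩ := s
  obtain rfl : l = 0 := Subsingleton.elim _ _
  refine Fin.addCases (fun i => ?_) (fun i => ?_) i
  · have h : mergeEquiv a ⟨0, Fin.castAdd (a 1) i⟩ = ⟨0, i⟩ := by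
      change Sum.elim _ _ (finSumFinEquiv.symm (Fin.castAdd (a 1) i)) = _
      rw [finSumFinEquiv_symm_apply_castAdd]
      rfl
    rw [h]
    exact Fin.append_left _ _ i
  · have h : mergeEquiv a ⟨0, Fin.natAdd (a 0) i⟩ = ⟨1, i⟩ := by
      change Sum.elim _ _ (finSumFinEquiv.symm (Fin.natAdd (a 0) i)) = _
      rw [finSumFinEquiv_symm_apply_natAdd]
      rfl
    rw [h]
    exact Fin.append_right _ _ i

/-- Both arguments of a bidifferential monomial are replaced by one argument, to which all the
derivatives are applied. -/
def Monomial.merge (Γ : Monomial 2) : Monomial 1 where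
  n := Γ.n
  numP := Γ.numP
  facP := Γ.facP
  numR := Γ.numR
  facR := Γ.facR
  ord _ := Γ.ord 0 + Γ.ord 1
  arg _ := Fin.append (Γ.arg 0) (Γ.arg 1)
  upper_once := Γ.upper_once
  lower_once := by
    have h := bijective_sumMap_id _ (Function.bijective_id.sumMap (mergeEquiv Γ.ord).bijective)
      Γ.lower_once
    convert h using 1
    funext s
    rcases s with s | s | s
    · rfl
    · rfl
    · exact append_eq_mergeEquiv Γ.arg s

lemma Monomial.merge_noLoop {Γ : Monomial 2} (h : Γ.NoLoop) : Γ.merge.NoLoop := h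

lemma Monomial.merge_ord (Γ : Monomial 2) (l : Fin 1) : Γ.merge.ord l = Γ.deg := by
  rw [Monomial.deg, Fin.sum_univ_two]
  rfl

/-- Letting both blocks of derivatives act on the same function restricts the symbol to the
diagonal. -/
lemma Monomial.merge_symbol {d : ℕ} (Γ : Monomial 2) (G : Fin d → Fin d → Fin d → Model d → ℝ)
    (P : Fin d → Fin d → Model d → ℝ) (y : Model d) (ξ : Fin 1 → Fin d → ℝ) :
    Γ.merge.symbol (𝕜 := 𝕜) G P y ξ = Γ.symbol G P y ![ξ 0, ξ 0] := by
  unfold Monomial.symbol Monomial.contract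
  refine Finset.sum_congr rfl fun v _ => ?_
  congr 1
  rw [Fin.prod_univ_two, Fin.prod_univ_one]
  change ∏ s : Fin (Γ.ord 0 + Γ.ord 1), (ξ 0 ((v ∘ Fin.append (Γ.arg 0) (Γ.arg 1)) s) : 𝕜) = _
  rw [Fin.prod_univ_add]
  congr 1
  · exact Finset.prod_congr rfl fun s _ =>
      congrArg (fun z => ((ξ 0 (v z) : ℝ) : 𝕜)) (Fin.append_left (Γ.arg 0) (Γ.arg 1) s)
  · exact Finset.prod_congr rfl fun s _ =>
      congrArg (fun z => ((ξ 0 (v z) : ℝ) : 𝕜)) (Fin.append_right (Γ.arg 0) (Γ.arg 1) s)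

/-- The weight of the total order `n` in the symmetric primitive of a cocycle. -/
def primWeight (𝕜 : Type) [RCLike 𝕜] (n : ℕ) : 𝕜 := (2 - 2 ^ n)⁻¹

/-- A primitive of the symmetric part of a cocycle. -/
def prim (e : Monomial 2 →₀ 𝕜) : Monomial 1 →₀ 𝕜 :=
  ∑ Γ ∈ e.support, Finsupp.single Γ.merge (primWeight 𝕜 Γ.deg * e Γ)

lemma prim_support {e : Monomial 2 →₀ 𝕜} {Δ : Monomial 1} (h : Δ ∈ (prim e).support) :
    ∃ Γ ∈ e.support, Δ = Γ.merge := by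
  classical
  obtain ⟨Γ, hΓ, hΔ⟩ := Finsupp.mem_support_finsetSum Δ h
  exact ⟨Γ, hΓ, Finset.mem_singleton.1 (Finsupp.support_single_subset hΔ)⟩

lemma linearCombination_prim (e : Monomial 2 →₀ 𝕜) (F : Monomial 1 → 𝕜) :
    Finsupp.linearCombination 𝕜 F (prim e) =
      ∑ Γ ∈ e.support, primWeight 𝕜 Γ.deg * (e Γ * F Γ.merge) := by
  rw [prim, map_sum]
  refine Finset.sum_congr rfl fun Γ _ => ?_
  rw [Finsupp.linearCombination_single, smul_eq_mul, mul_assoc]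

variable {M : Mfd.{u}}

lemma symbolSum_prim (e : Monomial 2 →₀ 𝕜) (D : Connection M) (P : PoissonTensor M)
    (c : OpenPartialHomeomorph M (Model M.dim)) (x : M) (ξ : Fin 1 → Fin M.dim → ℝ) :
    symbolSum (prim e) D P c x ξ = ∑ Γ ∈ e.support, primWeight 𝕜 Γ.deg *
      (e Γ * Γ.symbol (D.christoffel c) (bivComp P.tensor c) (c x) ![ξ 0, ξ 0]) := by
  simp only [← Monomial.merge_symbol]
  exact linearCombination_prim e _

variable {A : MultiOp.{u} 𝕜 2} {e : Monomial 2 →₀ 𝕜}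

lemma symbolSum_prim_coboundary (hA : A.RepresentedBy e) (hcoc : IsHochschildCocycle A)
    (hord : ∀ Γ ∈ e.support, ∀ l, Γ.ord l ≠ 0)
    (D : Connection M) (P : PoissonTensor M)
    {c : OpenPartialHomeomorph M (Model M.dim)} (hc : c ∈ M.charts) {x : M} (hx : x ∈ c.source)
    (ξ η : Fin M.dim → ℝ) :
    2 * (symbolSum (prim e) D P c x ![ξ] + symbolSum (prim e) D P c x ![η] -
      symbolSum (prim e) D P c x ![ξ + η]) =
      symbolSum e D P c x ![ξ, η] + symbolSum e D P c x ![η, ξ] := by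
  set S := fun ξ η => symbolSum e D P c x ![ξ, η] with hS
  have hcoc' : ∀ ξ η ζ, S η ζ - S (ξ + η) ζ + S ξ (η + ζ) - S ξ η = 0 :=
    symbolSum_cocycle hA hcoc D P hc hx
  -- Six instances of the cocycle equation, three for (ξ, η) and their mirror images. In degree n
  -- one has S(2ξ, 2η) = 2^n S(ξ, η), so this reads (2 − 2^n)(S(ξ, η) + S(η, ξ)) = 2(S(ξ, ξ) + S(η,
  -- η) − S(ξ+η, ξ+η)): the diagonal of S is a primitive up to the constant 2 − 2^n.
  have four : ∀ ξ η, 2 * S (ξ + η) (ξ + η) + 2 * (S ξ η + S η ξ) -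
      (S (ξ + ξ) (η + η) + S (η + η) (ξ + ξ)) - 2 * S ξ ξ - 2 * S η η = 0 := by
    intro ξ η
    have a1 := hcoc' ξ η (ξ + η)
    have a2 := hcoc' ξ ξ (η + η)
    have a3 := hcoc' ξ η η
    have b1 := hcoc' (ξ + η) η ξ
    have b2 := hcoc' (η + η) ξ ξ
    have b3 := hcoc' η η ξ
    have e1 : η + (ξ + η) = ξ + (η + η) := by abel
    have e2 : ξ + η + η = ξ + (η + η) := by abel
    have e3 : η + η + ξ = ξ + (η + η) := by abel
    have e4 : η + ξ = ξ + η := add_comm _ _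
    rw [e1] at a1
    rw [e2, e4] at b1
    rw [e3] at b2
    rw [e4] at b3
    linear_combination b1 - a1 + a2 - b2 - a3 + b3
  set sy := fun (Γ : Monomial 2) ξ η =>
    Γ.symbol (𝕜 := 𝕜) (D.christoffel c) (bivComp P.tensor c) (c x) ![ξ, η] with hsy
  have hsmul : ∀ (t : ℝ) ξ η, S (t • ξ) (t • η) =
      ∑ Γ ∈ e.support, (t : 𝕜) ^ Γ.deg * (e Γ * sy Γ ξ η) := by
    intro t ξ η
    have := symbolSum_smul e D P c x t ![ξ, η]
    rwa [Matrix.smul_vec2] at this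
  have hdbl : ∀ Γ ξ η, sy Γ (ξ + ξ) (η + η) = 2 ^ Γ.deg * sy Γ ξ η := by
    intro Γ ξ η
    have := Γ.symbol_smul_all (𝕜 := 𝕜) (D.christoffel c) (bivComp P.tensor c) (c x) 2 ![ξ, η]
    rw [Matrix.smul_vec2, two_smul, two_smul, RCLike.ofReal_ofNat] at this
    exact this
  have key := sum_weight_eq_zero e.support Monomial.deg (fun Γ => e Γ *
    (2 * sy Γ (ξ + η) (ξ + η) + 2 * (sy Γ ξ η + sy Γ η ξ) -
      (sy Γ (ξ + ξ) (η + η) + sy Γ (η + η) (ξ + ξ)) - 2 * sy Γ ξ ξ - 2 * sy Γ η η))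
    (fun t => ?_) (primWeight 𝕜)
  · have hw : ∀ Γ ∈ e.support, primWeight 𝕜 Γ.deg * (2 - 2 ^ Γ.deg) = 1 := by
      intro Γ hΓ
      refine inv_mul_cancel₀ fun h => ?_
      have h4 : (2 : ℕ) ^ 1 = 2 ^ Γ.deg := by
        rw [sub_eq_zero] at h
        exact_mod_cast h
      have h5 := Nat.pow_right_injective le_rfl h4
      rw [Monomial.deg, Fin.sum_univ_two] at h5
      have := hord Γ hΓ 0
      have := hord Γ hΓ 1
      omega
    simp only [symbolSum_prim]
    change 2 * (∑ Γ ∈ e.support, primWeight 𝕜 Γ.deg * (e Γ * sy Γ ξ ξ) +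
      ∑ Γ ∈ e.support, primWeight 𝕜 Γ.deg * (e Γ * sy Γ η η) -
      ∑ Γ ∈ e.support, primWeight 𝕜 Γ.deg * (e Γ * sy Γ (ξ + η) (ξ + η))) =
      ∑ Γ ∈ e.support, e Γ * sy Γ ξ η + ∑ Γ ∈ e.support, e Γ * sy Γ η ξ
    rw [← sub_eq_zero, ← neg_eq_zero, ← key]
    rw [← Finset.sum_add_distrib, ← Finset.sum_add_distrib, ← Finset.sum_sub_distrib,
      Finset.mul_sum, ← Finset.sum_sub_distrib, ← Finset.sum_neg_distrib]
    refine Finset.sum_congr rfl fun Γ hΓ => ?_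
    rw [hdbl, hdbl]
    linear_combination (-(e Γ) * (sy Γ ξ η + sy Γ η ξ)) * hw Γ hΓ
  · have := four (t • ξ) (t • η)
    simp only [← smul_add, hsmul] at this
    rw [← this]
    simp only [Finset.mul_sum, ← Finset.sum_add_distrib, ← Finset.sum_sub_distrib]
    exact Finset.sum_congr rfl fun Γ _ => by ring

lemma prim_ord_le {N : ℕ} (hN : ∀ Γ ∈ e.support, ∀ l, Γ.ord l ≤ N) :
    ∀ Γ ∈ (prim e).support, ∀ l, Γ.ord l ≤ N + N := by
  intro Δ hΔ l
  obtain ⟨Γ, hΓ, rfl⟩ := prim_support hΔ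
  exact Nat.add_le_add (hN Γ hΓ 0) (hN Γ hΓ 1)

/-- The weights depend on the order, so independence of the chart is not inherited directly from A.
But the diagonal symbol of A agrees in both charts for all multiples tξ, hence so does each of its
homogeneous parts, and thus any weighted sum of them. -/
lemma evalAt_prim_chart (hA : A.RepresentedBy e) (D : Connection M) (P : PoissonTensor M)
    (f : Fin 1 → Fun 𝕜 M) {c c' : OpenPartialHomeomorph M (Model M.dim)} (hc : c ∈ M.charts)
    (hc' : c' ∈ M.charts) {x : M} (hx : x ∈ c.source) (hx' : x ∈ c'.source) :
    evalAt (prim e) D P c f x = evalAt (prim e) D P c' f x := by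
  obtain ⟨N, hN⟩ := exists_ord_bound e
  have hN2 := prim_ord_le hN
  have hN3 : ∀ Γ ∈ e.support, ∀ l, Γ.ord l ≤ N + N := fun Γ hΓ l => (hN Γ hΓ l).trans (by omega)
  rw [← sub_eq_zero]
  rw [← Function.update_eq_self 0 f]
  refine functional_eq_zero D hc' hx' (N + N) (fun g => evalAt (prim e) D P c
    (Function.update f 0 g) x - evalAt (prim e) D P c' (Function.update f 0 g) x)
    (fun g h => ?_) (fun a g => ?_) (fun g h hgh => ?_) (fun ξ g hg => ?_) (f 0)
  · simp only [evalAt_update_add _ D P hc hx, evalAt_update_add _ D P hc' hx']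
    ring
  · simp only [evalAt_update_const_mul _ D P hc hx, evalAt_update_const_mul _ D P hc' hx']
    ring
  · rw [evalAt_congr_jet D P hN2 fun i => hgh.update f 0 i,
      evalAt_congr_jet D P hN2 fun i => (hgh.change hc hc' hx hx').update f 0 i]
  · have hf : ∀ g, Function.update f 0 g = ![g] := fun g => by
      funext l
      obtain rfl : l = 0 := Subsingleton.elim _ _
      simp
    simp only [hf]
    have hg' := hg.change hc hc' hx hx'
    rw [evalAt_exp D P hN2 (forall_funExpAt_single hg),
      evalAt_exp D P hN2 (forall_funExpAt_single hg')]
    change symbolSum (prim e) D P c x _ - symbolSum (prim e) D P c' x _ = 0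
    rw [symbolSum_prim, symbolSum_prim, ← Finset.sum_sub_distrib]
    set ξ' := pullCovector c c' x ξ with hξ'
    -- The scalings tξ produce an identity of polynomials in t, in which the total orders may be
    -- reweighted.
    have key := sum_weight_eq_zero e.support Monomial.deg (fun Γ => e Γ *
      (Γ.symbol (𝕜 := 𝕜) (D.christoffel c) (bivComp P.tensor c) (c x) ![ξ', ξ'] -
      Γ.symbol (𝕜 := 𝕜) (D.christoffel c') (bivComp P.tensor c') (c' x) ![ξ, ξ]))
      (fun t => ?_) (primWeight 𝕜)
    · rw [← key]
      exact Finset.sum_congr rfl fun Γ _ => by simp; ring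
    · obtain ⟨h, hh⟩ := exists_fun_isExpAt (𝕜 := 𝕜) D hc' hx' (N + N) (t • ξ)
      have hh' : FunExpAt D c x (N + N) (t • ξ') h := by
        rw [hξ', ← pullCovector_smul]
        exact FunExpAt.change hc hc' hx hx' hh
      have h1 := hA.apply_exp (P := P) hc hx hN3 (forall_funExpAt_pair hh' hh')
      have h2 := hA.apply_exp (P := P) hc' hx' hN3 (forall_funExpAt_pair hh hh)
      rw [h1, ← Matrix.smul_vec2, ← Matrix.smul_vec2, symbolSum_smul, symbolSum_smul,
        ← sub_eq_zero, ← Finset.sum_sub_distrib] at h2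
      rw [← h2]
      exact Finset.sum_congr rfl fun Γ _ => by ring

/-- The symmetric part of a universal Hochschild cocycle is a universal coboundary. -/
theorem exists_primitive (hA : A.RepresentedBy e) (hcoc : IsHochschildCocycle A)
    (hord : ∀ Γ ∈ e.support, ∀ l, Γ.ord l ≠ 0) :
    ∃ E : MultiOp.{u} 𝕜 1, E.RepresentedBy (prim e) ∧
      ∀ (M : Mfd.{u}) (D : Connection M) (P : PoissonTensor M) (f g : Fun 𝕜 M),
        f * E M D P ![g] - E M D P ![f * g] + E M D P ![f] * g =
          (2⁻¹ : ℝ) • (A M D P ![f, g] + A M D P ![g, f]) := by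
  obtain ⟨E, hE⟩ := exists_representedBy (prim e) fun M D P f c c' hc hc' x hx hx' =>
    evalAt_prim_chart hA D P f hc hc' hx hx'
  refine ⟨E, hE, fun M D P f g => ?_⟩
  ext x
  have hc : chartAt (Model M.dim) x ∈ M.charts := IsManifold.chart_mem_maximalAtlas x
  have hx := mem_chart_source (Model M.dim) x
  set c := chartAt (Model M.dim) x
  obtain ⟨N, hN⟩ := exists_ord_bound e
  have hN2 := prim_ord_le hN
  have hN3 : ∀ Γ ∈ e.support, ∀ l, Γ.ord l ≤ N + N := fun Γ hΓ l => (hN Γ hΓ l).trans (by omega)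
  -- Twice the difference of both sides at x. It is bilinear, symmetric, and depends on finite jets,
  -- so it vanishes as soon as it does on pairs of exponentials, where `symbolSum_prim_coboundary`
  -- applies.
  let L : Fun 𝕜 M → Fun 𝕜 M → 𝕜 := fun f g =>
    2 * (f x * E M D P ![g] x - E M D P ![f * g] x + E M D P ![f] x * g x) -
      (A M D P ![f, g] x + A M D P ![g, f] x)
  have u1 : ∀ f g : Fun 𝕜 M, Function.update ![f] 0 g = ![g] := fun f g => by
    funext l; obtain rfl : l = 0 := Subsingleton.elim _ _; simp
  have u20 : ∀ f g h : Fun 𝕜 M, Function.update ![f, g] 0 h = ![h, g] := fun f g h => by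
    funext l; fin_cases l <;> simp
  have u21 : ∀ f g h : Fun 𝕜 M, Function.update ![f, g] 1 h = ![f, h] := fun f g h => by
    funext l; fin_cases l <;> simp
  have Eadd : ∀ f g, E M D P ![f + g] x = E M D P ![f] x + E M D P ![g] x := fun f g => by
    simp only [hE.apply hc hx]
    simpa only [u1] using evalAt_update_add (prim e) D P hc hx ![f] 0 f g
  have Emul : ∀ a f, E M D P ![constFun M a * f] x = a * E M D P ![f] x := fun a f => by
    simp only [hE.apply hc hx]
    simpa only [u1] using evalAt_update_const_mul (prim e) D P hc hx ![f] 0 a f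
  have Ejet : ∀ f g, FunJetEq D c x (N + N) f g → E M D P ![f] x = E M D P ![g] x :=
    fun f g h => by
      simp only [hE.apply hc hx]
      exact evalAt_congr_jet D P hN2 (Fin.forall_fin_one.2 h)
  have Aadd0 : ∀ f g h, A M D P ![f + g, h] x = A M D P ![f, h] x + A M D P ![g, h] x :=
    fun f g h => by
      simp only [hA.apply hc hx]
      simpa only [u20] using evalAt_update_add e D P hc hx ![f, h] 0 f g
  have Aadd1 : ∀ f g h, A M D P ![h, f + g] x = A M D P ![h, f] x + A M D P ![h, g] x :=
    fun f g h => by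
      simp only [hA.apply hc hx]
      simpa only [u21] using evalAt_update_add e D P hc hx ![h, f] 1 f g
  have Amul0 : ∀ a f h, A M D P ![constFun M a * f, h] x = a * A M D P ![f, h] x :=
    fun a f h => by
      simp only [hA.apply hc hx]
      simpa only [u20] using evalAt_update_const_mul e D P hc hx ![f, h] 0 a f
  have Amul1 : ∀ a f h, A M D P ![h, constFun M a * f] x = a * A M D P ![h, f] x :=
    fun a f h => by
      simp only [hA.apply hc hx]
      simpa only [u21] using evalAt_update_const_mul e D P hc hx ![h, f] 1 a f
  have Ajet0 : ∀ f g h, FunJetEq D c x (N + N) f g → A M D P ![f, h] x = A M D P ![g, h] x :=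
    fun f g h hfg => by
      simp only [hA.apply hc hx]
      exact evalAt_congr_jet D P hN3 (Fin.forall_fin_two.2 ⟨hfg, FunJetEq.refl _ _ _ _ _⟩)
  have Ajet1 : ∀ f g h, FunJetEq D c x (N + N) f g → A M D P ![h, f] x = A M D P ![h, g] x :=
    fun f g h hfg => by
      simp only [hA.apply hc hx]
      exact evalAt_congr_jet D P hN3 (Fin.forall_fin_two.2 ⟨FunJetEq.refl _ _ _ _ _, hfg⟩)
  have hval : ∀ f g : Fun 𝕜 M, FunJetEq D c x (N + N) f g → f x = g x := fun f g h => by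
    have := h 0 (by omega) Fin.elim0
    rw [nablaSym_zero_order, nablaSym_zero_order] at this
    simpa [inChart, c.left_inv hx] using this
  have hca : ∀ (a : 𝕜) (f : Fun 𝕜 M), (constFun M a * f) x = a * f x := fun a f => rfl
  have hsymm : ∀ f g, L f g = L g f := fun f g => by
    simp only [L, mul_comm g f]
    ring
  have Ladd : ∀ h f g, L (f + g) h = L f h + L g h := fun h f g => by
    simp only [L, add_mul, Eadd, Aadd0, Aadd1]
    rw [show (f + g) x = f x + g x from rfl]
    ring
  have Lmul : ∀ h a f, L (constFun M a * f) h = a * L f h := fun h a f => by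
    simp only [L, mul_assoc, Emul, Amul0, Amul1, hca]
    ring
  have Ljet : ∀ h f g, FunJetEq D c x (N + N) f g → L f h = L g h := fun h f g hfg => by
    simp only [L]
    rw [hval f g hfg, Ejet f g hfg, Ajet0 f g h hfg, Ajet1 f g h hfg,
      Ejet _ _ (funJetEq_mul hc hx (g := h) hfg)]
  have hL : L f g = 0 := by
    refine functional_eq_zero D hc hx (N + N) (fun f => L f g) (Ladd g) (Lmul g) (Ljet g)
      (fun ξ f hf => ?_) f
    simp only [hsymm _ g]
    refine functional_eq_zero D hc hx (N + N) (fun g => L g f) (Ladd f) (Lmul f) (Ljet f)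
      (fun η g hg => ?_) g
    simp only [L]
    rw [hE.apply_exp hc hx hN2 (forall_funExpAt_single hg),
      hE.apply_exp hc hx hN2 (forall_funExpAt_single hf),
      hE.apply_exp hc hx hN2 (forall_funExpAt_single (funExpAt_mul hc hx hg hf)),
      hA.apply_exp hc hx hN3 (forall_funExpAt_pair hg hf),
      hA.apply_exp hc hx hN3 (forall_funExpAt_pair hf hg), funExpAt_apply hx hf,
      funExpAt_apply hx hg, ← symbolSum_prim_coboundary hA hcoc hord D P hc hx η ξ]
    ring
  change f x * E M D P ![g] x - E M D P ![f * g] x + E M D P ![f] x * g x =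
    (2⁻¹ : ℝ) • (A M D P ![f, g] x + A M D P ![g, f] x)
  simp only [L] at hL
  rw [RCLike.real_smul_eq_coe_mul]
  push_cast
  linear_combination (2⁻¹ : 𝕜) * hL

end Primitive

/-! ### Linear structure and permutation of arguments. -/

section RepresentedBy

variable {𝕜 : Type} [RCLike 𝕜] {k : ℕ}

lemma MultiOp.RepresentedBy.ext {A B : MultiOp.{u} 𝕜 k} {e : Monomial k →₀ 𝕜}
    (hA : A.RepresentedBy e) (hB : B.RepresentedBy e) : A = B := by
  funext M D P f
  ext x
  rw [hA.apply (IsManifold.chart_mem_maximalAtlas x) (mem_chart_source (Model M.dim) x),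
    hB.apply (IsManifold.chart_mem_maximalAtlas x) (mem_chart_source (Model M.dim) x)]

/-- Monomials with a property, as a submodule of the linear combinations. -/
abbrev combs (𝕜 : Type) [RCLike 𝕜] {k : ℕ} (p : Monomial k → Prop) :
    Submodule 𝕜 (Monomial k →₀ 𝕜) := Finsupp.supported 𝕜 𝕜 {Γ | p Γ}

lemma mem_combs {p : Monomial k → Prop} {e : Monomial k →₀ 𝕜} :
    e ∈ combs 𝕜 p ↔ ∀ Γ ∈ e.support, p Γ := by
  rw [Finsupp.mem_supported]
  rfl

lemma MultiOp.isNoLoop_iff {A : MultiOp.{u} 𝕜 k} :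
    A.IsNoLoop ↔ ∃ e ∈ combs 𝕜 (Monomial.NoLoop (k := k)), A.RepresentedBy e := by
  simp only [mem_combs]
  rfl

lemma MultiOp.RepresentedBy.smul {A : MultiOp.{u} 𝕜 k} {e : Monomial k →₀ 𝕜}
    (hA : A.RepresentedBy e) (a : ℝ) :
    MultiOp.RepresentedBy (fun M D P f => a • A M D P f) ((a : 𝕜) • e) := by
  intro M D P f c hc x hx
  change a • A M D P f x = evalAt _ D P c f x
  rw [hA.apply hc hx, RCLike.real_smul_eq_coe_mul]
  unfold evalAt evalComb
  rw [map_smul, smul_eq_mul]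

lemma MultiOp.RepresentedBy.sum {ι : Type*} (s : Finset ι) {A : ι → MultiOp.{u} 𝕜 k}
    {e : ι → Monomial k →₀ 𝕜} (hA : ∀ i ∈ s, (A i).RepresentedBy (e i)) :
    (∑ i ∈ s, A i).RepresentedBy (∑ i ∈ s, e i) := by
  classical
  induction s using Finset.induction_on with
  | empty => simpa using MultiOp.RepresentedBy.zero
  | insert i s hi ih =>
    rw [Finset.sum_insert hi, Finset.sum_insert hi]
    exact (hA i (Finset.mem_insert_self i s)).add
      (ih fun j hj => hA j (Finset.mem_insert_of_mem hj))

/-- Permutation of the arguments of a monomial. -/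
def Monomial.reindex (σ : Equiv.Perm (Fin k)) (Γ : Monomial k) : Monomial k where
  n := Γ.n
  numP := Γ.numP
  facP := Γ.facP
  numR := Γ.numR
  facR := Γ.facR
  ord l := Γ.ord (σ l)
  arg l := Γ.arg (σ l)
  upper_once := Γ.upper_once
  lower_once := by
    have h := bijective_sumMap_id _ (Function.bijective_id.sumMap
      (Equiv.sigmaCongrLeft (β := fun l => Fin (Γ.ord l)) σ).bijective) Γ.lower_once
    convert h using 1
    funext s
    rcases s with s | s | s <;> rfl

lemma Monomial.reindex_eval (σ : Equiv.Perm (Fin k)) (Γ : Monomial k) {d : ℕ}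
    (G : Fin d → Fin d → Fin d → Model d → ℝ) (P : Fin d → Fin d → Model d → ℝ)
    (f : Fin k → Model d → 𝕜) (y : Model d) :
    (Γ.reindex σ).eval G P f y = Γ.eval G P (f ∘ σ.symm) y := by
  unfold Monomial.eval
  refine Finset.sum_congr rfl fun (v : Fin Γ.n → Fin d) _ => ?_
  congr 1
  refine Eq.trans (Finset.prod_congr rfl fun l _ => ?_) (Equiv.prod_comp σ fun l =>
    nablaSym G ((f ∘ σ.symm) l) (Γ.ord l) (v ∘ Γ.arg l) y)
  change _ = nablaSym G (f (σ.symm (σ l))) _ _ y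
  rw [Equiv.symm_apply_apply]
  rfl

lemma MultiOp.RepresentedBy.reindex {A : MultiOp.{u} 𝕜 k} {e : Monomial k →₀ 𝕜}
    (hA : A.RepresentedBy e) (σ : Equiv.Perm (Fin k)) :
    MultiOp.RepresentedBy (fun M D P f => A M D P (f ∘ σ.symm))
      (e.mapDomain (Monomial.reindex σ)) := by
  intro M D P f c hc x hx
  change A M D P (f ∘ σ.symm) x = evalAt _ D P c f x
  rw [hA.apply hc hx]
  unfold evalAt evalComb
  rw [Finsupp.linearCombination_mapDomain]
  exact congrArg (fun F => Finsupp.linearCombination 𝕜 F e) (funext fun Γ =>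
    (Γ.reindex_eval σ (D.christoffel c) (bivComp P.tensor c) (fun l => inChart (f l) c) (c x)).symm)

lemma mapDomain_reindex_mem (σ : Equiv.Perm (Fin k)) {e : Monomial k →₀ 𝕜}
    (he : e ∈ combs 𝕜 (Monomial.NoLoop (k := k))) :
    e.mapDomain (Monomial.reindex σ) ∈ combs 𝕜 (Monomial.NoLoop (k := k)) := by
  classical
  rw [mem_combs] at *
  intro Γ hΓ
  obtain ⟨Δ, hΔ, rfl⟩ := Finset.mem_image.1 (Finsupp.mapDomain_support hΓ)
  exact he Δ hΔ

lemma filter_mem_combs {p q : Monomial k → Prop} [DecidablePred q] {e : Monomial k →₀ 𝕜}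
    (he : e ∈ combs 𝕜 p) : e.filter q ∈ combs 𝕜 fun Γ => p Γ ∧ q Γ := by
  rw [mem_combs] at *
  intro Γ hΓ
  rw [Finsupp.support_filter, Finset.mem_filter] at hΓ
  exact ⟨he Γ hΓ.1, hΓ.2⟩

end RepresentedBy

/-! ### The skewsymmetric part of a cocycle. -/

section SkewPart

variable {𝕜 : Type} [RCLike 𝕜]

lemma fin_two_eta {α : Type*} (f : Fin 2 → α) : ![f 0, f 1] = f := by
  funext l
  fin_cases l <;> rfl

lemma comp_swap {α : Type*} (f : Fin 2 → α) : f ∘ (Equiv.swap 0 1).symm = ![f 1, f 0] := by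
  funext l
  fin_cases l <;> rfl

lemma skewPart_representedBy {A : MultiOp.{u} 𝕜 2} {e : Monomial 2 →₀ 𝕜}
    (hA : A.RepresentedBy e) : (skewPart A).RepresentedBy
      (((2⁻¹ : ℝ) : 𝕜) • (e + -e.mapDomain (Monomial.reindex (Equiv.swap 0 1)))) := by
  convert (hA.add (hA.reindex (Equiv.swap 0 1)).neg).smul 2⁻¹ using 1
  funext M D P f
  simp only [skewPart, Pi.add_apply, Pi.neg_apply, comp_swap, fin_two_eta, sub_eq_add_neg]

lemma skewPart_apply (A : MultiOp.{u} 𝕜 2) {M : Mfd.{u}} (D : Connection M) (P : PoissonTensor M)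
    (f g : Fun 𝕜 M) : skewPart A M D P ![f, g] =
      (2⁻¹ : ℝ) • (A M D P ![f, g] - A M D P ![g, f]) := rfl

lemma isSkew_skewPart (A : MultiOp.{u} 𝕜 2) : IsSkew (skewPart A) := by
  intro M D P f g
  rw [skewPart_apply, skewPart_apply, ← smul_neg, neg_sub]

lemma skewPart_homogeneous {A : MultiOp.{u} 𝕜 2} {r : ℕ} (hA : A.IsHomogeneous r) :
    (skewPart A).IsHomogeneous r := by
  intro M D P t f
  simp only [skewPart]
  rw [hA, hA, ← smul_sub, smul_comm]

/-- The skewsymmetric part of a cocycle is a biderivation. -/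
lemma skewPart_mul_left {A : MultiOp.{u} 𝕜 2} (hcoc : IsHochschildCocycle A) {M : Mfd.{u}}
    (D : Connection M) (P : PoissonTensor M) (f g h : Fun 𝕜 M) :
    skewPart A M D P ![f * g, h] =
      f * skewPart A M D P ![g, h] + skewPart A M D P ![f, h] * g := by
  -- Three cocycle equations in which h moves from the last place to the first while f and g keep
  -- their order.
  have h1 := hcoc M D P f g h
  have h2 := hcoc M D P f h g
  have h3 := hcoc M D P h f g
  rw [mul_comm h g] at h2
  rw [mul_comm h f] at h3
  simp only [skewPart_apply, mul_smul_comm, smul_mul_assoc, ← smul_add]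
  congr 1
  linear_combination -h1 + h2 - h3

lemma FunExpAt.jetEq {M : Mfd.{u}} {D : Connection M} {c : OpenPartialHomeomorph M (Model M.dim)}
    {x : M} {N : ℕ} {ξ : Fin M.dim → ℝ} {f g : Fun 𝕜 M} (hf : FunExpAt D c x N ξ f)
    (hg : FunExpAt D c x N ξ g) : FunJetEq D c x N f g :=
  fun m hm J => (hf m hm J).trans (hg m hm J).symm

lemma MultiOp.RepresentedBy.congr_jet {k : ℕ} {A : MultiOp.{u} 𝕜 k} {e : Monomial k →₀ 𝕜}
    (hA : A.RepresentedBy e) {M : Mfd.{u}} {D : Connection M} {P : PoissonTensor M}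
    {c : OpenPartialHomeomorph M (Model M.dim)} (hc : c ∈ M.charts) {x : M} (hx : x ∈ c.source)
    {N : ℕ} (hN : ∀ Γ ∈ e.support, ∀ l, Γ.ord l ≤ N) {f g : Fin k → Fun 𝕜 M}
    (h : ∀ l, FunJetEq D c x N (f l) (g l)) : A M D P f x = A M D P g x := by
  rw [hA.apply hc hx, hA.apply hc hx, evalAt_congr_jet D P hN h]

/-- The skewsymmetric part of a universal Hochschild cocycle is of order one in each argument. -/
theorem skewPart_isNoLoopTensor {A : MultiOp.{u} 𝕜 2} (hA : A.IsNoLoop)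
    (hcoc : IsHochschildCocycle A) : (skewPart A).IsNoLoopTensor := by
  obtain ⟨e, he, hAe⟩ := MultiOp.isNoLoop_iff.1 hA
  have h0 := skewPart_representedBy hAe
  have hsk := isSkew_skewPart A
  have hl := fun {M : Mfd.{u}} => skewPart_mul_left hcoc (M := M)
  have hm : ((2⁻¹ : ℝ) : 𝕜) • (e + -e.mapDomain (Monomial.reindex (Equiv.swap 0 1))) ∈
      combs 𝕜 (Monomial.NoLoop (k := 2)) :=
    Submodule.smul_mem _ _ (Submodule.add_mem _ he
      (Submodule.neg_mem _ (mapDomain_reindex_mem _ he)))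
  set B := skewPart A
  generalize ((2⁻¹ : ℝ) : 𝕜) • (e + -e.mapDomain (Monomial.reindex (Equiv.swap 0 1))) = e0
    at h0 hm
  have hr : ∀ {M : Mfd.{u}} (D : Connection M) (P : PoissonTensor M) (f g h : Fun 𝕜 M),
      B M D P ![h, f * g] = f * B M D P ![h, g] + B M D P ![h, f] * g := by
    intro M D P f g h
    rw [hsk, hl, hsk M D P h g, hsk M D P h f]
    ring
  -- Doubling an exponent amounts to squaring the exponential. A derivation takes e² to 2e times its
  -- value on e, and e(x) = 1, so the symbol doubles as `filter_ord_eq_one` requires.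
  have h1 := h0.filter_ord_eq_one 0 fun M D P c hc x hx N hN f g ξ hf hg => by
    have hj : ∀ l, FunJetEq D c x N (g l) (![f 0 * f 0, f 1] l) := by
      refine Fin.forall_fin_two.2 ⟨?_, ?_⟩
      · refine (hg 0).jetEq ?_
        rw [Function.update_self, two_smul]
        exact funExpAt_mul hc hx (hf 0) (hf 0)
      · exact (hg 1).jetEq (by simpa using hf 1)
    rw [h0.congr_jet hc hx hN hj, hl, fin_two_eta]
    change f 0 x * B M D P f x + B M D P f x * f 0 x = _
    rw [funExpAt_apply hx (hf 0)]
    ring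
  have h2 := h1.filter_ord_eq_one 1 fun M D P c hc x hx N hN f g ξ hf hg => by
    have hj : ∀ l, FunJetEq D c x N (g l) (![f 0, f 1 * f 1] l) := by
      refine Fin.forall_fin_two.2 ⟨?_, ?_⟩
      · exact (hg 0).jetEq (by simpa using hf 0)
      · refine (hg 1).jetEq ?_
        rw [Function.update_self, two_smul]
        exact funExpAt_mul hc hx (hf 1) (hf 1)
    rw [h1.congr_jet hc hx hN hj, hr, fin_two_eta]
    change f 1 x * B M D P f x + B M D P f x * f 1 x = _
    rw [funExpAt_apply hx (hf 1)]
    ring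
  refine ⟨_, ?_, h2⟩
  have := mem_combs.1 (filter_mem_combs (q := fun Γ : Monomial 2 => Γ.ord 1 = 1)
    (filter_mem_combs (q := fun Γ : Monomial 2 => Γ.ord 0 = 1) hm))
  exact fun Γ hΓ => ⟨(this Γ hΓ).1.1, Fin.forall_fin_two.2 ⟨(this Γ hΓ).1.2, (this Γ hΓ).2⟩⟩

end SkewPart

/-! ### Index counting in degree one. -/

section DegreeCounting

variable {𝕜 : Type} [RCLike 𝕜] {k : ℕ}

/-- Both sides count the summation indices, once by their upper and once by their lower positions.
-/
lemma Monomial.count (Γ : Monomial k) : Γ.numP * 2 + Γ.numR =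
    ∑ i, (Γ.facP i).order + (∑ j, (3 + (Γ.facR j).order) + Γ.deg) := by
  have h1 := Fintype.card_of_bijective Γ.upper_once
  have h2 := Fintype.card_of_bijective Γ.lower_once
  rw [← h2] at h1
  simpa [Fintype.card_sigma, Fintype.card_sum, Fintype.card_prod, Monomial.deg] using h1

lemma nablaBivec_of_eq_zero {d : ℕ} (G : Fin d → Fin d → Fin d → Model d → ℝ)
    (P : Fin d → Fin d → Model d → ℝ) {a : ℕ} (ha : a = 0) (I : Fin 2 → Fin d)
    (J : Fin a → Fin d) (y : Model d) : nablaBivec G P a I J y = P (I 0) (I 1) y := by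
  subst ha
  rfl

lemma nablaSym_of_eq_one {d : ℕ} (G : Fin d → Fin d → Fin d → Model d → ℝ)
    (f : Model d → 𝕜) {m : ℕ} (hm : m = 1) (J : Fin m → Fin d) (y : Model d) :
    nablaSym G f m J y = pd (J ⟨0, by omega⟩) f y := by
  subst hm
  have : (default : Equiv.Perm (Fin 1)) = 1 := rfl
  simp [nablaSym, nablaFun, covD, this]

/-- One factor P supplies two upper indices, and each curvature consumes at least two more lower
indices than it supplies. With two derivatives on the arguments nothing is left for curvature or for
derivatives of P. -/
lemma Monomial.numP_one_structure {Γ : Monomial k} (hP : Γ.numP = 1) (hd : 2 ≤ Γ.deg) :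
    Γ.numR = 0 ∧ (∀ i, (Γ.facP i).order = 0) ∧ Γ.deg = 2 := by
  have h := Γ.count
  have hP2 : Γ.numP * 2 = 2 := by rw [hP]
  rw [hP2, Finset.sum_add_distrib, Finset.sum_const, Finset.card_univ, Fintype.card_fin,
    smul_eq_mul] at h
  refine ⟨by omega, fun i => ?_, by omega⟩
  have := Finset.single_le_sum (f := fun i => (Γ.facP i).order) (fun _ _ => Nat.zero_le _)
    (Finset.mem_univ i)
  omega

/-- Bidifferential monomials of degree one are skewsymmetric. -/
lemma Monomial.eval_skew {Γ : Monomial 2} (hP : Γ.numP = 1) (hord : ∀ l, Γ.ord l ≠ 0) {d : ℕ}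
    (G : Fin d → Fin d → Fin d → Model d → ℝ) (P : Fin d → Fin d → Model d → ℝ) (y : Model d)
    (hskew : ∀ i j, P i j y = - P j i y) (f : Fin 2 → Model d → 𝕜) :
    Γ.eval G P ![f 1, f 0] y = - Γ.eval G P f y := by
  classical
  have hd : 2 ≤ Γ.deg := by
    rw [Monomial.deg, Fin.sum_univ_two]
    have := hord 0
    have := hord 1
    omega
  obtain ⟨hR, hPo, hd2⟩ := Monomial.numP_one_structure hP hd
  have ho : ∀ l, Γ.ord l = 1 := by
    rw [Monomial.deg, Fin.sum_univ_two] at hd2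
    have := hord 0
    have := hord 1
    exact Fin.forall_fin_two.2 ⟨by omega, by omega⟩
  have : IsEmpty (Fin Γ.numR) := by rw [hR]; infer_instance
  let i0 : Fin Γ.numP := ⟨0, by omega⟩
  have hi0 : ∀ i, i = i0 := fun i => Fin.ext (by have := i.2; simp only [i0]; omega)
  let a := (Γ.facP i0).up 0
  let b := (Γ.facP i0).up 1
  let c : Fin 2 → Fin Γ.n := fun l => Γ.arg l ⟨0, by rw [ho]; omega⟩
  have hc01 : c 0 ≠ c 1 := by
    intro h
    have := Γ.lower_once.1 (a₁ := Sum.inr (Sum.inr ⟨0, ⟨0, by rw [ho]; omega⟩⟩))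
      (a₂ := Sum.inr (Sum.inr ⟨1, ⟨0, by rw [ho]; omega⟩⟩)) h
    simp at this
  -- There are only the two indices of P, since no curvature factor is present.
  have hcov : ∀ z, z = a ∨ z = b := by
    intro z
    obtain ⟨s, hs⟩ := Γ.upper_once.2 z
    rcases s with ⟨i, s⟩ | j
    · rw [hi0 i] at hs
      fin_cases s
      · exact Or.inl hs.symm
      · exact Or.inr hs.symm
    · exact isEmptyElim j
  -- The two arguments carry the two indices of P, in some order. Renaming the indices by their
  -- transposition therefore exchanges the arguments, at the price of the sign of P.
  have hτ : ∀ l, Equiv.swap a b (c l) = c (Equiv.swap 0 1 l) := by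
    have h0 := hcov (c 0)
    have h1 := hcov (c 1)
    refine Fin.forall_fin_two.2 ⟨?_, ?_⟩
    · rw [Equiv.swap_apply_left]
      rcases h0 with h0 | h0 <;> rcases h1 with h1 | h1
      · exact absurd (h0.trans h1.symm) hc01
      · rw [h0, h1, Equiv.swap_apply_left]
      · rw [h0, h1, Equiv.swap_apply_right]
      · exact absurd (h0.trans h1.symm) hc01
    · rw [Equiv.swap_apply_right]
      rcases h0 with h0 | h0 <;> rcases h1 with h1 | h1
      · exact absurd (h0.trans h1.symm) hc01
      · rw [h0, h1, Equiv.swap_apply_right]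
      · rw [h0, h1, Equiv.swap_apply_left]
      · exact absurd (h0.trans h1.symm) hc01
  have heval : ∀ f : Fin 2 → Model d → 𝕜, Γ.eval G P f y =
      ∑ v : Fin Γ.n → Fin d, ((P (v a) (v b) y : ℝ) : 𝕜) * ∏ l, pd (v (c l)) (f l) y := by
    intro f
    unfold Monomial.eval
    refine Finset.sum_congr rfl fun v _ => ?_
    rw [Fintype.prod_eq_single i0 fun i hi => absurd (hi0 i) hi, nablaBivec_of_eq_zero _ _ (hPo i0)]
    simp only [nablaSym_of_eq_one G _ (ho _), Finset.univ_eq_empty, Finset.prod_empty,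
      RCLike.ofReal_one, mul_one]
    rfl
  rw [heval, heval, ← Finset.sum_neg_distrib]
  refine Fintype.sum_equiv ((Equiv.swap a b).arrowCongr (Equiv.refl _)) _ _ fun v => ?_
  have hv : ∀ z, (Equiv.swap a b).arrowCongr (Equiv.refl (Fin d)) v z = v (Equiv.swap a b z) := by
    intro z
    simp
  simp only [hv, hτ, Fin.prod_univ_two, Equiv.swap_apply_left, Equiv.swap_apply_right,
    Matrix.cons_val_zero, Matrix.cons_val_one]
  rw [hskew (v b) (v a), RCLike.ofReal_neg]
  ring

/-- There is no universal vector field of no-loop type and of degree one. -/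
lemma Monomial.not_noLoop {Γ : Monomial 1} (hP : Γ.numP = 1) (hord : Γ.ord 0 = 1) :
    ¬ Γ.NoLoop := by
  intro hnl
  have h := Γ.count
  have hdeg : Γ.deg = 1 := by rw [Monomial.deg, Fin.sum_univ_one, hord]
  have hP2 : Γ.numP * 2 = 2 := by rw [hP]
  rw [hP2, Finset.sum_add_distrib, Finset.sum_const, Finset.card_univ, Fintype.card_fin,
    smul_eq_mul, hdeg] at h
  let i0 : Fin Γ.numP := ⟨0, by omega⟩
  have hi0 : ∀ i, i = i0 := fun i => Fin.ext (by have := i.2; simp only [i0]; omega)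
  have hR : Γ.numR = 0 := by omega
  have : IsEmpty (Fin Γ.numR) := by rw [hR]; infer_instance
  have hsum : ∑ i, (Γ.facP i).order = (Γ.facP i0).order :=
    Fintype.sum_eq_single i0 fun i hi => absurd (hi0 i) hi
  have hR0 : ∑ j, (Γ.facR j).order = 0 := by simp
  have ho : (Γ.facP i0).order = 1 := by
    rw [hsum, hR0, hR] at h
    omega
  -- The count leaves one derivative on P and no curvature. The index of that derivative must occur
  -- above, hence on P itself: this is the divergence of P, a loop.
  obtain ⟨s, hs⟩ := Γ.upper_once.2 ((Γ.facP i0).low ⟨0, by rw [ho]; omega⟩)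
  rcases s with ⟨i, s⟩ | j
  · rw [hi0 i] at hs
    exact hnl.1 i0 s _ hs
  · exact isEmptyElim j

lemma poissonTensor_comp_skew {M : Mfd.{u}} (P : PoissonTensor M)
    (c : OpenPartialHomeomorph M (Model M.dim)) (i j : Fin M.dim) (y : Model M.dim) :
    bivComp P.tensor c i j y = - bivComp P.tensor c j i y :=
  P.skew _ _ _

/-- A universal bidifferential operator of degree one that vanishes on constants is
skewsymmetric. -/
theorem isSkew_of_degree_one {A : MultiOp.{u} 𝕜 2} (hA : A.IsNoLoop) (h1 : A.IsHomogeneous 1)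
    (hc0 : ∀ (M : Mfd.{u}) (D : Connection M) (P : PoissonTensor M) (f : Fin 2 → Fun 𝕜 M) (l),
      f l = constFun M 1 → A M D P f = 0) : IsSkew A := by
  obtain ⟨e, -, he⟩ := hA
  have h := ((he.filter_numP h1).filter_ord_ne_zero 0 fun M D P f => hc0 M D P f 0)
    |>.filter_ord_ne_zero 1 fun M D P f => hc0 M D P f 1
  set e' := ((e.filter fun Γ => Γ.numP = 1).filter fun Γ => Γ.ord 0 ≠ 0).filter
    fun Γ => Γ.ord 1 ≠ 0 with he'
  have hs : ∀ Γ ∈ e'.support, Γ.numP = 1 ∧ ∀ l, Γ.ord l ≠ 0 := by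
    intro Γ hΓ
    simp only [he', Finsupp.support_filter, Finset.mem_filter] at hΓ
    exact ⟨hΓ.1.1.2, Fin.forall_fin_two.2 ⟨hΓ.1.2, hΓ.2⟩⟩
  intro M D P f g
  ext x
  change A M D P ![f, g] x = - A M D P ![g, f] x
  rw [h.apply (IsManifold.chart_mem_maximalAtlas x) (mem_chart_source (Model M.dim) x),
    h.apply (IsManifold.chart_mem_maximalAtlas x) (mem_chart_source (Model M.dim) x)]
  simp only [evalAt, evalComb_eq_sum]
  rw [← Finset.sum_neg_distrib]
  refine Finset.sum_congr rfl fun Γ hΓ => ?_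
  rw [← mul_neg, ← Monomial.eval_skew (hs Γ hΓ).1 (hs Γ hΓ).2 _ _ _
    fun i j => poissonTensor_comp_skew P _ i j _]
  congr 2
  funext l
  fin_cases l <;> rfl

/-- There is no nonzero universal vector field of no-loop type and of degree one. -/
theorem eq_zero_of_degree_one {B : MultiOp.{u} 𝕜 1} (hB : B.IsNoLoopTensor)
    (h1 : B.IsHomogeneous 1) : B = 0 := by
  obtain ⟨e, hs, he⟩ := hB
  have h := he.filter_numP h1
  have h0 : (e.filter fun Γ => Γ.numP = 1) = 0 := by
    rw [← Finsupp.support_eq_empty, Finset.eq_empty_iff_forall_notMem]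
    intro Γ hΓ
    rw [Finsupp.support_filter, Finset.mem_filter] at hΓ
    exact Monomial.not_noLoop hΓ.2 ((hs Γ hΓ.1).2 0) (hs Γ hΓ.1).1
  rw [h0] at h
  exact h.ext .zero

end DegreeCounting

/-! ### Homogeneous parts of operators and of coboundaries. -/

section HomogeneousParts

variable {𝕜 : Type} [RCLike 𝕜] {k : ℕ}

/-- The values in two charts agree for all tP, so as polynomials in t; hence each coefficient is
independent of the chart and defines an operator. -/
lemma exists_homogeneousPart {B : MultiOp.{u} 𝕜 k} {e : Monomial k →₀ 𝕜}
    (hB : B.RepresentedBy e) (j : ℕ) :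
    ∃ B' : MultiOp.{u} 𝕜 k, B'.RepresentedBy (e.filter fun Γ => Γ.numP = j) := by
  refine exists_representedBy _ fun M D P f c c' hc hc' x hx hx' => ?_
  rw [evalAt_filter, evalAt_filter, ← sub_eq_zero, ← Finset.sum_sub_distrib]
  have := sum_weight_eq_zero e.support Monomial.numP (fun Γ =>
      e Γ * Γ.eval (D.christoffel c) (bivComp P.tensor c) (fun l => inChart (f l) c) (c x) -
      e Γ * Γ.eval (D.christoffel c') (bivComp P.tensor c') (fun l => inChart (f l) c') (c' x))
    (fun t => ?_) (fun n => if n = j then 1 else 0)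
  · exact Eq.trans (Finset.sum_congr rfl fun Γ _ => (mul_sub _ _ _).symm) this
  · simp only [mul_sub]
    rw [Finset.sum_sub_distrib, ← evalAt_scale e hc hx, ← evalAt_scale e hc' hx',
      ← hB.apply hc hx, ← hB.apply hc' hx', sub_self]

lemma bracket_scale {M : Mfd.{u}} (P : PoissonTensor M) (t : ℝ) (f g : Fun 𝕜 M) :
    bracket (P.scale t) f g = t • bracket P f g := by
  ext x
  change (bracketInChart (P.scale t) f g _ _ : 𝕜) = t • bracketInChart P f g _ _
  unfold bracketInChart
  rw [Finset.smul_sum]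
  refine Finset.sum_congr rfl fun i _ => ?_
  rw [Finset.smul_sum]
  refine Finset.sum_congr rfl fun j _ => ?_
  have : bivComp (P.scale t).tensor (chartAt (Model M.dim) x) i j =
    t • bivComp P.tensor (chartAt (Model M.dim) x) i j := bivComp_smul P.tensor t _ i j
  rw [this, RCLike.real_smul_eq_coe_mul]
  simp only [Pi.smul_apply, smul_eq_mul, RCLike.ofReal_mul]
  ring

lemma bracket_smul_right {M : Mfd.{u}} (P : PoissonTensor M) (t : ℝ) (f g : Fun 𝕜 M) :
    bracket P f (t • g) = t • bracket P f g := by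
  ext x
  change (bracketInChart P f (t • g) _ _ : 𝕜) = t • bracketInChart P f g _ _
  have hc : chartAt (Model M.dim) x ∈ M.charts := IsManifold.chart_mem_maximalAtlas x
  have hd : DifferentiableAt ℝ (inChart g (chartAt (Model M.dim) x)) (chartAt (Model M.dim) x x) :=
    ((contDiffOn_inChart g hc).contDiffAt ((chartAt (Model M.dim) x).open_target.mem_nhds
      ((chartAt (Model M.dim) x).map_source (mem_chart_source _ x)))).differentiableAt (by simp)
  have h : ∀ j, pd j (inChart (t • g) (chartAt (Model M.dim) x)) (chartAt (Model M.dim) x x) =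
      t • pd j (inChart g (chartAt (Model M.dim) x)) (chartAt (Model M.dim) x x) := by
    intro j
    have h1 : inChart (t • g) (chartAt (Model M.dim) x) =
      t • inChart g (chartAt (Model M.dim) x) := rfl
    rw [h1, pd, fderiv_const_smul hd]
    rfl
  unfold bracketInChart
  simp only [h, Finset.smul_sum, mul_smul_comm]

/-- `δ_P` as an additive map. -/
def chevalleyHom (𝕜 : Type) [RCLike 𝕜] : MultiOp.{u} 𝕜 1 →+ MultiOp.{u} 𝕜 2 where
  toFun := chevalleyD
  map_zero' := by
    funext M D P f
    simp [chevalleyD, bracket_zero_right]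
  map_add' A B := by
    funext M D P f
    simp only [chevalleyD, Pi.add_apply, bracket_add_right]
    abel

/-- The bracket contributes one factor P. Real linearity of B is needed to pull the scalar out of
B({f, g}). -/
lemma chevalleyD_homogeneous {B : MultiOp.{u} 𝕜 1} {r : ℕ} (hB : B.IsHomogeneous r)
    (hs : ∀ (M : Mfd.{u}) (D : Connection M) (P : PoissonTensor M) (t : ℝ) (f : Fun 𝕜 M),
      B M D P ![t • f] = t • B M D P ![f]) : (chevalleyD B).IsHomogeneous (r + 1) := by
  intro M D P t f
  simp only [chevalleyD, bracket_scale, hB M D P t, hs, bracket_smul_right, smul_smul, smul_sub,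
    pow_succ, mul_comm]

lemma MultiOp.RepresentedBy.smul_apply {B : MultiOp.{u} 𝕜 1} {e : Monomial 1 →₀ 𝕜}
    (hB : B.RepresentedBy e) {M : Mfd.{u}} (D : Connection M) (P : PoissonTensor M) (t : ℝ)
    (f : Fun 𝕜 M) : B M D P ![t • f] = t • B M D P ![f] := by
  ext x
  have hc : chartAt (Model M.dim) x ∈ M.charts := IsManifold.chart_mem_maximalAtlas x
  have hx := mem_chart_source (Model M.dim) x
  change _ = t • B M D P ![f] x
  rw [hB.apply hc hx, hB.apply hc hx]
  have h1 : t • f = constFun M (t : 𝕜) * f := by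
    ext z
    exact RCLike.real_smul_eq_coe_mul _ _
  have := evalAt_update_const_mul e D P hc hx ![f] 0 (t : 𝕜) f
  rw [← h1] at this
  have u1 : ∀ g : Fun 𝕜 M, Function.update ![f] 0 g = ![g] := fun g => by
    funext l; obtain rfl : l = 0 := Subsingleton.elim _ _; simp
  rw [u1, u1] at this
  rw [this, RCLike.real_smul_eq_coe_mul]

/-- A homogeneous coboundary of degree `j + 1` is the coboundary of a cochain of degree `j`. -/
theorem exists_homogeneous_primitive {C : MultiOp.{u} 𝕜 2} {j : ℕ} (hC : C.IsHomogeneous (j + 1))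
    (hcob : IsPoissonCoboundary C) :
    ∃ B : MultiOp.{u} 𝕜 1, B.IsNoLoopTensor ∧ B.IsHomogeneous j ∧ C = chevalleyD B := by
  obtain ⟨B, ⟨e, hs, he⟩, rfl⟩ := hcob
  choose Bn hBn using exists_homogeneousPart he
  have hsupp : ∀ n, ∀ Γ ∈ (e.filter fun Γ => Γ.numP = n).support, Γ ∈ e.support ∧ Γ.numP = n := by
    intro n Γ hΓ
    rwa [Finsupp.support_filter, Finset.mem_filter] at hΓ
  have hhom : ∀ n, (Bn n).IsHomogeneous n := fun n =>
    (hBn n).isHomogeneous fun Γ hΓ => (hsupp n Γ hΓ).2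
  -- A crude bound for the degrees that occur. The range up to m + j + 1 contains them all, and also
  -- j, whose component may be zero.
  set m := ∑ Γ ∈ e.support, Γ.numP with hm
  have hlt : ∀ Γ ∈ e.support, Γ.numP < m + j + 1 := fun Γ hΓ => by
    have : Γ.numP ≤ m :=
      Finset.single_le_sum (f := fun Γ : Monomial 1 => Γ.numP) (fun _ _ => Nat.zero_le _) hΓ
    omega
  have hsum : B = ∑ n ∈ Finset.range (m + j + 1), Bn n := by
    refine he.ext ?_
    have hsume : e = ∑ n ∈ Finset.range (m + j + 1), e.filter fun Γ => Γ.numP = n := by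
      ext Γ
      rw [Finsupp.finsetSum_apply]
      simp only [Finsupp.filter_apply]
      rw [Finset.sum_ite_eq]
      by_cases hΓ : Γ ∈ e.support
      · rw [if_pos (Finset.mem_range.2 (hlt Γ hΓ))]
      · rw [Finsupp.notMem_support_iff.1 hΓ, ite_self]
    nth_rewrite 1 [hsume]
    exact MultiOp.RepresentedBy.sum _ fun n _ => hBn n
  refine ⟨Bn j, ⟨_, fun Γ hΓ => hs Γ (hsupp j Γ hΓ).1, hBn j⟩, hhom j, ?_⟩
  have hch : chevalleyD B = ∑ n ∈ Finset.range (m + j + 1), chevalleyD (Bn n) := by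
    rw [hsum]
    exact map_sum (chevalleyHom 𝕜) _ _
  have happ : ∀ (M : Mfd.{u}) (D : Connection M) (P : PoissonTensor M) (f : Fin 2 → Fun 𝕜 M)
      (x : M), chevalleyD B M D P f x =
        ∑ n ∈ Finset.range (m + j + 1), chevalleyD (Bn n) M D P f x := by
    intro M D P f x
    rw [hch]
    simp only [Finset.sum_apply]
    generalize Finset.range (m + j + 1) = s
    induction s using Finset.induction_on with
    | empty => rfl
    | insert i s hi ih => rw [Finset.sum_insert hi, Finset.sum_insert hi, ← ih]; rfl
  funext M D P f
  ext x
  -- Comparison of the coefficients of t^{j+1}: the given cocycle sits in degree j+1 by assumption,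
  -- and the coboundary of the n-th component in degree n+1.
  have key := sum_weight_eq_zero (Finset.insertNone (Finset.range (m + j + 1)))
    (fun o : Option ℕ => o.elim (j + 1) (· + 1))
    (fun o => o.elim (-chevalleyD B M D P f x) fun n => chevalleyD (Bn n) M D P f x) (fun t => ?_)
    (fun n => if n = j + 1 then 1 else 0)
  · rw [Finset.sum_insertNone] at key
    simp only [Option.elim, if_true, one_mul] at key
    rw [Finset.sum_eq_single j (fun n _ hn => by simp [hn])
      (fun h => absurd (Finset.mem_range.2 (by omega)) h)] at key
    simp only [if_true, one_mul] at key
    linear_combination -key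
  · rw [Finset.sum_insertNone]
    simp only [Option.elim]
    have h1 : chevalleyD B M D (P.scale t) f x = (t : 𝕜) ^ (j + 1) * chevalleyD B M D P f x := by
      rw [hC M D P t f]
      change t ^ (j + 1) • chevalleyD B M D P f x = _
      rw [RCLike.real_smul_eq_coe_mul, RCLike.ofReal_pow]
    have h2 : ∀ n, chevalleyD (Bn n) M D (P.scale t) f x =
        (t : 𝕜) ^ (n + 1) * chevalleyD (Bn n) M D P f x := by
      intro n
      rw [chevalleyD_homogeneous (hhom n) (fun M D P t f => (hBn n).smul_apply D P t f) M D P t f]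
      change t ^ (n + 1) • chevalleyD (Bn n) M D P f x = _
      rw [RCLike.real_smul_eq_coe_mul, RCLike.ofReal_pow]
    simp only [← h2]
    rw [← happ, h1]
    ring

end HomogeneousParts

/-! ### Products of tensor factors with labelled indices and their Leibniz rule. -/

section Factors

/-- Smooth data on an open subset of `ℝ^d`, from which the factors of a monomial are built. -/
structure LocalData (𝕜 : Type) [RCLike 𝕜] (β : Type) where
  d : ℕ
  U : Set (Model d)
  G : Fin d → Fin d → Fin d → Model d → ℝ
  P : Fin d → Fin d → Model d → ℝ
  f : β → Model d → 𝕜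
  isOpen : IsOpen U
  smooth_G : ∀ k i j, ContDiffOn ℝ ∞ (G k i j) U
  smooth_P : ∀ i j, ContDiffOn ℝ ∞ (P i j) U
  smooth_f : ∀ l, ContDiffOn ℝ ∞ (f l) U
  symm_G : ∀ y ∈ U, ∀ k i j, G k i j y = G k j i y

/-- A factor of a product of tensors, with upper indices labelled by `U` and lower indices labelled
by `L`: `∇^a P`, `∇^b R`, `∇^m f_l` or `∇^{sym,m} f_l`. -/
inductive Fac (β U L : Type) : Type
  | P (a : ℕ) (up : Fin 2 → U) (low : Fin a → L)
  | R (b : ℕ) (up : Fin 1 → U) (low : Fin (3 + b) → L)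
  | F (l : β) (m : ℕ) (low : Fin m → L)
  | S (l : β) (m : ℕ) (low : Fin m → L)

namespace Fac

variable {𝕜 : Type} [RCLike 𝕜] {β β' U U' L L' : Type}

/-- The value of a factor, for values `a` of the upper and `b` of the lower indices. -/
def comp (X : LocalData 𝕜 β) (a : U → Fin X.d) (b : L → Fin X.d) : Fac β U L → Model X.d → 𝕜
  | P n up low => fun y => ((nablaBivec X.G X.P n (a ∘ up) (b ∘ low) y : ℝ) : 𝕜)
  | R n up low => fun y => ((nablaCurv X.G n (a ∘ up) (b ∘ low) y : ℝ) : 𝕜)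
  | F l m low => nablaFun X.G (X.f l) m Fin.elim0 (b ∘ low)
  | S l m low => nablaSym X.G (X.f l) m (b ∘ low)

/-- The upper labels of a factor. -/
def ups : Fac β U L → Multiset U
  | P _ up _ => Finset.univ.val.map up
  | R _ up _ => Finset.univ.val.map up
  | F _ _ _ => 0
  | S _ _ _ => 0

/-- The lower labels of a factor. -/
def lows : Fac β U L → Multiset L
  | P _ _ low => Finset.univ.val.map low
  | R _ _ low => Finset.univ.val.map low
  | F _ _ low => Finset.univ.val.map low
  | S _ _ low => Finset.univ.val.map low

/-- The argument that occurs in a factor. -/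
def tags : Fac β U L → Multiset β
  | P _ _ _ => 0
  | R _ _ _ => 0
  | F l _ _ => {l}
  | S l _ _ => {l}

/-- A measure of the unsymmetrised derivatives in a factor. -/
def weight : Fac β U L → ℕ
  | F _ m _ => m + 1
  | _ => 0

/-- The factor is not a symmetrised derivative. -/
def NoS : Fac β U L → Prop
  | S _ _ _ => False
  | _ => True

/-- Change of labels. -/
def relabel (p : U → U') (q : L → L') : Fac β U L → Fac β U' L'
  | P n up low => P n (p ∘ up) (q ∘ low)
  | R n up low => R n (p ∘ up) (q ∘ low)
  | F l m low => F l m (q ∘ low)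
  | S l m low => S l m (q ∘ low)

/-- The covariant derivative of a factor, with a new label `none`. -/
def inc : Fac β U L → Fac β U (Option L)
  | P n up low => P (n + 1) up (Fin.cons none (some ∘ low))
  | R n up low => R (n + 1) up (Fin.cons (α := fun _ : Fin (3 + n + 1) => Option L) none (some ∘ low))
  | F l m low => F l (m + 1) (Fin.cons none (some ∘ low))
  | S l m low => S l (m + 1) (Fin.cons none (some ∘ low))

lemma comp_relabel (X : LocalData 𝕜 β) (p : U → U') (q : L → L') (a : U' → Fin X.d)
    (b : L' → Fin X.d) (φ : Fac β U L) :
    (φ.relabel p q).comp X a b = φ.comp X (a ∘ p) (b ∘ q) := by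
  cases φ <;> rfl

lemma ups_relabel (p : U → U') (q : L → L') (φ : Fac β U L) :
    (φ.relabel p q).ups = φ.ups.map p := by
  cases φ <;> simp only [relabel, ups, Multiset.map_map, Multiset.map_zero]

lemma lows_relabel (p : U → U') (q : L → L') (φ : Fac β U L) :
    (φ.relabel p q).lows = φ.lows.map q := by
  cases φ <;> simp only [relabel, lows, Multiset.map_map]

lemma tags_relabel (p : U → U') (q : L → L') (φ : Fac β U L) :
    (φ.relabel p q).tags = φ.tags := by
  cases φ <;> rfl

lemma weight_relabel (p : U → U') (q : L → L') (φ : Fac β U L) :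
    (φ.relabel p q).weight = φ.weight := by
  cases φ <;> rfl

lemma noS_relabel (p : U → U') (q : L → L') {φ : Fac β U L} (h : φ.NoS) :
    (φ.relabel p q).NoS := by
  cases φ <;> exact h

lemma ups_inc (φ : Fac β U L) : φ.inc.ups = φ.ups := by
  cases φ <;> rfl

lemma map_univ_cons {n : ℕ} {A : Type} (x : A) (g : Fin n → A) :
    Finset.univ.val.map (Fin.cons x g : Fin (n + 1) → A) = x ::ₘ Finset.univ.val.map g := by
  rw [Fin.univ_succ, Finset.cons_val, Multiset.map_cons, Finset.map_val, Multiset.map_map]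
  congr 1

lemma lows_inc (φ : Fac β U L) : φ.inc.lows = none ::ₘ φ.lows.map some := by
  cases φ with
  | R n up low => exact (map_univ_cons (n := 3 + n) none (some ∘ low)).trans (by simp only [lows, Multiset.map_map])
  | _ => simp only [inc, lows, map_univ_cons, Multiset.map_map]

lemma tags_inc (φ : Fac β U L) : φ.inc.tags = φ.tags := by
  cases φ <;> rfl

lemma weight_inc (φ : Fac β U L) : φ.inc.weight ≤ φ.weight + 1 := by
  cases φ <;> simp [inc, weight]

lemma noS_inc {φ : Fac β U L} (h : φ.NoS) : φ.inc.NoS := by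
  cases φ <;> exact h

lemma comp_congr (X : LocalData 𝕜 β) {a a' : U → Fin X.d} {b b' : L → Fin X.d} (φ : Fac β U L)
    (ha : ∀ u ∈ φ.ups, a u = a' u) (hb : ∀ w ∈ φ.lows, b w = b' w) :
    φ.comp X a b = φ.comp X a' b' := by
  have h1 : ∀ {n : ℕ} (up : Fin n → U), (∀ u ∈ Finset.univ.val.map up, a u = a' u) →
      a ∘ up = a' ∘ up := fun up h => funext fun s => h _ (Multiset.mem_map_of_mem _ (by simp))
  have h2 : ∀ {n : ℕ} (low : Fin n → L), (∀ u ∈ Finset.univ.val.map low, b u = b' u) →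
      b ∘ low = b' ∘ low := fun low h => funext fun s => h _ (Multiset.mem_map_of_mem _ (by simp))
  cases φ with
  | P n up low => simp only [comp, h1 up ha, h2 low hb]
  | R n up low => simp only [comp, h1 up ha, h2 low hb]
  | F l m low => simp only [comp, h2 low hb]
  | S l m low => simp only [comp, h2 low hb]

lemma contDiffOn_comp (X : LocalData 𝕜 β) (a : U → Fin X.d) (b : L → Fin X.d) (φ : Fac β U L) :
    ContDiffOn ℝ ∞ (φ.comp X a b) X.U := by
  cases φ with
  | P n up low =>
    exact (RCLike.ofRealCLM (K := 𝕜)).contDiff.comp_contDiffOn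
      (contDiffOn_nablaBivec X.isOpen X.smooth_G X.smooth_P _ _ _)
  | R n up low =>
    exact (RCLike.ofRealCLM (K := 𝕜)).contDiff.comp_contDiffOn
      (contDiffOn_nablaCurv X.isOpen X.smooth_G _ _ _)
  | F l m low => exact contDiffOn_nablaFun X.isOpen X.smooth_G (X.smooth_f l) _ _ _
  | S l m low => exact contDiffOn_nablaSym X.isOpen X.smooth_G (X.smooth_f l) _ _

lemma injective_of_nodup_map {n : ℕ} {A : Type} {g : Fin n → A}
    (h : (Finset.univ.val.map g).Nodup) : Function.Injective g := fun x y hxy =>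
  (Multiset.nodup_map_iff_inj_on Finset.univ.nodup).1 h x (Finset.mem_univ x) y
    (Finset.mem_univ y) hxy

/-- The definition of the covariant derivative solved for the partial derivative. Distinct labels
are needed so that changing one entry of an index tuple is the same as changing the value of one
label. -/
lemma pd_of_covD {d p q : ℕ} {F : Type} [NormedAddCommGroup F] [NormedSpace ℝ F]
    [DecidableEq U] [DecidableEq L]
    (G : Fin d → Fin d → Fin d → Model d → ℝ) (T : Comp d F p q) {up : Fin p → U}
    {low : Fin q → L} (hup : Function.Injective up) (hlow : Function.Injective low)
    (a : U → Fin d) (b : L → Fin d) (i : Fin d) (y : Model d) :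
    pd i (T (a ∘ up) (b ∘ low)) y = covD G T (a ∘ up) (Fin.cons i (b ∘ low)) y -
      ∑ s, ∑ m, G (a (up s)) i m y • T (Function.update a (up s) m ∘ up) (b ∘ low) y +
      ∑ s, ∑ m, G m i (b (low s)) y • T (a ∘ up) (Function.update b (low s) m ∘ low) y := by
  simp only [covD, Fin.cons_zero, Fin.tail_cons, Fin.cons_succ, Function.comp_apply,
    Function.update_comp_eq_of_injective _ hup, Function.update_comp_eq_of_injective _ hlow]
  abel

/-- The covariant derivative and the partial derivative of a factor. -/
lemma pd_comp [DecidableEq U] [DecidableEq L] (X : LocalData 𝕜 β) {φ : Fac β U L} (hφ : φ.NoS)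
    (hu : φ.ups.Nodup) (hl : φ.lows.Nodup) (a : U → Fin X.d) (b : L → Fin X.d) (i : Fin X.d)
    {y : Model X.d} (hy : y ∈ X.U) :
    pd i (φ.comp X a b) y = φ.inc.comp X a (fun o => o.elim i b) y -
      (φ.ups.map fun u => ∑ m, (X.G (a u) i m y : 𝕜) *
        φ.comp X (Function.update a u m) b y).sum +
      (φ.lows.map fun w => ∑ m, (X.G m i (b w) y : 𝕜) *
        φ.comp X a (Function.update b w m) y).sum := by
  have hcons : ∀ {n : ℕ} (low : Fin n → L), (fun o : Option L => o.elim i b) ∘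
      (Fin.cons none (some ∘ low) : Fin (n + 1) → Option L) = Fin.cons i (b ∘ low) := by
    intro n low
    funext s
    refine Fin.cases ?_ (fun s => ?_) s <;> simp
  have hreal : ∀ {f : Model X.d → ℝ}, ContDiffOn ℝ ∞ f X.U →
      pd i (fun y => ((f y : ℝ) : 𝕜)) y = ((pd i f y : ℝ) : 𝕜) := by
    intro f hf
    have := ((RCLike.ofRealCLM (K := 𝕜)).hasFDerivAt.comp y
      ((hf.contDiffAt (X.isOpen.mem_nhds hy)).differentiableAt (by simp)).hasFDerivAt).fderiv
    change fderiv ℝ ((RCLike.ofRealCLM (K := 𝕜)) ∘ f) y _ = _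
    rw [this]
    rfl
  cases φ with
  | P n up low =>
    have h1 := injective_of_nodup_map hu
    have h2 := injective_of_nodup_map hl
    simp only [comp, inc, ups, lows, Multiset.map_map]
    rw [hreal (contDiffOn_nablaBivec X.isOpen X.smooth_G X.smooth_P _ _ _),
      pd_of_covD X.G (nablaBivec X.G X.P n) h1 h2, hcons]
    simp only [RCLike.ofReal_add, RCLike.ofReal_sub, RCLike.ofReal_sum, smul_eq_mul,
      RCLike.ofReal_mul]
    rfl
  | R n up low =>
    have h1 := injective_of_nodup_map hu
    have h2 := injective_of_nodup_map hl
    simp only [comp, inc, ups, lows, Multiset.map_map]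
    rw [hreal (contDiffOn_nablaCurv X.isOpen X.smooth_G _ _ _),
      pd_of_covD X.G (nablaCurv X.G n) h1 h2]
    simp only [RCLike.ofReal_add, RCLike.ofReal_sub, RCLike.ofReal_sum, smul_eq_mul,
      RCLike.ofReal_mul]
    rw [← hcons]
    rfl
  | F l m low =>
    have h2 := injective_of_nodup_map hl
    simp only [comp, inc, ups, lows, Multiset.map_map]
    have := pd_of_covD (U := Fin 0) X.G (nablaFun X.G (X.f l) m) (up := id) Function.injective_id h2
      Fin.elim0 b i y
    simp only [Function.comp_id, Finset.univ_eq_empty, Finset.sum_empty, sub_zero,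
      RCLike.real_smul_eq_coe_mul] at this
    rw [this, hcons, Multiset.map_zero, Multiset.sum_zero, sub_zero]
    rfl
  | S l m low => exact hφ.elim

end Fac

/-- Products of factors. -/
abbrev Facs (β U L : Type) : Type := List (Fac β U L)

namespace Facs

variable {𝕜 : Type} [RCLike 𝕜] {β β' U U' L L' : Type}

def comp (X : LocalData 𝕜 β) (a : U → Fin X.d) (b : L → Fin X.d) (t : Facs β U L)
    (y : Model X.d) : 𝕜 := (t.map fun φ => φ.comp X a b y).prod

def ups (t : Facs β U L) : Multiset U := (t.map Fac.ups).sum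
def lows (t : Facs β U L) : Multiset L := (t.map Fac.lows).sum
def tags (t : Facs β U L) : Multiset β := (t.map Fac.tags).sum
def weight (t : Facs β U L) : ℕ := (t.map Fac.weight).sum
def NoS (t : Facs β U L) : Prop := ∀ φ ∈ t, φ.NoS

/-- Change of labels. -/
def relabel (p : U → U') (q : L → L') (t : Facs β U L) : Facs β U' L' := t.map (Fac.relabel p q)

/-- The terms of the covariant derivative of a product. -/
def incs : Facs β U L → List (Facs β U (Option L))
  | [] => []
  | φ :: t => (φ.inc :: relabel id some t) :: (incs t).map fun t' => φ.relabel id some :: t'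

lemma comp_cons (X : LocalData 𝕜 β) (a : U → Fin X.d) (b : L → Fin X.d) (φ : Fac β U L)
    (t : Facs β U L) (y : Model X.d) :
    comp X a b (φ :: t) y = φ.comp X a b y * comp X a b t y := by
  simp [comp]

lemma comp_append (X : LocalData 𝕜 β) (a : U → Fin X.d) (b : L → Fin X.d) (s t : Facs β U L)
    (y : Model X.d) : comp X a b (s ++ t) y = comp X a b s y * comp X a b t y := by
  simp [comp]

lemma comp_relabel (X : LocalData 𝕜 β) (p : U → U') (q : L → L') (a : U' → Fin X.d)
    (b : L' → Fin X.d) (t : Facs β U L) (y : Model X.d) :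
    comp X a b (relabel p q t) y = comp X (a ∘ p) (b ∘ q) t y := by
  simp only [comp, relabel, List.map_map]
  congr 1
  exact List.map_congr_left fun φ _ => congrFun (φ.comp_relabel X p q a b) y

lemma comp_congr (X : LocalData 𝕜 β) {a a' : U → Fin X.d} {b b' : L → Fin X.d} (t : Facs β U L)
    (ha : ∀ u ∈ ups t, a u = a' u) (hb : ∀ w ∈ lows t, b w = b' w) (y : Model X.d) :
    comp X a b t y = comp X a' b' t y := by
  induction t with
  | nil => rfl
  | cons φ t ih =>
    simp only [ups, lows, List.map_cons, List.sum_cons, Multiset.mem_add] at ha hb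
    rw [comp_cons, comp_cons, φ.comp_congr X (fun u hu => ha u (Or.inl hu))
      (fun w hw => hb w (Or.inl hw)), ih (fun u hu => ha u (Or.inr hu))
      (fun w hw => hb w (Or.inr hw))]

lemma contDiffOn_comp (X : LocalData 𝕜 β) (a : U → Fin X.d) (b : L → Fin X.d) (t : Facs β U L) :
    ContDiffOn ℝ ∞ (comp X a b t) X.U := by
  induction t with
  | nil => exact contDiffOn_const
  | cons φ t ih =>
    have : comp X a b (φ :: t) = fun y => φ.comp X a b y * comp X a b t y :=
      funext fun y => comp_cons X a b φ t y
    rw [this]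
    exact (φ.contDiffOn_comp X a b).mul ih

lemma ups_relabel (p : U → U') (q : L → L') (t : Facs β U L) :
    ups (relabel p q t) = (ups t).map p := by
  induction t with
  | nil => rfl
  | cons φ t ih =>
    change (φ.relabel p q).ups + ups (relabel p q t) = (φ.ups + ups t).map p
    rw [ih, φ.ups_relabel, Multiset.map_add]

lemma lows_relabel (p : U → U') (q : L → L') (t : Facs β U L) :
    lows (relabel p q t) = (lows t).map q := by
  induction t with
  | nil => rfl
  | cons φ t ih =>
    change (φ.relabel p q).lows + lows (relabel p q t) = (φ.lows + lows t).map q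
    rw [ih, φ.lows_relabel, Multiset.map_add]

lemma tags_relabel (p : U → U') (q : L → L') (t : Facs β U L) :
    tags (relabel p q t) = tags t := by
  simp only [tags, relabel, List.map_map]
  congr 1
  exact List.map_congr_left fun φ _ => φ.tags_relabel p q

lemma weight_relabel (p : U → U') (q : L → L') (t : Facs β U L) :
    weight (relabel p q t) = weight t := by
  simp only [weight, relabel, List.map_map]
  congr 1
  exact List.map_congr_left fun φ _ => φ.weight_relabel p q

lemma noS_relabel (p : U → U') (q : L → L') {t : Facs β U L} (h : NoS t) :
    NoS (relabel p q t) := by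
  intro φ hφ
  obtain ⟨ψ, hψ, rfl⟩ := List.mem_map.1 hφ
  exact Fac.noS_relabel p q (h ψ hψ)

lemma ups_append (s t : Facs β U L) : ups (s ++ t) = ups s + ups t := by simp [ups]
lemma lows_append (s t : Facs β U L) : lows (s ++ t) = lows s + lows t := by simp [lows]
lemma tags_append (s t : Facs β U L) : tags (s ++ t) = tags s + tags t := by simp [tags]
lemma weight_append (s t : Facs β U L) : weight (s ++ t) = weight s + weight t := by simp [weight]

/-- Everything needed later about a Leibniz term. The last clause is the one behind the no-loop
property: every factor keeps its upper labels and gains at most the fresh label `none` below, so no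
new contraction within a factor can appear. -/
lemma incs_spec (t : Facs β U L) : ∀ t' ∈ incs t, ups t' = ups t ∧
    lows t' = none ::ₘ (lows t).map some ∧ tags t' = tags t ∧ weight t' ≤ weight t + 1 ∧
    (NoS t → NoS t') ∧ ∀ ψ ∈ t', ∃ φ ∈ t, ψ.ups = φ.ups ∧ ∀ w, some w ∈ ψ.lows → w ∈ φ.lows := by
  induction t with
  | nil => simp [incs]
  | cons φ t ih =>
    have hrel : ∀ φ : Fac β U L, (φ.relabel id some).ups = φ.ups ∧
        ∀ w, some w ∈ (φ.relabel id some).lows → w ∈ φ.lows := by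
      intro φ
      rw [φ.ups_relabel, φ.lows_relabel]
      refine ⟨Multiset.map_id _, fun w hw => ?_⟩
      obtain ⟨w', h1, h2⟩ := Multiset.mem_map.1 hw
      rwa [← Option.some_inj.1 h2]
    intro t' ht'
    rw [incs, List.mem_cons] at ht'
    rcases ht' with rfl | ht'
    · refine ⟨?_, ?_, ?_, ?_, ?_, ?_⟩
      · change φ.inc.ups + ups (relabel id some t) = φ.ups + ups t
        rw [φ.ups_inc, ups_relabel, Multiset.map_id]
      · change φ.inc.lows + lows (relabel id some t) = none ::ₘ (φ.lows + lows t).map some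
        rw [φ.lows_inc, lows_relabel, Multiset.map_add, Multiset.cons_add]
      · change φ.inc.tags + tags (relabel id some t) = φ.tags + tags t
        rw [φ.tags_inc, tags_relabel]
      · change φ.inc.weight + weight (relabel id some t) ≤ φ.weight + weight t + 1
        rw [weight_relabel]
        have := φ.weight_inc
        omega
      · intro h ψ hψ
        rcases List.mem_cons.1 hψ with rfl | hψ
        · exact Fac.noS_inc (h φ (by simp))
        · exact noS_relabel id some (fun χ hχ => h χ (by simp [hχ])) ψ hψ
      · intro ψ hψ
        rcases List.mem_cons.1 hψ with rfl | hψ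
        · refine ⟨φ, by simp, φ.ups_inc, fun w hw => ?_⟩
          rw [φ.lows_inc, Multiset.mem_cons] at hw
          obtain ⟨w', h1, h2⟩ := Multiset.mem_map.1 (hw.resolve_left (by simp))
          rwa [← Option.some_inj.1 h2]
        · obtain ⟨χ, hχ, rfl⟩ := List.mem_map.1 hψ
          exact ⟨χ, by simp [hχ], hrel χ⟩
    · obtain ⟨s, hs, rfl⟩ := List.mem_map.1 ht'
      obtain ⟨h1, h2, h3, h4, h5, h6⟩ := ih s hs
      refine ⟨?_, ?_, ?_, ?_, ?_, ?_⟩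
      · change (φ.relabel id some).ups + ups s = φ.ups + ups t
        rw [h1, (hrel φ).1]
      · change (φ.relabel id some).lows + lows s = none ::ₘ (φ.lows + lows t).map some
        rw [h2, φ.lows_relabel, Multiset.map_add, Multiset.add_cons]
      · change (φ.relabel id some).tags + tags s = φ.tags + tags t
        rw [h3, φ.tags_relabel]
      · change (φ.relabel id some).weight + weight s ≤ φ.weight + weight t + 1
        rw [φ.weight_relabel]
        omega
      · intro h ψ hψ
        rcases List.mem_cons.1 hψ with rfl | hψ
        · exact Fac.noS_relabel id some (h φ (by simp))
        · exact h5 (fun χ hχ => h χ (by simp [hχ])) ψ hψ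
      · intro ψ hψ
        rcases List.mem_cons.1 hψ with rfl | hψ
        · exact ⟨φ, by simp, hrel φ⟩
        · obtain ⟨χ, hχ, hh⟩ := h6 ψ hψ
          exact ⟨χ, by simp [hχ], hh⟩

lemma sum_map_mul_right {A : Type} (s : Multiset A) (g h : A → 𝕜) (c : 𝕜)
    (hgh : ∀ x ∈ s, h x = g x * c) : (s.map h).sum = (s.map g).sum * c := by
  rw [← Multiset.sum_map_mul_right]
  exact congrArg _ (Multiset.map_congr rfl hgh)

/-- The Leibniz rule for a product of factors. -/
lemma pd_comp [DecidableEq U] [DecidableEq L] (X : LocalData 𝕜 β) {t : Facs β U L} (ht : NoS t)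
    (hu : (ups t).Nodup) (hl : (lows t).Nodup) (a : U → Fin X.d) (b : L → Fin X.d) (i : Fin X.d)
    {y : Model X.d} (hy : y ∈ X.U) :
    pd i (comp X a b t) y = ((incs t).map fun t' => comp X a (fun o => o.elim i b) t' y).sum -
      ((ups t).map fun u => ∑ m, (X.G (a u) i m y : 𝕜) *
        comp X (Function.update a u m) b t y).sum +
      ((lows t).map fun w => ∑ m, (X.G m i (b w) y : 𝕜) *
        comp X a (Function.update b w m) t y).sum := by
  induction t with
  | nil =>
    have : comp X a b ([] : Facs β U L) = fun _ => (1 : 𝕜) := rfl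
    rw [this]
    simp [incs, ups, lows, pd]
  | cons φ t ih =>
    have hupc : ups (φ :: t) = φ.ups + ups t := rfl
    have hlowc : lows (φ :: t) = φ.lows + lows t := rfl
    rw [hupc, Multiset.nodup_add] at hu
    rw [hlowc, Multiset.nodup_add] at hl
    have ihh := ih (fun χ hχ => ht χ (by simp [hχ])) hu.2.1 hl.2.1
    have hφ := φ.pd_comp X (ht φ (by simp)) hu.1 hl.1 a b i hy
    have hd1 : DifferentiableAt ℝ (φ.comp X a b) y :=
      ((φ.contDiffOn_comp X a b).contDiffAt (X.isOpen.mem_nhds hy)).differentiableAt (by simp)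
    have hd2 : DifferentiableAt ℝ (comp X a b t) y :=
      ((contDiffOn_comp X a b t).contDiffAt (X.isOpen.mem_nhds hy)).differentiableAt (by simp)
    have hprod : pd i (comp X a b (φ :: t)) y =
        pd i (φ.comp X a b) y * comp X a b t y + pd i (comp X a b t) y * φ.comp X a b y := by
      have : comp X a b (φ :: t) = fun y => φ.comp X a b y * comp X a b t y :=
        funext fun y => comp_cons X a b φ t y
      rw [this]
      change fderiv ℝ (φ.comp X a b * comp X a b t) y _ = _
      rw [(hd1.hasFDerivAt.mul hd2.hasFDerivAt).fderiv]
      simp only [add_apply, smul_apply, smul_eq_mul, pd]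
      ring
    rw [hprod, hφ, ihh, hupc, hlowc, Multiset.map_add, Multiset.map_add, Multiset.sum_add,
      Multiset.sum_add, incs, List.map_cons, List.sum_cons, List.map_map]
    -- No label is shared between the head and the tail on the same level, so a Christoffel
    -- correction at a label of one leaves the other unchanged.
    have upd_u : ∀ {s : Multiset U} {u : U}, u ∉ s → ∀ m, ∀ w ∈ s, Function.update a u m w = a w :=
      fun h m w hw => Function.update_of_ne (by rintro rfl; exact h hw) _ _
    have upd_l : ∀ {s : Multiset L} {u : L}, u ∉ s → ∀ m, ∀ w ∈ s, Function.update b u m w = b w :=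
      fun h m w hw => Function.update_of_ne (by rintro rfl; exact h hw) _ _
    have e1 := sum_map_mul_right φ.ups
      (fun u => ∑ m, (X.G (a u) i m y : 𝕜) * φ.comp X (Function.update a u m) b y)
      (fun u => ∑ m, (X.G (a u) i m y : 𝕜) * comp X (Function.update a u m) b (φ :: t) y)
      (comp X a b t y) fun u hu' => by
        rw [Finset.sum_mul]
        refine Finset.sum_congr rfl fun m _ => ?_
        rw [comp_cons, comp_congr X t (upd_u (Multiset.disjoint_left.1 hu.2.2 hu') m)
          (fun _ _ => rfl), mul_assoc]
    have e2 := sum_map_mul_right φ.lows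
      (fun u => ∑ m, (X.G m i (b u) y : 𝕜) * φ.comp X a (Function.update b u m) y)
      (fun u => ∑ m, (X.G m i (b u) y : 𝕜) * comp X a (Function.update b u m) (φ :: t) y)
      (comp X a b t y) fun u hu' => by
        rw [Finset.sum_mul]
        refine Finset.sum_congr rfl fun m _ => ?_
        rw [comp_cons, comp_congr X t (fun _ _ => rfl)
          (upd_l (Multiset.disjoint_left.1 hl.2.2 hu') m), mul_assoc]
    have e3 := sum_map_mul_right (ups t)
      (fun u => ∑ m, (X.G (a u) i m y : 𝕜) * comp X (Function.update a u m) b t y)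
      (fun u => ∑ m, (X.G (a u) i m y : 𝕜) * comp X (Function.update a u m) b (φ :: t) y)
      (φ.comp X a b y) fun u hu' => by
        rw [Finset.sum_mul]
        refine Finset.sum_congr rfl fun m _ => ?_
        rw [comp_cons, φ.comp_congr X (upd_u (Multiset.disjoint_right.1 hu.2.2 hu') m)
          (fun _ _ => rfl)]
        ring
    have e4 := sum_map_mul_right (lows t)
      (fun u => ∑ m, (X.G m i (b u) y : 𝕜) * comp X a (Function.update b u m) t y)
      (fun u => ∑ m, (X.G m i (b u) y : 𝕜) * comp X a (Function.update b u m) (φ :: t) y)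
      (φ.comp X a b y) fun u hu' => by
        rw [Finset.sum_mul]
        refine Finset.sum_congr rfl fun m _ => ?_
        rw [comp_cons, φ.comp_congr X (fun _ _ => rfl)
          (upd_l (Multiset.disjoint_right.1 hl.2.2 hu') m)]
        ring
    have e5 : ((incs t).map ((fun t' => comp X a (fun o => o.elim i b) t' y) ∘
        fun t' => φ.relabel id some :: t')).sum =
        ((incs t).map fun t' => comp X a (fun o => o.elim i b) t' y).sum * φ.comp X a b y := by
      rw [← List.sum_map_mul_right]
      refine congrArg _ (List.map_congr_left fun t' _ => ?_)
      rw [Function.comp_apply, comp_cons, φ.comp_relabel, mul_comm]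
      rfl
    have e6 : comp X a (fun o => o.elim i b) (φ.inc :: relabel id some t) y =
        φ.inc.comp X a (fun o => o.elim i b) y * comp X a b t y := by
      rw [comp_cons, comp_relabel]
      rfl
    rw [e1, e2, e3, e4, e5, e6]
    ring

end Facs

end Factors

/-! ### Contracted products without loops and their linear span. -/

section Graphs

/-- A product of factors in which each label of `V` occurs once as an upper and once as a lower
index, with `m` free lower indices, without contractions inside a factor. -/
structure Graph (β : Type) (m : ℕ) : Type 1 where
  V : Type
  [fintype : Fintype V]
  [decEq : DecidableEq V]
  facs : Facs β V (V ⊕ Fin m)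
  ups_eq : facs.ups = Finset.univ.val
  lows_eq : facs.lows = Finset.univ.val
  noLoop : ∀ φ ∈ facs, ∀ u ∈ φ.ups, Sum.inl u ∉ φ.lows

attribute [instance] Graph.fintype Graph.decEq

variable {𝕜 : Type} [RCLike 𝕜] {β : Type} {m : ℕ}

/-- Families of functions, indexed by `m` lower indices, that depend on local data. -/
abbrev Fam (𝕜 : Type) [RCLike 𝕜] (β : Type) (m : ℕ) : Type :=
  ∀ X : LocalData 𝕜 β, (Fin m → Fin X.d) → Model X.d → 𝕜

/-- The value of a graph. -/
def Graph.eval (Γ : Graph β m) : Fam 𝕜 β m := fun X J y =>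
  ∑ v : Γ.V → Fin X.d, Facs.comp X v (Sum.elim v J) Γ.facs y

/-- The families that are linear combinations of graphs with the property `p`. -/
def graphSpan (𝕜 : Type) [RCLike 𝕜] (p : Graph β m → Prop) : Submodule 𝕜 (Fam 𝕜 β m) where
  carrier := {F | ∃ F' ∈ Submodule.span 𝕜 {F | ∃ Γ, p Γ ∧ Graph.eval Γ = F},
    ∀ X J, ∀ y ∈ X.U, F X J y = F' X J y}
  zero_mem' := ⟨0, Submodule.zero_mem _, fun _ _ _ _ => rfl⟩
  add_mem' := by
    rintro F F' ⟨H, hH, h⟩ ⟨H', hH', h'⟩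
    exact ⟨H + H', Submodule.add_mem _ hH hH', fun X J y hy => by
      simp only [Pi.add_apply, h X J y hy, h' X J y hy]⟩
  smul_mem' := by
    rintro a F ⟨H, hH, h⟩
    exact ⟨a • H, Submodule.smul_mem _ a hH, fun X J y hy => by
      simp only [Pi.smul_apply, h X J y hy]⟩

lemma graphSpan_congr {p : Graph β m → Prop} {F F' : Fam 𝕜 β m} (hF : F ∈ graphSpan 𝕜 p)
    (h : ∀ X J, ∀ y ∈ X.U, F' X J y = F X J y) : F' ∈ graphSpan 𝕜 p := by
  obtain ⟨H, hH, h'⟩ := hF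
  exact ⟨H, hH, fun X J y hy => (h X J y hy).trans (h' X J y hy)⟩

lemma eval_mem_graphSpan {p : Graph β m → Prop} {Γ : Graph β m} (h : p Γ) :
    (Γ.eval : Fam 𝕜 β m) ∈ graphSpan 𝕜 p :=
  ⟨_, Submodule.subset_span ⟨Γ, h, rfl⟩, fun _ _ _ _ => rfl⟩

/-- To show that an operation maps linear combinations of graphs to a given submodule of families,
it suffices to look at graphs. -/
lemma graphSpan_map {m' : ℕ} {p : Graph β m → Prop} {W : Submodule 𝕜 (Fam 𝕜 β m')}
    (T : Fam 𝕜 β m →ₗ[𝕜] Fam 𝕜 β m') (hT : ∀ Γ, p Γ → T Γ.eval ∈ W)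
    (hW : ∀ F F', F ∈ W → (∀ X J, ∀ y ∈ X.U, F' X J y = F X J y) → F' ∈ W)
    (hloc : ∀ F F' : Fam 𝕜 β m, (∀ X J, ∀ y ∈ X.U, F X J y = F' X J y) →
      ∀ X J, ∀ y ∈ X.U, T F X J y = T F' X J y)
    {F : Fam 𝕜 β m} (hF : F ∈ graphSpan 𝕜 p) : T F ∈ W := by
  obtain ⟨F', hF', h⟩ := hF
  refine hW (T F') (T F) ?_ (hloc F F' h)
  have : Submodule.span 𝕜 {F | ∃ Γ, p Γ ∧ Graph.eval Γ = F} ≤ W.comap T := by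
    rw [Submodule.span_le]
    rintro _ ⟨Γ, hΓ, rfl⟩
    exact hT Γ hΓ
  exact this hF'

/-- Permutation of the free indices. -/
def Graph.perm (σ : Equiv.Perm (Fin m)) (Γ : Graph β m) : Graph β m where
  V := Γ.V
  facs := Γ.facs.relabel id (Sum.map id σ)
  ups_eq := by rw [Facs.ups_relabel, Multiset.map_id, Γ.ups_eq]
  lows_eq := by
    rw [Facs.lows_relabel, Γ.lows_eq]
    exact Multiset.map_univ_val_equiv ((Equiv.refl _).sumCongr σ)
  noLoop := by
    intro φ hφ u hu hl
    obtain ⟨ψ, hψ, rfl⟩ := List.mem_map.1 hφ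
    rw [ψ.ups_relabel, Multiset.map_id] at hu
    rw [ψ.lows_relabel] at hl
    obtain ⟨w, hw, h⟩ := Multiset.mem_map.1 hl
    rcases w with w | w
    · rw [Sum.map_inl, id, Sum.inl.injEq] at h
      exact Γ.noLoop ψ hψ u hu (h ▸ hw)
    · simp at h

lemma Graph.perm_eval (σ : Equiv.Perm (Fin m)) (Γ : Graph β m) :
    ((Γ.perm σ).eval : Fam 𝕜 β m) = fun X J y => Γ.eval X (J ∘ σ) y := by
  funext X J y
  refine Finset.sum_congr rfl fun v _ => ?_
  refine (Facs.comp_relabel X _ _ _ _ _ _).trans ?_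
  congr 1
  funext w
  rcases w with w | w <;> rfl

/-- The class of graphs without symmetrised derivatives, with given arguments and with bounded
weight. -/
structure Graph.IsPlain (τ : Multiset β) (N : ℕ) (Γ : Graph β m) : Prop where
  noS : Γ.facs.NoS
  tags : Γ.facs.tags = τ
  weight : Γ.facs.weight ≤ N

lemma Graph.IsPlain.perm {τ : Multiset β} {N : ℕ} {Γ : Graph β m} (h : Γ.IsPlain τ N)
    (σ : Equiv.Perm (Fin m)) : (Γ.perm σ).IsPlain τ N :=
  ⟨Facs.noS_relabel _ _ h.noS, (Facs.tags_relabel _ _ _).trans h.tags,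
    (Facs.weight_relabel _ _ _).trans_le h.weight⟩

lemma graphSpan_perm_of {p : Graph β m → Prop} (σ : Equiv.Perm (Fin m))
    (hp : ∀ Γ, p Γ → p (Γ.perm σ)) {F : Fam 𝕜 β m} (hF : F ∈ graphSpan 𝕜 p) :
    (fun X J y => F X (J ∘ σ) y : Fam 𝕜 β m) ∈ graphSpan 𝕜 p :=
  graphSpan_map (W := graphSpan 𝕜 p)
    { toFun := fun F X J y => F X (J ∘ σ) y
      map_add' := fun _ _ => rfl
      map_smul' := fun _ _ => rfl }
    (fun Γ hΓ => by
      change (fun X J y => Γ.eval X (J ∘ σ) y : Fam 𝕜 β m) ∈ _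
      rw [← Γ.perm_eval σ]
      exact eval_mem_graphSpan (hp Γ hΓ))
    (fun _ _ hF h => graphSpan_congr hF h) (fun _ _ h X J y hy => h X _ y hy) hF

lemma graphSpan_perm {τ : Multiset β} {N : ℕ} (σ : Equiv.Perm (Fin m)) {F : Fam 𝕜 β m}
    (hF : F ∈ graphSpan 𝕜 (Graph.IsPlain τ N)) :
    (fun X J y => F X (J ∘ σ) y : Fam 𝕜 β m) ∈ graphSpan 𝕜 (Graph.IsPlain τ N) :=
  graphSpan_perm_of σ (fun _ h => h.perm σ) hF

end Graphs

/-! ### Covariant derivatives of contracted products. -/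

section CovariantDerivative

variable {𝕜 : Type} [RCLike 𝕜] {β : Type} {m : ℕ}

lemma Graph.contDiffOn_eval (Γ : Graph β m) (X : LocalData 𝕜 β) (J : Fin m → Fin X.d) :
    ContDiffOn ℝ ∞ (Γ.eval X J) X.U := by
  unfold Graph.eval
  exact ContDiffOn.sum fun v _ => Facs.contDiffOn_comp X _ _ _

/-- The new label of a covariant derivative becomes the first free index. -/
def shiftLabel {V : Type} : Option (V ⊕ Fin m) ≃ V ⊕ Fin (m + 1) where
  toFun o := o.elim (Sum.inr 0) (Sum.map id Fin.succ)
  invFun := Sum.elim (fun v => some (Sum.inl v)) (Fin.cases none fun s => some (Sum.inr s))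
  left_inv o := by rcases o with _ | (v | s) <;> rfl
  right_inv w := by
    rcases w with v | s
    · rfl
    · refine Fin.cases rfl (fun s => rfl) s

/-- A term of the covariant derivative of a graph. -/
def Graph.inc (Γ : Graph β m) (t : Facs β Γ.V (Option (Γ.V ⊕ Fin m))) (ht : t ∈ Γ.facs.incs) :
    Graph β (m + 1) where
  V := Γ.V
  facs := t.relabel id shiftLabel
  ups_eq := by
    rw [Facs.ups_relabel, Multiset.map_id, (Facs.incs_spec _ _ ht).1, Γ.ups_eq]
  lows_eq := by
    rw [Facs.lows_relabel, (Facs.incs_spec _ _ ht).2.1, Γ.lows_eq]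
    exact Multiset.map_univ_val_equiv (shiftLabel (V := Γ.V) (m := m))
  noLoop := by
    intro φ hφ u hu hl
    obtain ⟨ψ, hψ, rfl⟩ := List.mem_map.1 hφ
    rw [ψ.ups_relabel, Multiset.map_id] at hu
    rw [ψ.lows_relabel] at hl
    obtain ⟨w, hw, h⟩ := Multiset.mem_map.1 hl
    obtain ⟨χ, hχ, h1, h2⟩ := (Facs.incs_spec _ _ ht).2.2.2.2.2 ψ hψ
    have hw' : w = some (Sum.inl u) := (shiftLabel (V := Γ.V) (m := m)).injective h
    rw [hw'] at hw
    exact Γ.noLoop χ hχ u (h1 ▸ hu) (h2 _ hw)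

lemma Graph.inc_isPlain {τ : Multiset β} {N : ℕ} {Γ : Graph β m} (h : Γ.IsPlain τ N)
    (t : Facs β Γ.V (Option (Γ.V ⊕ Fin m))) (ht : t ∈ Γ.facs.incs) :
    (Γ.inc t ht).IsPlain τ (N + 1) := by
  obtain ⟨-, -, h3, h4, h5, -⟩ := Facs.incs_spec _ _ ht
  have := h.weight
  refine ⟨Facs.noS_relabel _ _ (h5 h.noS), (Facs.tags_relabel _ _ _).trans (h3.trans h.tags), ?_⟩
  refine (Facs.weight_relabel _ _ _).trans_le ?_
  omega

lemma Graph.inc_eval (Γ : Graph β m) (t : Facs β Γ.V (Option (Γ.V ⊕ Fin m)))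
    (ht : t ∈ Γ.facs.incs) (X : LocalData 𝕜 β) (J : Fin (m + 1) → Fin X.d) (y : Model X.d) :
    (Γ.inc t ht).eval X J y = ∑ v : Γ.V → Fin X.d,
      Facs.comp X v (fun o => o.elim (J 0) (Sum.elim v (Fin.tail J))) t y := by
  refine Finset.sum_congr rfl fun v _ => ?_
  refine (Facs.comp_relabel X _ _ _ _ _ _).trans ?_
  congr 1
  funext w
  rcases w with _ | (w | w) <;> rfl

/-- The covariant derivative of a family. -/
def covFam (F : Fam 𝕜 β m) : Fam 𝕜 β (m + 1) := fun X J =>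
  covD X.G (fun _ : Fin 0 → Fin X.d => F X) Fin.elim0 J

lemma covFam_eq (F : Fam 𝕜 β m) (X : LocalData 𝕜 β) (J : Fin (m + 1) → Fin X.d) (y : Model X.d) :
    covFam F X J y = pd (J 0) (F X (Fin.tail J)) y -
      ∑ s : Fin m, ∑ n, (X.G n (J 0) (J s.succ) y : 𝕜) *
        F X (Function.update (Fin.tail J) s n) y := by
  simp [covFam, covD, RCLike.real_smul_eq_coe_mul]

/-- The covariant derivative of a graph is a sum of graphs. -/
lemma Graph.covFam_eval (Γ : Graph β m) (hS : Γ.facs.NoS) (X : LocalData 𝕜 β)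
    (J : Fin (m + 1) → Fin X.d) {y : Model X.d} (hy : y ∈ X.U) :
    covFam Γ.eval X J y = (Γ.facs.incs.map fun t => ∑ v : Γ.V → Fin X.d,
      Facs.comp X v (fun o => o.elim (J 0) (Sum.elim v (Fin.tail J))) t y).sum := by
  have hd : ∀ v : Γ.V → Fin X.d, DifferentiableAt ℝ
      (Facs.comp X v (Sum.elim v (Fin.tail J)) Γ.facs) y := fun v =>
    ((Facs.contDiffOn_comp X _ _ _).contDiffAt (X.isOpen.mem_nhds hy)).differentiableAt (by simp)
  have hpd : pd (J 0) (Γ.eval X (Fin.tail J)) y = ∑ v : Γ.V → Fin X.d,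
      pd (J 0) (Facs.comp X v (Sum.elim v (Fin.tail J)) Γ.facs) y := by
    have : (Γ.eval X (Fin.tail J) : Model X.d → 𝕜) = fun z => ∑ v : Γ.V → Fin X.d,
      Facs.comp X v (Sum.elim v (Fin.tail J)) Γ.facs z := rfl
    rw [this, pd, fderiv_fun_sum fun v _ => hd v]
    simp [pd]
  have hul : ∀ v : Γ.V → Fin X.d, pd (J 0) (Facs.comp X v (Sum.elim v (Fin.tail J)) Γ.facs) y =
      (Γ.facs.incs.map fun t =>
        Facs.comp X v (fun o => o.elim (J 0) (Sum.elim v (Fin.tail J))) t y).sum -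
      ∑ u, ∑ n, (X.G (v u) (J 0) n y : 𝕜) *
        Facs.comp X (Function.update v u n) (Sum.elim v (Fin.tail J)) Γ.facs y +
      (∑ u, ∑ n, (X.G n (J 0) (v u) y : 𝕜) *
        Facs.comp X v (Sum.elim (Function.update v u n) (Fin.tail J)) Γ.facs y +
      ∑ s : Fin m, ∑ n, (X.G n (J 0) (J s.succ) y : 𝕜) *
        Facs.comp X v (Sum.elim v (Function.update (Fin.tail J) s n)) Γ.facs y) := by
    intro v
    rw [Facs.pd_comp X hS (by rw [Γ.ups_eq]; exact Finset.univ.nodup)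
      (by rw [Γ.lows_eq]; exact Finset.univ.nodup) _ _ _ hy, Γ.ups_eq, Γ.lows_eq]
    congr 1
    refine (Fintype.sum_sum_type _).trans ?_
    simp only [Sum.elim_inl, Sum.elim_inr, Sum.update_elim_inl, Sum.update_elim_inr]
    rfl
  -- A contracted label is corrected once as an upper and once as a lower index; after renaming the
  -- summation index the two corrections are equal and have opposite signs. Only the corrections at
  -- free indices remain.
  have hcancel : ∀ u, ∑ v : Γ.V → Fin X.d, ∑ n, (X.G (v u) (J 0) n y : 𝕜) *
        Facs.comp X (Function.update v u n) (Sum.elim v (Fin.tail J)) Γ.facs y =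
      ∑ v : Γ.V → Fin X.d, ∑ n, (X.G n (J 0) (v u) y : 𝕜) *
        Facs.comp X v (Sum.elim (Function.update v u n) (Fin.tail J)) Γ.facs y := by
    intro u
    rw [← sum_sum_update u fun (v : Γ.V → Fin X.d) n => (X.G n (J 0) (v u) y : 𝕜) *
        Facs.comp X v (Sum.elim (Function.update v u n) (Fin.tail J)) Γ.facs y]
    refine Finset.sum_congr rfl fun v _ => Finset.sum_congr rfl fun n _ => ?_
    simp
  rw [covFam_eq, hpd, Finset.sum_congr rfl fun v _ => hul v, Finset.sum_add_distrib,
    Finset.sum_add_distrib, Finset.sum_sub_distrib]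
  have hfree : ∑ v : Γ.V → Fin X.d, ∑ s : Fin m, ∑ n, (X.G n (J 0) (J s.succ) y : 𝕜) *
        Facs.comp X v (Sum.elim v (Function.update (Fin.tail J) s n)) Γ.facs y =
      ∑ s : Fin m, ∑ n, (X.G n (J 0) (J s.succ) y : 𝕜) *
        Γ.eval X (Function.update (Fin.tail J) s n) y := by
    rw [Finset.sum_comm]
    refine Finset.sum_congr rfl fun s _ => ?_
    rw [Finset.sum_comm]
    refine Finset.sum_congr rfl fun n _ => ?_
    rw [Graph.eval, Finset.mul_sum]
  have hA : ∑ v : Γ.V → Fin X.d, ∑ u, ∑ n, (X.G (v u) (J 0) n y : 𝕜) *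
        Facs.comp X (Function.update v u n) (Sum.elim v (Fin.tail J)) Γ.facs y =
      ∑ v : Γ.V → Fin X.d, ∑ u, ∑ n, (X.G n (J 0) (v u) y : 𝕜) *
        Facs.comp X v (Sum.elim (Function.update v u n) (Fin.tail J)) Γ.facs y := by
    rw [Finset.sum_comm, Finset.sum_congr rfl fun u _ => hcancel u, Finset.sum_comm]
  rw [hA, hfree]
  have hlist : ∀ l : List (Facs β Γ.V (Option (Γ.V ⊕ Fin m))), ∑ v : Γ.V → Fin X.d,
      (l.map fun t =>
        Facs.comp X v (fun o => o.elim (J 0) (Sum.elim v (Fin.tail J))) t y).sum =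
      (l.map fun t => ∑ v : Γ.V → Fin X.d,
        Facs.comp X v (fun o => o.elim (J 0) (Sum.elim v (Fin.tail J))) t y).sum := by
    intro l
    induction l with
    | nil => simp
    | cons t l ih => simp [Finset.sum_add_distrib, ih]
  rw [hlist]
  ring

lemma covFam_congr {F F' : Fam 𝕜 β m} (h : ∀ X J, ∀ y ∈ X.U, F X J y = F' X J y)
    (X : LocalData 𝕜 β) (J : Fin (m + 1) → Fin X.d) {y : Model X.d} (hy : y ∈ X.U) :
    covFam F X J y = covFam F' X J y :=
  covD_congr X.isOpen (fun _ J _ hz => h X J _ hz) _ _ hy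

/-- The covariant derivative of a linear combination of graphs. -/
lemma covFam_mem_of {p : Graph β m → Prop} {q : Graph β (m + 1) → Prop}
    (hp : ∀ Γ, p Γ → Γ.facs.NoS) (hq : ∀ Γ, p Γ → ∀ t ht, q (Γ.inc t ht)) {F : Fam 𝕜 β m}
    (hF : F ∈ graphSpan 𝕜 p) : covFam F ∈ graphSpan 𝕜 q := by
  obtain ⟨F', hF', h⟩ := hF
  refine graphSpan_congr (F := covFam F') ?_ fun X J y hy => covFam_congr h X J hy
  -- Smoothness is carried through the induction, because the covariant derivative is additive only
  -- on differentiable families.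
  suffices H : (∀ X J, ContDiffOn ℝ ∞ (F' X J) X.U) ∧
      covFam F' ∈ graphSpan 𝕜 q from H.2
  clear h
  induction hF' using Submodule.span_induction with
  | mem F' hF' =>
    obtain ⟨Γ, hΓ, rfl⟩ := hF'
    refine ⟨fun X J => Γ.contDiffOn_eval X J, graphSpan_congr (F :=
      (Γ.facs.incs.attach.map fun t => (Γ.inc t.1 t.2).eval).sum) ?_ fun X J y hy => ?_⟩
    · refine list_sum_mem fun F hF => ?_
      obtain ⟨t, -, rfl⟩ := List.mem_map.1 hF
      exact eval_mem_graphSpan (hq Γ hΓ t.1 t.2)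
    · rw [Γ.covFam_eval (hp Γ hΓ) X J hy]
      have hap : ∀ l : List (Fam 𝕜 β (m + 1)), l.sum X J y = (l.map fun F => F X J y).sum := by
        intro l
        induction l with
        | nil => rfl
        | cons F l ih => simp [ih]
      rw [hap, List.map_map]
      simp only [Function.comp_def, Graph.inc_eval]
      exact congrArg List.sum (List.attach_map_val (l := Γ.facs.incs)
        (f := fun t : Facs β Γ.V (Option (Γ.V ⊕ Fin m)) => ∑ v : Γ.V → Fin X.d,
          (Facs.comp X v (fun o : Option (Γ.V ⊕ Fin m) =>
            o.elim (J 0) (Sum.elim v (Fin.tail J))) t y : 𝕜))).symm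
  | zero =>
    refine ⟨fun X J => contDiffOn_const, ?_⟩
    convert Submodule.zero_mem (graphSpan 𝕜 q) using 1
    funext X J y
    rw [covFam_eq]
    simp [pd]
  | add F F' _ _ hF hF' =>
    refine ⟨fun X J => (hF.1 X J).add (hF'.1 X J),
      graphSpan_congr (Submodule.add_mem _ hF.2 hF'.2) fun X J y hy => ?_⟩
    have hd : ∀ {F : Fam 𝕜 β m}, (∀ X J, ContDiffOn ℝ ∞ (F X J) X.U) → ∀ J,
        DifferentiableAt ℝ (F X J) y := fun h J =>
      ((h X J).contDiffAt (X.isOpen.mem_nhds hy)).differentiableAt (by simp)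
    simp only [Pi.add_apply, covFam_eq]
    have : pd (J 0) (F X (Fin.tail J) + F' X (Fin.tail J)) y =
        pd (J 0) (F X (Fin.tail J)) y + pd (J 0) (F' X (Fin.tail J)) y := by
      rw [pd, fderiv_add (hd hF.1 _) (hd hF'.1 _)]
      rfl
    simp only [this, mul_add, Finset.sum_add_distrib]
    ring
  | smul a F _ hF =>
    refine ⟨fun X J => (hF.1 X J).const_smul a,
      graphSpan_congr (Submodule.smul_mem _ a hF.2) fun X J y hy => ?_⟩
    have hd : ∀ J, DifferentiableAt ℝ (F X J) y := fun J =>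
      ((hF.1 X J).contDiffAt (X.isOpen.mem_nhds hy)).differentiableAt (by simp)
    simp only [Pi.smul_apply, covFam_eq]
    have : pd (J 0) (a • F X (Fin.tail J)) y = a • pd (J 0) (F X (Fin.tail J)) y := by
      rw [pd, fderiv_const_smul (hd _)]
      rfl
    simp only [this, smul_eq_mul, mul_sub, Finset.mul_sum]
    congr 1
    exact Finset.sum_congr rfl fun s _ => Finset.sum_congr rfl fun n _ => by ring

lemma covFam_mem {τ : Multiset β} {N : ℕ} {F : Fam 𝕜 β m}
    (hF : F ∈ graphSpan 𝕜 (Graph.IsPlain τ N)) :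
    covFam F ∈ graphSpan 𝕜 (Graph.IsPlain (m := m + 1) τ (N + 1)) :=
  covFam_mem_of (fun _ h => h.noS) (fun _ h t ht => Graph.inc_isPlain h t ht) hF

end CovariantDerivative

/-! ### The Ricci identity. -/

section Ricci

variable {𝕜 : Type} [RCLike 𝕜] {β : Type} {m : ℕ}

lemma contDiffOn_ofReal {d : ℕ} {U : Set (Model d)} {f : Model d → ℝ} (hf : ContDiffOn ℝ ∞ f U) :
    ContDiffOn ℝ ∞ (fun y => (f y : 𝕜)) U :=
  (RCLike.ofRealCLM (K := 𝕜)).contDiff.comp_contDiffOn hf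

lemma pd_ofReal {d : ℕ} {f : Model d → ℝ} {y : Model d} (hf : DifferentiableAt ℝ f y) (i : Fin d) :
    pd i (fun y => (f y : 𝕜)) y = ((pd i f y : ℝ) : 𝕜) := by
  change fderiv ℝ ((RCLike.ofRealCLM (K := 𝕜)) ∘ f) y _ = _
  rw [((RCLike.ofRealCLM (K := 𝕜)).hasFDerivAt.comp y hf.hasFDerivAt).fderiv]
  rfl

lemma pd_pd_comm {d : ℕ} {f : Model d → 𝕜} {y : Model d} (hf : ContDiffAt ℝ ∞ f y) (i j : Fin d) :
    pd i (pd j f) y = pd j (pd i f) y := by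
  have hd : DifferentiableAt ℝ (fderiv ℝ f) y :=
    (hf.fderiv_right (m := ∞) (by simp)).differentiableAt (by simp)
  have h : ∀ i j, pd i (pd j f) y =
      fderiv ℝ (fderiv ℝ f) y (EuclideanSpace.single i 1) (EuclideanSpace.single j 1) := by
    intro i j
    change fderiv ℝ (fun z => fderiv ℝ f z (EuclideanSpace.single j 1)) y _ = _
    rw [fderiv_clm_apply hd (differentiableAt_const _)]
    simp
  rw [h, h]
  exact hf.isSymmSndFDerivAt (by simpa using ENat.LEInfty.out) _ _

/-- The second covariant derivative, up to terms that are symmetric in the two new indices. -/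
lemma covFam_covFam (F : Fam 𝕜 β m) (X : LocalData 𝕜 β) (hF : ∀ K, ContDiffOn ℝ ∞ (F X K) X.U)
    (i j : Fin X.d) (K : Fin m → Fin X.d) {y : Model X.d} (hy : y ∈ X.U) :
    covFam (covFam F) X (Fin.cons i (Fin.cons j K)) y = (pd i (pd j (F X K)) y -
      ∑ n, (X.G n i j y : 𝕜) * covFam F X (Fin.cons n K) y -
      ∑ s, ∑ n, ((X.G n j (K s) y : 𝕜) * pd i (F X (Function.update K s n)) y +
        (X.G n i (K s) y : 𝕜) * pd j (F X (Function.update K s n)) y)) -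
      ∑ s, ∑ n, ((pd i (X.G n j (K s)) y : ℝ) : 𝕜) * F X (Function.update K s n) y +
      ∑ s, ∑ n, (X.G n i (K s) y : 𝕜) * ∑ s', ∑ n', (X.G n' j (Function.update K s n s') y : 𝕜) *
        F X (Function.update (Function.update K s n) s' n') y := by
  have hdF : ∀ K, DifferentiableAt ℝ (F X K) y := fun K =>
    ((hF K).contDiffAt (X.isOpen.mem_nhds hy)).differentiableAt (by simp)
  have hdp : DifferentiableAt ℝ (pd j (F X K)) y :=
    ((contDiffOn_pd X.isOpen (hF K) j).contDiffAt (X.isOpen.mem_nhds hy)).differentiableAt (by simp)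
  have hdGr : ∀ k i j, DifferentiableAt ℝ (X.G k i j) y := fun k i j =>
    ((X.smooth_G k i j).contDiffAt (X.isOpen.mem_nhds hy)).differentiableAt (by simp)
  have hdG : ∀ k i j, DifferentiableAt ℝ (fun z => (X.G k i j z : 𝕜)) y := fun k i j =>
    ((contDiffOn_ofReal (X.smooth_G k i j)).contDiffAt
      (X.isOpen.mem_nhds hy)).differentiableAt (by simp)
  have h1 : pd i (covFam F X (Fin.cons j K)) y = pd i (pd j (F X K)) y -
      ∑ s, ∑ n, (((pd i (X.G n j (K s)) y : ℝ) : 𝕜) * F X (Function.update K s n) y +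
        (X.G n j (K s) y : 𝕜) * pd i (F X (Function.update K s n)) y) := by
    have : covFam F X (Fin.cons j K) = fun z => pd j (F X K) z -
        ∑ s : Fin m, ∑ n, (X.G n j (K s) z : 𝕜) * F X (Function.update K s n) z := by
      funext z
      rw [covFam_eq]
      simp
    have hmul : ∀ s n, DifferentiableAt ℝ
        (fun z => (X.G n j (K s) z : 𝕜) * F X (Function.update K s n) z) y := fun s n =>
      (hdG _ _ _).mul (hdF _)
    rw [this, pd, fderiv_fun_sub hdp (DifferentiableAt.fun_sum fun s _ =>
      DifferentiableAt.fun_sum fun n _ => hmul s n),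
      fderiv_fun_sum fun s _ => DifferentiableAt.fun_sum fun n _ => hmul s n]
    simp only [sub_apply, sum_apply]
    congr 1
    refine Finset.sum_congr rfl fun s _ => ?_
    rw [fderiv_fun_sum fun n _ => hmul s n, sum_apply]
    refine Finset.sum_congr rfl fun n _ => ?_
    rw [fderiv_fun_mul (hdG n j (K s)) (hdF (Function.update K s n))]
    rw [← pd_ofReal (hdGr n j (K s)) i]
    simp only [add_apply, smul_apply, smul_eq_mul, pd]
    ring
  rw [covFam_eq, Fin.tail_cons, Fin.cons_zero, h1, Fin.sum_univ_succ]
  simp only [Fin.cons_succ, Fin.cons_zero, Fin.update_cons_zero, ← Fin.cons_update]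
  have h2 : ∀ s n, covFam F X (Fin.cons j (Function.update K s n)) y =
      pd j (F X (Function.update K s n)) y - ∑ s', ∑ n',
        (X.G n' j (Function.update K s n s') y : 𝕜) *
          F X (Function.update (Function.update K s n) s' n') y := by
    intro s n
    rw [covFam_eq]
    simp
  simp only [h2, mul_sub, Finset.sum_sub_distrib, Finset.sum_add_distrib]
  ring

/-- The Ricci identity. -/
lemma ricci (F : Fam 𝕜 β m) (X : LocalData 𝕜 β) (hF : ∀ K, ContDiffOn ℝ ∞ (F X K) X.U)
    (i j : Fin X.d) (K : Fin m → Fin X.d) {y : Model X.d} (hy : y ∈ X.U) :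
    covFam (covFam F) X (Fin.cons i (Fin.cons j K)) y -
      covFam (covFam F) X (Fin.cons j (Fin.cons i K)) y =
    - ∑ s, ∑ n, ((curvature X.G (fun _ => n) ![i, j, K s] y : ℝ) : 𝕜) *
      F X (Function.update K s n) y := by
  rw [covFam_covFam F X hF i j K hy, covFam_covFam F X hF j i K hy]
  have hpp : pd i (pd j (F X K)) y = pd j (pd i (F X K)) y :=
    pd_pd_comm ((hF K).contDiffAt (X.isOpen.mem_nhds hy)) i j
  -- The terms quadratic in the Christoffel symbols are split according to whether both hit the same
  -- slot. Different slots are symmetric in i, j after exchanging the sums; equal slots give the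
  -- quadratic part of the curvature.
  have hQ : ∀ i j, ∑ s, ∑ n, (X.G n i (K s) y : 𝕜) * ∑ s', ∑ n',
        (X.G n' j (Function.update K s n s') y : 𝕜) *
          F X (Function.update (Function.update K s n) s' n') y =
      ∑ s, ∑ s', (if s = s' then 0 else ∑ n, ∑ n', (X.G n i (K s) y : 𝕜) * (X.G n' j (K s') y : 𝕜) *
          F X (Function.update (Function.update K s n) s' n') y) +
      ∑ s, ∑ n', (∑ n, (X.G n i (K s) y : 𝕜) * (X.G n' j n y : 𝕜)) *
          F X (Function.update K s n') y := by
    intro i j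
    rw [← Finset.sum_add_distrib]
    refine Finset.sum_congr rfl fun s _ => ?_
    have : ∀ n, (X.G n i (K s) y : 𝕜) * ∑ s', ∑ n', (X.G n' j (Function.update K s n s') y : 𝕜) *
          F X (Function.update (Function.update K s n) s' n') y =
        ∑ s', ((if s = s' then 0 else ∑ n', (X.G n i (K s) y : 𝕜) * (X.G n' j (K s') y : 𝕜) *
          F X (Function.update (Function.update K s n) s' n') y) +
        if s = s' then ∑ n', (X.G n i (K s) y : 𝕜) * (X.G n' j n y : 𝕜) *
          F X (Function.update K s n') y else 0) := by
      intro n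
      rw [Finset.mul_sum]
      refine Finset.sum_congr rfl fun s' _ => ?_
      rw [Finset.mul_sum]
      by_cases h : s = s'
      · subst h
        simp only [if_true, Function.update_self, Function.update_idem, zero_add, mul_assoc]
      · rw [if_neg h, if_neg h, add_zero]
        refine Finset.sum_congr rfl fun n' _ => ?_
        rw [Function.update_of_ne (Ne.symm h), mul_assoc]
    rw [Finset.sum_congr rfl fun n _ => this n]
    simp only [Finset.sum_add_distrib, Finset.sum_ite_eq, Finset.mem_univ, if_true]
    congr 1
    · rw [Finset.sum_comm]
      refine Finset.sum_congr rfl fun s' _ => ?_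
      by_cases h : s = s'
      · simp [h]
      · simp [h]
    · rw [Finset.sum_comm]
      simp only [Finset.sum_mul]
  have hoff : ∑ s, ∑ s', (if s = s' then 0 else ∑ n, ∑ n', (X.G n i (K s) y : 𝕜) *
        (X.G n' j (K s') y : 𝕜) * F X (Function.update (Function.update K s n) s' n') y) =
      ∑ s, ∑ s', (if s = s' then 0 else ∑ n, ∑ n', (X.G n j (K s) y : 𝕜) *
        (X.G n' i (K s') y : 𝕜) * F X (Function.update (Function.update K s n) s' n') y) := by
    rw [Finset.sum_comm]
    refine Finset.sum_congr rfl fun s _ => Finset.sum_congr rfl fun s' _ => ?_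
    by_cases h : s = s'
    · simp [h]
    · rw [if_neg h, if_neg (Ne.symm h), Finset.sum_comm]
      refine Finset.sum_congr rfl fun n _ => Finset.sum_congr rfl fun n' _ => ?_
      rw [Function.update_comm (Ne.symm h)]
      ring
  have hcurv : ∑ s, ∑ n, ((curvature X.G (fun _ => n) ![i, j, K s] y : ℝ) : 𝕜) *
        F X (Function.update K s n) y =
      ∑ s, ∑ n, ((pd i (X.G n j (K s)) y : ℝ) : 𝕜) * F X (Function.update K s n) y -
      ∑ s, ∑ n, ((pd j (X.G n i (K s)) y : ℝ) : 𝕜) * F X (Function.update K s n) y +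
      (∑ s, ∑ n', (∑ n, (X.G n j (K s) y : 𝕜) * (X.G n' i n y : 𝕜)) *
          F X (Function.update K s n') y -
       ∑ s, ∑ n', (∑ n, (X.G n i (K s) y : 𝕜) * (X.G n' j n y : 𝕜)) *
          F X (Function.update K s n') y) := by
    simp only [← Finset.sum_sub_distrib, ← Finset.sum_add_distrib]
    refine Finset.sum_congr rfl fun s _ => Finset.sum_congr rfl fun n _ => ?_
    have hm : ∑ n', ((X.G n i n' y : 𝕜) * (X.G n' j (K s) y : 𝕜) -
        (X.G n j n' y : 𝕜) * (X.G n' i (K s) y : 𝕜)) =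
      ∑ n', (X.G n' j (K s) y : 𝕜) * (X.G n i n' y : 𝕜) -
        ∑ n', (X.G n' i (K s) y : 𝕜) * (X.G n j n' y : 𝕜) := by
      rw [← Finset.sum_sub_distrib]
      exact Finset.sum_congr rfl fun n' _ => by ring
    simp only [curvature, Matrix.cons_val_zero, Matrix.cons_val_one, Matrix.cons_val_two,
      Matrix.head_cons, Matrix.tail_cons, RCLike.ofReal_add, RCLike.ofReal_sub,
      RCLike.ofReal_sum, RCLike.ofReal_mul]
    rw [hm]
    ring
  -- The only place where vanishing torsion enters: otherwise a term with the torsion and a first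
  -- derivative would survive.
  have hsym : ∑ n, (X.G n i j y : 𝕜) * covFam F X (Fin.cons n K) y =
      ∑ n, (X.G n j i y : 𝕜) * covFam F X (Fin.cons n K) y :=
    Finset.sum_congr rfl fun n _ => by rw [X.symm_G y hy n i j]
  have hsw : ∑ s, ∑ n, ((X.G n j (K s) y : 𝕜) * pd i (F X (Function.update K s n)) y +
        (X.G n i (K s) y : 𝕜) * pd j (F X (Function.update K s n)) y) =
      ∑ s, ∑ n, ((X.G n i (K s) y : 𝕜) * pd j (F X (Function.update K s n)) y +
        (X.G n j (K s) y : 𝕜) * pd i (F X (Function.update K s n)) y) :=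
    Finset.sum_congr rfl fun s _ => Finset.sum_congr rfl fun n _ => add_comm _ _
  rw [hQ i j, hQ j i, hoff, hcurv, hsym, hsw, hpp]
  ring

end Ricci

/-! ### Symmetrised against iterated derivatives. -/

section Symmetrisation

variable {𝕜 : Type} [RCLike 𝕜] {β : Type} {m : ℕ}

lemma multiset_eq_univ {A : Type} [Fintype A] {s : Multiset A} (h : ∀ x, x ∈ s)
    (hc : Multiset.card s = Fintype.card A) : s = Finset.univ.val :=
  (Multiset.eq_of_le_of_card_le
    ((Multiset.le_iff_subset Finset.univ.nodup).2 fun x _ => h x) (by rw [hc]; rfl)).symm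

/-- The new derivative occupies the first slot, so a permutation of the old slots passes through it.
-/
lemma covFam_perm (F : Fam 𝕜 β m) (σ : Equiv.Perm (Fin m)) (X : LocalData 𝕜 β)
    (J : Fin (m + 1) → Fin X.d) (J' : Fin (m + 1) → Fin X.d) (h0 : J' 0 = J 0)
    (hs : ∀ s : Fin m, J' s.succ = J (σ s).succ) (y : Model X.d) :
    covFam (fun X K => F X (K ∘ σ)) X J y = covFam F X J' y := by
  have ht : Fin.tail J' = Fin.tail J ∘ σ := funext hs
  rw [covFam_eq, covFam_eq, h0, ht]
  congr 1
  rw [← Equiv.sum_comp σ]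
  refine Finset.sum_congr rfl fun s _ => Finset.sum_congr rfl fun n _ => ?_
  rw [hs, Function.update_comp_eq_of_injective _ σ.injective]

/-- The iterated covariant derivatives of the argument `l`. -/
def nabFam (𝕜 : Type) [RCLike 𝕜] {β : Type} (l : β) (n : ℕ) : Fam 𝕜 β n := fun X J =>
  nablaFun X.G (X.f l) n Fin.elim0 J

lemma covFam_nabFam (l : β) (n : ℕ) : covFam (nabFam 𝕜 l n) = nabFam 𝕜 l (n + 1) := by
  funext X J
  change covD X.G _ _ _ = covD X.G _ _ _
  congr 1
  funext I
  rw [Subsingleton.elim I Fin.elim0]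
  rfl

lemma contDiffOn_nabFam (l : β) (n : ℕ) (X : LocalData 𝕜 β) (J : Fin n → Fin X.d) :
    ContDiffOn ℝ ∞ (nabFam 𝕜 l n X J) X.U :=
  contDiffOn_nablaFun X.isOpen X.smooth_G (X.smooth_f l) _ _ _

/-- The factors of a term of the Ricci identity. -/
def ricciFacs (l : β) (n : ℕ) (s : Fin n) : Facs β (Fin 1) (Fin 1 ⊕ Fin (n + 2)) :=
  [Fac.R 0 (fun _ => 0) ![Sum.inr 0, Sum.inr 1, Sum.inr s.succ.succ],
    Fac.F l n (Function.update (fun s' => Sum.inr s'.succ.succ) s (Sum.inl 0))]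

/-- A term of the Ricci identity. -/
def ricciGraph (l : β) (n : ℕ) (s : Fin n) : Graph β (n + 2) where
  V := Fin 1
  facs := ricciFacs l n s
  ups_eq := rfl
  lows_eq := by
    refine multiset_eq_univ (fun w => ?_) ?_
    · simp only [ricciFacs, Facs.lows, Fac.lows, List.map_cons, List.map_nil, List.sum_cons,
        List.sum_nil, add_zero, Multiset.mem_add, Multiset.mem_map, Finset.mem_val,
        Finset.mem_univ, true_and]
      rcases w with w | w
      · exact Or.inr ⟨s, by rw [Function.update_self, Subsingleton.elim w 0]⟩
      · refine Fin.cases (Or.inl ⟨0, rfl⟩) (fun w => ?_) w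
        refine Fin.cases (Or.inl ⟨1, rfl⟩) (fun w => ?_) w
        by_cases h : w = s
        · exact Or.inl ⟨2, by rw [h]; rfl⟩
        · exact Or.inr ⟨w, Function.update_of_ne h _ _⟩
    · simp [ricciFacs, Facs.lows, Fac.lows]
      omega
  noLoop := by
    intro φ hφ u hu hl
    simp only [ricciFacs, List.mem_cons, List.not_mem_nil, or_false] at hφ
    rcases hφ with rfl | rfl
    · have hl' : Sum.inl u ∈ Finset.univ.val.map (![Sum.inr 0, Sum.inr 1, Sum.inr s.succ.succ] :
          Fin 3 → Fin 1 ⊕ Fin (n + 2)) := hl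
      obtain ⟨t, -, ht⟩ := Multiset.mem_map.1 hl'
      revert ht
      fin_cases t <;> simp
    · simp [Fac.ups] at hu

lemma ricciGraph_isPlain (l : β) (n : ℕ) (s : Fin n) :
    (ricciGraph l n s).IsPlain {l} (n + 2) where
  noS := by
    have : (ricciFacs l n s).NoS := by
      intro φ hφ
      simp only [ricciFacs, List.mem_cons, List.not_mem_nil, or_false] at hφ
      rcases hφ with rfl | rfl <;> trivial
    exact this
  tags := by simp [ricciGraph, ricciFacs, Facs.tags, Fac.tags]
  weight := by simp [ricciGraph, ricciFacs, Facs.weight, Fac.weight]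

lemma ricciGraph_eval (l : β) (n : ℕ) (s : Fin n) (X : LocalData 𝕜 β) (i j : Fin X.d)
    (K : Fin n → Fin X.d) (y : Model X.d) :
    (ricciGraph l n s).eval X (Fin.cons i (Fin.cons j K)) y =
      ∑ r, ((curvature X.G (fun _ => r) ![i, j, K s] y : ℝ) : 𝕜) *
        nabFam 𝕜 l n X (Function.update K s r) y := by
  refine Fintype.sum_equiv (Equiv.funUnique (Fin 1) (Fin X.d)) _ _ fun (v : Fin 1 → Fin X.d) => ?_
  have h1 : Sum.elim v (Fin.cons i (Fin.cons j K) : Fin (n + 2) → Fin X.d) ∘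
      (![Sum.inr 0, Sum.inr 1, Sum.inr s.succ.succ] : Fin 3 → Fin 1 ⊕ Fin (n + 2)) =
      ![i, j, K s] := by
    funext t
    fin_cases t <;> rfl
  have h2 : Sum.elim v (Fin.cons i (Fin.cons j K) : Fin (n + 2) → Fin X.d) ∘
      (Function.update (fun s' : Fin n => (Sum.inr s'.succ.succ : Fin 1 ⊕ Fin (n + 2))) s
        (Sum.inl 0)) = Function.update K s (v 0) := by
    rw [Function.comp_update]
    rfl
  have key : (Facs.comp X v (Sum.elim v (Fin.cons i (Fin.cons j K))) (ricciFacs l n s) y : 𝕜) =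
      ((curvature X.G (fun _ => v 0) (Sum.elim v (Fin.cons i (Fin.cons j K)) ∘
      (![Sum.inr 0, Sum.inr 1, Sum.inr s.succ.succ] : Fin 3 → Fin 1 ⊕ Fin (n + 2))) y : ℝ) : 𝕜) *
      nabFam 𝕜 l n X (Sum.elim v (Fin.cons i (Fin.cons j K) : Fin (n + 2) → Fin X.d) ∘
      (Function.update (fun s' : Fin n => (Sum.inr s'.succ.succ : Fin 1 ⊕ Fin (n + 2))) s
        (Sum.inl 0))) y := by
    rw [ricciFacs, Facs.comp_cons, Facs.comp_cons]
    simp only [Facs.comp, List.map_nil, List.prod_nil, mul_one]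
    rfl
  rw [h1, h2] at key
  exact key

lemma covFam_sub {F F' : Fam 𝕜 β m} (X : LocalData 𝕜 β) (hF : ∀ K, ContDiffOn ℝ ∞ (F X K) X.U)
    (hF' : ∀ K, ContDiffOn ℝ ∞ (F' X K) X.U) (J : Fin (m + 1) → Fin X.d) {y : Model X.d}
    (hy : y ∈ X.U) : covFam (F - F') X J y = covFam F X J y - covFam F' X J y := by
  have hd : ∀ {F : Fam 𝕜 β m}, (∀ J, ContDiffOn ℝ ∞ (F X J) X.U) → ∀ J,
      DifferentiableAt ℝ (F X J) y := fun h J =>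
    ((h J).contDiffAt (X.isOpen.mem_nhds hy)).differentiableAt (by simp)
  simp only [Pi.sub_apply, covFam_eq]
  have : pd (J 0) (F X (Fin.tail J) - F' X (Fin.tail J)) y =
      pd (J 0) (F X (Fin.tail J)) y - pd (J 0) (F' X (Fin.tail J)) y := by
    rw [pd, fderiv_sub (hd hF _) (hd hF' _)]
    rfl
  simp only [this, mul_sub, Finset.sum_sub_distrib]
  ring

/-- Covariant derivatives commute up to terms with fewer derivatives. -/
lemma nabFam_swap (l : β) (n : ℕ) : ∀ i : Fin n,
    ((fun X J => nabFam 𝕜 l (n + 1) X (J ∘ Equiv.swap i.castSucc i.succ)) - nabFam 𝕜 l (n + 1)) ∈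
      graphSpan 𝕜 (Graph.IsPlain (m := n + 1) {l} (n + 1)) := by
  induction n with
  | zero => exact fun i => i.elim0
  | succ n ih =>
    intro i
    refine Fin.cases ?_ (fun i => ?_) i
    -- Exchange of the two outermost derivatives: the Ricci identity trades two derivatives for one
    -- curvature factor, which is contracted with the function factor and not with itself.
    · refine graphSpan_congr (F := ∑ s, (ricciGraph l n s).eval) (Submodule.sum_mem _ fun s _ =>
        eval_mem_graphSpan (ricciGraph_isPlain l n s)) fun X J y hy => ?_
      have hJ : J = Fin.cons (J 0) (Fin.cons (J 1) (Fin.tail (Fin.tail J))) := by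
        funext t
        refine Fin.cases rfl (fun t => ?_) t
        exact Fin.cases rfl (fun t => rfl) t
      have hJ' : J ∘ Equiv.swap (0 : Fin (n + 1)).castSucc (0 : Fin (n + 1)).succ =
          Fin.cons (J 1) (Fin.cons (J 0) (Fin.tail (Fin.tail J))) := by
        funext t
        refine Fin.cases ?_ (fun t => ?_) t
        · simp
        · refine Fin.cases ?_ (fun t => ?_) t
          · simp
          · have h1 : t.succ.succ ≠ (0 : Fin (n + 1)).castSucc := by simp
            have h2 : t.succ.succ ≠ (0 : Fin (n + 1)).succ := by
              rw [Ne, Fin.succ_inj]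
              exact Fin.succ_ne_zero t
            rw [Function.comp_apply, Equiv.swap_apply_of_ne_of_ne h1 h2]
            rfl
      have key := ricci (nabFam 𝕜 l n) X (contDiffOn_nabFam l n X) (J 0) (J 1)
        (Fin.tail (Fin.tail J)) hy
      rw [covFam_nabFam, covFam_nabFam, ← hJ, ← hJ'] at key
      have hsum : (∑ s, (ricciGraph l n s).eval : Fam 𝕜 β (n + 2)) X J y =
          ∑ s, (ricciGraph l n s).eval X J y := by
        simp only [Finset.sum_apply]
      rw [hsum]
      conv_rhs => rw [hJ]
      simp only [ricciGraph_eval]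
      simp only [Pi.sub_apply]
      linear_combination -key
    -- An exchange further inside is the covariant derivative of the same statement with one
    -- derivative fewer; differentiation raises the weight by at most one.
    · refine graphSpan_congr (covFam_mem (ih i)) fun X J y hy => ?_
      rw [covFam_sub (F := fun X J => nabFam 𝕜 l (n + 1) X
          (J ∘ Equiv.swap i.castSucc i.succ)) X (fun K => contDiffOn_nabFam l (n + 1) X _)
        (contDiffOn_nabFam l (n + 1) X) J hy, covFam_nabFam,
        covFam_perm (nabFam 𝕜 l (n + 1)) _ X J
          (J ∘ Equiv.swap i.succ.castSucc i.succ.succ) ?_ ?_ y, covFam_nabFam]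
      · rfl
      · rw [Function.comp_apply, Equiv.swap_apply_of_ne_of_ne]
        · rw [Fin.castSucc_succ]
          exact (Fin.succ_ne_zero _).symm
        · exact (Fin.succ_ne_zero _).symm
      · intro s
        rw [Function.comp_apply]
        congr 1
        rw [Fin.castSucc_succ]
        have hinj := Fin.succ_injective (n + 1)
        exact (hinj.swap_apply i.castSucc i.succ s)

/-- Adjacent transpositions generate the permutations, and the difference for a product telescopes;
the class of correction terms is stable under permuting free indices. -/
lemma nabFam_perm (l : β) (n : ℕ) (σ : Equiv.Perm (Fin n)) :
    ((fun X J => nabFam 𝕜 l n X (J ∘ σ)) - nabFam 𝕜 l n) ∈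
      graphSpan 𝕜 (Graph.IsPlain (m := n) {l} n) := by
  rcases n with _ | n
  · rw [Subsingleton.elim σ 1]
    exact graphSpan_congr (Submodule.zero_mem _) fun X J y _ => sub_self _
  · have h : σ ∈ Submonoid.closure (Set.range fun i : Fin n => Equiv.swap i.castSucc i.succ) := by
      rw [Equiv.Perm.mclosure_swap_castSucc_succ]
      trivial
    induction h using Submonoid.closure_induction with
    | mem σ hσ =>
      obtain ⟨i, rfl⟩ := hσ
      exact nabFam_swap l n i
    | one => exact graphSpan_congr (Submodule.zero_mem _) fun X J y _ => sub_self _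
    | mul σ τ _ _ hσ hτ =>
      refine graphSpan_congr (Submodule.add_mem _ (graphSpan_perm σ hτ) hσ) fun X J y _ => ?_
      simp only [Pi.sub_apply, Pi.add_apply]
      rw [sub_add_sub_cancel]
      rfl

/-- The symmetrised covariant derivatives of the argument `l`. -/
def symFam (𝕜 : Type) [RCLike 𝕜] {β : Type} (l : β) (n : ℕ) : Fam 𝕜 β n := fun X J =>
  nablaSym X.G (X.f l) n J

/-- The symmetrised and the iterated covariant derivative agree up to terms with fewer
derivatives. -/
lemma nabFam_sub_symFam (l : β) (n : ℕ) :
    nabFam 𝕜 l n - symFam 𝕜 l n ∈ graphSpan 𝕜 (Graph.IsPlain (m := n) {l} n) := by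
  refine graphSpan_congr (Submodule.smul_mem _ (-((n.factorial : 𝕜)⁻¹))
    (Submodule.sum_mem _ (t := Finset.univ) fun σ _ => nabFam_perm (𝕜 := 𝕜) l n σ)) fun X J y _ => ?_
  simp only [Pi.smul_apply, Pi.sub_apply, Finset.sum_apply, symFam, nablaSym, smul_eq_mul]
  simp only [Finset.sum_sub_distrib, Finset.sum_const, Finset.card_univ, Fintype.card_perm,
    Fintype.card_fin, RCLike.real_smul_eq_coe_mul, nsmul_eq_mul, RCLike.ofReal_inv,
    RCLike.ofReal_natCast, nabFam]
  have : (n.factorial : 𝕜) ≠ 0 := by exact_mod_cast n.factorial_ne_zero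
  field_simp
  ring

end Symmetrisation

/-! ### Inserting families into contracted products. -/

section Glue

variable {𝕜 : Type} [RCLike 𝕜] {β : Type}

namespace Facs

variable {U L : Type}

lemma mem_ups {t : Facs β U L} {u : U} : u ∈ ups t ↔ ∃ φ ∈ t, u ∈ φ.ups := by
  induction t with
  | nil => simp [ups]
  | cons φ t ih =>
    have : ups (φ :: t) = φ.ups + ups t := rfl
    rw [this, Multiset.mem_add, ih]
    simp

lemma mem_lows {t : Facs β U L} {u : L} : u ∈ lows t ↔ ∃ φ ∈ t, u ∈ φ.lows := by
  induction t with
  | nil => simp [lows]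
  | cons φ t ih =>
    have : lows (φ :: t) = φ.lows + lows t := rfl
    rw [this, Multiset.mem_add, ih]
    simp

lemma ups_perm {t t' : Facs β U L} (h : t.Perm t') : ups t = ups t' := (h.map _).sum_eq
lemma lows_perm {t t' : Facs β U L} (h : t.Perm t') : lows t = lows t' := (h.map _).sum_eq
lemma tags_perm {t t' : Facs β U L} (h : t.Perm t') : tags t = tags t' := (h.map _).sum_eq
lemma weight_perm {t t' : Facs β U L} (h : t.Perm t') : weight t = weight t' := (h.map _).sum_eq

lemma comp_perm (X : LocalData 𝕜 β) (a : U → Fin X.d) (b : L → Fin X.d) {t t' : Facs β U L}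
    (h : t.Perm t') (y : Model X.d) : comp X a b t y = comp X a b t' y := (h.map _).prod_eq

/-- The number of symmetrised derivatives. -/
def numS : Facs β U L → ℕ
  | [] => 0
  | Fac.S _ _ _ :: t => numS t + 1
  | _ :: t => numS t

lemma numS_eq_zero {t : Facs β U L} : numS t = 0 ↔ NoS t := by
  induction t with
  | nil => simp [numS, NoS]
  | cons φ t ih =>
    have : NoS (φ :: t) ↔ φ.NoS ∧ NoS t := by simp [NoS]
    rw [this, ← ih]
    cases φ <;> simp [numS, Fac.NoS]

lemma numS_append (s t : Facs β U L) : numS (s ++ t) = numS s + numS t := by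
  induction s with
  | nil => simp [numS]
  | cons φ s ih => cases φ <;> (simp only [List.cons_append, numS, ih]; try omega)

lemma numS_relabel {U' L' : Type} (p : U → U') (q : L → L') (t : Facs β U L) :
    numS (relabel p q t) = numS t := by
  induction t with
  | nil => rfl
  | cons φ t ih =>
    have : relabel p q (φ :: t) = φ.relabel p q :: relabel p q t := rfl
    rw [this]
    cases φ <;> simp only [Fac.relabel, numS, ih]

lemma numS_perm {t t' : Facs β U L} (h : t.Perm t') : numS t = numS t' := by
  induction h with
  | nil => rfl
  | cons φ _ ih => cases φ <;> simp only [numS, ih]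
  | swap φ ψ _ => cases φ <;> cases ψ <;> rfl
  | trans _ _ h1 h2 => exact h1.trans h2

end Facs

/-- A product of factors with a hole, into which a family with `n` lower indices can be
inserted. -/
structure Context (β : Type) (n : ℕ) : Type 1 where
  V : Type
  [fintype : Fintype V]
  [decEq : DecidableEq V]
  facs : Facs β V (V ⊕ Fin 0)
  hole : Fin n → V ⊕ Fin 0
  ups_eq : facs.ups = Finset.univ.val
  lows_eq : facs.lows + Finset.univ.val.map hole = Finset.univ.val
  noLoop : ∀ φ ∈ facs, ∀ u ∈ φ.ups, Sum.inl u ∉ φ.lows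

attribute [instance] Context.fintype Context.decEq

variable {n : ℕ}

/-- Insertion of a family into a context. -/
def Context.plug (K : Context β n) : Fam 𝕜 β n →ₗ[𝕜] Fam 𝕜 β 0 where
  toFun F X J y := ∑ v : K.V → Fin X.d,
    Facs.comp X v (Sum.elim v J) K.facs y * F X (Sum.elim v J ∘ K.hole) y
  map_add' F F' := by
    funext X J y
    simp only [Pi.add_apply, mul_add, Finset.sum_add_distrib]
  map_smul' a F := by
    funext X J y
    simp only [Pi.smul_apply, smul_eq_mul, RingHom.id_apply, Finset.mul_sum]
    exact Finset.sum_congr rfl fun v _ => by ring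

/-- The factors of a context and of a graph that is inserted into it. -/
def Context.glueFacs (K : Context β n) (Δ : Graph β n) :
    Facs β (K.V ⊕ Δ.V) ((K.V ⊕ Δ.V) ⊕ Fin 0) :=
  K.facs.relabel Sum.inl (Sum.map Sum.inl id) ++
    Δ.facs.relabel Sum.inr (Sum.elim (Sum.inl ∘ Sum.inr) (Sum.map Sum.inl id ∘ K.hole))

lemma Context.tags_glueFacs (K : Context β n) (Δ : Graph β n) :
    (K.glueFacs Δ).tags = K.facs.tags + Δ.facs.tags := by
  rw [glueFacs, Facs.tags_append, Facs.tags_relabel, Facs.tags_relabel]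

lemma Context.weight_glueFacs (K : Context β n) (Δ : Graph β n) :
    (K.glueFacs Δ).weight = K.facs.weight + Δ.facs.weight := by
  rw [glueFacs, Facs.weight_append, Facs.weight_relabel, Facs.weight_relabel]

lemma Context.numS_glueFacs (K : Context β n) (Δ : Graph β n) :
    (K.glueFacs Δ).numS = K.facs.numS + Δ.facs.numS := by
  rw [glueFacs, Facs.numS_append, Facs.numS_relabel, Facs.numS_relabel]

lemma Context.comp_glueFacs (K : Context β n) (Δ : Graph β n) (X : LocalData 𝕜 β)
    (v : K.V ⊕ Δ.V → Fin X.d) (J : Fin 0 → Fin X.d) (y : Model X.d) :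
    (K.glueFacs Δ).comp X v (Sum.elim v J) y =
      K.facs.comp X (v ∘ Sum.inl) (Sum.elim (v ∘ Sum.inl) J) y *
        Δ.facs.comp X (v ∘ Sum.inr)
          (Sum.elim (v ∘ Sum.inr) (Sum.elim (v ∘ Sum.inl) J ∘ K.hole)) y := by
  rw [glueFacs, Facs.comp_append, Facs.comp_relabel, Facs.comp_relabel]
  congr 2
  · funext w
    rcases w with w | w
    · rfl
    · exact w.elim0
  · funext w
    rcases w with w | w
    · rfl
    · change Sum.elim v J (Sum.map Sum.inl id (K.hole w)) = Sum.elim _ J (K.hole w)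
      rcases K.hole w with w' | w'
      · rfl
      · exact w'.elim0

/-- Insertion of a graph into a context. -/
def Context.glue (K : Context β n) (Δ : Graph β n) : Graph β 0 where
  V := K.V ⊕ Δ.V
  facs := K.glueFacs Δ
  ups_eq := by
    rw [glueFacs, Facs.ups_append, Facs.ups_relabel, Facs.ups_relabel, K.ups_eq, Δ.ups_eq]
    refine multiset_eq_univ (fun w => ?_) (by simp)
    rcases w with w | w <;> simp
  lows_eq := by
    rw [glueFacs, Facs.lows_append, Facs.lows_relabel, Facs.lows_relabel, Δ.lows_eq]
    refine multiset_eq_univ (fun w => ?_) ?_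
    · rcases w with (w | w) | w
      · have h : Sum.inl w ∈ K.facs.lows + Finset.univ.val.map K.hole := by
          rw [K.lows_eq]
          exact Finset.mem_univ _
        rcases Multiset.mem_add.1 h with h | h
        · exact Multiset.mem_add.2 (Or.inl (Multiset.mem_map.2 ⟨_, h, rfl⟩))
        · obtain ⟨s, -, hs⟩ := Multiset.mem_map.1 h
          refine Multiset.mem_add.2 (Or.inr (Multiset.mem_map.2 ⟨Sum.inr s, by simp, ?_⟩))
          simp [hs]
      · exact Multiset.mem_add.2 (Or.inr (Multiset.mem_map.2 ⟨Sum.inl w, by simp, rfl⟩))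
      · exact w.elim0
    · have := congrArg Multiset.card K.lows_eq
      simp at this
      simp
      omega
  noLoop := by
    intro φ hφ u hu hl
    rcases List.mem_append.1 hφ with hφ | hφ
    · obtain ⟨ψ, hψ, rfl⟩ := List.mem_map.1 hφ
      rw [ψ.ups_relabel] at hu
      rw [ψ.lows_relabel] at hl
      obtain ⟨u', hu', rfl⟩ := Multiset.mem_map.1 hu
      obtain ⟨w, hw, h⟩ := Multiset.mem_map.1 hl
      rcases w with w | w
      · simp only [Sum.map_inl, Sum.inl.injEq] at h
        exact K.noLoop ψ hψ u' hu' (h ▸ hw)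
      · exact w.elim0
    · obtain ⟨ψ, hψ, rfl⟩ := List.mem_map.1 hφ
      rw [ψ.ups_relabel] at hu
      rw [ψ.lows_relabel] at hl
      obtain ⟨u', hu', rfl⟩ := Multiset.mem_map.1 hu
      obtain ⟨w, hw, h⟩ := Multiset.mem_map.1 hl
      rcases w with w | w
      · simp only [Sum.elim_inl, Function.comp_apply, Sum.inl.injEq, Sum.inr.injEq] at h
        exact Δ.noLoop ψ hψ u' hu' (h ▸ hw)
      -- A free index of the inserted graph receives a label of the context, whereas upper labels of
      -- inserted factors belong to the inserted graph. Insertion therefore contracts only different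
      -- factors.
      · simp only [Sum.elim_inr, Function.comp_apply] at h
        rcases hole : K.hole w with w' | w'
        · rw [hole] at h
          simp at h
        · exact w'.elim0

lemma Context.glue_eval (K : Context β n) (Δ : Graph β n) :
    ((K.glue Δ).eval : Fam 𝕜 β 0) = K.plug Δ.eval := by
  funext X J y
  refine (Fintype.sum_equiv (Equiv.sumArrowEquivProdArrow K.V Δ.V (Fin X.d)) _
    (fun p : (K.V → Fin X.d) × (Δ.V → Fin X.d) =>
      Facs.comp X p.1 (Sum.elim p.1 J) K.facs y *
        Facs.comp X p.2 (Sum.elim p.2 (Sum.elim p.1 J ∘ K.hole)) Δ.facs y) fun v =>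
      K.comp_glueFacs Δ X v J y).trans ?_
  rw [Fintype.sum_prod_type]
  refine Finset.sum_congr rfl fun v _ => ?_
  rw [Graph.eval, Finset.mul_sum]

/-- Insertion is linear and local, and on a graph it is again a graph by `glue_eval`. -/
lemma Context.plug_mem (K : Context β n) {p : Graph β n → Prop} {q : Graph β 0 → Prop}
    (h : ∀ Δ, p Δ → q (K.glue Δ)) {F : Fam 𝕜 β n} (hF : F ∈ graphSpan 𝕜 p) :
    K.plug F ∈ graphSpan 𝕜 q :=
  graphSpan_map K.plug (fun Δ hΔ => by
      rw [← K.glue_eval]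
      exact eval_mem_graphSpan (h Δ hΔ))
    (fun _ _ hF h => graphSpan_congr hF h)
    (fun _ _ h X J y hy => Finset.sum_congr rfl fun v _ => by rw [h X _ y hy]) hF

/-- A context, filled with a factor. -/
def Context.fill (K : Context β n) (φ : Fac β K.V (K.V ⊕ Fin 0)) (hu : φ.ups = 0)
    (hl : φ.lows = Finset.univ.val.map K.hole) : Graph β 0 where
  V := K.V
  facs := φ :: K.facs
  ups_eq := by
    change φ.ups + K.facs.ups = _
    rw [hu, zero_add, K.ups_eq]
  lows_eq := by
    change φ.lows + K.facs.lows = _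
    rw [hl, add_comm, K.lows_eq]
  noLoop := by
    intro ψ hψ u hu'
    rcases List.mem_cons.1 hψ with rfl | hψ
    · rw [hu] at hu'
      simp at hu'
    · exact K.noLoop ψ hψ u hu'

/-- The context that is obtained by removing a factor without upper indices. -/
def Graph.remove (Γ : Graph β 0) (φ : Fac β Γ.V (Γ.V ⊕ Fin 0)) (t : Facs β Γ.V (Γ.V ⊕ Fin 0))
    (h : Γ.facs.Perm (φ :: t)) (hu : φ.ups = 0) (hole : Fin n → Γ.V ⊕ Fin 0)
    (hl : φ.lows = Finset.univ.val.map hole) : Context β n where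
  V := Γ.V
  facs := t
  hole := hole
  ups_eq := by
    have : Facs.ups (φ :: t) = φ.ups + t.ups := rfl
    rw [← Γ.ups_eq, Facs.ups_perm h, this, hu, zero_add]
  lows_eq := by
    have : Facs.lows (φ :: t) = φ.lows + t.lows := rfl
    rw [← Γ.lows_eq, Facs.lows_perm h, this, hl, add_comm]
  noLoop := fun ψ hψ => Γ.noLoop ψ (h.symm.subset (List.mem_cons_of_mem _ hψ))

/-- Every closed graph is a linear combination of closed graphs without unsymmetrised
derivatives. -/
lemma closed_mem_of_weight {τ : Multiset β} : ∀ (N : ℕ) (Γ : Graph β 0), Γ.facs.tags = τ →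
    Γ.facs.weight = N →
    (Γ.eval : Fam 𝕜 β 0) ∈ graphSpan 𝕜 (fun Γ : Graph β 0 => Γ.facs.tags = τ ∧
      Γ.facs.weight = 0) := by
  intro N
  induction N using Nat.strong_induction_on with
  | _ N ih =>
    intro Γ hτ hN
    rcases Nat.eq_zero_or_pos N with h0 | hpos
    · exact eval_mem_graphSpan ⟨hτ, hN.trans h0⟩
    · have hex : ∃ φ ∈ Γ.facs, φ.weight ≠ 0 := by
        by_contra hcon
        push Not at hcon
        have : Γ.facs.weight = 0 := List.sum_eq_zero (by simpa using hcon)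
        omega
      obtain ⟨φ, hφ, hw⟩ := hex
      obtain ⟨s, t, hst⟩ := List.append_of_mem hφ
      have hperm : Γ.facs.Perm (φ :: (s ++ t)) := hst ▸ List.perm_middle
      rcases φ with _ | _ | ⟨l, n, low⟩ | _
      · exact absurd rfl hw
      · exact absurd rfl hw
      · set K : Context β n := Γ.remove _ (s ++ t) hperm rfl low rfl with hK
        have htags : ({l} : Multiset β) + K.facs.tags = τ := by
          rw [← hτ, Facs.tags_perm hperm]
          rfl
        have hweight : n + 1 + K.facs.weight = N := by
          rw [← hN, Facs.weight_perm hperm]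
          rfl
        set Γ' : Graph β 0 := K.fill (Fac.S l n low) rfl rfl with hΓ'
        have h1 : (Γ'.eval : Fam 𝕜 β 0) ∈ graphSpan 𝕜 (fun Γ : Graph β 0 => Γ.facs.tags = τ ∧
            Γ.facs.weight = 0) := by
          refine ih K.facs.weight (by omega) Γ' htags ?_
          change 0 + K.facs.weight = _
          rw [zero_add]
        -- The corrections have weight at most n, while the factor they replace has weight n+1. The
        -- total weight drops and the induction applies, even for n = 0.
        have h2 : K.plug (nabFam 𝕜 l n - symFam 𝕜 l n) ∈
            graphSpan 𝕜 (fun Γ : Graph β 0 => Γ.facs.tags = τ ∧ Γ.facs.weight = 0) := by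
          have := K.plug_mem (q := fun Γ => Γ.facs.tags = τ ∧ Γ.facs.weight < N) (fun Δ hΔ => ?_)
            (nabFam_sub_symFam (𝕜 := 𝕜) l n)
          · exact graphSpan_map LinearMap.id (fun Δ hΔ => ih _ hΔ.2 Δ hΔ.1 rfl)
              (fun _ _ hF h => graphSpan_congr hF h) (fun _ _ h => h) this
          · have e1 : (K.glue Δ).facs.tags = K.facs.tags + Δ.facs.tags := K.tags_glueFacs Δ
            have e2 : (K.glue Δ).facs.weight = K.facs.weight + Δ.facs.weight := K.weight_glueFacs Δ
            have := hΔ.weight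
            refine ⟨by rw [e1, hΔ.tags, add_comm, htags], by rw [e2]; omega⟩
        refine graphSpan_congr (Submodule.add_mem _ h1 h2) fun X J y _ => ?_
        have e1 : Γ.eval X J y = ∑ v : K.V → Fin X.d,
            nabFam 𝕜 l n X (Sum.elim v J ∘ low) y * Facs.comp X v (Sum.elim v J) K.facs y := by
          refine Finset.sum_congr rfl fun v _ => ?_
          rw [Facs.comp_perm X _ _ hperm, Facs.comp_cons]
          rfl
        have e2 : Γ'.eval X J y = ∑ v : K.V → Fin X.d,
            symFam 𝕜 l n X (Sum.elim v J ∘ low) y * Facs.comp X v (Sum.elim v J) K.facs y := by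
          refine Finset.sum_congr rfl fun v _ => ?_
          exact Facs.comp_cons X _ _ _ _ y
        have e3 : K.plug (nabFam 𝕜 l n - symFam 𝕜 l n) X J y = ∑ v : K.V → Fin X.d,
            Facs.comp X v (Sum.elim v J) K.facs y *
              (nabFam 𝕜 l n X (Sum.elim v J ∘ low) y - symFam 𝕜 l n X (Sum.elim v J ∘ low) y) :=
          rfl
        rw [Pi.add_apply, Pi.add_apply, Pi.add_apply, e1, e2, e3, ← Finset.sum_add_distrib]
        exact Finset.sum_congr rfl fun v _ => by ring
      · exact absurd rfl hw

/-- Every closed graph is a linear combination of closed graphs without symmetrised derivatives. -/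
lemma closed_mem_of_numS {τ : Multiset β} : ∀ (N : ℕ) (Γ : Graph β 0), Γ.facs.tags = τ →
    Γ.facs.numS = N →
    (Γ.eval : Fam 𝕜 β 0) ∈ graphSpan 𝕜 (fun Γ : Graph β 0 => Γ.facs.tags = τ ∧ Γ.facs.NoS) := by
  intro N
  induction N with
  | zero => exact fun Γ hτ hN => eval_mem_graphSpan ⟨hτ, Facs.numS_eq_zero.1 hN⟩
  | succ N ih =>
    intro Γ hτ hN
    have hex : ∃ φ ∈ Γ.facs, ¬ φ.NoS := by
      by_contra hcon
      push Not at hcon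
      have := Facs.numS_eq_zero.2 hcon
      omega
    obtain ⟨φ, hφ, hw⟩ := hex
    obtain ⟨s, t, hst⟩ := List.append_of_mem hφ
    have hperm : Γ.facs.Perm (φ :: (s ++ t)) := hst ▸ List.perm_middle
    rcases φ with _ | _ | _ | ⟨l, n, low⟩
    · exact absurd trivial hw
    · exact absurd trivial hw
    · exact absurd trivial hw
    · set K : Context β n := Γ.remove _ (s ++ t) hperm rfl low rfl with hK
      have htags : ({l} : Multiset β) + K.facs.tags = τ := by
        rw [← hτ, Facs.tags_perm hperm]
        rfl
      have hnum : K.facs.numS = N := by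
        have : Γ.facs.numS = K.facs.numS + 1 := Facs.numS_perm hperm
        omega
      set Γ' : Graph β 0 := K.fill (Fac.F l n low) rfl rfl with hΓ'
      have h1 : (Γ'.eval : Fam 𝕜 β 0) ∈ graphSpan 𝕜 (fun Γ : Graph β 0 => Γ.facs.tags = τ ∧
          Γ.facs.NoS) := ih Γ' htags hnum
      -- The corrections contain no symmetrised derivatives, so one fewer of these remains.
      have h2 : K.plug (nabFam 𝕜 l n - symFam 𝕜 l n) ∈
          graphSpan 𝕜 (fun Γ : Graph β 0 => Γ.facs.tags = τ ∧ Γ.facs.NoS) := by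
        have := K.plug_mem (q := fun Γ => Γ.facs.tags = τ ∧ Γ.facs.numS = N) (fun Δ hΔ => ?_)
          (nabFam_sub_symFam (𝕜 := 𝕜) l n)
        · exact graphSpan_map LinearMap.id (fun Δ hΔ => ih Δ hΔ.1 hΔ.2)
            (fun _ _ hF h => graphSpan_congr hF h) (fun _ _ h => h) this
        · have e1 : (K.glue Δ).facs.tags = K.facs.tags + Δ.facs.tags := K.tags_glueFacs Δ
          have e2 : (K.glue Δ).facs.numS = K.facs.numS + Δ.facs.numS := K.numS_glueFacs Δ
          have := Facs.numS_eq_zero.2 hΔ.noS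
          refine ⟨by rw [e1, hΔ.tags, add_comm, htags], by rw [e2]; omega⟩
      refine graphSpan_congr (Submodule.sub_mem _ h1 h2) fun X J y _ => ?_
      have e1 : Γ.eval X J y = ∑ v : K.V → Fin X.d,
          symFam 𝕜 l n X (Sum.elim v J ∘ low) y * Facs.comp X v (Sum.elim v J) K.facs y := by
        refine Finset.sum_congr rfl fun v _ => ?_
        rw [Facs.comp_perm X _ _ hperm, Facs.comp_cons]
        rfl
      have e2 : Γ'.eval X J y = ∑ v : K.V → Fin X.d,
          nabFam 𝕜 l n X (Sum.elim v J ∘ low) y * Facs.comp X v (Sum.elim v J) K.facs y := by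
        refine Finset.sum_congr rfl fun v _ => ?_
        exact Facs.comp_cons X _ _ _ _ y
      have e3 : K.plug (nabFam 𝕜 l n - symFam 𝕜 l n) X J y = ∑ v : K.V → Fin X.d,
          Facs.comp X v (Sum.elim v J) K.facs y *
            (nabFam 𝕜 l n X (Sum.elim v J ∘ low) y - symFam 𝕜 l n X (Sum.elim v J ∘ low) y) :=
        rfl
      rw [Pi.sub_apply, Pi.sub_apply, Pi.sub_apply, e1, e2, e3, ← Finset.sum_sub_distrib]
      exact Finset.sum_congr rfl fun v _ => by ring

end Glue

/-! ### Translation between monomials and closed graphs. -/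

section MonomialGraph

variable {𝕜 : Type} [RCLike 𝕜] {β : Type} {n numP numR k : ℕ}

/-- A factor `∇^a P` of a monomial. -/
def PFactor.toFac (β : Type) (p : PFactor n) : Fac β (Fin n) (Fin n) := Fac.P p.order p.up p.low

/-- A factor `∇^b R` of a monomial. -/
def RFactor.toFac (β : Type) (p : RFactor n) : Fac β (Fin n) (Fin n) :=
  Fac.R p.order (fun _ => p.up) p.low

lemma PFactor.mem_ups {p : PFactor n} {u : Fin n} : u ∈ (p.toFac β).ups ↔ ∃ s, p.up s = u := by
  simp [toFac, Fac.ups, eq_comm]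

lemma PFactor.mem_lows {p : PFactor n} {u : Fin n} : u ∈ (p.toFac β).lows ↔ ∃ s, p.low s = u := by
  simp [toFac, Fac.lows]

lemma RFactor.mem_ups {p : RFactor n} {u : Fin n} : u ∈ (p.toFac β).ups ↔ p.up = u := by
  simp [toFac, Fac.ups, eq_comm]

lemma RFactor.mem_lows {p : RFactor n} {u : Fin n} : u ∈ (p.toFac β).lows ↔ ∃ s, p.low s = u := by
  simp [toFac, Fac.lows]

lemma Fac.mem_lows_S {U L : Type} {l : β} {m : ℕ} {low : Fin m → L} {u : L} :
    u ∈ (Fac.S l m low : Fac β U L).lows ↔ ∃ s, low s = u := by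
  simp [Fac.lows]

/-- The factors of a monomial, with only the arguments in the list `s`. -/
def rawFacs (facP : Fin numP → PFactor n) (facR : Fin numR → RFactor n) (ord : Fin k → ℕ)
    (arg : (l : Fin k) → Fin (ord l) → Fin n) (ρ : Fin k → β) (s : List (Fin k)) :
    Facs β (Fin n) (Fin n) :=
  List.ofFn (fun i => (facP i).toFac β) ++ List.ofFn (fun j => (facR j).toFac β) ++
    s.map fun l => Fac.S (ρ l) (ord l) (arg l)

variable (facP : Fin numP → PFactor n) (facR : Fin numR → RFactor n) (ord : Fin k → ℕ)
    (arg : (l : Fin k) → Fin (ord l) → Fin n) (ρ : Fin k → β) (s : List (Fin k))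

lemma mem_rawFacs {φ : Fac β (Fin n) (Fin n)} : φ ∈ rawFacs facP facR ord arg ρ s ↔
    (∃ i, (facP i).toFac β = φ) ∨ (∃ j, (facR j).toFac β = φ) ∨
      ∃ l ∈ s, Fac.S (ρ l) (ord l) (arg l) = φ := by
  simp [rawFacs, List.mem_ofFn']

lemma mem_ups_rawFacs {u : Fin n} : u ∈ (rawFacs facP facR ord arg ρ s).ups ↔
    ∃ w, (Sum.elim (fun s : Fin numP × Fin 2 => (facP s.1).up s.2)
      (fun j : Fin numR => (facR j).up)) w = u := by
  rw [Facs.mem_ups]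
  constructor
  · rintro ⟨φ, hφ, hu⟩
    rcases (mem_rawFacs _ _ _ _ _ _).1 hφ with ⟨i, rfl⟩ | ⟨j, rfl⟩ | ⟨l, _, rfl⟩
    · obtain ⟨t, rfl⟩ := PFactor.mem_ups.1 hu
      exact ⟨Sum.inl (i, t), rfl⟩
    · exact ⟨Sum.inr j, RFactor.mem_ups.1 hu⟩
    · simp [Fac.ups] at hu
  · rintro ⟨⟨i, t⟩ | j, rfl⟩
    · exact ⟨_, (mem_rawFacs _ _ _ _ _ _).2 (Or.inl ⟨i, rfl⟩),
        PFactor.mem_ups.2 ⟨t, rfl⟩⟩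
    · exact ⟨_, (mem_rawFacs _ _ _ _ _ _).2 (Or.inr (Or.inl ⟨j, rfl⟩)),
        RFactor.mem_ups.2 rfl⟩

lemma mem_lows_rawFacs {u : Fin n} : u ∈ (rawFacs facP facR ord arg ρ (List.finRange k)).lows ↔
    ∃ w, (Sum.elim (fun s : (i : Fin numP) × Fin (facP i).order => (facP s.1).low s.2)
      (Sum.elim (fun s : (j : Fin numR) × Fin (3 + (facR j).order) => (facR s.1).low s.2)
        (fun s : (l : Fin k) × Fin (ord l) => arg s.1 s.2))) w = u := by
  rw [Facs.mem_lows]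
  constructor
  · rintro ⟨φ, hφ, hu⟩
    rcases (mem_rawFacs _ _ _ _ _ _).1 hφ with ⟨i, rfl⟩ | ⟨j, rfl⟩ | ⟨l, _, rfl⟩
    · obtain ⟨t, rfl⟩ := PFactor.mem_lows.1 hu
      exact ⟨Sum.inl ⟨i, t⟩, rfl⟩
    · obtain ⟨t, rfl⟩ := RFactor.mem_lows.1 hu
      exact ⟨Sum.inr (Sum.inl ⟨j, t⟩), rfl⟩
    · obtain ⟨t, rfl⟩ := Fac.mem_lows_S.1 hu
      exact ⟨Sum.inr (Sum.inr ⟨l, t⟩), rfl⟩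
  · rintro ⟨⟨i, t⟩ | ⟨j, t⟩ | ⟨l, t⟩, rfl⟩
    · exact ⟨_, (mem_rawFacs _ _ _ _ _ _).2 (Or.inl ⟨i, rfl⟩),
        PFactor.mem_lows.2 ⟨t, rfl⟩⟩
    · exact ⟨_, (mem_rawFacs _ _ _ _ _ _).2 (Or.inr (Or.inl ⟨j, rfl⟩)),
        RFactor.mem_lows.2 ⟨t, rfl⟩⟩
    · exact ⟨_, (mem_rawFacs _ _ _ _ _ _).2 (Or.inr (Or.inr ⟨l, List.mem_finRange l, rfl⟩)),
        Fac.mem_lows_S.2 ⟨t, rfl⟩⟩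

lemma sum_map_rawFacs {A : Type} [AddCommMonoid A] (g : Fac β (Fin n) (Fin n) → A) :
    ((rawFacs facP facR ord arg ρ (List.finRange k)).map g).sum =
      ∑ i, g ((facP i).toFac β) + ∑ j, g ((facR j).toFac β) +
        ∑ l, g (Fac.S (ρ l) (ord l) (arg l)) := by
  simp [rawFacs, List.map_ofFn, List.sum_ofFn, Fin.sum_univ_def, Function.comp_def, add_assoc]

lemma card_ups_rawFacs :
    Multiset.card (rawFacs facP facR ord arg ρ (List.finRange k)).ups =
      Fintype.card ((Fin numP × Fin 2) ⊕ Fin numR) := by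
  rw [Facs.ups, sum_map_rawFacs]
  simp [Fac.ups, PFactor.toFac, RFactor.toFac]

lemma card_lows_rawFacs :
    Multiset.card (rawFacs facP facR ord arg ρ (List.finRange k)).lows =
      Fintype.card (((i : Fin numP) × Fin (facP i).order) ⊕
        ((j : Fin numR) × Fin (3 + (facR j).order)) ⊕ ((l : Fin k) × Fin (ord l))) := by
  rw [Facs.lows, sum_map_rawFacs]
  simp [Fac.lows, PFactor.toFac, RFactor.toFac, add_assoc]

lemma comp_rawFacs (X : LocalData 𝕜 β) (v : Fin n → Fin X.d) (y : Model X.d) :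
    (rawFacs facP facR ord arg ρ s).comp X v v y =
      ((∏ i, nablaBivec X.G X.P (facP i).order (v ∘ (facP i).up) (v ∘ (facP i).low) y : ℝ) : 𝕜) *
      ((∏ j, nablaCurv X.G (facR j).order (fun _ => v (facR j).up) (v ∘ (facR j).low) y : ℝ) : 𝕜) *
      (s.map fun l => nablaSym X.G (X.f (ρ l)) (ord l) (v ∘ arg l) y).prod := by
  simp only [rawFacs, Facs.comp_append]
  congr 1
  · congr 1
    · simp only [Facs.comp, List.map_ofFn, List.prod_ofFn, Function.comp_apply, RCLike.ofReal_prod]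
      rfl
    · simp only [Facs.comp, List.map_ofFn, List.prod_ofFn, Function.comp_apply, RCLike.ofReal_prod]
      rfl
  · simp only [Facs.comp, List.map_map]
    rfl

lemma rawFacs_perm {l : Fin k} {s s' : List (Fin k)} (h : s'.Perm (l :: s)) :
    (rawFacs facP facR ord arg ρ s').Perm
      (Fac.S (ρ l) (ord l) (arg l) :: rawFacs facP facR ord arg ρ s) :=
  ((h.map _).append_left _).trans List.perm_middle

lemma tags_rawFacs : (rawFacs facP facR ord arg ρ s).tags = (s.map ρ : Multiset β) := by
  have h1 : ∀ {n : ℕ} (l : List (Fac β (Fin n) (Fin n))), (∀ φ ∈ l, φ.tags = 0) →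
      Facs.tags l = 0 := fun l h => List.sum_eq_zero (by simpa using h)
  have h2 : ∀ s : List (Fin k), Facs.tags (s.map fun l => Fac.S (U := Fin n) (ρ l) (ord l) (arg l)) =
      (s.map ρ : Multiset β) := by
    intro s
    induction s with
    | nil => rfl
    | cons l s ih =>
      change {ρ l} + Facs.tags (s.map fun l => Fac.S (U := Fin n) (ρ l) (ord l) (arg l)) = _
      rw [ih]
      rfl
  rw [rawFacs, Facs.tags_append, Facs.tags_append, h1 _, h1 _, h2, zero_add, zero_add]
  · intro φ hφ
    obtain ⟨j, rfl⟩ := (List.mem_ofFn' _ _).1 hφ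
    rfl
  · intro φ hφ
    obtain ⟨j, rfl⟩ := (List.mem_ofFn' _ _).1 hφ
    rfl

/-- The graph of a monomial of no-loop type. -/
def Monomial.toGraph (Γ : Monomial k) (hΓ : Γ.NoLoop) (ρ : Fin k → β) : Graph β 0 where
  V := Fin Γ.n
  facs := (rawFacs Γ.facP Γ.facR Γ.ord Γ.arg ρ (List.finRange k)).relabel id Sum.inl
  ups_eq := by
    rw [Facs.ups_relabel, Multiset.map_id]
    refine multiset_eq_univ (fun u => (mem_ups_rawFacs _ _ _ _ _ _).2 (Γ.upper_once.2 u)) ?_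
    rw [card_ups_rawFacs]
    exact Fintype.card_of_bijective Γ.upper_once
  lows_eq := by
    rw [Facs.lows_relabel]
    refine multiset_eq_univ (fun u => ?_) ?_
    · rcases u with u | u
      · exact Multiset.mem_map_of_mem _ ((mem_lows_rawFacs _ _ _ _ _).2 (Γ.lower_once.2 u))
      · exact u.elim0
    · rw [Multiset.card_map, card_lows_rawFacs, Fintype.card_of_bijective Γ.lower_once]
      simp
  noLoop := by
    intro φ hφ u hu hl
    obtain ⟨ψ, hψ, rfl⟩ := List.mem_map.1 hφ
    rw [ψ.ups_relabel, Multiset.map_id] at hu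
    rw [ψ.lows_relabel] at hl
    obtain ⟨w, hw, h⟩ := Multiset.mem_map.1 hl
    rw [Sum.inl.injEq] at h
    subst h
    rcases (mem_rawFacs _ _ _ _ _ _).1 hψ with ⟨i, rfl⟩ | ⟨j, rfl⟩ | ⟨l, _, rfl⟩
    · obtain ⟨s, hs⟩ := PFactor.mem_ups.1 hu
      obtain ⟨t, ht⟩ := PFactor.mem_lows.1 hw
      exact hΓ.1 i s t (hs.trans ht.symm)
    · obtain ⟨t, ht⟩ := RFactor.mem_lows.1 hw
      exact hΓ.2 j t ((RFactor.mem_ups.1 hu).trans ht.symm)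
    · simp [Fac.ups] at hu

lemma Monomial.toGraph_eval (Γ : Monomial k) (hΓ : Γ.NoLoop) (ρ : Fin k → β) (X : LocalData 𝕜 β)
    (J : Fin 0 → Fin X.d) (y : Model X.d) :
    (Γ.toGraph hΓ ρ).eval X J y = Γ.eval X.G X.P (X.f ∘ ρ) y := by
  refine Finset.sum_congr rfl fun v _ => ?_
  refine (Facs.comp_relabel X _ _ _ _ _ _).trans ?_
  refine (comp_rawFacs _ _ _ _ _ _ X v y).trans ?_
  rw [← Fin.prod_univ_def]
  rfl

lemma Monomial.toGraph_tags (Γ : Monomial k) (hΓ : Γ.NoLoop) (ρ : Fin k → β) :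
    (Γ.toGraph hΓ ρ).facs.tags = Finset.univ.val.map ρ :=
  (Facs.tags_relabel _ _ _).trans (tags_rawFacs _ _ _ _ _ _)

/-- The factors of a product without unsymmetrised derivatives, sorted by their kind. -/
lemma exists_sorted (t : Facs β (Fin n) (Fin n)) (ht : t.weight = 0) :
    ∃ (Ps : List (PFactor n)) (Rs : List (RFactor n)) (Ss : List (β × (m : ℕ) × (Fin m → Fin n))),
      t.Perm (Ps.map (PFactor.toFac β) ++ Rs.map (RFactor.toFac β) ++
        Ss.map fun s => Fac.S s.1 s.2.1 s.2.2) := by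
  induction t with
  | nil => exact ⟨[], [], [], List.Perm.refl _⟩
  | cons φ t ih =>
    have hw : φ.weight + Facs.weight t = 0 := ht
    obtain ⟨Ps, Rs, Ss, h⟩ := ih (by omega)
    rcases φ with ⟨a, up, low⟩ | ⟨b, up, low⟩ | ⟨l, m, low⟩ | ⟨l, m, low⟩
    · exact ⟨⟨a, up, low⟩ :: Ps, Rs, Ss, h.cons _⟩
    · refine ⟨Ps, ⟨b, up 0, low⟩ :: Rs, Ss, (h.cons _).trans ?_⟩
      have : (Fac.R b up low : Fac β (Fin n) (Fin n)) = RFactor.toFac β ⟨b, up 0, low⟩ := by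
        have hup : up = fun _ => up 0 := funext fun i => by rw [Subsingleton.elim i 0]
        rw [RFactor.toFac]
        conv_lhs => rw [hup]
      rw [this, List.map_cons, List.append_assoc, List.append_assoc]
      exact List.perm_middle.symm
    · simp [Fac.weight] at hw
    · exact ⟨Ps, Rs, ⟨l, m, low⟩ :: Ss, (h.cons _).trans List.perm_middle.symm⟩

/-- A closed graph without unsymmetrised derivatives, in which each argument occurs once, is the
graph of a monomial. -/
lemma exists_monomial (Δ : Graph (Fin k) 0) (hτ : Δ.facs.tags = Finset.univ.val)
    (hw : Δ.facs.weight = 0) :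
    ∃ Γ : Monomial k, Γ.NoLoop ∧ ∀ (X : LocalData 𝕜 (Fin k)) (J : Fin 0 → Fin X.d) (y : Model X.d),
      Δ.eval X J y = Γ.eval X.G X.P X.f y := by
  set e := Fintype.equivFin Δ.V with he
  set e' : Δ.V ⊕ Fin 0 ≃ Fin (Fintype.card Δ.V) := (Equiv.sumEmpty Δ.V (Fin 0)).trans e with he'
  set t := Δ.facs.relabel e e' with ht
  obtain ⟨Ps, Rs, Ss, hperm⟩ := exists_sorted t ((Facs.weight_relabel _ _ _).trans hw)
  -- Only the symmetrised derivatives carry arguments, since weight zero excludes the unsymmetrised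
  -- ones. Each argument thus labels exactly one of them.
  have htags : (Ss.map Prod.fst : Multiset (Fin k)) = Finset.univ.val := by
    have h1 : ∀ l : Facs (Fin k) (Fin (Fintype.card Δ.V)) (Fin (Fintype.card Δ.V)),
        (∀ φ ∈ l, φ.tags = 0) → Facs.tags l = 0 := fun l h => List.sum_eq_zero (by simpa using h)
    have h2 : ∀ Ss : List (Fin k × (m : ℕ) × (Fin m → Fin (Fintype.card Δ.V))),
        Facs.tags (Ss.map fun s => Fac.S (U := Fin (Fintype.card Δ.V)) s.1 s.2.1 s.2.2) =
          (Ss.map Prod.fst : Multiset (Fin k)) := by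
      intro s
      induction s with
      | nil => rfl
      | cons l s ih =>
        change {l.1} + Facs.tags
          (s.map fun s => Fac.S (U := Fin (Fintype.card Δ.V)) s.1 s.2.1 s.2.2) = _
        rw [ih]
        rfl
    rw [← hτ, ← Facs.tags_relabel e e' Δ.facs, ← ht, Facs.tags_perm hperm, Facs.tags_append,
      Facs.tags_append, h1 _, h1 _, h2, zero_add, zero_add]
    · intro φ hφ
      obtain ⟨j, -, rfl⟩ := List.mem_map.1 hφ
      rfl
    · intro φ hφ
      obtain ⟨j, -, rfl⟩ := List.mem_map.1 hφ
      rfl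
  have hex : ∀ l : Fin k, ∃ x, (l, x) ∈ Ss := by
    intro l
    have : l ∈ (Ss.map Prod.fst : Multiset (Fin k)) := by
      rw [htags]
      exact Finset.mem_univ l
    obtain ⟨⟨l', x⟩, hx, rfl⟩ := List.mem_map.1 (Multiset.mem_coe.1 this)
    exact ⟨x, hx⟩
  choose g hg using hex
  have hnd : (Ss.map Prod.fst).Nodup := by
    rw [← Multiset.coe_nodup, htags]
    exact Finset.univ.nodup
  have hSs : Ss.Perm ((List.finRange k).map fun l => (l, g l)) := by
    refine (List.perm_ext_iff_of_nodup (List.Nodup.of_map _ hnd)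
      ((List.nodup_finRange k).map fun a b h => (Prod.ext_iff.1 h).1)).2 fun ⟨l, x⟩ => ?_
    constructor
    · intro hx
      have : (l, x) = (l, g l) := List.inj_on_of_nodup_map hnd hx (hg l) rfl
      exact List.mem_map.2 ⟨l, List.mem_finRange l, this.symm⟩
    · intro hx
      obtain ⟨l', -, h⟩ := List.mem_map.1 hx
      rw [← h]
      exact hg l'
  have hraw : t.Perm (rawFacs Ps.get Rs.get (fun l => (g l).1) (fun l => (g l).2) id
      (List.finRange k)) := by
    refine hperm.trans ?_
    have hP : List.ofFn (fun i => (Ps.get i).toFac (Fin k)) = Ps.map (PFactor.toFac (Fin k)) := by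
      conv_rhs => rw [← List.ofFn_get Ps, List.map_ofFn]
      rfl
    have hR : List.ofFn (fun i => (Rs.get i).toFac (Fin k)) = Rs.map (RFactor.toFac (Fin k)) := by
      conv_rhs => rw [← List.ofFn_get Rs, List.map_ofFn]
      rfl
    rw [rawFacs, hP, hR]
    refine List.Perm.append_left _ ((hSs.map _).trans ?_)
    rw [List.map_map]
    exact List.Perm.refl _
  have hups : (rawFacs Ps.get Rs.get (fun l => (g l).1) (fun l => (g l).2) id
      (List.finRange k)).ups = Finset.univ.val := by
    rw [← Facs.ups_perm hraw, ht, Facs.ups_relabel, Δ.ups_eq]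
    exact Multiset.map_univ_val_equiv e
  have hlows : (rawFacs Ps.get Rs.get (fun l => (g l).1) (fun l => (g l).2) id
      (List.finRange k)).lows = Finset.univ.val := by
    rw [← Facs.lows_perm hraw, ht, Facs.lows_relabel, Δ.lows_eq]
    exact Multiset.map_univ_val_equiv e'
  -- Each label occurs, which gives surjectivity, and the number of occurrences equals the number of
  -- labels; between finite sets of equal size this is bijectivity.
  refine ⟨{ n := Fintype.card Δ.V
            numP := Ps.length
            facP := Ps.get
            numR := Rs.length
            facR := Rs.get
            ord := fun l => (g l).1
            arg := fun l => (g l).2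
            upper_once := (Fintype.bijective_iff_surjective_and_card _).2 ⟨fun u =>
              (mem_ups_rawFacs _ _ _ _ _ _).1 (by rw [hups]; exact Finset.mem_univ u), ?_⟩
            lower_once := (Fintype.bijective_iff_surjective_and_card _).2 ⟨fun u =>
              (mem_lows_rawFacs _ _ _ _ _).1 (by rw [hlows]; exact Finset.mem_univ u), ?_⟩ }, ⟨?_, ?_⟩, ?_⟩
  · have := congrArg Multiset.card hups
    rw [card_ups_rawFacs] at this
    exact this
  · have := congrArg Multiset.card hlows
    rw [card_lows_rawFacs] at this
    exact this
  all_goals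
    have hloop : ∀ φ ∈ rawFacs Ps.get Rs.get (fun l => (g l).1) (fun l => (g l).2) id
        (List.finRange k), ∀ u ∈ φ.ups, u ∉ φ.lows := by
      intro φ hφ u hu hl
      obtain ⟨ψ, hψ, rfl⟩ := List.mem_map.1 (hraw.symm.subset hφ)
      rw [ψ.ups_relabel] at hu
      rw [ψ.lows_relabel] at hl
      obtain ⟨u', hu', rfl⟩ := Multiset.mem_map.1 hu
      obtain ⟨w, hw, h⟩ := Multiset.mem_map.1 hl
      have : w = Sum.inl u' := e'.injective h
      exact Δ.noLoop ψ hψ u' hu' (this ▸ hw)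
  · intro i s t h
    refine hloop _ ((mem_rawFacs _ _ _ _ _ _).2 (Or.inl ⟨i, rfl⟩)) _
      (PFactor.mem_ups.2 ⟨s, rfl⟩) (PFactor.mem_lows.2 ⟨t, h.symm⟩)
  · intro j t h
    refine hloop _ ((mem_rawFacs _ _ _ _ _ _).2 (Or.inr (Or.inl ⟨j, rfl⟩))) _
      (RFactor.mem_ups.2 rfl) (RFactor.mem_lows.2 ⟨t, h.symm⟩)
  · intro X J y
    refine Fintype.sum_equiv (e.arrowCongr (Equiv.refl _)) _ _ fun v => ?_
    have h1 : Facs.comp X v (Sum.elim v J) Δ.facs y =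
        Facs.comp X (v ∘ e.symm) (v ∘ e.symm) t y := by
      rw [ht, Facs.comp_relabel]
      congr 1
      · funext u
        simp
      · funext u
        rcases u with u | u
        · simp [he']
        · exact u.elim0
    rw [h1, Facs.comp_perm X _ _ hraw, comp_rawFacs, ← Fin.prod_univ_def]
    rfl

end MonomialGraph

/-! ### Closure of no-loop operators under composition. -/

section Composition

variable {𝕜 : Type} [RCLike 𝕜] {β : Type} {k k' K : ℕ}

/-- The iterated covariant derivatives of a family without indices. -/
def iterFam (H : Fam 𝕜 β 0) (n : ℕ) : Fam 𝕜 β n := fun X J =>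
  nablaFun X.G (H X Fin.elim0) n Fin.elim0 J

/-- The absence of symmetrised derivatives is essential: the derivative of a symmetrised derivative
is not one of the available factors, so the Leibniz rule for products would fail. -/
lemma iterFam_mem {τ : Multiset β} {H : Fam 𝕜 β 0}
    (hH : H ∈ graphSpan 𝕜 (fun Γ : Graph β 0 => Γ.facs.tags = τ ∧ Γ.facs.NoS)) (n : ℕ) :
    iterFam H n ∈ graphSpan 𝕜 (fun Γ : Graph β n => Γ.facs.tags = τ ∧ Γ.facs.NoS) := by
  induction n with
  | zero => exact graphSpan_congr hH fun X J y _ => by rw [Subsingleton.elim J Fin.elim0]; rfl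
  | succ n ih =>
    have : covFam (iterFam H n) = iterFam H (n + 1) := by
      funext X J
      change covD X.G _ _ _ = covD X.G _ _ _
      congr 1
      funext I
      rw [Subsingleton.elim I Fin.elim0]
      rfl
    rw [← this]
    refine covFam_mem_of (fun _ h => h.2) (fun Γ hΓ t ht => ?_) ih
    obtain ⟨-, -, h3, -, h5, -⟩ := Facs.incs_spec _ _ ht
    exact ⟨(Facs.tags_relabel _ _ _).trans (h3.trans hΓ.1), Facs.noS_relabel _ _ (h5 hΓ.2)⟩

/-- The symmetrised covariant derivatives of a family without indices. -/
def symIterFam (H : Fam 𝕜 β 0) (n : ℕ) : Fam 𝕜 β n := fun X J =>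
  nablaSym X.G (H X Fin.elim0) n J

/-- The symmetrisation averages over permutations of the free indices, under which the class is
stable. -/
lemma symIterFam_mem {τ : Multiset β} {H : Fam 𝕜 β 0}
    (hH : H ∈ graphSpan 𝕜 (fun Γ : Graph β 0 => Γ.facs.tags = τ ∧ Γ.facs.NoS)) (n : ℕ) :
    symIterFam H n ∈ graphSpan 𝕜 (fun Γ : Graph β n => Γ.facs.tags = τ ∧ Γ.facs.NoS) := by
  have hperm : ∀ σ : Equiv.Perm (Fin n), (fun X J y => iterFam H n X (J ∘ σ) y : Fam 𝕜 β n) ∈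
      graphSpan 𝕜 (fun Γ : Graph β n => Γ.facs.tags = τ ∧ Γ.facs.NoS) := fun σ =>
    graphSpan_perm_of σ (fun Γ h => ⟨(Facs.tags_relabel _ _ _).trans h.1,
      Facs.noS_relabel _ _ h.2⟩) (iterFam_mem hH n)
  refine graphSpan_congr (Submodule.smul_mem _ ((n.factorial : 𝕜)⁻¹)
    (Submodule.sum_mem _ (t := Finset.univ) fun σ _ => hperm σ)) fun X J y _ => ?_
  simp only [symIterFam, nablaSym, Pi.smul_apply, Finset.sum_apply, smul_eq_mul,
    RCLike.real_smul_eq_coe_mul, RCLike.ofReal_inv, RCLike.ofReal_natCast]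
  rfl

/-- Insertion of a family for one of the arguments of a monomial. -/
lemma Monomial.insert_mem {τ : Multiset β} {H : Fam 𝕜 β 0}
    (hH : H ∈ graphSpan 𝕜 (fun Γ : Graph β 0 => Γ.facs.tags = τ ∧ Γ.facs.NoS)) (Γ : Monomial k)
    (hΓ : Γ.NoLoop) (l : Fin k) (ρ : Fin k → β) {s : List (Fin k)}
    (hs : (List.finRange k).Perm (l :: s)) :
    (fun X _ => Γ.eval X.G X.P (Function.update (X.f ∘ ρ) l (H X Fin.elim0)) : Fam 𝕜 β 0) ∈
      graphSpan 𝕜 (fun Γ : Graph β 0 => Γ.facs.tags = (s.map ρ : Multiset β) + τ ∧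
        Γ.facs.weight = 0) := by
  have hperm : (Γ.toGraph hΓ ρ).facs.Perm
      (Fac.S (ρ l) (Γ.ord l) (Sum.inl ∘ Γ.arg l) ::
        (rawFacs Γ.facP Γ.facR Γ.ord Γ.arg ρ s).relabel id Sum.inl) :=
    (rawFacs_perm Γ.facP Γ.facR Γ.ord Γ.arg ρ hs).map _
  -- Removing the factor of the l-th argument leaves a context with one slot for each of its
  -- derivatives.
  set C : Context β (Γ.ord l) := (Γ.toGraph hΓ ρ).remove _ _ hperm rfl (Sum.inl ∘ Γ.arg l) rfl
  have htags : C.facs.tags = (s.map ρ : Multiset β) :=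
    (Facs.tags_relabel _ _ _).trans (tags_rawFacs _ _ _ _ _ _)
  have h1 : C.plug (symIterFam H (Γ.ord l)) ∈ graphSpan 𝕜 (fun Γ : Graph β 0 =>
      Γ.facs.tags = (s.map ρ : Multiset β) + τ) :=
    C.plug_mem (fun Δ hΔ => (C.tags_glueFacs Δ).trans (by rw [htags, hΔ.1])) (symIterFam_mem hH _)
  -- The inserted derivatives are unsymmetrised; `closed_mem_of_weight` brings the result back to
  -- symmetrised ones, as required for monomials.
  refine graphSpan_congr (graphSpan_map LinearMap.id
    (fun Δ hΔ => closed_mem_of_weight _ Δ hΔ rfl) (fun _ _ hF h => graphSpan_congr hF h)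
    (fun _ _ h => h) h1) fun X J y _ => ?_
  refine Finset.sum_congr rfl fun v _ => ?_
  have e1 : Facs.comp X v (Sum.elim v J)
      ((rawFacs Γ.facP Γ.facR Γ.ord Γ.arg ρ s).relabel id Sum.inl) y = _ :=
    (Facs.comp_relabel X _ _ _ _ _ _).trans (comp_rawFacs _ _ _ _ _ _ X v y)
  have e2 : ∏ i, nablaSym X.G (Function.update (X.f ∘ ρ) l (H X Fin.elim0) i) (Γ.ord i)
        (v ∘ Γ.arg i) y =
      nablaSym X.G (H X Fin.elim0) (Γ.ord l) (v ∘ Γ.arg l) y *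
        (s.map fun i => nablaSym X.G (X.f (ρ i)) (Γ.ord i) (v ∘ Γ.arg i) y).prod := by
    rw [Fin.prod_univ_def, (hs.map _).prod_eq, List.map_cons, List.prod_cons, Function.update_self]
    have hnd : (l :: s).Nodup := hs.nodup_iff.1 (List.nodup_finRange k)
    congr 2
    refine List.map_congr_left fun i hi => ?_
    rw [Function.update_of_ne (by rintro rfl; exact (List.nodup_cons.1 hnd).1 hi)]
    rfl
  rw [e2]
  refine Eq.trans ?_ (congrArg (· * nablaSym X.G (H X Fin.elim0) (Γ.ord l) (v ∘ Γ.arg l) y) e1).symm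
  ring

/-- A linear combination of closed graphs in which each argument occurs once is a linear
combination of monomials. -/
lemma exists_evalComb {F : Fam 𝕜 (Fin K) 0} (hF : F ∈ graphSpan 𝕜 (fun Γ : Graph (Fin K) 0 =>
    Γ.facs.tags = Finset.univ.val ∧ Γ.facs.weight = 0)) :
    ∃ e ∈ combs 𝕜 (Monomial.NoLoop (k := K)), ∀ (X : LocalData 𝕜 (Fin K)) (J : Fin 0 → Fin X.d),
      ∀ y ∈ X.U, F X J y = e.sum fun Γ a => a * Γ.eval X.G X.P X.f y := by
  obtain ⟨F', hF', h⟩ := hF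
  suffices H : ∃ e ∈ combs 𝕜 (Monomial.NoLoop (k := K)), ∀ (X : LocalData 𝕜 (Fin K))
      (J : Fin 0 → Fin X.d) (y : Model X.d),
      F' X J y = e.sum fun Γ a => a * Γ.eval X.G X.P X.f y by
    obtain ⟨e, he, h'⟩ := H
    exact ⟨e, he, fun X J y hy => (h X J y hy).trans (h' X J y)⟩
  clear h
  induction hF' using Submodule.span_induction with
  | mem F' hF' =>
    obtain ⟨Δ, ⟨hτ, hw⟩, rfl⟩ := hF'
    obtain ⟨Γ, hΓ, h⟩ := exists_monomial (𝕜 := 𝕜) Δ hτ hw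
    refine ⟨Finsupp.single Γ 1, mem_combs.2 fun Γ' hΓ' => ?_, fun X J y => ?_⟩
    · rw [Finset.mem_singleton.1 (Finsupp.support_single_subset hΓ')]
      exact hΓ
    · rw [Finsupp.sum_single_index (by simp), one_mul, h X J y]
  | zero => exact ⟨0, Submodule.zero_mem _, fun X J y => by simp⟩
  | add F F' _ _ hF hF' =>
    obtain ⟨e, he, h⟩ := hF
    obtain ⟨e', he', h'⟩ := hF'
    refine ⟨e + e', Submodule.add_mem _ he he', fun X J y => ?_⟩
    rw [Finsupp.sum_add_index' (by simp) (by intros; ring), ← h, ← h']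
    rfl
  | smul a F _ hF =>
    obtain ⟨e, he, h⟩ := hF
    refine ⟨a • e, Submodule.smul_mem _ a he, fun X J y => ?_⟩
    rw [Finsupp.sum_smul_index (by simp)]
    simp only [mul_assoc]
    rw [← Finsupp.mul_sum, ← h]
    rfl

/-- The local data in a chart. -/
def chartData {M : Mfd.{u}} (D : Connection M) (P : PoissonTensor M) (f : β → Fun 𝕜 M)
    {c : OpenPartialHomeomorph M (Model M.dim)} (hc : c ∈ M.charts) : LocalData 𝕜 β where
  d := M.dim
  U := c.target
  G := D.christoffel c
  P := bivComp P.tensor c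
  f := fun l => inChart (f l) c
  isOpen := c.open_target
  smooth_G := contDiffOn_christoffel D hc
  smooth_P := P.smooth c hc
  smooth_f := fun l => contDiffOn_inChart (f l) hc
  symm_G := fun _ hy k i j => Connection.christoffel_symm D hc hy k i j

lemma Monomial.eval_congr {d : ℕ} (Γ : Monomial k) (G : Fin d → Fin d → Fin d → Model d → ℝ)
    (P : Fin d → Fin d → Model d → ℝ) {f f' : Fin k → Model d → 𝕜} {U : Set (Model d)}
    (hU : IsOpen U) (h : ∀ i, Set.EqOn (f i) (f' i) U) {y : Model d} (hy : y ∈ U) :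
    Γ.eval G P f y = Γ.eval G P f' y := by
  refine Finset.sum_congr rfl fun v _ => ?_
  congr 1
  exact Finset.prod_congr rfl fun i _ => nablaSym_congr hU (h i) _ _ hy

/-- The composition of universal operators of no-loop type is of no-loop type. -/
theorem MultiOp.IsNoLoop.comp {A : MultiOp.{u} 𝕜 k} {B : MultiOp.{u} 𝕜 k'} (hA : A.IsNoLoop)
    (hB : B.IsNoLoop) (l : Fin k) (ρ : Fin k → Fin K) (σ : Fin k' → Fin K)
    (h : (Finset.univ.erase l).val.map ρ + Finset.univ.val.map σ = Finset.univ.val) :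
    MultiOp.IsNoLoop fun M D P f =>
      A M D P (Function.update (f ∘ ρ) l (B M D P (f ∘ σ))) := by
  obtain ⟨e, he, hAe⟩ := hA
  obtain ⟨e', he', hBe⟩ := hB
  set H : Fam 𝕜 (Fin K) 0 := fun X _ y => e'.sum fun Δ a => a * Δ.eval X.G X.P (X.f ∘ σ) y with hHdef
  -- The inner operator is rewritten with unsymmetrised derivatives, in which form it can be
  -- differentiated.
  have hH : H ∈ graphSpan 𝕜 (fun Γ : Graph (Fin K) 0 =>
      Γ.facs.tags = Finset.univ.val.map σ ∧ Γ.facs.NoS) := by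
    refine graphSpan_congr (Submodule.sum_mem _ (t := e'.support.attach)
      (f := fun Δ => e' Δ.1 • (Δ.1.toGraph (he' Δ.1 Δ.2) σ).eval) fun Δ _ =>
      Submodule.smul_mem _ _ (closed_mem_of_numS _ _ (Δ.1.toGraph_tags _ σ) rfl)) fun X J y _ => ?_
    simp only [Finset.sum_apply, Pi.smul_apply, smul_eq_mul, Monomial.toGraph_eval, hHdef,
      Finsupp.sum]
    exact (Finset.sum_attach e'.support fun Δ => e' Δ * Δ.eval X.G X.P (X.f ∘ σ) y).symm
  set s := (List.finRange k).erase l with hs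
  have hperm : (List.finRange k).Perm (l :: s) := List.perm_cons_erase (List.mem_finRange l)
  have htag : (s.map ρ : Multiset (Fin K)) + Finset.univ.val.map σ = Finset.univ.val := by
    rw [← h, Finset.erase_val]
    rfl
  set F : Fam 𝕜 (Fin K) 0 := fun X _ y => e.sum fun Γ a =>
    a * Γ.eval X.G X.P (Function.update (X.f ∘ ρ) l (H X Fin.elim0)) y with hFdef
  have hF : F ∈ graphSpan 𝕜 (fun Γ : Graph (Fin K) 0 =>
      Γ.facs.tags = Finset.univ.val ∧ Γ.facs.weight = 0) := by
    rw [← htag]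
    refine graphSpan_congr (Submodule.sum_mem _ (t := e.support.attach)
      (f := fun Γ => e Γ.1 • (fun X _ => Γ.1.eval X.G X.P
        (Function.update (X.f ∘ ρ) l (H X Fin.elim0)))) fun Γ _ =>
      Submodule.smul_mem _ _ (Γ.1.insert_mem hH (he Γ.1 Γ.2) l ρ hperm)) fun X J y _ => ?_
    simp only [Finset.sum_apply, Pi.smul_apply, smul_eq_mul, hFdef, Finsupp.sum]
    exact (Finset.sum_attach e.support fun Γ => e Γ * Γ.eval X.G X.P
        (Function.update (X.f ∘ ρ) l (H X Fin.elim0)) y).symm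
  obtain ⟨e'', he'', hres⟩ := exists_evalComb hF
  refine ⟨e'', mem_combs.1 he'', fun M D P f c hc x hx => ?_⟩
  have hy := c.map_source hx
  refine Eq.trans ?_ (hres (chartData D P f hc) Fin.elim0 (c x) hy)
  rw [hAe M D P _ c hc x hx]
  refine Finsupp.sum_congr fun Γ _ => ?_
  congr 1
  -- The outer operator differentiates the inner one, so equality at the point alone would not do.
  -- The representation holds at every point of the chart, hence on an open set.
  refine Γ.eval_congr _ _ c.open_target (fun i => ?_) hy
  by_cases hi : i = l
  · subst hi
    simp only [Function.update_self]
    intro z hz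
    have := hBe M D P (f ∘ σ) c hc (c.symm z) (c.map_target hz)
    rw [c.right_inv hz] at this
    exact this
  · simp only [Function.update_of_ne hi]
    exact fun z _ => rfl

end Composition

/-! ### Operators on formal series and their exponentials. -/

section FormalOperators

variable {A : Type u} [CommRing A]

/-- An additive operator that commutes with `X` is determined by its values on constants. -/
lemma ext_of_comm_X {Φ Ψ : PowerSeries A →+ PowerSeries A}
    (hΦ : ∀ F, Φ (PowerSeries.X * F) = PowerSeries.X * Φ F)
    (hΨ : ∀ F, Ψ (PowerSeries.X * F) = PowerSeries.X * Ψ F)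
    (h : ∀ a, Φ (PowerSeries.C a) = Ψ (PowerSeries.C a)) (F : PowerSeries A) : Φ F = Ψ F := by
  suffices H : ∀ n F, PowerSeries.coeff n (Φ F) = PowerSeries.coeff n (Ψ F) from
    PowerSeries.ext fun n => H n F
  have hdec : ∀ F : PowerSeries A, ∃ F' a, F = PowerSeries.X * F' + PowerSeries.C a := fun F =>
    ⟨_, _, PowerSeries.eq_X_mul_shift_add_const F⟩
  intro n
  induction n with
  | zero =>
    intro F
    obtain ⟨F', a, rfl⟩ := hdec F
    simp only [map_add, hΦ, hΨ, h, PowerSeries.coeff_zero_X_mul]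
  | succ n ih =>
    intro F
    obtain ⟨F', a, rfl⟩ := hdec F
    simp only [map_add, hΦ, hΨ, h, PowerSeries.coeff_succ_X_mul, ih]

variable [Algebra ℝ A]

/-- An operator on formal series that commutes with `X` and whose values are divisible by `X^n`. -/
structure IsOrd (n : ℕ) (L : Module.End ℝ (PowerSeries A)) : Prop where
  comm : ∀ F, L (PowerSeries.X * F) = PowerSeries.X * L F
  dvd : ∀ F, PowerSeries.X ^ n ∣ L F

namespace IsOrd

variable {n n' : ℕ} {L L' : Module.End ℝ (PowerSeries A)}

lemma comm_pow (h : IsOrd n L) (j : ℕ) (F : PowerSeries A) :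
    L (PowerSeries.X ^ j * F) = PowerSeries.X ^ j * L F := by
  induction j with
  | zero => simp
  | succ j ih => rw [pow_succ', mul_assoc, h.comm, ih, mul_assoc]

lemma mono (h : IsOrd n L) (hn : n' ≤ n) : IsOrd n' L :=
  ⟨h.comm, fun F => (pow_dvd_pow _ hn).trans (h.dvd F)⟩

lemma dvd_add (h : IsOrd n L) {j : ℕ} {F : PowerSeries A} (hF : PowerSeries.X ^ j ∣ F) :
    PowerSeries.X ^ (n + j) ∣ L F := by
  obtain ⟨F', rfl⟩ := hF
  rw [h.comm_pow, add_comm, pow_add]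
  exact mul_dvd_mul_left _ (h.dvd F')

lemma add (h : IsOrd n L) (h' : IsOrd n L') : IsOrd n (L + L') :=
  ⟨fun F => by simp only [LinearMap.add_apply, h.comm, h'.comm, mul_add],
    fun F => _root_.dvd_add (h.dvd F) (h'.dvd F)⟩

lemma neg (h : IsOrd n L) : IsOrd n (-L) :=
  ⟨fun F => by simp only [LinearMap.neg_apply, h.comm, mul_neg], fun F => (h.dvd F).neg_right⟩

lemma sub (h : IsOrd n L) (h' : IsOrd n L') : IsOrd n (L - L') := by
  rw [sub_eq_add_neg]
  exact h.add h'.neg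

lemma smul (h : IsOrd n L) (a : ℝ) : IsOrd n (a • L) :=
  ⟨fun F => by simp only [LinearMap.smul_apply, h.comm, mul_smul_comm],
    fun F => PowerSeries.X_pow_dvd_iff.2 fun m hm => by
      rw [LinearMap.smul_apply, PowerSeries.coeff_smul, PowerSeries.X_pow_dvd_iff.1 (h.dvd F) m hm,
        smul_zero]⟩

lemma zero : IsOrd n (0 : Module.End ℝ (PowerSeries A)) :=
  ⟨fun F => by simp, fun F => by simp⟩

lemma one : IsOrd 0 (1 : Module.End ℝ (PowerSeries A)) := ⟨fun F => by simp, fun F => by simp⟩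

lemma mul (h : IsOrd n L) (h' : IsOrd n' L') : IsOrd (n + n') (L * L') :=
  ⟨fun F => by simp only [Module.End.mul_apply, h.comm, h'.comm], fun F => h.dvd_add (h'.dvd F)⟩

lemma pow (h : IsOrd n L) (m : ℕ) : IsOrd (m * n) (L ^ m) := by
  induction m with
  | zero => simpa using one
  | succ m ih =>
    rw [pow_succ, Nat.succ_mul]
    exact ih.mul h

lemma sum {ι : Type*} (s : Finset ι) {f : ι → Module.End ℝ (PowerSeries A)}
    (h : ∀ i ∈ s, IsOrd n (f i)) : IsOrd n (∑ i ∈ s, f i) := by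
  classical
  induction s using Finset.induction_on with
  | empty => simpa using zero
  | insert i s hi ih =>
    rw [Finset.sum_insert hi]
    exact (h i (Finset.mem_insert_self i s)).add
      (ih fun j hj => h j (Finset.mem_insert_of_mem hj))

lemma coeff_eq_zero (h : IsOrd n L) {i : ℕ} (hi : i < n) (F : PowerSeries A) :
    PowerSeries.coeff i (L F) = 0 := PowerSeries.X_pow_dvd_iff.1 (h.dvd F) i hi

lemma eq_zero (h : ∀ n, IsOrd n L) : L = 0 := by
  ext F n
  exact (h (n + 1)).coeff_eq_zero (Nat.lt_succ_self n) F

end IsOrd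

/-- The operator `∑ r, ν^r e_r`. -/
def opLin (e : ℕ → Module.End ℝ A) : Module.End ℝ (PowerSeries A) where
  toFun F := PowerSeries.mk fun n => ∑ p ∈ Finset.HasAntidiagonal.antidiagonal n,
    e p.1 (PowerSeries.coeff p.2 F)
  map_add' F G := by
    ext n
    simp [Finset.sum_add_distrib]
  map_smul' a F := by
    ext n
    simp [Finset.smul_sum]

lemma coeff_opLin (e : ℕ → Module.End ℝ A) (F : PowerSeries A) (n : ℕ) :
    PowerSeries.coeff n (opLin e F) = ∑ p ∈ Finset.HasAntidiagonal.antidiagonal n,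
      e p.1 (PowerSeries.coeff p.2 F) := by
  simp [opLin]

lemma coeff_opLin_C (e : ℕ → Module.End ℝ A) (f : A) (n : ℕ) :
    PowerSeries.coeff n (opLin e (PowerSeries.C f)) = e n f := by
  rw [coeff_opLin]
  cases n with
  | zero => simp
  | succ n =>
    rw [Finset.Nat.sum_antidiagonal_succ']
    simp [PowerSeries.coeff_C]

lemma opLin_isOrd {e : ℕ → Module.End ℝ A} {n : ℕ} (h : ∀ r < n, e r = 0) :
    IsOrd n (opLin e) := by
  refine ⟨fun F => ?_, fun F => PowerSeries.X_pow_dvd_iff.2 fun m hm => ?_⟩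
  · ext m
    cases m with
    | zero => simp [coeff_opLin]
    | succ m =>
      rw [PowerSeries.coeff_succ_X_mul, coeff_opLin, Finset.Nat.sum_antidiagonal_succ', coeff_opLin]
      simp [PowerSeries.coeff_succ_X_mul]
  · rw [coeff_opLin]
    refine Finset.sum_eq_zero fun p hp => ?_
    rw [h p.1 (by have := Finset.HasAntidiagonal.mem_antidiagonal.1 hp; omega)]
    rfl

lemma opLin_add (e e' : ℕ → Module.End ℝ A) :
    opLin (fun r => e r + e' r) = opLin e + opLin e' := by
  ext F n
  simp [coeff_opLin, Finset.sum_add_distrib]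

lemma opLin_neg (e : ℕ → Module.End ℝ A) : opLin (fun r => - e r) = - opLin e := by
  ext F n
  simp [coeff_opLin]

/-- The partial sums of the exponential series. -/
def pexp (N : ℕ) (L : Module.End ℝ (PowerSeries A)) : Module.End ℝ (PowerSeries A) :=
  ∑ m ∈ Finset.range (N + 1), ((m.factorial : ℝ)⁻¹) • L ^ m

/-- The exponential of an operator of positive order. -/
def expEnd (L : Module.End ℝ (PowerSeries A)) : Module.End ℝ (PowerSeries A) where
  toFun F := PowerSeries.mk fun n => PowerSeries.coeff n (pexp n L F)
  map_add' F G := by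
    ext n
    simp
  map_smul' a F := by
    ext n
    simp

/-- The power L^m is divisible by X^m, so the terms with m > n do not reach the coefficient of X^n.
-/
lemma coeff_expEnd {L : Module.End ℝ (PowerSeries A)} (hL : IsOrd 1 L) {n N : ℕ} (h : n ≤ N)
    (F : PowerSeries A) : PowerSeries.coeff n (expEnd L F) = PowerSeries.coeff n (pexp N L F) := by
  have h0 : PowerSeries.coeff n (expEnd L F) = PowerSeries.coeff n (pexp n L F) := by
    simp [expEnd]
  rw [h0]
  have hsub : Finset.range (n + 1) ⊆ Finset.range (N + 1) :=
    Finset.range_subset_range.2 (by omega)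
  have hz : IsOrd (n + 1) (pexp N L - pexp n L) := by
    unfold pexp
    rw [← Finset.sum_sdiff_eq_sub hsub]
    refine IsOrd.sum _ fun m hm => ((hL.pow m).mono ?_).smul _
    simp only [Finset.mem_sdiff, Finset.mem_range, not_lt] at hm
    omega
  have := hz.coeff_eq_zero (Nat.lt_succ_self n) F
  rw [LinearMap.sub_apply, map_sub, sub_eq_zero] at this
  exact this.symm

lemma pexp_isOrd {L : Module.End ℝ (PowerSeries A)} (hL : IsOrd 1 L) (N : ℕ) :
    IsOrd 0 (pexp N L) :=
  IsOrd.sum _ fun m _ => ((hL.pow m).mono (Nat.zero_le _)).smul _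

lemma expEnd_isOrd {L : Module.End ℝ (PowerSeries A)} (hL : IsOrd 1 L) : IsOrd 0 (expEnd L) := by
  refine ⟨fun F => ?_, fun F => by simp⟩
  ext n
  cases n with
  | zero =>
    rw [coeff_expEnd hL le_rfl, (pexp_isOrd hL 0).comm, PowerSeries.coeff_zero_X_mul,
      PowerSeries.coeff_zero_X_mul]
  | succ n =>
    rw [coeff_expEnd hL le_rfl, (pexp_isOrd hL _).comm, PowerSeries.coeff_succ_X_mul,
      PowerSeries.coeff_succ_X_mul, coeff_expEnd hL (Nat.le_succ n)]

lemma expEnd_sub_pexp {L : Module.End ℝ (PowerSeries A)} (hL : IsOrd 1 L) (N : ℕ) :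
    IsOrd (N + 1) (expEnd L - pexp N L) := by
  refine ⟨((expEnd_isOrd hL).sub (pexp_isOrd hL N)).comm, fun F =>
    PowerSeries.X_pow_dvd_iff.2 fun m hm => ?_⟩
  rw [LinearMap.sub_apply, map_sub, coeff_expEnd hL (N := N) (by omega), sub_self]

/-- The truncated exponentials satisfy p(x)p(−x) ≡ 1 modulo x^{N+1} by exp(x)exp(−x) = 1. Evaluating
this at L, with L^{N+1} of order N+1, gives the claim. -/
lemma pexp_mul_pexp_neg {L : Module.End ℝ (PowerSeries A)} (hL : IsOrd 1 L) (N : ℕ) :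
    IsOrd (N + 1) (pexp N L * pexp N (-L) - 1) := by
  set p : Polynomial ℝ := ∑ m ∈ Finset.range (N + 1),
    Polynomial.C ((m.factorial : ℝ)⁻¹) * Polynomial.X ^ m with hp
  set q : Polynomial ℝ := ∑ m ∈ Finset.range (N + 1),
    Polynomial.C ((-1) ^ m * (m.factorial : ℝ)⁻¹) * Polynomial.X ^ m with hq
  have hpc : ∀ d ≤ N, p.coeff d = (d.factorial : ℝ)⁻¹ := by
    intro d hd
    simp only [hp, Polynomial.finsetSum_coeff, Polynomial.coeff_C_mul, Polynomial.coeff_X_pow,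
      mul_ite, mul_one, mul_zero]
    rw [Finset.sum_ite_eq, if_pos (Finset.mem_range.2 (by omega))]
  have hqc : ∀ d ≤ N, q.coeff d = (-1) ^ d * (d.factorial : ℝ)⁻¹ := by
    intro d hd
    simp only [hq, Polynomial.finsetSum_coeff, Polynomial.coeff_C_mul, Polynomial.coeff_X_pow,
      mul_ite, mul_one, mul_zero]
    rw [Finset.sum_ite_eq, if_pos (Finset.mem_range.2 (by omega))]
  have hdvd : (Polynomial.X : Polynomial ℝ) ^ (N + 1) ∣ p * q - 1 := by
    refine Polynomial.X_pow_dvd_iff.2 fun d hd => ?_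
    rw [Polynomial.coeff_sub, Polynomial.coeff_mul]
    have h := congrArg (PowerSeries.coeff d) (PowerSeries.exp_mul_exp_neg_eq_one (A := ℝ))
    rw [PowerSeries.coeff_mul, PowerSeries.coeff_one] at h
    rw [Polynomial.coeff_one, sub_eq_zero, ← h]
    refine Finset.sum_congr rfl fun x hx => ?_
    have := Finset.HasAntidiagonal.mem_antidiagonal.1 hx
    rw [hpc _ (by omega), hqc _ (by omega)]
    simp [PowerSeries.evalNegHom, PowerSeries.coeff_rescale, PowerSeries.coeff_exp]
  obtain ⟨r, hr⟩ := hdvd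
  have hpL : Polynomial.aeval L p = pexp N L := by
    simp [hp, pexp, Algebra.smul_def]
  have hqL : Polynomial.aeval L q = pexp N (-L) := by
    simp only [hq, pexp, map_sum, map_mul, Polynomial.aeval_C, map_pow, Polynomial.aeval_X]
    refine Finset.sum_congr rfl fun m _ => ?_
    rw [map_neg, map_one, neg_pow L m, Algebra.smul_def,
      ((Commute.neg_one_left (algebraMap ℝ (Module.End ℝ (PowerSeries A)) _)).pow_left m).eq,
      mul_assoc]
  have hL' := congrArg (Polynomial.aeval L) hr
  rw [map_sub, map_mul, map_one, hpL, hqL, map_mul, map_pow, Polynomial.aeval_X] at hL'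
  rw [hL']
  have hr0 : IsOrd 0 (Polynomial.aeval L r) := by
    rw [Polynomial.aeval_eq_sum_range]
    exact IsOrd.sum _ fun m _ => ((hL.pow m).mono (Nat.zero_le _)).smul _
  exact ((hL.pow (N + 1)).mul hr0).mono (by omega)

lemma expEnd_mul_expEnd_neg {L : Module.End ℝ (PowerSeries A)} (hL : IsOrd 1 L) :
    expEnd L * expEnd (-L) = 1 := by
  rw [← sub_eq_zero]
  refine IsOrd.eq_zero fun n => IsOrd.mono (n := n + 1) ?_ (Nat.le_succ n)
  have h1 := ((expEnd_sub_pexp hL n).mul (expEnd_isOrd hL.neg))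
  have h2 := ((pexp_isOrd hL n).mul (expEnd_sub_pexp hL.neg n))
  have h3 := pexp_mul_pexp_neg hL n
  have : expEnd L * expEnd (-L) - 1 = (expEnd L - pexp n L) * expEnd (-L) +
      pexp n L * (expEnd (-L) - pexp n (-L)) + (pexp n L * pexp n (-L) - 1) := by
    simp only [mul_sub, sub_mul]
    abel
  rw [this]
  exact ((h1.mono (by omega)).add (h2.mono (by omega))).add h3

lemma expEnd_zero : expEnd (0 : Module.End ℝ (PowerSeries A)) = 1 := by
  ext F n
  rw [coeff_expEnd IsOrd.zero le_rfl, pexp, Finset.sum_range_succ']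
  simp

/-- Perturbation of the exponent in high order. -/
lemma expEnd_add_sub {L Y : Module.End ℝ (PowerSeries A)} {k : ℕ} (hL : IsOrd 2 L)
    (hY : IsOrd 2 Y) (hk : IsOrd k Y) : IsOrd (k + 2) (expEnd (L + Y) - expEnd L - Y) := by
  have hLY := hL.add hY
  have h1 : ∀ m, IsOrd k ((L + Y) ^ m - L ^ m) := by
    intro m
    induction m with
    | zero => simpa using IsOrd.zero
    | succ m ih =>
      have : (L + Y) ^ (m + 1) - L ^ (m + 1) = (L + Y) * ((L + Y) ^ m - L ^ m) + Y * L ^ m := by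
        rw [pow_succ', pow_succ']
        simp only [mul_sub, add_mul]
        abel
      rw [this]
      exact ((hLY.mul ih).mono (by omega)).add ((hk.mul (hL.pow m)).mono (by omega))
  -- In a power of exponent at least two every term of the difference contains Y and one more factor
  -- of order two. Hence only the linear term Y survives below order k+2.
  have h2 : ∀ m, IsOrd (k + 2) ((L + Y) ^ (m + 2) - L ^ (m + 2)) := by
    intro m
    have : (L + Y) ^ (m + 2) - L ^ (m + 2) =
        (L + Y) * ((L + Y) ^ (m + 1) - L ^ (m + 1)) + Y * L ^ (m + 1) := by
      rw [pow_succ' _ (m + 1), pow_succ' _ (m + 1)]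
      simp only [mul_sub, add_mul]
      abel
    rw [this]
    exact ((hLY.mul (h1 _)).mono (by omega)).add
      ((hk.mul (hL.pow (m + 1))).mono (by rw [Nat.succ_mul]; omega))
  -- The partial sums up to k+1 suffice, as they agree with the exponentials modulo X^{k+2}.
  have h3 : IsOrd (k + 2) (pexp (k + 1) (L + Y) - pexp (k + 1) L - Y) := by
    have : pexp (k + 1) (L + Y) - pexp (k + 1) L - Y = ∑ m ∈ Finset.range k,
        (((m + 2).factorial : ℝ)⁻¹) • ((L + Y) ^ (m + 2) - L ^ (m + 2)) := by
      unfold pexp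
      rw [Finset.sum_range_succ', Finset.sum_range_succ', Finset.sum_range_succ' _ (k + 1),
        Finset.sum_range_succ' _ k]
      simp only [smul_sub, Finset.sum_sub_distrib]
      simp
      abel
    rw [this]
    exact IsOrd.sum _ fun m _ => (h2 m).smul _
  have h4 := expEnd_sub_pexp (hLY.mono (by omega : 1 ≤ 2)) (k + 1)
  have h5 := expEnd_sub_pexp (hL.mono (by omega : 1 ≤ 2)) (k + 1)
  have : expEnd (L + Y) - expEnd L - Y = (expEnd (L + Y) - pexp (k + 1) (L + Y)) -
      (expEnd L - pexp (k + 1) L) + (pexp (k + 1) (L + Y) - pexp (k + 1) L - Y) := by abel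
  rw [this]
  exact (h4.sub h5).add h3

lemma expEnd_sub_one {L : Module.End ℝ (PowerSeries A)} (hL : IsOrd 2 L) :
    IsOrd 2 (expEnd L - 1) := by
  have := (expEnd_add_sub (k := 0) IsOrd.zero hL (hL.mono (by omega))).add hL
  simp only [zero_add, expEnd_zero, sub_add_cancel] at this
  exact this

lemma opSeries_eq {E : ℕ → (Fin 1 → A) → A} {e : ℕ → Module.End ℝ A}
    (h : ∀ r f, E r f = e r (f 0)) : opSeries E = opLin e := by
  funext F
  ext n
  simp [opSeries, coeff_opLin, h]

lemma expSeries_eq {E : ℕ → (Fin 1 → A) → A} {e : ℕ → Module.End ℝ A}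
    (h : ∀ r f, E r f = e r (f 0)) (F : PowerSeries A) :
    expSeries E F = expEnd (opLin e) F := by
  ext n
  simp only [expSeries, PowerSeries.coeff_mk, expEnd, opSeries_eq h, pexp, LinearMap.coe_mk,
    AddHom.coe_mk, LinearMap.sum_apply, LinearMap.smul_apply, map_sum, Module.End.pow_apply]
  rfl

end FormalOperators

/-! ### ν-bilinear products and their conjugation. -/

section FormalProducts

variable {A : Type u} [CommRing A] {C : ℕ → (Fin 2 → A) → A}

/-- A family of biadditive maps. -/
structure IsBiadditive (C : ℕ → (Fin 2 → A) → A) : Prop where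
  left : ∀ r f f' g, C r ![f + f', g] = C r ![f, g] + C r ![f', g]
  right : ∀ r f g g', C r ![f, g + g'] = C r ![f, g] + C r ![f, g']

lemma IsBiadditive.zero_left (hC : IsBiadditive C) (r : ℕ) (g : A) : C r ![0, g] = 0 :=
  map_zero (AddMonoidHom.mk' (fun f => C r ![f, g]) fun f f' => hC.left r f f' g)

lemma IsBiadditive.zero_right (hC : IsBiadditive C) (r : ℕ) (f : A) : C r ![f, 0] = 0 :=
  map_zero (AddMonoidHom.mk' (fun g => C r ![f, g]) fun g g' => hC.right r f g g')

/-- The product `starMul C` as a biadditive map. -/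
def starHom (hC : IsBiadditive C) : PowerSeries A →+ PowerSeries A →+ PowerSeries A :=
  AddMonoidHom.mk' (fun F => AddMonoidHom.mk' (fun G => starMul C F G) fun G G' => by
    ext n
    simp [starMul, hC.right, Finset.sum_add_distrib]) fun F F' => by
    ext G n
    simp [starMul, hC.left, Finset.sum_add_distrib]

lemma starHom_apply (hC : IsBiadditive C) (F G : PowerSeries A) :
    starHom hC F G = starMul C F G := rfl

lemma starHom_X_left (hC : IsBiadditive C) (F G : PowerSeries A) :
    starHom hC (PowerSeries.X * F) G = PowerSeries.X * starHom hC F G := by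
  ext n
  simp only [starHom_apply, starMul]
  cases n with
  | zero => simp [hC.zero_left]
  | succ n =>
    rw [PowerSeries.coeff_succ_X_mul, PowerSeries.coeff_mk, PowerSeries.coeff_mk,
      Finset.Nat.sum_antidiagonal_succ']
    simp only [Finset.Nat.antidiagonal_zero, Finset.sum_singleton, PowerSeries.coeff_zero_X_mul,
      hC.zero_left, zero_add, Finset.Nat.sum_antidiagonal_succ, PowerSeries.coeff_succ_X_mul]

lemma starHom_X_right (hC : IsBiadditive C) (F G : PowerSeries A) :
    starHom hC F (PowerSeries.X * G) = PowerSeries.X * starHom hC F G := by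
  ext n
  simp only [starHom_apply, starMul]
  cases n with
  | zero => simp [hC.zero_right]
  | succ n =>
    rw [PowerSeries.coeff_succ_X_mul, PowerSeries.coeff_mk, PowerSeries.coeff_mk,
      Finset.Nat.sum_antidiagonal_succ']
    simp only [Finset.Nat.antidiagonal_zero, Finset.sum_singleton, PowerSeries.coeff_zero_X_mul,
      hC.zero_right, zero_add, Finset.Nat.sum_antidiagonal_succ', PowerSeries.coeff_succ_X_mul]

lemma starHom_dvd (hC : IsBiadditive C) {a b : ℕ} {F G : PowerSeries A}
    (hF : PowerSeries.X ^ a ∣ F) (hG : PowerSeries.X ^ b ∣ G) :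
    PowerSeries.X ^ (a + b) ∣ starHom hC F G := by
  obtain ⟨F, rfl⟩ := hF
  obtain ⟨G, rfl⟩ := hG
  have h1 : ∀ a F G, starHom hC (PowerSeries.X ^ a * F) G = PowerSeries.X ^ a * starHom hC F G := by
    intro a F G
    induction a with
    | zero => simp
    | succ a ih => rw [pow_succ', mul_assoc, starHom_X_left, ih, mul_assoc]
  have h2 : ∀ b F G, starHom hC F (PowerSeries.X ^ b * G) = PowerSeries.X ^ b * starHom hC F G := by
    intro b F G
    induction b with
    | zero => simp
    | succ a ih => rw [pow_succ', mul_assoc, starHom_X_right, ih, mul_assoc]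
  rw [h1, h2, ← mul_assoc, ← pow_add]
  exact dvd_mul_right _ _

lemma coeff_starHom_C_right (hC : IsBiadditive C) (F : PowerSeries A) (g : A) (n : ℕ) :
    PowerSeries.coeff n (starHom hC F (PowerSeries.C g)) =
      ∑ p ∈ Finset.HasAntidiagonal.antidiagonal n, C p.1 ![PowerSeries.coeff p.2 F, g] := by
  rw [starHom_apply, starMul, PowerSeries.coeff_mk]
  refine Finset.sum_congr rfl fun p _ => ?_
  rcases p with ⟨p, m⟩
  cases m with
  | zero => simp
  | succ m =>
    rw [Finset.Nat.sum_antidiagonal_succ']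
    simp [PowerSeries.coeff_C, hC.zero_right]

lemma coeff_starHom_C_left (hC : IsBiadditive C) (f : A) (G : PowerSeries A) (n : ℕ) :
    PowerSeries.coeff n (starHom hC (PowerSeries.C f) G) =
      ∑ p ∈ Finset.HasAntidiagonal.antidiagonal n, C p.1 ![f, PowerSeries.coeff p.2 G] := by
  rw [starHom_apply, starMul, PowerSeries.coeff_mk]
  refine Finset.sum_congr rfl fun p _ => ?_
  rcases p with ⟨p, m⟩
  cases m with
  | zero => simp
  | succ m =>
    rw [Finset.Nat.sum_antidiagonal_succ]
    simp [PowerSeries.coeff_C, hC.zero_left]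

lemma coeff_starHom_C_C (hC : IsBiadditive C) (f g : A) (n : ℕ) :
    PowerSeries.coeff n (starHom hC (PowerSeries.C f) (PowerSeries.C g)) = C n ![f, g] := by
  rw [coeff_starHom_C_right]
  cases n with
  | zero => simp
  | succ n =>
    rw [Finset.Nat.sum_antidiagonal_succ']
    simp [PowerSeries.coeff_C, hC.zero_left]

/-- Effect of a perturbation of the exponent in high order on a conjugated product. -/
lemma conj_perturbation [Algebra ℝ A] (hC : IsBiadditive C) {L Y : Module.End ℝ (PowerSeries A)} {k : ℕ}
    (hL : IsOrd 2 L) (hY : IsOrd 2 Y) (hk : IsOrd k Y) (F G : PowerSeries A) :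
    PowerSeries.X ^ (k + 2) ∣
      expEnd (L + Y) (starHom hC (expEnd (-(L + Y)) F) (expEnd (-(L + Y)) G)) -
        expEnd L (starHom hC (expEnd (-L) F) (expEnd (-L) G)) -
        (Y (starHom hC F G) - starHom hC (Y F) G - starHom hC F (Y G)) := by
  have hT := expEnd_add_sub hL hY hk
  have hS := expEnd_add_sub hL.neg hY.neg hk.neg
  rw [← neg_add] at hS
  have hT1 := expEnd_sub_one hL
  have hS1' := expEnd_sub_one (hL.add hY).neg
  have hS1 := expEnd_sub_one hL.neg
  set T' := expEnd (L + Y)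
  set T := expEnd L
  set S' := expEnd (-(L + Y))
  set S := expEnd (-L)
  have one_dvd' : ∀ F : PowerSeries A, (PowerSeries.X : PowerSeries A) ^ 0 ∣ F := fun F => by simp
  have dsub : ∀ F, PowerSeries.X ^ 2 ∣ S' F - F := fun F => hS1'.dvd F
  have dsub0 : ∀ F, PowerSeries.X ^ 2 ∣ S F - F := fun F => hS1.dvd F
  have dS : ∀ F, PowerSeries.X ^ (k + 2) ∣ S' F - S F + Y F := fun F => by
    have := hS.dvd F
    simpa [sub_eq_add_neg] using this
  -- The nine terms are the errors in replacing T' by T + Y, S' by S − Y, and T, S, S' by the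
  -- identity wherever Y already occurs. The first two replacements cost order k+2; the others cost
  -- order 2 next to a factor of order k.
  have t1 : PowerSeries.X ^ (k + 2) ∣ (T' - T - Y) (starHom hC (S' F) (S' G)) := hT.dvd _
  have t2 : PowerSeries.X ^ (k + 2) ∣ Y (starHom hC (S' F - F) (S' G)) :=
    (hk.dvd_add (starHom_dvd hC (dsub F) (one_dvd' (S' G))))
  have t3 : PowerSeries.X ^ (k + 2) ∣ Y (starHom hC F (S' G - G)) :=
    (pow_dvd_pow _ (by omega)).trans (hk.dvd_add (starHom_dvd hC (one_dvd' F) (dsub G)))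
  have hT0 : IsOrd 0 T := expEnd_isOrd (hL.mono (by omega))
  have t4 : PowerSeries.X ^ (k + 2) ∣ T (starHom hC (S' F - S F + Y F) (S' G)) :=
    (pow_dvd_pow _ (by omega)).trans (hT0.dvd_add (starHom_dvd hC (dS F) (one_dvd' (S' G))))
  have t5 : PowerSeries.X ^ (k + 2) ∣ T (starHom hC (S F) (S' G - S G + Y G)) :=
    (pow_dvd_pow _ (by omega)).trans (hT0.dvd_add (starHom_dvd hC (one_dvd' (S F)) (dS G)))
  have t6 : PowerSeries.X ^ (k + 2) ∣ T (starHom hC (Y F) (S' G - G)) :=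
    (pow_dvd_pow _ (by omega)).trans (hT0.dvd_add (starHom_dvd hC (hk.dvd F) (dsub G)))
  have t7 : PowerSeries.X ^ (k + 2) ∣ T (starHom hC (S F - F) (Y G)) :=
    (pow_dvd_pow _ (by omega)).trans (hT0.dvd_add (starHom_dvd hC (dsub0 F) (hk.dvd G)))
  have t8 : PowerSeries.X ^ (k + 2) ∣ (T - 1) (starHom hC (Y F) G) :=
    (pow_dvd_pow _ (by omega)).trans (hT1.dvd_add (starHom_dvd hC (hk.dvd F) (one_dvd' G)))
  have t9 : PowerSeries.X ^ (k + 2) ∣ (T - 1) (starHom hC F (Y G)) :=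
    (pow_dvd_pow _ (by omega)).trans (hT1.dvd_add (starHom_dvd hC (one_dvd' F) (hk.dvd G)))
  have key := (((((((t1.add t2).add t3).add t4).add t5).sub t6).sub t7).sub t8).sub t9
  convert key using 1
  simp only [map_sub, map_add, LinearMap.sub_apply, AddMonoidHom.sub_apply, AddMonoidHom.add_apply,
    Module.End.one_apply]
  abel

end FormalProducts

/-! ### Stability properties of no-loop operators. -/

section Closure

variable {𝕜 : Type} [RCLike 𝕜] {k K : ℕ}

lemma MultiOp.IsNoLoop.map_update_add {A : MultiOp.{u} 𝕜 k} (hA : A.IsNoLoop) {M : Mfd.{u}}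
    (D : Connection M) (P : PoissonTensor M) (f : Fin k → Fun 𝕜 M) (l : Fin k) (g h : Fun 𝕜 M) :
    A M D P (Function.update f l (g + h)) =
      A M D P (Function.update f l g) + A M D P (Function.update f l h) := by
  obtain ⟨e, -, he⟩ := hA
  ext x
  have hc : chartAt (Model M.dim) x ∈ M.charts := IsManifold.chart_mem_maximalAtlas x
  have hx := mem_chart_source (Model M.dim) x
  change _ = A M D P (Function.update f l g) x + A M D P (Function.update f l h) x
  rw [he.apply hc hx, he.apply hc hx, he.apply hc hx, evalAt_update_add e D P hc hx]

lemma MultiOp.IsNoLoop.map_update_const_mul {A : MultiOp.{u} 𝕜 k} (hA : A.IsNoLoop) {M : Mfd.{u}}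
    (D : Connection M) (P : PoissonTensor M) (f : Fin k → Fun 𝕜 M) (l : Fin k) (a : 𝕜)
    (g : Fun 𝕜 M) : A M D P (Function.update f l (constFun M a * g)) =
      constFun M a * A M D P (Function.update f l g) := by
  obtain ⟨e, -, he⟩ := hA
  ext x
  have hc : chartAt (Model M.dim) x ∈ M.charts := IsManifold.chart_mem_maximalAtlas x
  have hx := mem_chart_source (Model M.dim) x
  change _ = a * A M D P (Function.update f l g) x
  rw [he.apply hc hx, he.apply hc hx, evalAt_update_const_mul e D P hc hx]

lemma real_smul_eq_const_mul {M : Mfd.{u}} (t : ℝ) (f : Fun 𝕜 M) :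
    t • f = constFun M (t : 𝕜) * f := by
  ext z
  exact RCLike.real_smul_eq_coe_mul _ _

lemma update_single {α : Type*} (f : Fin 1 → α) (g : α) : Function.update f 0 g = ![g] := by
  funext l
  obtain rfl : l = 0 := Subsingleton.elim _ _
  simp

lemma update_pair_zero {α : Type*} (f g h : α) : Function.update ![f, g] 0 h = ![h, g] := by
  funext l
  fin_cases l <;> simp

lemma update_pair_one {α : Type*} (f g h : α) : Function.update ![f, g] 1 h = ![f, h] := by
  funext l
  fin_cases l <;> simp

lemma fin_one_eta {α : Type*} (f : Fin 1 → α) : ![f 0] = f := by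
  funext l
  obtain rfl : l = 0 := Subsingleton.elim _ _
  rfl

lemma MultiOp.IsNoLoop.zero : (0 : MultiOp.{u} 𝕜 k).IsNoLoop := ⟨0, by simp, .zero⟩

lemma MultiOp.IsNoLoop.add {A B : MultiOp.{u} 𝕜 k} (hA : A.IsNoLoop) (hB : B.IsNoLoop) :
    (A + B).IsNoLoop := by
  obtain ⟨e, he, h⟩ := MultiOp.isNoLoop_iff.1 hA
  obtain ⟨e', he', h'⟩ := MultiOp.isNoLoop_iff.1 hB
  exact MultiOp.isNoLoop_iff.2 ⟨e + e', Submodule.add_mem _ he he', h.add h'⟩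

lemma MultiOp.IsNoLoop.neg {A : MultiOp.{u} 𝕜 k} (hA : A.IsNoLoop) : (-A).IsNoLoop := by
  obtain ⟨e, he, h⟩ := MultiOp.isNoLoop_iff.1 hA
  exact MultiOp.isNoLoop_iff.2 ⟨-e, Submodule.neg_mem _ he, h.neg⟩

lemma MultiOp.IsNoLoop.smul {A : MultiOp.{u} 𝕜 k} (hA : A.IsNoLoop) (a : ℝ) :
    MultiOp.IsNoLoop fun M D P f => a • A M D P f := by
  obtain ⟨e, he, h⟩ := MultiOp.isNoLoop_iff.1 hA
  exact MultiOp.isNoLoop_iff.2 ⟨(a : 𝕜) • e, Submodule.smul_mem _ _ he, h.smul a⟩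

lemma MultiOp.IsNoLoop.sum {ι : Type*} (s : Finset ι) {A : ι → MultiOp.{u} 𝕜 k}
    (hA : ∀ i ∈ s, (A i).IsNoLoop) :
    MultiOp.IsNoLoop fun M D P f => ∑ i ∈ s, A i M D P f := by
  classical
  induction s using Finset.induction_on with
  | empty =>
    simp only [Finset.sum_empty]
    exact MultiOp.IsNoLoop.zero
  | insert i s hi ih =>
    simp only [Finset.sum_insert hi]
    exact (hA i (Finset.mem_insert_self i s)).add
      (ih fun j hj => hA j (Finset.mem_insert_of_mem hj))

lemma MultiOp.IsHomogeneous.sum {ι : Type*} (s : Finset ι) {A : ι → MultiOp.{u} 𝕜 k} {r : ℕ}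
    (hA : ∀ i ∈ s, (A i).IsHomogeneous r) :
    MultiOp.IsHomogeneous (fun M D P f => ∑ i ∈ s, A i M D P f) r := by
  intro M D P t f
  simp only [Finset.smul_sum]
  exact Finset.sum_congr rfl fun i hi => hA i hi M D P t f

/-- The monomial without derivatives. -/
def Monomial.prod (k : ℕ) : Monomial k where
  n := 0
  numP := 0
  facP := Fin.elim0
  numR := 0
  facR := Fin.elim0
  ord _ := 0
  arg _ := Fin.elim0
  upper_once := ⟨fun s => by rcases s with ⟨s, -⟩ | s <;> exact s.elim0, fun s => s.elim0⟩
  lower_once := ⟨fun s => by rcases s with ⟨s, -⟩ | ⟨s, -⟩ | ⟨-, s⟩ <;> exact s.elim0,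
    fun s => s.elim0⟩

/-- The multiplication of functions is a universal operator. -/
lemma isNoLoop_prod : MultiOp.IsNoLoop (𝕜 := 𝕜) (k := k) fun _ _ _ f => ∏ l, f l := by
  refine ⟨Finsupp.single (Monomial.prod k) 1, fun Γ hΓ => ?_, fun M D P f c hc x hx => ?_⟩
  · rw [Finset.mem_singleton.1 (Finsupp.support_single_subset hΓ)]
    exact ⟨fun i => i.elim0, fun j => j.elim0⟩
  · rw [Finsupp.sum_single_index (by simp), one_mul]
    have h1 : (∏ l, f l) x = ∏ l, f l x := by
      have : ∀ s : Finset (Fin k), (∏ l ∈ s, f l) x = ∏ l ∈ s, f l x := by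
        classical
        intro s
        induction s using Finset.induction_on with
        | empty => rfl
        | insert i s hi ih =>
          rw [Finset.prod_insert hi, Finset.prod_insert hi, ← ih]
          rfl
      exact this _
    have h2 : ∀ F : (Fin 0 → Fin M.dim) → 𝕜, ∑ I, F I = F Fin.elim0 := fun F => by
      rw [Fintype.sum_unique, Subsingleton.elim (default : Fin 0 → Fin M.dim) Fin.elim0]
    rw [h1, Monomial.eval]
    refine Eq.trans ?_ (h2 _).symm
    have hP : IsEmpty (Fin (Monomial.prod k).numP) := inferInstanceAs (IsEmpty (Fin 0))
    have hR : IsEmpty (Fin (Monomial.prod k).numR) := inferInstanceAs (IsEmpty (Fin 0))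
    refine Eq.trans ?_ (congrArg₂ _ (congrArg₂ _ (congrArg _ (Fintype.prod_empty _))
      (congrArg _ (Fintype.prod_empty _))) rfl).symm
    rw [RCLike.ofReal_one, one_mul, one_mul]
    refine Finset.prod_congr rfl fun l _ => ?_
    refine Eq.trans ?_ (nablaSym_zero_order ..).symm
    rw [inChart, c.left_inv hx]

/-- Composition with a unary operator. -/
lemma MultiOp.IsNoLoop.comp_one {A : MultiOp.{u} 𝕜 1} {B : MultiOp.{u} 𝕜 (K + 1)}
    (hA : A.IsNoLoop) (hB : B.IsNoLoop) :
    MultiOp.IsNoLoop fun M D P f => A M D P ![B M D P f] := by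
  have := hA.comp hB 0 (fun _ => 0) id (by rw [Multiset.map_id]; rfl)
  simp only [update_single, Function.comp_id] at this
  exact this

lemma MultiOp.IsNoLoop.comp_left {A : MultiOp.{u} 𝕜 2} {B : MultiOp.{u} 𝕜 1}
    (hA : A.IsNoLoop) (hB : B.IsNoLoop) :
    MultiOp.IsNoLoop (k := 2) fun M D P f => A M D P ![B M D P ![f 0], f 1] := by
  have := hA.comp (K := 2) hB 0 id (fun _ : Fin 1 => (0 : Fin 2)) (by decide)
  have h2 : ∀ {M : Mfd.{u}} (f : Fin 2 → Fun 𝕜 M) (g : Fun 𝕜 M),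
      Function.update f 0 g = ![g, f 1] := fun f g => by
    conv_lhs => rw [← fin_two_eta f, update_pair_zero]
  have h3 : ∀ {M : Mfd.{u}} (f : Fin 2 → Fun 𝕜 M), (f ∘ fun _ : Fin 1 => (0 : Fin 2)) = ![f 0] :=
    fun f => (fin_one_eta _).symm
  simp only [Function.comp_id, h2, h3] at this
  exact this

lemma MultiOp.IsNoLoop.comp_right {A : MultiOp.{u} 𝕜 2} {B : MultiOp.{u} 𝕜 1}
    (hA : A.IsNoLoop) (hB : B.IsNoLoop) :
    MultiOp.IsNoLoop (k := 2) fun M D P f => A M D P ![f 0, B M D P ![f 1]] := by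
  have := hA.comp (K := 2) hB 1 id (fun _ : Fin 1 => (1 : Fin 2)) (by decide)
  have h2 : ∀ {M : Mfd.{u}} (f : Fin 2 → Fun 𝕜 M) (g : Fun 𝕜 M),
      Function.update f 1 g = ![f 0, g] := fun f g => by
    conv_lhs => rw [← fin_two_eta f, update_pair_one]
  have h3 : ∀ {M : Mfd.{u}} (f : Fin 2 → Fun 𝕜 M), (f ∘ fun _ : Fin 1 => (1 : Fin 2)) = ![f 1] :=
    fun f => (fin_one_eta _).symm
  simp only [Function.comp_id, h2, h3] at this
  exact this

/-- A universal operator with one argument as an endomorphism. -/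
def MultiOp.toEnd (A : MultiOp.{u} 𝕜 1) (hA : A.IsNoLoop) {M : Mfd.{u}} (D : Connection M)
    (P : PoissonTensor M) : Module.End ℝ (Fun 𝕜 M) where
  toFun f := A M D P ![f]
  map_add' f g := by
    have := hA.map_update_add D P ![0] 0 f g
    simpa only [update_single] using this
  map_smul' t f := by
    have := hA.map_update_const_mul D P ![0] 0 (t : 𝕜) f
    simp only [update_single, ← real_smul_eq_const_mul] at this
    exact this

lemma MultiOp.toEnd_apply (A : MultiOp.{u} 𝕜 1) (hA : A.IsNoLoop) {M : Mfd.{u}} (D : Connection M)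
    (P : PoissonTensor M) (f : Fun 𝕜 M) : A.toEnd hA D P f = A M D P ![f] := rfl

end Closure

/-! ### Gauge series and the coefficients of their exponentials. -/

section UniversalSeries

variable {𝕜 : Type} [RCLike 𝕜]

lemma IsGaugeSeries.isNoLoop {E : ℕ → MultiOp.{u} 𝕜 1} (hE : IsGaugeSeries E) (r : ℕ) :
    (E r).IsNoLoop := by
  rcases Nat.lt_or_ge r 2 with h | h
  · rw [hE.low r h]
    exact .zero
  · exact hE.noLoop r h

lemma IsGaugeSeries.isHomogeneous {E : ℕ → MultiOp.{u} 𝕜 1} (hE : IsGaugeSeries E) (r : ℕ) :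
    (E r).IsHomogeneous r := by
  rcases Nat.lt_or_ge r 2 with h | h
  · rw [hE.low r h]
    exact .zero
  · exact hE.homogeneous r h

lemma IsGaugeSeries.map_const {E : ℕ → MultiOp.{u} 𝕜 1} (hE : IsGaugeSeries E) (r : ℕ)
    {M : Mfd.{u}} (D : Connection M) (P : PoissonTensor M) (a : 𝕜) :
    E r M D P ![constFun M a] = 0 := by
  rcases Nat.lt_or_ge r 2 with h | h
  · rw [hE.low r h]
    rfl
  · exact hE.const r h M D P a

lemma IsGaugeSeries.neg {E : ℕ → MultiOp.{u} 𝕜 1} (hE : IsGaugeSeries E) :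
    IsGaugeSeries fun r => - E r where
  low r h := by rw [hE.low r h, neg_zero]
  noLoop r h := (hE.noLoop r h).neg
  homogeneous r h := (hE.homogeneous r h).neg
  const r h M D P a := by
    change - E r M D P _ = 0
    rw [hE.const r h, neg_zero]

/-- A gauge series as an operator on formal series. -/
def IsGaugeSeries.op {E : ℕ → MultiOp.{u} 𝕜 1} (hE : IsGaugeSeries E) {M : Mfd.{u}}
    (D : Connection M) (P : PoissonTensor M) : Module.End ℝ (PowerSeries (Fun 𝕜 M)) :=
  opLin fun r => (E r).toEnd (hE.isNoLoop r) D P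

lemma IsGaugeSeries.op_isOrd {E : ℕ → MultiOp.{u} 𝕜 1} (hE : IsGaugeSeries E) {M : Mfd.{u}}
    (D : Connection M) (P : PoissonTensor M) : IsOrd 2 (hE.op D P) := by
  refine opLin_isOrd fun r hr => ?_
  ext1 f
  rw [MultiOp.toEnd_apply, hE.low r hr]
  rfl

lemma IsGaugeSeries.expSeries_eq {E : ℕ → MultiOp.{u} 𝕜 1} (hE : IsGaugeSeries E) {M : Mfd.{u}}
    (D : Connection M) (P : PoissonTensor M) (F : PowerSeries (Fun 𝕜 M)) :
    expSeries (fun r => E r M D P) F = expEnd (hE.op D P) F :=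
  UniversalStar.expSeries_eq (fun r f => by rw [MultiOp.toEnd_apply, fin_one_eta]) F

lemma IsGaugeSeries.op_neg {E : ℕ → MultiOp.{u} 𝕜 1} (hE : IsGaugeSeries E) {M : Mfd.{u}}
    (D : Connection M) (P : PoissonTensor M) : hE.neg.op D P = - hE.op D P :=
  opLin_neg fun r => (E r).toEnd (hE.isNoLoop r) D P

/-- The coefficients of `exp E`. -/
def expCoeff (E : ℕ → MultiOp.{u} 𝕜 1) (p : ℕ) : MultiOp.{u} 𝕜 1 := fun M D P f =>
  PowerSeries.coeff p (expSeries (fun r => E r M D P) (PowerSeries.C (f 0)))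

/-- The coefficients of `E^m`. -/
def powCoeff (E : ℕ → MultiOp.{u} 𝕜 1) (m p : ℕ) : MultiOp.{u} 𝕜 1 := fun M D P f =>
  PowerSeries.coeff p ((opSeries fun r => E r M D P)^[m] (PowerSeries.C (f 0)))

lemma powCoeff_succ (E : ℕ → MultiOp.{u} 𝕜 1) (m p : ℕ) : powCoeff E (m + 1) p =
    fun M D P f => ∑ q ∈ Finset.HasAntidiagonal.antidiagonal p,
      E q.1 M D P ![powCoeff E m q.2 M D P f] := by
  funext M D P f
  rw [powCoeff, Function.iterate_succ_apply', opSeries, PowerSeries.coeff_mk]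
  rfl

lemma powCoeff_isNoLoop {E : ℕ → MultiOp.{u} 𝕜 1} (hE : IsGaugeSeries E) (m : ℕ) :
    ∀ p, (powCoeff E m p).IsNoLoop := by
  induction m with
  | zero =>
    intro p
    rcases p with _ | p
    · have := isNoLoop_prod (𝕜 := 𝕜) (k := 1)
      simp only [Finset.univ_unique, Finset.prod_singleton] at this
      convert this using 1
      funext M D P f
      simp [powCoeff]
    · convert MultiOp.IsNoLoop.zero (𝕜 := 𝕜) (k := 1) using 1
      funext M D P f
      simp [powCoeff]
  | succ m ih =>
    intro p
    rw [powCoeff_succ]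
    exact MultiOp.IsNoLoop.sum _ fun q _ => (hE.isNoLoop q.1).comp_one (ih q.2)

lemma powCoeff_isHomogeneous {E : ℕ → MultiOp.{u} 𝕜 1} (hE : IsGaugeSeries E) (m : ℕ) :
    ∀ p, (powCoeff E m p).IsHomogeneous p := by
  induction m with
  | zero =>
    intro p M D P t f
    rcases p with _ | p
    · simp [powCoeff]
    · simp [powCoeff]
  | succ m ih =>
    intro p
    rw [powCoeff_succ]
    refine MultiOp.IsHomogeneous.sum _ fun q hq M D P t f => ?_
    rw [ih q.2 M D P t f, hE.isHomogeneous q.1 M D P t, ← Finset.HasAntidiagonal.mem_antidiagonal.1 hq,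
      pow_add, ← smul_smul]
    congr 1
    exact map_smul ((E q.1).toEnd (hE.isNoLoop q.1) D P) (t ^ q.2) _

lemma expCoeff_eq (E : ℕ → MultiOp.{u} 𝕜 1) (p : ℕ) : expCoeff E p =
    fun M D P f => ∑ m ∈ Finset.range (p + 1), ((m.factorial : ℝ)⁻¹) • powCoeff E m p M D P f := by
  funext M D P f
  simp [expCoeff, expSeries, powCoeff]

lemma expCoeff_isNoLoop {E : ℕ → MultiOp.{u} 𝕜 1} (hE : IsGaugeSeries E) (p : ℕ) :
    (expCoeff E p).IsNoLoop := by
  rw [expCoeff_eq]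
  exact MultiOp.IsNoLoop.sum _ fun m _ => (powCoeff_isNoLoop hE m p).smul _

lemma expCoeff_isHomogeneous {E : ℕ → MultiOp.{u} 𝕜 1} (hE : IsGaugeSeries E) (p : ℕ) :
    (expCoeff E p).IsHomogeneous p := by
  rw [expCoeff_eq]
  refine MultiOp.IsHomogeneous.sum _ fun m _ M D P t f => ?_
  rw [powCoeff_isHomogeneous hE m p M D P t f, smul_comm]

/-- The exponential commutes with ν, so it is determined by its values on series without ν, that is
by the operators `expCoeff`. Their universality makes the transformed product universal. -/
lemma coeff_expEnd_op {E : ℕ → MultiOp.{u} 𝕜 1} (hE : IsGaugeSeries E) {M : Mfd.{u}}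
    (D : Connection M) (P : PoissonTensor M) (F : PowerSeries (Fun 𝕜 M)) (n : ℕ) :
    PowerSeries.coeff n (expEnd (hE.op D P) F) = ∑ p ∈ Finset.HasAntidiagonal.antidiagonal n,
      expCoeff E p.1 M D P ![PowerSeries.coeff p.2 F] := by
  set e : ℕ → Module.End ℝ (Fun 𝕜 M) := fun r =>
    (expCoeff E r).toEnd (expCoeff_isNoLoop hE r) D P with he
  have h : ∀ F, expEnd (hE.op D P) F = opLin e F := by
    refine fun F => ext_of_comm_X (Φ := (expEnd (hE.op D P)).toAddMonoidHom)
      (Ψ := (opLin e).toAddMonoidHom)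
      (expEnd_isOrd ((hE.op_isOrd D P).mono (by omega))).comm
      (opLin_isOrd (n := 0) (fun r hr => absurd hr (Nat.not_lt_zero r))).comm (fun a => ?_) F
    ext1 n
    change PowerSeries.coeff n (expEnd (hE.op D P) (PowerSeries.C a)) =
      PowerSeries.coeff n (opLin e (PowerSeries.C a))
    rw [coeff_opLin_C, ← hE.expSeries_eq]
    rfl
  rw [h, coeff_opLin]
  rfl

end UniversalSeries

/-! ### Degrees add under composition. -/

section HomogeneousComposition

variable {𝕜 : Type} [RCLike 𝕜] {K : ℕ}

lemma MultiOp.IsNoLoop.map_smul_left {A : MultiOp.{u} 𝕜 2} (hA : A.IsNoLoop) {M : Mfd.{u}}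
    (D : Connection M) (P : PoissonTensor M) (t : ℝ) (f g : Fun 𝕜 M) :
    A M D P ![t • f, g] = t • A M D P ![f, g] := by
  have := hA.map_update_const_mul D P ![0, g] 0 (t : 𝕜) f
  simpa only [update_pair_zero, ← real_smul_eq_const_mul] using this

lemma MultiOp.IsNoLoop.map_smul_right {A : MultiOp.{u} 𝕜 2} (hA : A.IsNoLoop) {M : Mfd.{u}}
    (D : Connection M) (P : PoissonTensor M) (t : ℝ) (f g : Fun 𝕜 M) :
    A M D P ![f, t • g] = t • A M D P ![f, g] := by
  have := hA.map_update_const_mul D P ![f, 0] 1 (t : 𝕜) g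
  simpa only [update_pair_one, ← real_smul_eq_const_mul] using this

lemma MultiOp.IsHomogeneous.comp_one {A : MultiOp.{u} 𝕜 1} {B : MultiOp.{u} 𝕜 K} {r s : ℕ}
    (hA : A.IsNoLoop) (hr : A.IsHomogeneous r) (hs : B.IsHomogeneous s) :
    MultiOp.IsHomogeneous (fun M D P f => A M D P ![B M D P f]) (r + s) := by
  intro M D P t f
  beta_reduce
  rw [hs M D P t f, hr M D P t, pow_add, ← smul_smul]
  congr 1
  exact map_smul (A.toEnd hA D P) (t ^ s) _

lemma MultiOp.IsHomogeneous.comp_left {A : MultiOp.{u} 𝕜 2} {B : MultiOp.{u} 𝕜 1} {r s : ℕ}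
    (hA : A.IsNoLoop) (hr : A.IsHomogeneous r) (hs : B.IsHomogeneous s) :
    MultiOp.IsHomogeneous (k := 2) (fun M D P f => A M D P ![B M D P ![f 0], f 1]) (r + s) := by
  intro M D P t f
  beta_reduce
  rw [hs M D P t, hr M D P t, pow_add, ← smul_smul, hA.map_smul_left]

lemma MultiOp.IsHomogeneous.comp_right {A : MultiOp.{u} 𝕜 2} {B : MultiOp.{u} 𝕜 1} {r s : ℕ}
    (hA : A.IsNoLoop) (hr : A.IsHomogeneous r) (hs : B.IsHomogeneous s) :
    MultiOp.IsHomogeneous (k := 2) (fun M D P f => A M D P ![f 0, B M D P ![f 1]]) (r + s) := by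
  intro M D P t f
  beta_reduce
  rw [hs M D P t, hr M D P t, pow_add, ← smul_smul, hA.map_smul_right]

lemma isBiadditive_of_isNoLoop {C : ℕ → MultiOp.{u} 𝕜 2} (hC : ∀ r, (C r).IsNoLoop) {M : Mfd.{u}}
    (D : Connection M) (P : PoissonTensor M) : IsBiadditive fun r => C r M D P where
  left r f f' g := by
    have := (hC r).map_update_add D P ![0, g] 0 f f'
    simpa only [update_pair_zero] using this
  right r f g g' := by
    have := (hC r).map_update_add D P ![f, 0] 1 g g'
    simpa only [update_pair_one] using this

end HomogeneousComposition

/-! ### Invertibility of the exponential. -/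

section ExpEnd

variable {A : Type u} [CommRing A] [Algebra ℝ A]

lemma expEnd_eq_self {L : Module.End ℝ (PowerSeries A)} (hL : IsOrd 1 L) {F : PowerSeries A}
    (h : L F = 0) : expEnd L F = F := by
  ext n
  rw [coeff_expEnd hL le_rfl, pexp, Finset.sum_range_succ']
  simp [pow_succ, h]

lemma expEnd_neg_apply_expEnd {L : Module.End ℝ (PowerSeries A)} (hL : IsOrd 1 L)
    (F : PowerSeries A) : expEnd (-L) (expEnd L F) = F := by
  have := expEnd_mul_expEnd_neg hL.neg
  rw [neg_neg] at this
  exact DFunLike.congr_fun this F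

lemma expEnd_apply_expEnd_neg {L : Module.End ℝ (PowerSeries A)} (hL : IsOrd 1 L)
    (F : PowerSeries A) : expEnd L (expEnd (-L) F) = F :=
  DFunLike.congr_fun (expEnd_mul_expEnd_neg hL) F

end ExpEnd

/-! ### Gauge transformation of universal star products. -/

section StarProducts

variable {𝕜 : Type} [RCLike 𝕜] {C : ℕ → MultiOp.{u} 𝕜 2} {E : ℕ → MultiOp.{u} 𝕜 1}

lemma IsUniversalStarProduct.zero_eq (hC : IsUniversalStarProduct C) :
    C 0 = fun _ _ _ f => ∏ l, f l := by
  funext M D P f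
  conv_lhs => rw [← fin_two_eta f]
  rw [Fin.prod_univ_two]
  exact (hC.star M D P).zeroth _ _

lemma IsUniversalStarProduct.isNoLoop (hC : IsUniversalStarProduct C) (r : ℕ) :
    (C r).IsNoLoop := by
  rcases Nat.eq_zero_or_pos r with rfl | h
  · rw [hC.zero_eq]
    exact isNoLoop_prod
  · exact hC.noLoop r h

lemma IsUniversalStarProduct.isHomogeneous (hC : IsUniversalStarProduct C) (r : ℕ) :
    (C r).IsHomogeneous r := by
  rcases Nat.eq_zero_or_pos r with rfl | h
  · intro M D P t f
    rw [hC.zero_eq, pow_zero, one_smul]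
  · exact hC.homogeneous r h

lemma IsUniversalStarProduct.isBiadditive (hC : IsUniversalStarProduct C) {M : Mfd.{u}}
    (D : Connection M) (P : PoissonTensor M) : IsBiadditive fun r => C r M D P :=
  isBiadditive_of_isNoLoop hC.isNoLoop D P

/-- The product on formal series defined by a universal star product. -/
abbrev IsUniversalStarProduct.mulHom (hC : IsUniversalStarProduct C) {M : Mfd.{u}}
    (D : Connection M) (P : PoissonTensor M) :
    PowerSeries (Fun 𝕜 M) →+ PowerSeries (Fun 𝕜 M) →+ PowerSeries (Fun 𝕜 M) :=
  starHom (hC.isBiadditive D P)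

lemma IsUniversalStarProduct.mulHom_assoc (hC : IsUniversalStarProduct C) {M : Mfd.{u}}
    (D : Connection M) (P : PoissonTensor M) (F G H : PowerSeries (Fun 𝕜 M)) :
    hC.mulHom D P (hC.mulHom D P F G) H = hC.mulHom D P F (hC.mulHom D P G H) :=
  (hC.star M D P).assoc F G H

/-- The C_r with r ≥ 1 vanish on constants, so constants act by ordinary multiplication. This lets
the transformed product inherit the vanishing on constants. -/
lemma IsUniversalStarProduct.mulHom_const_left (hC : IsUniversalStarProduct C) {M : Mfd.{u}}
    (D : Connection M) (P : PoissonTensor M) (a : 𝕜) (G : PowerSeries (Fun 𝕜 M)) :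
    hC.mulHom D P (PowerSeries.C (constFun M a)) G = PowerSeries.C (constFun M a) * G := by
  refine ext_of_comm_X (Φ := hC.mulHom D P (PowerSeries.C (constFun M a)))
    (Ψ := AddMonoidHom.mulLeft (PowerSeries.C (constFun M a))) (fun F => starHom_X_right _ _ _)
    (fun F => mul_left_comm _ _ _) (fun g => ?_) G
  ext1 n
  rw [coeff_starHom_C_C, AddMonoidHom.coe_mulLeft, ← map_mul]
  rcases Nat.eq_zero_or_pos n with rfl | h
  · rw [(hC.star M D P).zeroth, PowerSeries.coeff_zero_C]
  · rw [(hC.star M D P).const_left n h, PowerSeries.coeff_C, if_neg (by omega)]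

lemma IsUniversalStarProduct.mulHom_const_right (hC : IsUniversalStarProduct C) {M : Mfd.{u}}
    (D : Connection M) (P : PoissonTensor M) (F : PowerSeries (Fun 𝕜 M)) (a : 𝕜) :
    hC.mulHom D P F (PowerSeries.C (constFun M a)) = PowerSeries.C (constFun M a) * F := by
  refine ext_of_comm_X (Φ := (hC.mulHom D P).flip (PowerSeries.C (constFun M a)))
    (Ψ := AddMonoidHom.mulLeft (PowerSeries.C (constFun M a))) (fun F => by
      rw [AddMonoidHom.flip_apply, AddMonoidHom.flip_apply, starHom_X_left])
    (fun F => mul_left_comm _ _ _) (fun g => ?_) F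
  ext1 n
  rw [AddMonoidHom.flip_apply, coeff_starHom_C_C, AddMonoidHom.coe_mulLeft, ← map_mul]
  rcases Nat.eq_zero_or_pos n with rfl | h
  · rw [(hC.star M D P).zeroth, PowerSeries.coeff_zero_C, mul_comm]
  · rw [(hC.star M D P).const_right n h, PowerSeries.coeff_C, if_neg (by omega)]

lemma IsGaugeSeries.op_isOrd_one (hE : IsGaugeSeries E) {M : Mfd.{u}}
    (D : Connection M) (P : PoissonTensor M) : IsOrd 1 (hE.op D P) :=
  (hE.op_isOrd D P).mono (by omega)

lemma IsGaugeSeries.op_const (hE : IsGaugeSeries E) {M : Mfd.{u}} (D : Connection M)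
    (P : PoissonTensor M) (a : 𝕜) : hE.op D P (PowerSeries.C (constFun M a)) = 0 := by
  ext1 n
  rw [IsGaugeSeries.op, coeff_opLin_C, MultiOp.toEnd_apply, hE.map_const, map_zero]

lemma IsGaugeSeries.expEnd_op_const_mul (hE : IsGaugeSeries E) {M : Mfd.{u}} (D : Connection M)
    (P : PoissonTensor M) (a : 𝕜) (F : PowerSeries (Fun 𝕜 M)) :
    expEnd (hE.op D P) (PowerSeries.C (constFun M a) * F) =
      PowerSeries.C (constFun M a) * expEnd (hE.op D P) F := by
  ext1 n
  rw [PowerSeries.coeff_C_mul, coeff_expEnd_op, coeff_expEnd_op, Finset.mul_sum]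
  refine Finset.sum_congr rfl fun p _ => ?_
  have := (expCoeff_isNoLoop hE p.1).map_update_const_mul D P ![0] 0 a (PowerSeries.coeff p.2 F)
  rw [update_single, update_single] at this
  rw [PowerSeries.coeff_C_mul, this]

lemma expAd_apply (hC : IsUniversalStarProduct C) (hE : IsGaugeSeries E) (r : ℕ) {M : Mfd.{u}}
    (D : Connection M) (P : PoissonTensor M) (f : Fin 2 → Fun 𝕜 M) : expAd E C r M D P f =
      PowerSeries.coeff r (expEnd (hE.op D P) (hC.mulHom D P
        (expEnd (-hE.op D P) (PowerSeries.C (f 0))) (expEnd (-hE.op D P) (PowerSeries.C (f 1))))) := by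
  rw [← hE.op_neg, ← hE.neg.expSeries_eq, ← hE.neg.expSeries_eq, ← hE.expSeries_eq]
  rfl

/-- Each coefficient is a finite sum of compositions of universal operators whose degrees add up to
r; no-loop type and degree can be read off. -/
lemma expAd_eq (hE : IsGaugeSeries E) (r : ℕ) : expAd E C r = fun M D P f =>
    ∑ a ∈ Finset.HasAntidiagonal.antidiagonal r, expCoeff E a.1 M D P
      ![∑ p ∈ Finset.HasAntidiagonal.antidiagonal a.2, ∑ q ∈ Finset.HasAntidiagonal.antidiagonal p.2,
        C p.1 M D P ![expCoeff (fun s => - E s) q.1 M D P ![f 0],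
          expCoeff (fun s => - E s) q.2 M D P ![f 1]]] := by
  funext M D P f
  rw [expAd, hE.expSeries_eq, coeff_expEnd_op]
  simp only [starMul, PowerSeries.coeff_mk]
  rfl

lemma expAd_isNoLoop (hC : IsUniversalStarProduct C) (hE : IsGaugeSeries E) (r : ℕ) :
    (expAd E C r).IsNoLoop := by
  rw [expAd_eq hE]
  exact .sum _ fun a _ => (expCoeff_isNoLoop hE a.1).comp_one (.sum _ fun p _ => .sum _ fun q _ =>
    ((hC.isNoLoop p.1).comp_right (expCoeff_isNoLoop hE.neg q.2)).comp_left
      (expCoeff_isNoLoop hE.neg q.1))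

lemma expAd_isHomogeneous (hC : IsUniversalStarProduct C) (hE : IsGaugeSeries E) (r : ℕ) :
    (expAd E C r).IsHomogeneous r := by
  rw [expAd_eq hE]
  refine .sum _ fun a ha => ?_
  rw [← Finset.HasAntidiagonal.mem_antidiagonal.1 ha]
  refine .comp_one (expCoeff_isNoLoop hE a.1) (expCoeff_isHomogeneous hE a.1)
    (.sum _ fun p hp => .sum _ fun q hq => ?_)
  rw [← Finset.HasAntidiagonal.mem_antidiagonal.1 hp, ← Finset.HasAntidiagonal.mem_antidiagonal.1 hq,
    add_comm q.1, ← add_assoc]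
  exact .comp_left ((hC.isNoLoop p.1).comp_right (expCoeff_isNoLoop hE.neg q.2))
    (.comp_right (hC.isNoLoop p.1) (hC.isHomogeneous p.1) (expCoeff_isHomogeneous hE.neg q.2))
    (expCoeff_isHomogeneous hE.neg q.1)

lemma expAd_isBiadditive (hC : IsUniversalStarProduct C) (hE : IsGaugeSeries E) {M : Mfd.{u}}
    (D : Connection M) (P : PoissonTensor M) : IsBiadditive fun r => expAd E C r M D P :=
  isBiadditive_of_isNoLoop (expAd_isNoLoop hC hE) D P

/-- The coefficients were defined on functions only. Both sides commute with ν in the second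
argument, so the formula extends to series there; `starHom_expAd` then treats the first argument. -/
lemma starHom_expAd_C_left (hC : IsUniversalStarProduct C) (hE : IsGaugeSeries E) {M : Mfd.{u}}
    (D : Connection M) (P : PoissonTensor M) (f : Fun 𝕜 M) (G : PowerSeries (Fun 𝕜 M)) :
    starHom (expAd_isBiadditive hC hE D P) (PowerSeries.C f) G = expEnd (hE.op D P)
      (hC.mulHom D P (expEnd (-hE.op D P) (PowerSeries.C f)) (expEnd (-hE.op D P) G)) := by
  have hT := (expEnd_isOrd (hE.op_isOrd_one D P)).comm
  have hS := (expEnd_isOrd (hE.op_isOrd_one D P).neg).comm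
  set B := starHom (expAd_isBiadditive hC hE D P) with hB
  have hX : ∀ F G, B F (PowerSeries.X * G) = PowerSeries.X * B F G := starHom_X_right _
  have hc : ∀ g, B (PowerSeries.C f) (PowerSeries.C g) = expEnd (hE.op D P)
      (hC.mulHom D P (expEnd (-hE.op D P) (PowerSeries.C f))
        (expEnd (-hE.op D P) (PowerSeries.C g))) := fun g => by
    ext1 n
    rw [hB, coeff_starHom_C_C]
    exact expAd_apply hC hE n D P ![f, g]
  clear_value B
  exact ext_of_comm_X (Φ := B (PowerSeries.C f))
    (Ψ := (expEnd (hE.op D P)).toAddMonoidHom.comp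
      ((hC.mulHom D P (expEnd (-hE.op D P) (PowerSeries.C f))).comp
        (expEnd (-hE.op D P)).toAddMonoidHom)) (hX _) (fun G => by
      simp only [AddMonoidHom.comp_apply, LinearMap.toAddMonoidHom_coe, hS, starHom_X_right, hT])
    hc G

lemma starHom_expAd (hC : IsUniversalStarProduct C) (hE : IsGaugeSeries E) {M : Mfd.{u}}
    (D : Connection M) (P : PoissonTensor M) (F G : PowerSeries (Fun 𝕜 M)) :
    starHom (expAd_isBiadditive hC hE D P) F G = expEnd (hE.op D P)
      (hC.mulHom D P (expEnd (-hE.op D P) F) (expEnd (-hE.op D P) G)) := by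
  have hT := (expEnd_isOrd (hE.op_isOrd_one D P)).comm
  have hS := (expEnd_isOrd (hE.op_isOrd_one D P).neg).comm
  have hc := fun f => starHom_expAd_C_left hC hE D P f G
  set B := starHom (expAd_isBiadditive hC hE D P) with hB
  have hX : ∀ F G, B (PowerSeries.X * F) G = PowerSeries.X * B F G := starHom_X_left _
  clear_value B
  exact ext_of_comm_X (Φ := B.flip G) (Ψ := (expEnd (hE.op D P)).toAddMonoidHom.comp
      (((hC.mulHom D P).flip (expEnd (-hE.op D P) G)).comp (expEnd (-hE.op D P)).toAddMonoidHom))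
    (fun F => hX F G) (fun F => by
      simp only [AddMonoidHom.comp_apply, LinearMap.toAddMonoidHom_coe, AddMonoidHom.flip_apply, hS,
        starHom_X_left, hT]) hc F

/-- The exponent starts with ν², so conjugation by exp E is the identity modulo ν². -/
lemma expAd_coincideMod_two (hC : IsUniversalStarProduct C) (hE : IsGaugeSeries E) :
    CoincideMod (expAd E C) C 2 := by
  intro r hr
  funext M D P f
  rw [expAd_apply hC hE, ← fin_two_eta f, ← coeff_starHom_C_C (hC.isBiadditive D P) (f 0) (f 1) r,
    fin_two_eta f, ← sub_eq_zero, ← map_sub]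
  have hT := expEnd_sub_one (hE.op_isOrd D P)
  have hS := expEnd_sub_one (hE.op_isOrd D P).neg
  set T := expEnd (hE.op D P)
  set S := expEnd (-hE.op D P)
  set F : PowerSeries (Fun 𝕜 M) := PowerSeries.C (f 0)
  set G : PowerSeries (Fun 𝕜 M) := PowerSeries.C (f 1)
  have hF : PowerSeries.X ^ 2 ∣ S F - F := hS.dvd F
  have hG : PowerSeries.X ^ 2 ∣ S G - G := hS.dvd G
  have one_dvd' : ∀ F : PowerSeries (Fun 𝕜 M), (PowerSeries.X : PowerSeries _) ^ 0 ∣ F :=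
    fun F => by simp
  refine PowerSeries.X_pow_dvd_iff.1 ?_ r hr
  have h1 : PowerSeries.X ^ 2 ∣ T (hC.mulHom D P (S F) (S G)) - hC.mulHom D P (S F) (S G) :=
    hT.dvd _
  have h2 := starHom_dvd (hC.isBiadditive D P) hF (one_dvd' (S G))
  have h3 := starHom_dvd (hC.isBiadditive D P) (one_dvd' F) hG
  have := dvd_add (dvd_add h1 h2) h3
  simpa only [map_sub, AddMonoidHom.sub_apply, sub_add_sub_cancel] using this

/-- Gauge equivalence preserves universal star products. -/
lemma IsUniversalStarProduct.expAd (hC : IsUniversalStarProduct C) (hE : IsGaugeSeries E) :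
    IsUniversalStarProduct (expAd E C) where
  star M D P := by
    have hmul := starHom_expAd hC hE D P
    have hop := hE.op_isOrd_one D P
    have hconst : ∀ a : 𝕜, expEnd (-hE.op D P) (PowerSeries.C (constFun M a)) =
        PowerSeries.C (constFun M a) := fun a => by
      refine expEnd_eq_self hop.neg ?_
      rw [LinearMap.neg_apply, hE.op_const, neg_zero]
    refine ⟨fun f g => ?_, fun F G H => ?_, fun f g => ?_, fun r hr a g => ?_, fun r hr f a => ?_⟩
    · rw [expAd_coincideMod_two hC hE 0 (by omega)]
      exact (hC.star M D P).zeroth f g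
    · change starHom (expAd_isBiadditive hC hE D P) (starHom (expAd_isBiadditive hC hE D P) F G) H =
        starHom (expAd_isBiadditive hC hE D P) F (starHom (expAd_isBiadditive hC hE D P) G H)
      -- Conjugation preserves associativity because the inner exp(−E) exp(E) cancels.
      rw [hmul, hmul F G, hmul, hmul G H, expEnd_neg_apply_expEnd hop, expEnd_neg_apply_expEnd hop,
        hC.mulHom_assoc]
    · rw [expAd_coincideMod_two hC hE 1 (by omega)]
      exact (hC.star M D P).first f g
    · rw [expAd_apply hC hE]
      change PowerSeries.coeff r (expEnd _ (hC.mulHom D P (expEnd _ (PowerSeries.C (constFun M a)))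
        (expEnd _ (PowerSeries.C g)))) = 0
      rw [hconst, hC.mulHom_const_left, hE.expEnd_op_const_mul, expEnd_apply_expEnd_neg hop,
        ← map_mul, PowerSeries.coeff_C, if_neg (by omega)]
    · rw [expAd_apply hC hE]
      change PowerSeries.coeff r (expEnd _ (hC.mulHom D P (expEnd _ (PowerSeries.C f))
        (expEnd _ (PowerSeries.C (constFun M a))))) = 0
      rw [hconst, hC.mulHom_const_right, hE.expEnd_op_const_mul, expEnd_apply_expEnd_neg hop,
        ← map_mul, PowerSeries.coeff_C, if_neg (by omega)]
  noLoop r _ := expAd_isNoLoop hC hE r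
  homogeneous r _ := expAd_isHomogeneous hC hE r

end StarProducts

/-! ### Operators of order one are derivations. -/

section Derivations

variable {𝕜 : Type} [RCLike 𝕜]

lemma pd_inChart_mul {M : Mfd.{u}} (f g : Fun 𝕜 M)
    {c : OpenPartialHomeomorph M (Model M.dim)} (hc : c ∈ M.charts) {y : Model M.dim}
    (hy : y ∈ c.target) (i : Fin M.dim) :
    pd i (inChart (f * g) c) y =
      pd i (inChart f c) y * inChart g c y + inChart f c y * pd i (inChart g c) y := by
  have hd : ∀ f : Fun 𝕜 M, DifferentiableAt ℝ (inChart f c) y := fun f =>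
    ((contDiffOn_inChart f hc).contDiffAt (c.open_target.mem_nhds hy)).differentiableAt (by simp)
  have hmul : inChart (f * g) c = inChart f c * inChart g c := rfl
  rw [hmul, pd, fderiv_mul (hd f) (hd g)]
  simp only [add_apply, smul_apply, smul_eq_mul, pd]
  ring

lemma MultiOp.IsNoLoopTensor.map_mul {B : MultiOp.{u} 𝕜 1} (hB : B.IsNoLoopTensor) {M : Mfd.{u}}
    (D : Connection M) (P : PoissonTensor M) (f g : Fun 𝕜 M) :
    B M D P ![f * g] = B M D P ![f] * g + f * B M D P ![g] := by
  obtain ⟨e, hs, he⟩ := hB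
  ext x
  have hc : chartAt (Model M.dim) x ∈ M.charts := IsManifold.chart_mem_maximalAtlas x
  have hx := mem_chart_source (Model M.dim) x
  have ht := (chartAt (Model M.dim) x).map_source hx
  have hf : ∀ f : Fun 𝕜 M, f x = inChart f (chartAt (Model M.dim) x) (chartAt (Model M.dim) x x) :=
    fun f => by rw [inChart, (chartAt (Model M.dim) x).left_inv hx]
  change B M D P ![f * g] x = B M D P ![f] x * g x + f x * B M D P ![g] x
  rw [he M D P _ _ hc x hx, he M D P _ _ hc x hx, he M D P _ _ hc x hx, Finsupp.sum, Finsupp.sum,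
    Finsupp.sum, Finset.sum_mul, Finset.mul_sum, ← Finset.sum_add_distrib]
  refine Finset.sum_congr rfl fun Γ hΓ => ?_
  have h1 := (hs Γ hΓ).2 0
  rw [mul_assoc, mul_left_comm (f x), ← mul_add]
  congr 1
  unfold Monomial.eval
  rw [Finset.sum_mul, Finset.mul_sum, ← Finset.sum_add_distrib]
  refine Finset.sum_congr rfl fun v _ => ?_
  simp only [Fin.prod_univ_one, nablaSym_of_eq_one _ _ h1, Matrix.cons_val_zero,
    pd_inChart_mul f g hc ht, hf f, hf g]
  ring

end Derivations

/-! ### Associativity order by order and the resulting cocycles. -/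

section OrderByOrder

variable {𝕜 : Type} [RCLike 𝕜] {C C' : ℕ → MultiOp.{u} 𝕜 2} {k : ℕ}

lemma sum_antidiagonal_eq_ends {A : Type*} [AddCommMonoid A] {n : ℕ} (hn : 1 ≤ n) {F : ℕ × ℕ → A}
    (h : ∀ p ∈ Finset.HasAntidiagonal.antidiagonal n, p.1 ≠ 0 → p.2 ≠ 0 → F p = 0) :
    ∑ p ∈ Finset.HasAntidiagonal.antidiagonal n, F p = F (0, n) + F (n, 0) := by
  rw [← Finset.sum_pair (by simp; omega)]
  symm
  refine Finset.sum_subset (fun p hp => ?_) fun p hp hp' => h p hp (fun h0 => hp' ?_) fun h0 => hp' ?_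
  · simp only [Finset.mem_insert, Finset.mem_singleton] at hp
    rw [Finset.HasAntidiagonal.mem_antidiagonal]
    rcases hp with rfl | rfl <;> simp
  all_goals
    rw [Finset.HasAntidiagonal.mem_antidiagonal] at hp
    obtain ⟨a, b⟩ := p
    simp_all

lemma sum_antidiagonal_eq_lower {A : Type*} [AddCommMonoid A] {n : ℕ} {F : ℕ × ℕ → A}
    (h : ∀ p ∈ Finset.HasAntidiagonal.antidiagonal (n + 1), 2 ≤ p.1 → F p = 0) :
    ∑ p ∈ Finset.HasAntidiagonal.antidiagonal (n + 1), F p = F (0, n + 1) + F (1, n) := by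
  rw [Finset.Nat.sum_antidiagonal_succ]
  cases n with
  | zero => simp
  | succ n =>
    rw [Finset.Nat.sum_antidiagonal_succ, Finset.sum_eq_zero fun p hp => ?_, add_zero]
    have := Finset.HasAntidiagonal.mem_antidiagonal.1 hp
    exact h _ (by rw [Finset.HasAntidiagonal.mem_antidiagonal]; omega) (by omega)

lemma IsUniversalStarProduct.coeff_assoc (hC : IsUniversalStarProduct C) {M : Mfd.{u}}
    (D : Connection M) (P : PoissonTensor M) (n : ℕ) (f g h : Fun 𝕜 M) :
    ∑ p ∈ Finset.HasAntidiagonal.antidiagonal n, C p.1 M D P ![C p.2 M D P ![f, g], h] =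
      ∑ p ∈ Finset.HasAntidiagonal.antidiagonal n, C p.1 M D P ![f, C p.2 M D P ![g, h]] := by
  have := congrArg (PowerSeries.coeff n) (hC.mulHom_assoc D P (PowerSeries.C f) (PowerSeries.C g)
    (PowerSeries.C h))
  rw [coeff_starHom_C_right, coeff_starHom_C_left] at this
  simpa only [coeff_starHom_C_C] using this

/-- In the order-k associativity relations only the terms pairing order k with C_0, the pointwise
product, differ; their difference is the Hochschild coboundary up to sign. -/
lemma IsUniversalStarProduct.isHochschildCocycle (hC : IsUniversalStarProduct C)
    (hC' : IsUniversalStarProduct C') (h : CoincideMod C C' k) :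
    IsHochschildCocycle (C' k - C k) := by
  intro M D P f g h'
  change f * (C' k M D P ![g, h'] - C k M D P ![g, h']) -
    (C' k M D P ![f * g, h'] - C k M D P ![f * g, h']) +
    (C' k M D P ![f, g * h'] - C k M D P ![f, g * h']) -
    (C' k M D P ![f, g] - C k M D P ![f, g]) * h' = 0
  rcases Nat.eq_zero_or_pos k with rfl | hk
  · simp only [(hC.star M D P).zeroth, (hC'.star M D P).zeroth]
    ring
  · have h1 := hC.coeff_assoc D P k f g h'
    have h2 := hC'.coeff_assoc D P k f g h'
    have hl : ∑ p ∈ Finset.HasAntidiagonal.antidiagonal k,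
        ((C' p.1 M D P ![C' p.2 M D P ![f, g], h'] - C' p.1 M D P ![f, C' p.2 M D P ![g, h']]) -
        (C p.1 M D P ![C p.2 M D P ![f, g], h'] - C p.1 M D P ![f, C p.2 M D P ![g, h']])) = 0 := by
      rw [Finset.sum_sub_distrib, Finset.sum_sub_distrib, Finset.sum_sub_distrib, h1, h2]
      simp
    rw [sum_antidiagonal_eq_ends hk fun p hp h1 h2 => ?_] at hl
    · simp only [(hC.star M D P).zeroth, (hC'.star M D P).zeroth] at hl
      linear_combination -hl
    · have := Finset.HasAntidiagonal.mem_antidiagonal.1 hp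
      rw [h p.1 (by omega), h p.2 (by omega), sub_self]

lemma MultiOp.IsNoLoop.sub {n : ℕ} {A B : MultiOp.{u} 𝕜 n} (hA : A.IsNoLoop) (hB : B.IsNoLoop) :
    (A - B).IsNoLoop := by
  rw [sub_eq_add_neg]
  exact hA.add hB.neg

lemma MultiOp.IsHomogeneous.sub {n r : ℕ} {A B : MultiOp.{u} 𝕜 n} (hA : A.IsHomogeneous r)
    (hB : B.IsHomogeneous r) : (A - B).IsHomogeneous r := by
  rw [sub_eq_add_neg]
  exact hA.add hB.neg

lemma eq_zero_of_two_mul {M : Mfd.{u}} {x : Fun 𝕜 M} (h : 2 * x = 0) : x = 0 := by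
  have := congrArg (fun y => (2⁻¹ : ℝ) • y) h
  simpa only [two_mul, ← two_smul ℝ, smul_smul, smul_zero, inv_mul_cancel₀ (two_ne_zero (α := ℝ)),
    one_smul] using this

lemma IsUniversalStarProduct.eq_zero_of_one (hC : IsUniversalStarProduct C) {r : ℕ} (hr : 1 ≤ r)
    {M : Mfd.{u}} (D : Connection M) (P : PoissonTensor M) (f : Fin 2 → Fun 𝕜 M) (l : Fin 2)
    (hl : f l = constFun M 1) : C r M D P f = 0 := by
  rw [← fin_two_eta f]
  fin_cases l
  · exact hl ▸ (hC.star M D P).const_left r hr 1 (f 1)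
  · exact hl ▸ (hC.star M D P).const_right r hr (f 0) 1

/-- Universality forces C_1 to be skew, so its prescribed antisymmetrisation 2{f, g} equals 2 C_1(f,
g). -/
lemma IsUniversalStarProduct.one_eq_bracket (hC : IsUniversalStarProduct C) {M : Mfd.{u}}
    (D : Connection M) (P : PoissonTensor M) (f g : Fun 𝕜 M) : C 1 M D P ![f, g] = bracket P f g := by
  have h1 := isSkew_of_degree_one (hC.noLoop 1 le_rfl) (hC.homogeneous 1 le_rfl)
    (fun M D P f l => hC.eq_zero_of_one le_rfl D P f l) M D P f g
  have h2 := (hC.star M D P).first f g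
  rw [← sub_eq_zero]
  refine eq_zero_of_two_mul ?_
  linear_combination h1 + h2

lemma IsUniversalStarProduct.bracket_swap (hC : IsUniversalStarProduct C) {M : Mfd.{u}}
    (D : Connection M) (P : PoissonTensor M) (f g : Fun 𝕜 M) :
    bracket P f g = - bracket P g f := by
  rw [← hC.one_eq_bracket D P, ← hC.one_eq_bracket D P]
  exact isSkew_of_degree_one (hC.noLoop 1 le_rfl) (hC.homogeneous 1 le_rfl)
    (fun M D P f l => hC.eq_zero_of_one le_rfl D P f l) M D P f g

/-- The start of all inductions: orders 0 and 1 are the same for every universal star product. -/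
lemma IsUniversalStarProduct.coincideMod_two (hC : IsUniversalStarProduct C)
    (hC' : IsUniversalStarProduct C') : CoincideMod C C' 2 := by
  intro r hr
  funext M D P f
  rw [← fin_two_eta f]
  rcases Nat.lt_or_ge r 1 with h | h
  · obtain rfl : r = 0 := by omega
    exact ((hC.star M D P).zeroth _ _).trans ((hC'.star M D P).zeroth _ _).symm
  · obtain rfl : r = 1 := by omega
    rw [hC.one_eq_bracket, hC'.one_eq_bracket]

/-- Associativity in the order after the first one in which two star products differ. -/
lemma IsUniversalStarProduct.assoc_next (hC : IsUniversalStarProduct C)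
    (hC' : IsUniversalStarProduct C') (hk : 2 ≤ k) (h : CoincideMod C C' k) {M : Mfd.{u}}
    (D : Connection M) (P : PoissonTensor M) (u v w : Fun 𝕜 M) :
    (C' (k + 1) - C (k + 1)) M D P ![u, v] * w + (C' (k + 1) - C (k + 1)) M D P ![u * v, w] +
      bracket P ((C' k - C k) M D P ![u, v]) w + (C' k - C k) M D P ![bracket P u v, w] =
    u * (C' (k + 1) - C (k + 1)) M D P ![v, w] + (C' (k + 1) - C (k + 1)) M D P ![u, v * w] +
      bracket P u ((C' k - C k) M D P ![v, w]) + (C' k - C k) M D P ![u, bracket P v w] := by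
  obtain ⟨j, rfl⟩ : ∃ j, k = j + 1 := ⟨k - 1, by omega⟩
  have h1 := hC.coeff_assoc D P (j + 1 + 1) u v w
  have h2 := hC'.coeff_assoc D P (j + 1 + 1) u v w
  have hl : ∑ p ∈ Finset.HasAntidiagonal.antidiagonal (j + 1 + 1),
      ((C' p.1 M D P ![C' p.2 M D P ![u, v], w] - C' p.1 M D P ![u, C' p.2 M D P ![v, w]]) -
      (C p.1 M D P ![C p.2 M D P ![u, v], w] - C p.1 M D P ![u, C p.2 M D P ![v, w]])) = 0 := by
    rw [Finset.sum_sub_distrib, Finset.sum_sub_distrib, Finset.sum_sub_distrib, h1, h2]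
    simp
  -- The two extreme terms pair C_0 with order k+1. Of the rest, only the ends, pairing order 1 with
  -- order k, can differ between the two products; they are distinct because k ≥ 2.
  rw [Finset.Nat.sum_antidiagonal_succ, Finset.Nat.sum_antidiagonal_succ',
    ← add_assoc, sum_antidiagonal_eq_ends (by omega) fun p hp h1 h2 => ?_] at hl
  · simp only [(hC.star M D P).zeroth, (hC'.star M D P).zeroth, zero_add, hC.one_eq_bracket,
      hC'.one_eq_bracket] at hl
    simp only [Pi.sub_apply, sub_eq_add_neg, bracket_add_left, bracket_neg_left, bracket_add_right,
      bracket_neg_right]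
    linear_combination hl
  · have := Finset.HasAntidiagonal.mem_antidiagonal.1 hp
    rw [h _ (by omega), h _ (by omega), sub_self]

/-- The relation in order k+1 is summed over the permutations of u, v, w with signs. The Hochschild
coboundary of the unknown difference in order k+1 cancels, and so does the symmetric part of the
difference in order k; what remains is the Chevalley equation for the skew part. -/
lemma IsUniversalStarProduct.isPoissonCocycle (hC : IsUniversalStarProduct C)
    (hC' : IsUniversalStarProduct C') (h : CoincideMod C C' k) :
    IsPoissonCocycle (skewPart (C' k - C k)) where
  tensor := skewPart_isNoLoopTensor ((hC'.isNoLoop k).sub (hC.isNoLoop k))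
    (hC.isHochschildCocycle hC' h)
  skew := isSkew_skewPart _
  closed M D P u v w := by
    -- Below order two the difference is zero.
    rcases Nat.lt_or_ge k 2 with hk | hk
    · rw [hC.coincideMod_two hC' k hk, sub_self]
      simp [skewPart, bracket_zero_left]
    · have key := hC.assoc_next hC' hk h D P
      have hA := (hC'.isNoLoop k).sub (hC.isNoLoop k)
      have hneg := fun f g => hA.map_smul_left D P (-1) f g
      have hneg' := fun f g => hA.map_smul_right D P (-1) f g
      have hb := hC.bracket_swap D P
      generalize C' k - C k = A at *
      generalize C' (k + 1) - C (k + 1) = W at *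
      simp only [skewPart_apply, neg_smul, one_smul] at hneg hneg' ⊢
      have hs : ∀ f g, bracket P ((2⁻¹ : ℝ) • f) g = (2⁻¹ : ℝ) • bracket P f g := fun f g => by
        rw [hb, bracket_smul_right, ← smul_neg, ← hb]
      have hbA : ∀ f g h, bracket P f (A M D P ![g, h]) = - bracket P (A M D P ![g, h]) f :=
        fun f g h => hb _ _
      have e1 := key u v w
      have e2 := key v w u
      have e3 := key w u v
      have e4 := key v u w
      have e5 := key u w v
      have e6 := key w v u
      have m1 : v * u = u * v := mul_comm _ _
      have m2 : w * v = v * w := mul_comm _ _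
      have m3 : u * w = w * u := mul_comm _ _
      simp only [hb v u, hb w v, hb u w, m1, m2, m3, hbA, hneg, hneg'] at e1 e2 e3 e4 e5 e6
      simp only [hs, ← smul_add]
      refine Eq.trans (congrArg _ (eq_zero_of_two_mul ?_)) (smul_zero _)
      simp only [sub_eq_add_neg, bracket_add_left, bracket_neg_left]
      linear_combination e1 + e2 + e3 - e4 - e5 - e6

end OrderByOrder

/-! ### Removing the obstruction in one order. -/

section GaugeStep

variable {𝕜 : Type} [RCLike 𝕜] {C C' : ℕ → MultiOp.{u} 𝕜 2} {E E' : ℕ → MultiOp.{u} 𝕜 1} {k : ℕ}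

lemma MultiOp.RepresentedBy.map_const {A : MultiOp.{u} 𝕜 1} {e : Monomial 1 →₀ 𝕜}
    (h : A.RepresentedBy e) (he : ∀ Γ ∈ e.support, Γ.ord 0 ≠ 0) {M : Mfd.{u}} (D : Connection M)
    (P : PoissonTensor M) (a : 𝕜) : A M D P ![constFun M a] = 0 := by
  ext x
  have hc : chartAt (Model M.dim) x ∈ M.charts := IsManifold.chart_mem_maximalAtlas x
  have hx := mem_chart_source (Model M.dim) x
  rw [h M D P _ _ hc x hx]
  refine Finset.sum_eq_zero fun Γ hΓ => ?_
  exact mul_eq_zero_of_right _ (Γ.eval_const hc hx 0 (he Γ hΓ) (a := a) rfl)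

/-- Primitives of the symmetric parts of universal Hochschild cocycles. -/
lemma exists_symmetric_primitive {A : MultiOp.{u} 𝕜 2} {r : ℕ} (hA : A.IsNoLoop)
    (hr : A.IsHomogeneous r) (hcoc : IsHochschildCocycle A)
    (hc0 : ∀ (M : Mfd.{u}) (D : Connection M) (P : PoissonTensor M) (f : Fin 2 → Fun 𝕜 M) (l),
      f l = constFun M 1 → A M D P f = 0) :
    ∃ B : MultiOp.{u} 𝕜 1, B.IsNoLoop ∧ B.IsHomogeneous r ∧
      (∀ (M : Mfd.{u}) (D : Connection M) (P : PoissonTensor M) (a : 𝕜),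
        B M D P ![constFun M a] = 0) ∧
      ∀ (M : Mfd.{u}) (D : Connection M) (P : PoissonTensor M) (f g : Fun 𝕜 M),
        f * B M D P ![g] - B M D P ![f * g] + B M D P ![f] * g =
          (2⁻¹ : ℝ) • (A M D P ![f, g] + A M D P ![g, f]) := by
  classical
  obtain ⟨e, hs, he⟩ := hA
  have h := ((he.filter_numP hr).filter_ord_ne_zero 0 fun M D P f => hc0 M D P f 0)
    |>.filter_ord_ne_zero 1 fun M D P f => hc0 M D P f 1
  set e' := ((e.filter fun Γ => Γ.numP = r).filter fun Γ => Γ.ord 0 ≠ 0).filter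
    fun Γ => Γ.ord 1 ≠ 0
  have hs' : ∀ Γ ∈ e'.support, Γ.NoLoop ∧ Γ.numP = r ∧ Γ.ord 0 ≠ 0 ∧ Γ.ord 1 ≠ 0 := by
    intro Γ hΓ
    simp only [e', Finsupp.support_filter, Finset.mem_filter] at hΓ
    exact ⟨hs Γ hΓ.1.1.1, hΓ.1.1.2, hΓ.1.2, hΓ.2⟩
  obtain ⟨B, hB, hBA⟩ := exists_primitive h hcoc fun Γ hΓ l => by
    fin_cases l
    exacts [(hs' Γ hΓ).2.2.1, (hs' Γ hΓ).2.2.2]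
  refine ⟨B, ⟨_, fun Δ hΔ => ?_, hB⟩, hB.isHomogeneous fun Δ hΔ => ?_,
    fun M D P a => hB.map_const (fun Δ hΔ => ?_) D P a, hBA⟩
  all_goals obtain ⟨Γ, hΓ, rfl⟩ := prim_support hΔ
  · exact Monomial.merge_noLoop (hs' Γ hΓ).1
  · exact (hs' Γ hΓ).2.1
  · rw [Γ.merge_ord, Monomial.deg, Fin.sum_univ_two]
    have := (hs' Γ hΓ).2.2.1
    omega

lemma IsGaugeSeries.zero : IsGaugeSeries (0 : ℕ → MultiOp.{u} 𝕜 1) where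
  low _ _ := rfl
  noLoop _ _ := .zero
  homogeneous _ _ := .zero
  const _ _ _ _ _ _ := rfl

lemma IsGaugeSeries.add (hE : IsGaugeSeries E) (hE' : IsGaugeSeries E') :
    IsGaugeSeries (E + E') where
  low r h := by
    change E r + E' r = 0
    rw [hE.low r h, hE'.low r h, add_zero]
  noLoop r h := (hE.noLoop r h).add (hE'.noLoop r h)
  homogeneous r h := (hE.homogeneous r h).add (hE'.homogeneous r h)
  const r h M D P a := by
    change E r M D P _ + E' r M D P _ = 0
    rw [hE.const r h, hE'.const r h, add_zero]

lemma IsGaugeSeries.op_add (hE : IsGaugeSeries E) (hE' : IsGaugeSeries E') {M : Mfd.{u}}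
    (D : Connection M) (P : PoissonTensor M) :
    (hE.add hE').op D P = hE.op D P + hE'.op D P :=
  opLin_add (fun r => (E r).toEnd (hE.isNoLoop r) D P) fun r => (E' r).toEnd (hE'.isNoLoop r) D P

lemma expAd_zero (hC : IsUniversalStarProduct C) : expAd 0 C = C := by
  funext r M D P f
  have h : (IsGaugeSeries.zero (𝕜 := 𝕜)).op D P = 0 := by
    refine LinearMap.ext fun F => ?_
    ext1 n
    rw [IsGaugeSeries.op, coeff_opLin, LinearMap.zero_apply, map_zero]
    exact Finset.sum_eq_zero fun _ _ => rfl
  rw [expAd_apply hC IsGaugeSeries.zero, h, neg_zero, expEnd_zero]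
  simp only [Module.End.one_apply]
  rw [coeff_starHom_C_C, fin_two_eta]

/-- A gauge series that starts in order `k` changes the orders up to `k + 1` of the product by
explicit terms. -/
lemma expAd_add (hC : IsUniversalStarProduct C) (hE : IsGaugeSeries E) (hE' : IsGaugeSeries E')
    (hk : ∀ r < k, E' r = 0) {n : ℕ} (hn : n < k + 2) {M : Mfd.{u}} (D : Connection M)
    (P : PoissonTensor M) (f g : Fun 𝕜 M) :
    expAd (E + E') C n M D P ![f, g] = expAd E C n M D P ![f, g] +
      ∑ p ∈ Finset.HasAntidiagonal.antidiagonal n, (E' p.2 M D P ![C p.1 M D P ![f, g]] -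
        C p.1 M D P ![E' p.2 M D P ![f], g] - C p.1 M D P ![f, E' p.2 M D P ![g]]) := by
  have hord : IsOrd k (hE'.op D P) := opLin_isOrd fun r hr => by
    ext1 f
    rw [MultiOp.toEnd_apply, hk r hr]
    rfl
  have h := PowerSeries.X_pow_dvd_iff.1 (conj_perturbation (hC.isBiadditive D P)
    (hE.op_isOrd D P) (hE'.op_isOrd D P) hord (PowerSeries.C f) (PowerSeries.C g)) n hn
  rw [← hE.op_add hE'] at h
  have h1 := expAd_apply hC (hE.add hE') n D P ![f, g]
  have h2 := expAd_apply hC hE n D P ![f, g]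
  have hc : ∀ f n, PowerSeries.coeff n (hE'.op D P (PowerSeries.C f)) = E' n M D P ![f] :=
    fun f n => coeff_opLin_C _ _ _
  have h3 : PowerSeries.coeff n (hE'.op D P (hC.mulHom D P (PowerSeries.C f) (PowerSeries.C g))) =
      ∑ p ∈ Finset.HasAntidiagonal.antidiagonal n, E' p.2 M D P ![C p.1 M D P ![f, g]] := by
    rw [IsGaugeSeries.op, coeff_opLin, ← Finset.Nat.sum_antidiagonal_swap]
    refine Finset.sum_congr rfl fun p _ => ?_
    rw [coeff_starHom_C_C]
    rfl
  rw [map_sub, map_sub, map_sub, map_sub, h3, coeff_starHom_C_right, coeff_starHom_C_left] at h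
  simp only [hc] at h
  rw [Finset.sum_sub_distrib, Finset.sum_sub_distrib, h1, h2]
  simp only [Matrix.cons_val_zero, Matrix.cons_val_one]
  linear_combination h

/-- Removing an exact obstruction in order `k`. -/
lemma exists_gauge_step (hC : IsUniversalStarProduct C) (hC' : IsUniversalStarProduct C')
    (hE : IsGaugeSeries E) (hk : 2 ≤ k) (h : CoincideMod (expAd E C) C' k)
    {B : MultiOp.{u} 𝕜 1} (hB : B.IsNoLoopTensor) (hBk : B.IsHomogeneous (k - 1))
    (hskew : skewPart (C' k - expAd E C k) = chevalleyD B) :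
    ∃ E' : ℕ → MultiOp.{u} 𝕜 1, IsGaugeSeries E' ∧ (∀ r < k - 1, E' r = E r) ∧
      CoincideMod (expAd E' C) C' (k + 1) := by
  have hCE := hC.expAd hE
  obtain ⟨A, hA, hAk, hA0, hsym⟩ := exists_symmetric_primitive
    ((hC'.isNoLoop k).sub (hCE.isNoLoop k)) ((hC'.isHomogeneous k).sub (hCE.isHomogeneous k))
    (hCE.isHochschildCocycle hC' h) (fun M D P f l hl => by
      change C' k M D P f - expAd E C k M D P f = 0
      rw [hC'.eq_zero_of_one (by omega) D P f l hl, hCE.eq_zero_of_one (by omega) D P f l hl,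
        sub_self])
  have hBno : B.IsNoLoop := by
    obtain ⟨e, hs, he⟩ := hB
    exact ⟨e, fun Γ hΓ => (hs Γ hΓ).1, he⟩
  have hB0 : ∀ (M : Mfd.{u}) (D : Connection M) (P : PoissonTensor M) (a : 𝕜),
      B M D P ![constFun M a] = 0 := by
    obtain ⟨e, hs, he⟩ := hB
    exact fun M D P a => he.map_const (fun Γ hΓ => by rw [(hs Γ hΓ).2 0]; omega) D P a
  obtain ⟨j, rfl⟩ : ∃ j, k = j + 2 := ⟨k - 2, by omega⟩
  have hj : j + 2 - 1 = j + 1 := rfl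
  rw [hj] at hBk ⊢
  -- With k = j + 2: minus the Chevalley primitive in order k−1, to be paired with C_1, and minus
  -- the symmetric primitive in order k, to be paired with C_0.
  set X : ℕ → MultiOp.{u} 𝕜 1 := fun r =>
    if r = j + 1 then -B else if r = j + 2 then -A else 0 with hX
  have X1 : X (j + 1) = -B := if_pos rfl
  have X2 : X (j + 2) = -A := (if_neg (by omega)).trans (if_pos rfl)
  have X0 : ∀ r, r ≠ j + 1 → r ≠ j + 2 → X r = 0 := fun r h1 h2 =>
    (if_neg h1).trans (if_neg h2)
  clear_value X
  have hXg : IsGaugeSeries X := by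
    refine ⟨fun r hr => ?_, fun r _ => ?_, fun r _ => ?_, fun r _ M D P a => ?_⟩
    · by_cases h1 : r = j + 1
      -- For k = 2 the operator B would enter in order one, which a gauge series does not have;
      -- being of degree one it vanishes.
      · obtain rfl : j = 0 := by omega
        rw [h1, X1, eq_zero_of_degree_one hB hBk, neg_zero]
      · exact X0 r h1 (by omega)
    all_goals
      by_cases h1 : r = j + 1
      · rw [h1, X1]
        first
        | exact hBno.neg
        | exact hBk.neg
        | exact neg_eq_zero.2 (hB0 M D P a)
      · by_cases h2 : r = j + 2
        · rw [h2, X2]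
          first
          | exact hA.neg
          | exact hAk.neg
          | exact neg_eq_zero.2 (hA0 M D P a)
        · rw [X0 r h1 h2]
          first
          | exact .zero
          | rfl
  have hlow : ∀ r < j + 1, X r = 0 := fun r hr => X0 r (by omega) (by omega)
  refine ⟨E + X, hE.add hXg, fun r hr => ?_, fun r hr => ?_⟩
  · change E r + X r = E r
    rw [hlow r hr, add_zero]
  funext M D P f
  rw [← fin_two_eta f, expAd_add hC hE hXg hlow (by omega)]
  generalize f 0 = f, f 1 = g
  have hz : ∀ p : ℕ × ℕ, X p.2 = 0 → (X p.2 M D P ![C p.1 M D P ![f, g]] -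
        C p.1 M D P ![X p.2 M D P ![f], g] - C p.1 M D P ![f, X p.2 M D P ![g]]) = 0 := by
    intro p hp
    have hb := hC.isBiadditive D P
    rw [hp]
    change 0 - C p.1 M D P ![0, g] - C p.1 M D P ![f, 0] = 0
    rw [hb.zero_left p.1 g, hb.zero_right p.1 f, sub_self, sub_self]
  rcases Nat.lt_or_ge r (j + 1) with h1 | h1
  · rw [h r (by omega), Finset.sum_eq_zero fun p hp => hz p (hlow _ ?_), add_zero]
    have := Finset.HasAntidiagonal.mem_antidiagonal.1 hp
    omega
  obtain ⟨m, rfl⟩ : ∃ m, r = m + 1 := ⟨r - 1, by omega⟩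
  rw [sum_antidiagonal_eq_lower fun p hp h2 => hz p (hlow _ ?_)]
  swap
  · have := Finset.HasAntidiagonal.mem_antidiagonal.1 hp
    omega
  have hder := hB.map_mul D P f g
  rcases Nat.lt_or_ge m (j + 1) with h2 | h2
  -- In order k−1 the change is the Hochschild coboundary of B, which is zero since B is a
  -- derivation.
  · obtain rfl : m = j := by omega
    rw [h (m + 1) (by omega), hz (1, m) (hlow _ (by simp)), X1]
    change _ + ((-B M D P ![C 0 M D P ![f, g]] - C 0 M D P ![-B M D P ![f], g] -
      C 0 M D P ![f, -B M D P ![g]]) + 0) = _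
    simp only [(hC.star M D P).zeroth, hder]
    ring
  -- In order k the change is the Hochschild coboundary of A plus δ_P B, that is the symmetric plus
  -- the skew part of the difference.
  · obtain rfl : m = j + 1 := by omega
    have hs := hsym M D P f g
    have hsk : skewPart (C' (j + 2) - expAd E C (j + 2)) M D P ![f, g] = chevalleyD B M D P ![f, g] := by
      rw [hskew]
    rw [X1, X2]
    change _ + ((-A M D P ![C 0 M D P ![f, g]] - C 0 M D P ![-A M D P ![f], g] -
      C 0 M D P ![f, -A M D P ![g]]) + (-B M D P ![C 1 M D P ![f, g]] -
      C 1 M D P ![-B M D P ![f], g] - C 1 M D P ![f, -B M D P ![g]])) = _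
    simp only [(hC.star M D P).zeroth, hC.one_eq_bracket, bracket_neg_left, bracket_neg_right]
    rw [skewPart_apply] at hsk
    simp only [chevalleyD, Matrix.cons_val_zero, Matrix.cons_val_one,
      hC.bracket_swap D P g (B M D P ![f])] at hsk
    set a := (C' (j + 2) - expAd E C (j + 2)) M D P ![f, g] with ha
    have hhalf : ∀ a b : Fun 𝕜 M, (2⁻¹ : ℝ) • (a + b) + (2⁻¹ : ℝ) • (a - b) = a := fun a b => by
      module
    have ha' : a = C' (j + 2) M D P ![f, g] - expAd E C (j + 2) M D P ![f, g] := rfl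
    have := hhalf a ((C' (j + 2) - expAd E C (j + 2)) M D P ![g, f])
    rw [← hs, hsk, ha'] at this
    change _ = C' (j + 2) M D P ![f, g]
    change expAd E C (j + 2) M D P ![f, g] + _ = _
    linear_combination this

end GaugeStep

/-! ### Iteration of the gauge step. -/

section Equivalence

variable {𝕜 : Type} [RCLike 𝕜] {C C' : ℕ → MultiOp.{u} 𝕜 2} {E E' : ℕ → MultiOp.{u} 𝕜 1} {k : ℕ}

lemma powCoeff_congr (m : ℕ) : ∀ p, (∀ s ≤ p, E s = E' s) → powCoeff E m p = powCoeff E' m p := by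
  induction m with
  | zero => exact fun p _ => rfl
  | succ m ih =>
    intro p h
    rw [powCoeff_succ, powCoeff_succ]
    funext M D P f
    refine Finset.sum_congr rfl fun q hq => ?_
    have := Finset.HasAntidiagonal.mem_antidiagonal.1 hq
    rw [h q.1 (by omega), ih q.2 fun s hs => h s (by omega)]

lemma expCoeff_congr {p : ℕ} (h : ∀ s ≤ p, E s = E' s) : expCoeff E p = expCoeff E' p := by
  rw [expCoeff_eq, expCoeff_eq]
  funext M D P f
  exact Finset.sum_congr rfl fun m _ => by rw [powCoeff_congr m p h]

/-- Order r of the transformed product involves the exponent only up to order r; this makes the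
ν-adic limit of the gauges meaningful. -/
lemma expAd_congr (hE : IsGaugeSeries E) (hE' : IsGaugeSeries E') {r : ℕ}
    (h : ∀ s ≤ r, E s = E' s) : expAd E C r = expAd E' C r := by
  rw [expAd_eq hE, expAd_eq hE']
  funext M D P f
  refine Finset.sum_congr rfl fun a ha => ?_
  have h1 := Finset.HasAntidiagonal.mem_antidiagonal.1 ha
  rw [expCoeff_congr fun s hs => h s (by omega)]
  refine congrArg (fun g => expCoeff E' a.1 M D P ![g]) ?_
  refine Finset.sum_congr rfl fun p hp => Finset.sum_congr rfl fun q hq => ?_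
  have h2 := Finset.HasAntidiagonal.mem_antidiagonal.1 hp
  have h3 := Finset.HasAntidiagonal.mem_antidiagonal.1 hq
  rw [expCoeff_congr (p := q.1) fun s hs => congrArg Neg.neg (h s (by omega)),
    expCoeff_congr (p := q.2) fun s hs => congrArg Neg.neg (h s (by omega))]

lemma expAd_zero_coincideMod_two (hC : IsUniversalStarProduct C)
    (hC' : IsUniversalStarProduct C') : CoincideMod (expAd 0 C) C' 2 := by
  rw [expAd_zero hC]
  exact hC.coincideMod_two hC'

/-- The obstruction of order `k` to an equivalence vanishes if the cohomology does. -/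
lemma exists_gauge_step_of_subsingleton (hC : IsUniversalStarProduct C)
    (hC' : IsUniversalStarProduct C') (hE : IsGaugeSeries E) (hk : 2 ≤ k)
    (h : CoincideMod (expAd E C) C' k) (hH : Subsingleton (H2NoLoopPol.{u} 𝕜 k)) :
    ∃ E' : ℕ → MultiOp.{u} 𝕜 1, IsGaugeSeries E' ∧ (∀ r < k - 1, E' r = E r) ∧
      CoincideMod (expAd E' C) C' (k + 1) := by
  have hCE := hC.expAd hE
  have hmem : skewPart (C' k - expAd E C k) ∈ cocycles.{u} 𝕜 k :=
    ⟨hCE.isPoissonCocycle hC' h,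
      skewPart_homogeneous ((hC'.isHomogeneous k).sub (hCE.isHomogeneous k))⟩
  have h0 := Subsingleton.elim
    (QuotientAddGroup.mk (⟨_, hmem⟩ : cocycles.{u} 𝕜 k) : H2NoLoopPol.{u} 𝕜 k) 0
  rw [QuotientAddGroup.eq_zero_iff, AddSubgroup.mem_addSubgroupOf] at h0
  obtain ⟨B, hB, hBk, hskew⟩ := h0
  exact exists_gauge_step hC hC' hE hk h hB hBk hskew

theorem equivalentAtOrder_of_subsingleton (hC : IsUniversalStarProduct C)
    (hC' : IsUniversalStarProduct C')
    (hH : ∀ j, 2 ≤ j → j ≤ k → Subsingleton (H2NoLoopPol.{u} 𝕜 j)) :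
    EquivalentAtOrder C C' k := by
  -- The maximum with 2 records that orders 0 and 1 agree at no cost, so that cohomology is used
  -- only from degree two on.
  have key : ∀ n, n ≤ k → ∃ E : ℕ → MultiOp.{u} 𝕜 1, IsGaugeSeries E ∧
      CoincideMod (expAd E C) C' (max 2 (n + 1)) := by
    intro n
    induction n with
    | zero => exact fun _ => ⟨0, .zero, expAd_zero_coincideMod_two hC hC'⟩
    | succ n ih =>
      intro hn
      obtain ⟨E, hE, h⟩ := ih (by omega)
      rcases Nat.lt_or_ge (n + 1) 2 with h2 | h2
      · exact ⟨E, hE, fun r hr => h r (by omega)⟩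
      · obtain ⟨E', hE', -, h'⟩ := exists_gauge_step_of_subsingleton hC hC' hE h2
          (fun r hr => h r (by omega)) (hH (n + 1) h2 hn)
        exact ⟨E', hE', fun r hr => h' r (by omega)⟩
  obtain ⟨E, hE, h⟩ := key k le_rfl
  exact ⟨E, hE, fun r hr => h r (by omega)⟩

/-- The step in order k keeps the coefficients of the exponent below k−1. Along the infinite
iteration each coefficient is therefore eventually constant, and the diagonal sequence is a single
gauge series that works in all orders. -/
theorem universallyEquivalent_of_subsingleton (hC : IsUniversalStarProduct C)
    (hC' : IsUniversalStarProduct C')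
    (hH : ∀ j, 2 ≤ j → Subsingleton (H2NoLoopPol.{u} 𝕜 j)) : UniversallyEquivalent C C' := by
  have step : ∀ (n : ℕ) (E : {E : ℕ → MultiOp.{u} 𝕜 1 //
      IsGaugeSeries E ∧ CoincideMod (expAd E C) C' (n + 2)}),
      ∃ E' : {E : ℕ → MultiOp.{u} 𝕜 1 //
        IsGaugeSeries E ∧ CoincideMod (expAd E C) C' (n + 1 + 2)},
      ∀ r < n + 1, E'.1 r = E.1 r := by
    rintro n ⟨E, hE, h⟩
    obtain ⟨E', hE', heq, h'⟩ := exists_gauge_step_of_subsingleton hC hC' hE (by omega) h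
      (hH (n + 2) (by omega))
    exact ⟨⟨E', hE', h'⟩, heq⟩
  choose next hnext using step
  let seq : ∀ n, {E : ℕ → MultiOp.{u} 𝕜 1 //
      IsGaugeSeries E ∧ CoincideMod (expAd E C) C' (n + 2)} := fun n =>
    Nat.rec ⟨0, .zero, expAd_zero_coincideMod_two hC hC'⟩ next n
  have hseq : ∀ n r, r ≤ n → (seq n).1 r = (seq r).1 r := by
    intro n
    induction n with
    | zero =>
      intro r hr
      obtain rfl : r = 0 := by omega
      rfl
    | succ n ih =>
      intro r hr
      rcases Nat.lt_or_ge n r with h | h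
      · obtain rfl : r = n + 1 := by omega
        rfl
      · exact (hnext n (seq n) r (by omega)).trans (ih r h)
  have hE : IsGaugeSeries fun r => (seq r).1 r :=
    ⟨fun r h => (seq r).2.1.low r h, fun r h => (seq r).2.1.noLoop r h,
      fun r h => (seq r).2.1.homogeneous r h, fun r h => (seq r).2.1.const r h⟩
  refine ⟨_, hE, funext fun r => ?_⟩
  -- Up to order r the limit coincides with stage r, which already matches the target modulo
  -- ν^{r+2}.
  rw [expAd_congr hE (seq r).2.1 fun s hs => (hseq r s hs).symm]
  exact (seq r).2.2 r (by omega)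

/-- The given B need not be homogeneous, whereas a gauge series demands degree k−1 for it;
`exists_homogeneous_primitive` passes to that component. Below order two the zero gauge suffices. -/
theorem exists_gauge_of_coboundary (hC : IsUniversalStarProduct C)
    (hC' : IsUniversalStarProduct C') (h : CoincideMod C C' k)
    (hcob : IsPoissonCoboundary (skewPart (C' k - C k))) :
    ∃ E : ℕ → MultiOp.{u} 𝕜 1, IsGaugeSeries E ∧ CoincideMod (expAd E C) C' (k + 1) := by
  rcases Nat.lt_or_ge k 2 with hk | hk
  · exact ⟨0, .zero, fun r hr => expAd_zero_coincideMod_two hC hC' r (by omega)⟩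
  · obtain ⟨j, rfl⟩ : ∃ j, k = j + 1 := ⟨k - 1, by omega⟩
    obtain ⟨B, hB, hBj, hskew⟩ := exists_homogeneous_primitive
      (skewPart_homogeneous ((hC'.isHomogeneous _).sub (hC.isHomogeneous _))) hcob
    have h0 := expAd_zero hC
    obtain ⟨E, hE, -, hE'⟩ := exists_gauge_step hC hC' (k := j + 1) .zero hk (by rwa [h0]) hB hBj
      (by rw [h0, hskew])
    exact ⟨E, hE, hE'⟩

end Equivalence

end

end UniversalStar

theorem mainTheorem7 (𝕜 : Type) [RCLike 𝕜] (C C' : ℕ → MultiOp.{u} 𝕜 2)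
    (hC : IsUniversalStarProduct C) (hC' : IsUniversalStarProduct C') :
    (∀ k : ℕ, CoincideMod C C' k →
      (IsHochschildCocycle (C' k - C k) ∧ (C' k - C k).IsNoLoop ∧ (C' k - C k).IsHomogeneous k) ∧
      (IsPoissonCocycle (skewPart (C' k - C k)) ∧ (skewPart (C' k - C k)).IsHomogeneous k) ∧
      (IsPoissonCoboundary (skewPart (C' k - C k)) →
        ∃ E : ℕ → MultiOp.{u} 𝕜 1, IsGaugeSeries E ∧ CoincideMod (expAd E C) C' (k + 1))) ∧
    ((∀ j : ℕ, 2 ≤ j → Subsingleton (H2NoLoopPol.{u} 𝕜 j)) → UniversallyEquivalent C C') ∧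
    (∀ k : ℕ, (∀ j : ℕ, 2 ≤ j → j ≤ k → Subsingleton (H2NoLoopPol.{u} 𝕜 j)) →
      EquivalentAtOrder C C' k) := by
  exact ⟨fun k h => ⟨⟨hC.isHochschildCocycle hC' h, (hC'.isNoLoop k).sub (hC.isNoLoop k),
      (hC'.isHomogeneous k).sub (hC.isHomogeneous k)⟩,
    ⟨hC.isPoissonCocycle hC' h,
      skewPart_homogeneous ((hC'.isHomogeneous k).sub (hC.isHomogeneous k))⟩,
    exists_gauge_of_coboundary hC hC' h⟩,
    universallyEquivalent_of_subsingleton hC hC', fun _ => equivalentAtOrder_of_subsingleton hC hC'⟩
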